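/- **Setting.** Let $n\ge 1$, $\mathcal Z=\mathbb Z^n\times\{-1,1\}$, and for $J=(j,\sigma)\in\mathcal Z$ let $\overline J=(j,-\sigma)$, $|J|=|j|$ (Euclidean), $\langle J\rangle=\langle j\rangle=\max\{|j|,c\}$, where $c>0$ is fixed. *Weight (A.0).* $f:[c,\infty)\to(0,\infty)$ is nondecreasing, $f(x)\to+\infty$ as $x\to\infty$, and there is a constant $C_f<1$ with $f(\sum_{l=1}^k x_l)\le f(x_m)+C_f\sum_{l\ne m}f(x_l)$ for all $k\ge 1$ and all $x_1,\dots,x_k\ge c$ with $x_m=\max_l x_l$. In addition $\sum_{J\in\mathcal Z}e^{-s_0f(\langle J\rangle)}<\infty$ for some $s_0$. The space $W_s$ consists of all $u=(u_J)_{J\in\mathcal Z}\in\mathbb C^{\mathcal Z}$ with $\|u\|_s^2=\sum_{J}|u_J|^2e^{2sf(\langle J\rangle)}<\infty$; $u$ is real if $u_{\overline J}=\overline{u_J}$ for all $J$. *Hamiltonian.* $H=\sum_{j\in\mathbb Z^n}\omega_j u_{(j,1)}u_{(j,-1)}+P$ with $\omega_j\in\mathbb R$ and a formal series $P=\sum_{d\ge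 3}\sum_{\mathcal J\in\mathcal Z^d}P_{\mathcal J}\,u_{J_1}\cdots u_{J_d}$ such that: $P_{\mathcal J}=0$ unless $\sum_l\sigma_lj_l=0$; $\overline{P_{\mathcal J}}=P_{\overline{\mathcal J}}$; and $|P_{\mathcal J}|\le C_PR^d$ for all $d\ge 3$ and $\mathcal J\in\mathcal Z^d$, with constants $C_P,R$. The equation of motion is $\dot u=X_H(u)$, $(X_H)_{(j,\sigma)}=-\sigma\mathrm i\,\partial H/\partial u_{(j,-\sigma)}$, where $P$ is differentiated term by term. A solution on an interval $I$ is a continuous curve $u:I\to W_s$ for which the series of $\partial P/\partial u_J$ converge absolutely and the equation holds in every component. *Frequencies (Assumption 2), with $\beta>1$ and $p>0$.* (A.1) There is $C_0>0$ with $\frac1{C_0}\le\omega_j/|j|^\beta\le C_0$ for all $j$ with $|j|$ sufficiently large. (A.2) There are $\gamma>0$ and $\tau$ such that for all sufficiently large $N\in\mathbb N$, all $d\ge 1$ and all $J_1,\dots,J_d\in\mathcal Z$ with $|J_l|\le N$: if $\sum_l\sigma_l\omega_{j_l}\ne 0$, then $|\sum_l\sigma_l\omega_{j_l}|\ge\gamma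 N^{-\tau d^p}$. Moreover, if $\sum_{l=1}^d\sigma_l\omega_{j_l}=0$, then $d$ is even and the entries $J_1,\dots,J_d$ can be grouped into $d/2$ pairs such that the two entries $(j,\sigma)$, $(j',\sigma')$ of each pair satisfy $\omega_j=\omega_{j'}$ and $\sigma=-\sigma'$. (A.3) $\mathcal Z$ is a disjoint union of blocks $\Omega_\alpha$, and there are constants $C_0,C_1$ and $C_2,\delta>0$ such that $|J|\le C_0$ on one block $\Omega_0$; $\sup_{\Omega_\alpha}|J|-\inf_{\Omega_\alpha}|J|\le C_1$ for all $\alpha\ne 0$; and $|\omega_{j_1}-\omega_{j_2}|\ge C_2(|j_1|^\delta+|j_2|^\delta)$ whenever $(j_1,\sigma_1)\in\Omega_\alpha$ and $(j_2,\sigma_2)\in\Omega_{\alpha'}$ with $\alpha\ne\alpha'$. *The cut-off $N(\varepsilon)$.* For $0<\varepsilon<1$ it is determined, together with a real $d>0$, by the balance equations $d^p\ln(dN)=\frac{f(N)}d=\frac{|\ln\varepsilon|}2$. Precisely, $N(\varepsilon)$ is the supremum of all real $N\ge c$ for which $d^p\ln(dN)\le\frac{|\ln\varepsilon|}2$ with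 $d=2f(N)/|\ln\varepsilon|$. (If the balance equations have a solution $(d,N)$ with $d>0$, $N\ge c$, then $N=N(\varepsilon)$.) **Theorem (Main theorem).** Let $n,c,f,\omega,\beta,p,P$ be as above. Then for all sufficiently large $s$ there are a threshold $\varepsilon_0>0$ and constants $C_{\mathtt{sta}},C_{\mathtt{fin}}>0$ such that the following holds. If $u_0\in W_s$ is real and $\varepsilon:=\|u_0\|_s$ satisfies $0<\varepsilon<\varepsilon_0$, then there is a time $$T_\varepsilon>\frac{e^{C_{\mathtt{fin}}\,s\,f(N(\varepsilon))}}{C_{\mathtt{sta}}}$$ such that $\dot u=X_H(u)$, $u(0)=u_0$, has a solution $u$ on $[-T_\varepsilon,T_\varepsilon]$; it is unique (every solution on some $[-T',T']$, $0<T'\le T_\varepsilon$, with the same initial value coincides with $u$ there), and $$\sup_{|t|\le T_\varepsilon}\|u(t)\|_s<C_{\mathtt{sta}}\,\varepsilon .$$ -/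

import Mathlib

open Filter Topology

noncomputable section

namespace UltraDiff

/-- The index set `ℤ^n × {-1, 1}`; the units of `ℤ` are exactly `1` and `-1`. -/
abbrev Index (n : ℕ) : Type := (Fin n → ℤ) × ℤˣ

/-- The Euclidean length of `j ∈ ℤ^n`. -/
def len {n : ℕ} (j : Fin n → ℤ) : ℝ := Real.sqrt (∑ l, (j l : ℝ) ^ 2)

/-- The regularised length `⟨j⟩ = max {|j|, c}`. -/
def bracket {n : ℕ} (c : ℝ) (j : Fin n → ℤ) : ℝ := max (len j) c

/-- The sign `σ ∈ {-1, 1}` as a real number. -/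
def sgn (σ : ℤˣ) : ℝ := ((σ : ℤ) : ℝ)

/-- The conjugate index of `(j, σ)`, namely `(j, -σ)`. -/
def bar {n : ℕ} (J : Index n) : Index n := (J.1, -J.2)

/-! ### Weights and weighted spaces -/

/-- Assumption A.0 on the weight `f`, which is evaluated at real numbers `x ≥ c` only. -/
structure WeightA0 (f : ℝ → ℝ) (c : ℝ) : Prop where
  c_pos : 0 < c
  pos : ∀ x, c ≤ x → 0 < f x
  mono : MonotoneOn f (Set.Ici c)
  tendsto : Tendsto f atTop atTop
  subadd : ∃ Cf : ℝ, Cf < 1 ∧ ∀ (k : ℕ) (x : Fin k → ℝ) (m : Fin k),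
    (∀ l, c ≤ x l) → (∀ l, x l ≤ x m) →
      f (∑ l, x l) ≤ f (x m) + Cf * ∑ l ∈ Finset.univ.erase m, f (x l)

/-- The terms `|u_J|² e^{2 s f(⟨J⟩)}` of the squared norm of `W_s`. -/
def weightedSq {n : ℕ} (f : ℝ → ℝ) (c s : ℝ) (u : Index n → ℂ) (J : Index n) : ℝ :=
  ‖u J‖ ^ 2 * Real.exp (2 * s * f (bracket c J.1))

/-- Membership in the weighted `ℓ²` space `W_s`. -/
def MemW {n : ℕ} (f : ℝ → ℝ) (c s : ℝ) (u : Index n → ℂ) : Prop :=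
  Summable (weightedSq f c s u)

/-- The norm of `W_s`. -/
def normW {n : ℕ} (f : ℝ → ℝ) (c s : ℝ) (u : Index n → ℂ) : ℝ :=
  Real.sqrt (∑' J, weightedSq f c s u J)

/-- `u` is real: `u_{(j,-1)}` is the complex conjugate of `u_{(j,1)}`. -/
def IsRealSeq {n : ℕ} (u : Index n → ℂ) : Prop :=
  ∀ J, u (bar J) = (starRingEnd ℂ) (u J)

/-! ### Formal polynomials and power series -/

/-- A formal power series in the variables `u_J`, given by its coefficients:
`coef d 𝒥` is the coefficient of `u_{J_1} ⋯ u_{J_d}` for `𝒥 = (J_1, …, J_d)`. -/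
abbrev FormalSeries (n : ℕ) : Type := (d : ℕ) → (Fin d → Index n) → ℂ

/-- The momentum `∑ σ_l j_l` of a multi-index. -/
def momentum {n d : ℕ} (𝒥 : Fin d → Index n) : Fin n → ℤ :=
  ∑ l, ((𝒥 l).2 : ℤ) • (𝒥 l).1

/-- The class `𝒫_{3,∞}`: series of homogeneous polynomials of degrees `d ≥ 3` that conserve
momentum, are real, and have bounded coefficients in every degree. The bound may grow
geometrically with the degree, so that the series converges near the origin. -/
structure MemP3 {n : ℕ} (P : FormalSeries n) : Prop where
  degree : ∀ d, d < 3 → ∀ 𝒥, P d 𝒥 = 0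
  momentum_conservation : ∀ d 𝒥, momentum 𝒥 ≠ 0 → P d 𝒥 = 0
  reality : ∀ d 𝒥, (starRingEnd ℂ) (P d 𝒥) = P d (fun l => bar (𝒥 l))
  bounded : ∃ C R : ℝ, ∀ d 𝒥, ‖P d 𝒥‖ ≤ C * R ^ d

/-- The terms of the formal derivative `∂P/∂u_J`: for every degree `d`, every position `l` and
every `𝒥` with `J_l = J`, the product of the coefficient with all `u_{J_i}`, `i ≠ l`. -/
def gradTerm {n : ℕ} (P : FormalSeries n) (J : Index n) (u : Index n → ℂ)
    (q : (d : ℕ) × (Fin d × (Fin d → Index n))) : ℂ :=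
  if q.2.2 q.2.1 = J then
    P q.1 q.2.2 * ∏ i ∈ Finset.univ.erase q.2.1, u (q.2.2 i)
  else 0

/-- `∂P/∂u_J`. -/
def gradP {n : ℕ} (P : FormalSeries n) (J : Index n) (u : Index n → ℂ) : ℂ :=
  ∑' q, gradTerm P J u q

/-- `∂H/∂u_J` for `H = ∑_j ω_j u_{(j,1)} u_{(j,-1)} + P`. -/
def gradH {n : ℕ} (ω : (Fin n → ℤ) → ℝ) (P : FormalSeries n) (J : Index n)
    (u : Index n → ℂ) : ℂ :=
  (ω J.1 : ℂ) * u (bar J) + gradP P J u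

/-- The Hamiltonian vector field `(X_H)_{(j,σ)} = -σ i ∂H/∂u_{(j,-σ)}`. -/
def vectorField {n : ℕ} (ω : (Fin n → ℤ) → ℝ) (P : FormalSeries n) (u : Index n → ℂ)
    (J : Index n) : ℂ :=
  -(sgn J.2 : ℂ) * Complex.I * gradH ω P (bar J) u

/-- `u` solves `u' = X_H(u)` on the time set `I`: it is a continuous curve in `W_s`, the series
defining the vector field converge absolutely along it, and the equation holds for every
component. -/
structure IsSolutionOn {n : ℕ} (f : ℝ → ℝ) (c s : ℝ) (ω : (Fin n → ℤ) → ℝ)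
    (P : FormalSeries n) (I : Set ℝ) (u : ℝ → Index n → ℂ) : Prop where
  mem : ∀ t ∈ I, MemW f c s (u t)
  continuous : ∀ t ∈ I, Tendsto (fun τ => normW f c s (u τ - u t)) (𝓝[I] t) (𝓝 0)
  summable : ∀ t ∈ I, ∀ J, Summable (gradTerm P J (u t))
  equation : ∀ t ∈ I, ∀ J,
    HasDerivWithinAt (fun τ => u τ J) (vectorField ω P (u t) J) I t

/-! ### Assumptions on the frequencies -/

/-- Assumption A.1: `ω_j` is comparable with `|j|^β` for large `j`. -/
def FreqA1 {n : ℕ} (ω : (Fin n → ℤ) → ℝ) (β : ℝ) : Prop :=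
  ∃ C₀ : ℝ, 0 < C₀ ∧ ∃ R : ℝ, ∀ j, R ≤ len j →
    1 / C₀ ≤ ω j / len j ^ β ∧ ω j / len j ^ β ≤ C₀

/-- The combination `∑ σ_l ω_{j_l}` attached to a multi-index. -/
def divisor {n d : ℕ} (ω : (Fin n → ℤ) → ℝ) (𝒥 : Fin d → Index n) : ℝ :=
  ∑ l, sgn (𝒥 l).2 * ω (𝒥 l).1

/-- The entries of the multi-index cancel in pairs: they can be grouped into pairs with equal
frequencies and opposite signs (so that their number is even). -/
def CancelsInPairs {n d : ℕ} (ω : (Fin n → ℤ) → ℝ) (𝒥 : Fin d → Index n) : Prop :=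
  ∃ (m : ℕ) (e : Fin m ⊕ Fin m ≃ Fin d), ∀ i,
    ω (𝒥 (e (Sum.inl i))).1 = ω (𝒥 (e (Sum.inr i))).1 ∧
    (𝒥 (e (Sum.inl i))).2 = -(𝒥 (e (Sum.inr i))).2

/-- Assumption A.2: the non-resonance condition with exponent `p`. -/
def FreqA2 {n : ℕ} (ω : (Fin n → ℤ) → ℝ) (p : ℝ) : Prop :=
  (∃ γ τ : ℝ, 0 < γ ∧ ∃ N₀ : ℕ, ∀ N : ℕ, N₀ ≤ N → ∀ (d : ℕ) (𝒥 : Fin d → Index n), 1 ≤ d →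
    (∀ l, len (𝒥 l).1 ≤ N) → divisor ω 𝒥 ≠ 0 →
      γ / (N : ℝ) ^ (τ * (d : ℝ) ^ p) ≤ |divisor ω 𝒥|) ∧
  (∀ (d : ℕ) (𝒥 : Fin d → Index n), divisor ω 𝒥 = 0 → CancelsInPairs ω 𝒥)

/-- Assumption A.3: a division of the (countable) index set into blocks
`Ω_α = {J | block J = α}`, `α ∈ ℕ`. -/
def FreqA3 {n : ℕ} (ω : (Fin n → ℤ) → ℝ) : Prop :=
  ∃ (block : Index n → ℕ) (C₀ C₁ C₂ δ : ℝ), 0 < C₂ ∧ 0 < δ ∧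
    (∀ J, block J = 0 → len J.1 ≤ C₀) ∧
    (∀ J K, block J = block K → block J ≠ 0 → len J.1 - len K.1 ≤ C₁) ∧
    (∀ J K, block J ≠ block K → C₂ * (len J.1 ^ δ + len K.1 ^ δ) ≤ |ω J.1 - ω K.1|)

/-! ### The balance between the two remainders -/

/-- The degree `d` determined by `f(N) / d = |ln ε| / 2`. -/
def balanceDegree (f : ℝ → ℝ) (ε N : ℝ) : ℝ := 2 * f N / |Real.log ε|

/-- The cut-off `N(ε)`: the largest `N` for which `d ^ p * ln (d N) ≤ |ln ε| / 2`, where `d` is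
determined by `f(N) / d = |ln ε| / 2`. If `f` is continuous, there is equality at `N(ε)`, and
`cutoff_eq_of_balance` below shows that any exact solution of the balance equations is `N(ε)`;
the supremum gives a value also if `f` jumps. -/
def cutoff (f : ℝ → ℝ) (c p ε : ℝ) : ℝ :=
  sSup {N : ℝ | c ≤ N ∧
    balanceDegree f ε N ^ p * Real.log (balanceDegree f ε N * N) ≤ |Real.log ε| / 2}

/-- An exact solution `(d, N)` of the balance equations
`(ε (d N)^{d^p})^d = e^{-f(N)}` and `d^p ln (d N) = f(N) / d` has `N = N(ε)`. -/
theorem cutoff_eq_of_balance {f : ℝ → ℝ} {c p ε d N : ℝ} (hf : WeightA0 f c) (hp : 0 < p)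
    (hε : 0 < ε) (hε' : ε < 1) (hN : c ≤ N) (hd : 0 < d)
    (h₁ : d ^ p * Real.log (d * N) + Real.log ε = -f N / d)
    (h₂ : d ^ p * Real.log (d * N) = f N / d) : cutoff f c p ε = N := by
  have hlog : Real.log ε < 0 := Real.log_neg hε hε'
  have habs : |Real.log ε| = -Real.log ε := abs_of_neg hlog
  have hL : 0 < |Real.log ε| := by rw [habs]; linarith
  have hfd : f N / d = |Real.log ε| / 2 := by
    have : -f N / d = -(f N / d) := neg_div _ _
    rw [habs]; linarith
  have hdeg : balanceDegree f ε N = d := by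
    unfold balanceDegree
    rw [div_eq_iff hL.ne']
    rw [div_eq_iff hd.ne'] at hfd
    linarith
  have hNpos : 0 < N := lt_of_lt_of_le hf.c_pos hN
  have hlogpos : 0 < Real.log (d * N) := by
    have h3 : 0 < d ^ p * Real.log (d * N) := by rw [h₂, hfd]; linarith
    exact (pos_iff_pos_of_mul_pos h3).1 (Real.rpow_pos_of_pos hd p)
  refine IsGreatest.csSup_eq ⟨⟨hN, ?_⟩, ?_⟩
  · rw [hdeg, h₂, hfd]
  · rintro x ⟨hx, hxle⟩
    by_contra hlt
    have hlt : N < x := not_le.mp hlt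
    have hmono : f N ≤ f x := hf.mono hN hx hlt.le
    have hdx : d ≤ balanceDegree f ε x := by
      rw [← hdeg]
      unfold balanceDegree
      gcongr
    have h4 : d * N < balanceDegree f ε x * x :=
      mul_lt_mul' hdx hlt hNpos.le (lt_of_lt_of_le hd hdx)
    have h5 : Real.log (d * N) < Real.log (balanceDegree f ε x * x) :=
      Real.log_lt_log (mul_pos hd hNpos) h4
    have h6 : d ^ p ≤ balanceDegree f ε x ^ p := Real.rpow_le_rpow hd.le hdx hp.le
    have h7 : d ^ p * Real.log (d * N) <
        balanceDegree f ε x ^ p * Real.log (balanceDegree f ε x * x) :=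
      mul_lt_mul' h6 h5 hlogpos.le (lt_of_lt_of_le (Real.rpow_pos_of_pos hd p) h6)
    rw [h₂, hfd] at h7
    linarith

end UltraDiff

end

/-! The squared norm of `W_s` is nearly conserved. Let S = ∑ w_J u_J u_{bar J}, with weights w
constant on the blocks of A.3 and comparable to e^{2 s f}. A monomial with vanishing divisor has
entries that cancel in pairs of equal frequency, hence of equal block, so its bracket with S is
zero. Other monomials of degree at most r + 2 are removed by a Birkhoff normal form, unless every
term of their bracket with S keeps two factors outside a ball of radius N besides the factor u_J.
Such terms are harmless: the tame convolution estimate puts the strong weight e^{s f} on one factor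
only, so one high factor is measured with the weaker weight e^{s κ f}, κ < 1, which gains e^{-s (1 -
κ) f(N) / 2} up to a constant (`l2_convPow_two_le`, `GoodWeight.highGain`).

The phase space is never transformed. On polynomials in finitely many modes the Lie series operators
Ψ_k respect products and Poisson brackets (`Phase.lie_bilinear`), and they are chosen such that H_k
= ∑_{a+b=k} Ψ_a Z_b with Z in normal form (`Phase.exists_normalForm`). The modified energy E =
∑_{k≤r} Ψ_k S is close to S (`NormalForm.enorm_energy_sub_le`), and its derivative along the flow is
∑ Ψ_a {Z_b, S} plus terms of order larger than r (`NormalForm.enorm_dEval_energy_le`). Coefficients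
are compared with the sums `Phase.theta` of all monomials of given degree and momentum. These are
stable under Poisson brackets and their values are iterated convolutions, so no constant depends on
the number of modes. A solution of the full equation, restricted to a box of modes, solves the
truncated system up to an error; the part of the error caused by the box tends to zero, and the
energy estimate passes to the full norm (`IsSolutionOn.wenorm_sq_le`).

The divisors are bounded in `Blocks.exists_divisor_bound`. If all entries are below a power of (r +
2)(N + A), condition A.2 applies. If one entry is larger, conservation of momentum excludes that it
is the only high entry, three high entries mean that the monomial is kept, and for exactly two the
growth of the frequencies or the gap between blocks makes the divisor at least 1.

For the Cauchy problem the linear flow, a unitary group, is factored out; the remaining field is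
bounded and Lipschitz on a ball, and after a radial cut-off it has global solutions. A continuity
argument turns the energy estimate into existence up to time T (`exists_solution_of_apriori`).

The parameters are chosen in `exists_degree` and `exists_thresholds`. With L = |ln ε|, a radius N
close to N(ε) and r + 1 at least a multiple of 2 f(N) / L, the divisors cost so little that the
effective small parameter is at most e^{-L/2}. Its power r + 1 and the gain from high modes are then
both exponentially small in f(N). -/

open scoped ENNReal NNReal

namespace UltraDiff

/-! ### The `ℓ²` norm of nonnegative families -/

section EllTwo

variable {κ κ' : Type*}

/-- The `ℓ²` norm of a family of extended nonnegative numbers. -/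
noncomputable def l2 (x : κ → ℝ≥0∞) : ℝ≥0∞ := (∑' k, x k ^ 2) ^ (1 / 2 : ℝ)

theorem l2_sq (x : κ → ℝ≥0∞) : l2 x ^ 2 = ∑' k, x k ^ 2 := by
  unfold l2
  rw [← ENNReal.rpow_natCast, ← ENNReal.rpow_mul]
  norm_num

theorem l2_le_of_sq_le {x : κ → ℝ≥0∞} {a : ℝ≥0∞} (h : ∑' k, x k ^ 2 ≤ a ^ 2) : l2 x ≤ a := by
  rw [← l2_sq] at h
  exact (ENNReal.pow_right_strictMono two_ne_zero).le_iff_le.1 h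

theorem l2_mono {x y : κ → ℝ≥0∞} (h : ∀ k, x k ≤ y k) : l2 x ≤ l2 y := by
  apply l2_le_of_sq_le
  rw [l2_sq]
  exact ENNReal.tsum_le_tsum fun k => pow_le_pow_left' (h k) 2

theorem l2_const_mul (a : ℝ≥0∞) (x : κ → ℝ≥0∞) : l2 (fun k => a * x k) = a * l2 x := by
  have h : l2 (fun k => a * x k) ^ 2 = (a * l2 x) ^ 2 := by
    rw [mul_pow, l2_sq, l2_sq, ← ENNReal.tsum_mul_left]
    simp only [mul_pow]
  exact (ENNReal.pow_right_strictMono two_ne_zero).injective h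

theorem le_l2 (x : κ → ℝ≥0∞) (k : κ) : x k ≤ l2 x := by
  have : x k ^ 2 ≤ l2 x ^ 2 := by rw [l2_sq]; exact ENNReal.le_tsum (f := fun k => x k ^ 2) k
  exact (ENNReal.pow_right_strictMono two_ne_zero).le_iff_le.1 this

/-- Cauchy–Schwarz. -/
theorem tsum_mul_le_l2 (x y : κ → ℝ≥0∞) : ∑' k, x k * y k ≤ l2 x * l2 y := by
  rw [ENNReal.tsum_eq_iSup_sum]
  refine iSup_le fun s => ?_
  refine (ENNReal.inner_le_Lp_mul_Lq s x y Real.HolderConjugate.two_two).trans ?_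
  unfold l2
  gcongr
  · simp only [ENNReal.rpow_two]
    exact ENNReal.sum_le_tsum s
  · simp only [ENNReal.rpow_two]
    exact ENNReal.sum_le_tsum s

/-- Minkowski's inequality for arbitrary sums. -/
theorem l2_tsum_le (x : κ' → κ → ℝ≥0∞) : l2 (fun p => ∑' k, x k p) ≤ ∑' k, l2 (x k) := by
  apply l2_le_of_sq_le
  calc ∑' p, (∑' k, x k p) ^ 2 = ∑' p, ∑' k, ∑' l, x k p * x l p := by
        refine tsum_congr fun p => ?_
        rw [sq, ← ENNReal.tsum_mul_right]
        exact tsum_congr fun k => ENNReal.tsum_mul_left.symm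
    _ = ∑' k, ∑' l, ∑' p, x k p * x l p := by
        rw [ENNReal.tsum_comm]
        exact tsum_congr fun k => ENNReal.tsum_comm
    _ ≤ ∑' k, ∑' l, l2 (x k) * l2 (x l) :=
        ENNReal.tsum_le_tsum fun k => ENNReal.tsum_le_tsum fun l => tsum_mul_le_l2 _ _
    _ = (∑' k, l2 (x k)) ^ 2 := by
        rw [sq, ← ENNReal.tsum_mul_right]
        exact tsum_congr fun k => ENNReal.tsum_mul_left

theorem l2_sum_le (s : Finset κ') (x : κ' → κ → ℝ≥0∞) :
    l2 (fun p => ∑ k ∈ s, x k p) ≤ ∑ k ∈ s, l2 (x k) := by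
  have h := l2_tsum_le (fun (k : s) => x k)
  simp only [tsum_fintype, Finset.univ_eq_attach] at h
  rwa [Finset.sum_attach s (fun k => l2 (x k)),
    show (fun p => ∑ k ∈ s.attach, x k p) = fun p => ∑ k ∈ s, x k p from
      funext fun p => Finset.sum_attach s (fun k => x k p)] at h

theorem l2_add_le (x y : κ → ℝ≥0∞) : l2 (fun p => x p + y p) ≤ l2 x + l2 y := by
  have h := l2_sum_le Finset.univ (fun b : Bool => if b then x else y)
  simpa using h

/-- Young's inequality `‖x * y‖₂ ≤ ‖x‖₁ ‖y‖₂`. -/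
theorem l2_conv_le_left {ι G : Type*} [AddCommGroup G] (q : ι → G) (x : ι → ℝ≥0∞)
    (y : G → ℝ≥0∞) :
    l2 (fun p => ∑' k, x k * y (p - q k)) ≤ (∑' k, x k) * l2 y := by
  refine (l2_tsum_le fun k p => x k * y (p - q k)).trans ?_
  rw [← ENNReal.tsum_mul_right]
  refine ENNReal.tsum_le_tsum fun k => ?_
  rw [l2_const_mul]
  refine mul_le_mul_right (le_of_eq ?_) _
  unfold l2
  rw [← (Equiv.subRight (q k)).tsum_eq (fun p => y p ^ 2)]
  rfl

/-- Young's inequality with the roles exchanged; the momentum map is at most two-to-one. -/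
theorem l2_conv_le_right {ι G : Type*} [AddCommGroup G] (q : ι → G)
    (hq : ∀ y : G → ℝ≥0∞, ∑' k, y (q k) ≤ 2 * ∑' p, y p) (x : ι → ℝ≥0∞) (y : G → ℝ≥0∞) :
    l2 (fun p => ∑' k, x k * y (p - q k)) ≤ 2 * (∑' p, y p) * l2 x := by
  have key : ∀ p, (∑' k, x k * y (p - q k)) ^ 2 ≤
      (2 * ∑' p, y p) * ∑' k, x k ^ 2 * y (p - q k) := by
    intro p
    have h1 : ∑' k, y (p - q k) ≤ 2 * ∑' p, y p := by
      refine (hq fun a => y (p - a)).trans_eq ?_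
      rw [← (Equiv.subLeft p).tsum_eq y]
      rfl
    -- One half of the factor y goes to each side of Cauchy–Schwarz; the lone half sums to the ℓ¹
    -- norm of y.
    have h2 := tsum_mul_le_l2 (fun k => y (p - q k) ^ (1 / 2 : ℝ))
      (fun k => x k * y (p - q k) ^ (1 / 2 : ℝ))
    have e : ∀ k, (y (p - q k) ^ (1 / 2 : ℝ)) ^ 2 = y (p - q k) := fun k => by
      rw [← ENNReal.rpow_natCast, ← ENNReal.rpow_mul]; norm_num
    have h3 : ∑' k, x k * y (p - q k) =
        ∑' k, y (p - q k) ^ (1 / 2 : ℝ) * (x k * y (p - q k) ^ (1 / 2 : ℝ)) := by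
      refine tsum_congr fun k => ?_
      rw [mul_left_comm, ← sq, e]
    rw [h3]
    refine (pow_le_pow_left' h2 2).trans ?_
    rw [mul_pow, l2_sq, l2_sq]
    simp only [mul_pow, e]
    exact mul_le_mul_left h1 _
  apply l2_le_of_sq_le
  calc ∑' p, (∑' k, x k * y (p - q k)) ^ 2
      ≤ ∑' p, (2 * ∑' p, y p) * ∑' k, x k ^ 2 * y (p - q k) := ENNReal.tsum_le_tsum key
    _ = (2 * ∑' p, y p) * ∑' k, x k ^ 2 * ∑' p, y p := by
        rw [ENNReal.tsum_mul_left, ENNReal.tsum_comm]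
        congr 1
        refine tsum_congr fun k => ?_
        rw [ENNReal.tsum_mul_left, ← (Equiv.subRight (q k)).tsum_eq y]
        rfl
    _ ≤ (2 * (∑' p, y p) * l2 x) ^ 2 := by
        rw [ENNReal.tsum_mul_right, mul_pow, l2_sq, sq]
        refine le_trans (le_of_eq (by ring)) (mul_le_mul_left (?_ :
          (2 * ∑' p, y p) * (∑' p, y p) ≤ _) _)
        refine mul_le_mul_right ?_ _
        nth_rewrite 1 [← one_mul (∑' p, y p)]
        gcongr
        norm_num

end EllTwo

/-! ### Convolutions in weighted spaces -/

/-- A pair of weights `α`, `β` on the momenta, for which convolution is tame. -/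
structure TameWeight {ι G : Type*} [AddCommGroup G] (q : ι → G) (α β : G → ℝ≥0∞) (K : ℝ≥0∞) :
    Prop where
  fiber : ∀ y : G → ℝ≥0∞, ∑' k, y (q k) ≤ 2 * ∑' p, y p
  tame : ∀ p p', α (p + p') ≤ α p * β p' + β p * α p'
  submul : ∀ p p', β (p + p') ≤ β p * β p'
  embed : ∀ x : ι → ℝ≥0∞, ∑' k, β (q k) * x k ≤ K * l2 fun k => α (q k) * x k
  embedG : ∀ x : G → ℝ≥0∞, ∑' p, β p * x p ≤ K * l2 fun p => α p * x p
  one_le : 1 ≤ K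
  one_le_zero : 1 ≤ α 0
  le_zero : β 0 ≤ α 0

/-- The convolution of `v` with `g`, along the momentum map. -/
noncomputable def conv {ι G : Type*} [AddCommGroup G] (q : ι → G) (v : ι → ℝ≥0∞) (g : G → ℝ≥0∞)
    (p : G) : ℝ≥0∞ :=
  ∑' k, v k * g (p - q k)

open Classical in
/-- The `d`-fold convolution of `v`: the sum of `v_{J_1} ⋯ v_{J_d}` over all multi-indices with
momentum `p` that have at least `h` entries in `H`. -/
noncomputable def convPow {ι G : Type*} [AddCommGroup G] (q : ι → G) (H : ι → Prop)
    (v : ι → ℝ≥0∞) : ℕ → ℕ → G → ℝ≥0∞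
  | 0, h, p => if h = 0 ∧ p = 0 then 1 else 0
  | d + 1, h, p => ∑' k, v k * convPow q H v d (if H k then h - 1 else h) (p - q k)

section Conv

variable {ι G : Type*} [AddCommGroup G] {q : ι → G} {α β : G → ℝ≥0∞} {K : ℝ≥0∞}

/-- Tameness puts the strong weight α on one factor and the weak weight β on the other. The first is
measured in ℓ², the second in ℓ¹, and the two forms of Young's inequality apply. -/
theorem l2_conv_le (hw : TameWeight q α β K) (v : ι → ℝ≥0∞) (g : G → ℝ≥0∞) :
    l2 (fun p => α p * conv q v g p) ≤
      2 * (∑' p, β p * g p) * l2 (fun k => α (q k) * v k) +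
        (∑' k, β (q k) * v k) * l2 (fun p => α p * g p) := by
  have h : ∀ p, α p * conv q v g p ≤
      ∑' k, (α (q k) * v k) * (β (p - q k) * g (p - q k)) +
        ∑' k, (β (q k) * v k) * (α (p - q k) * g (p - q k)) := by
    intro p
    rw [conv, ← ENNReal.tsum_mul_left, ← ENNReal.tsum_add]
    refine ENNReal.tsum_le_tsum fun k => ?_
    have := hw.tame (q k) (p - q k)
    rw [add_sub_cancel] at this
    calc α p * (v k * g (p - q k)) ≤
        (α (q k) * β (p - q k) + β (q k) * α (p - q k)) * (v k * g (p - q k)) := by gcongr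
      _ = _ := by ring
  refine (l2_mono h).trans ((l2_add_le _ _).trans (add_le_add ?_ ?_))
  · exact l2_conv_le_right q hw.fiber (fun k => α (q k) * v k) (fun p => β p * g p)
  · exact l2_conv_le_left q (fun k => β (q k) * v k) (fun p => α p * g p)

/-- Submultiplicativity of β makes the β-weighted ℓ¹ space an algebra under convolution. -/
theorem l1_conv_le (hw : TameWeight q α β K) (v : ι → ℝ≥0∞) (g : G → ℝ≥0∞) :
    ∑' p, β p * conv q v g p ≤ (∑' k, β (q k) * v k) * ∑' p, β p * g p := by
  calc ∑' p, β p * conv q v g p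
      ≤ ∑' p, ∑' k, (β (q k) * v k) * (β (p - q k) * g (p - q k)) := by
        refine ENNReal.tsum_le_tsum fun p => ?_
        rw [conv, ← ENNReal.tsum_mul_left]
        refine ENNReal.tsum_le_tsum fun k => ?_
        have := hw.submul (q k) (p - q k)
        rw [add_sub_cancel] at this
        calc β p * (v k * g (p - q k)) ≤ (β (q k) * β (p - q k)) * (v k * g (p - q k)) := by
              gcongr
          _ = _ := by ring
    _ = (∑' k, β (q k) * v k) * ∑' p, β p * g p := by
        rw [ENNReal.tsum_comm, ← ENNReal.tsum_mul_right]
        refine tsum_congr fun k => ?_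
        rw [ENNReal.tsum_mul_left, ← (Equiv.subRight (q k)).tsum_eq (fun p => β p * g p)]
        rfl

/-- The weak ℓ¹ norms are dominated by K times the strong ℓ² norms; the constant is 3 = 2 + 1. -/
theorem l2_conv_le' (hw : TameWeight q α β K) (v : ι → ℝ≥0∞) (g : G → ℝ≥0∞) :
    l2 (fun p => α p * conv q v g p) ≤
      3 * K * l2 (fun k => α (q k) * v k) * l2 (fun p => α p * g p) := by
  refine (l2_conv_le hw v g).trans ?_
  calc _ ≤ 2 * (K * l2 fun p => α p * g p) * l2 (fun k => α (q k) * v k) +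
        (K * l2 fun k => α (q k) * v k) * l2 (fun p => α p * g p) := by
        gcongr
        · exact hw.embedG g
        · exact hw.embed v
    _ = _ := by ring

theorem l2_momentum_le (hw : TameWeight q α β K) (g : G → ℝ≥0∞) :
    l2 (fun k => α (q k) * g (q k)) ≤ 2 * l2 (fun p => α p * g p) := by
  apply l2_le_of_sq_le
  refine (hw.fiber fun p => (α p * g p) ^ 2).trans ?_
  rw [mul_pow, l2_sq]
  gcongr
  norm_num

theorem l2_delta (a : ℝ≥0∞) [DecidableEq G] :
    l2 (fun p : G => α p * if p = 0 then a else 0) = α 0 * a := by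
  have h : l2 (fun p : G => α p * if p = 0 then a else 0) ^ 2 = (α 0 * a) ^ 2 := by
    rw [l2_sq, tsum_eq_single 0]
    · simp
    · intro p hp; simp [hp]
  exact (ENNReal.pow_right_strictMono two_ne_zero).injective h

/-! ### Iterated convolutions and the gain from high entries -/

theorem convPow_zero_succ (H : ι → Prop) (v : ι → ℝ≥0∞) (d : ℕ) :
    convPow q H v (d + 1) 0 = conv q v (convPow q H v d 0) := by
  funext p
  simp [convPow, conv]

theorem convPow_antitone (H : ι → Prop) (v : ι → ℝ≥0∞) (d : ℕ) (h : ℕ) (p : G) :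
    convPow q H v d (h + 1) p ≤ convPow q H v d h p := by
  induction d generalizing h p with
  | zero => simp [convPow]
  | succ d ih =>
    refine ENNReal.tsum_le_tsum fun k => mul_le_mul_right ?_ _
    split_ifs
    · cases h with
      | zero => simp
      | succ h => simpa using ih h _
    · exact ih h _

-- Either the first entry is high and pays for one of the required high entries, or all of them are
-- found among the rest.
open Classical in
theorem convPow_succ_le (H : ι → Prop) (v : ι → ℝ≥0∞) (d h : ℕ) (p : G) :
    convPow q H v (d + 1) (h + 1) p ≤ conv q v (convPow q H v d (h + 1)) p +
      conv q (fun k => if H k then v k else 0) (convPow q H v d h) p := by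
  rw [conv, conv, ← ENNReal.tsum_add]
  refine ENNReal.tsum_le_tsum fun k => ?_
  split_ifs <;> simp

theorem l2_convPow_le (hw : TameWeight q α β K) (H : ι → Prop) (v : ι → ℝ≥0∞) (d : ℕ) :
    l2 (fun p => α p * convPow q H v d 0 p) ≤
      α 0 * (3 * K * l2 (fun k => α (q k) * v k)) ^ d := by
  classical
  induction d with
  | zero =>
    have := l2_delta (α := α) (1 : ℝ≥0∞)
    simpa [convPow] using this.le
  | succ d ih =>
    rw [convPow_zero_succ, pow_succ', mul_left_comm]
    exact (l2_conv_le' hw v _).trans (mul_le_mul_right ih _)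

theorem l1_convPow_le (hw : TameWeight q α β K) (H : ι → Prop) (v : ι → ℝ≥0∞) (d : ℕ) :
    ∑' p, β p * convPow q H v d 0 p ≤ α 0 * (K * l2 (fun k => α (q k) * v k)) ^ d := by
  classical
  induction d with
  | zero =>
    rw [tsum_eq_single 0]
    · simpa [convPow] using hw.le_zero
    · intro p hp; simp [convPow, hp]
  | succ d ih =>
    rw [convPow_zero_succ, pow_succ', mul_left_comm]
    exact (l1_conv_le hw v _).trans (mul_le_mul' (hw.embed v) ih)

open Classical in
/-- The set `H` of high indices costs a factor `γ` in the weaker norm. -/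
def HighGain (q : ι → G) (α β : G → ℝ≥0∞) (K : ℝ≥0∞) (H : ι → Prop) (γ : ℝ≥0∞) : Prop :=
  ∀ x : ι → ℝ≥0∞, ∑' k, β (q k) * (if H k then x k else 0) ≤
    γ * (K * l2 fun k => α (q k) * x k)

/-- The factor d counts the positions of the high entry; in the weak norm that entry brings the gain
γ. -/
theorem l1_convPow_one_le (hw : TameWeight q α β K) {H : ι → Prop} {γ : ℝ≥0∞}
    (hH : HighGain q α β K H γ) (v : ι → ℝ≥0∞) (d : ℕ) :
    ∑' p, β p * convPow q H v d 1 p ≤ d * γ * α 0 * (K * l2 (fun k => α (q k) * v k)) ^ d := by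
  classical
  induction d with
  | zero => simp [convPow]
  | succ d ih =>
    calc ∑' p, β p * convPow q H v (d + 1) 1 p
        ≤ ∑' p, β p * conv q v (convPow q H v d 1) p +
          ∑' p, β p * conv q (fun k => if H k then v k else 0) (convPow q H v d 0) p := by
          rw [← ENNReal.tsum_add]
          refine ENNReal.tsum_le_tsum fun p => ?_
          rw [← mul_add]
          exact mul_le_mul_right (convPow_succ_le H v d 0 p) _
      _ ≤ (K * l2 fun k => α (q k) * v k) *
            (d * γ * α 0 * (K * l2 (fun k => α (q k) * v k)) ^ d) +
          (γ * (K * l2 fun k => α (q k) * v k)) *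
            (α 0 * (K * l2 (fun k => α (q k) * v k)) ^ d) := by
          refine add_le_add ((l1_conv_le hw _ _).trans (mul_le_mul' (hw.embed v) ih))
            ((l1_conv_le hw _ _).trans (mul_le_mul' (hH v) (l1_convPow_le hw H v d)))
      _ = _ := by push_cast; ring

/-- Two high entries are needed for a gain in the strong norm: the entry that carries the strong
weight gains nothing, but the other high entry is then measured in the weak norm. -/
theorem l2_convPow_two_le (hw : TameWeight q α β K) {H : ι → Prop} {γ : ℝ≥0∞}
    (hH : HighGain q α β K H γ) (v : ι → ℝ≥0∞) (d : ℕ) :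
    l2 (fun p => α p * convPow q H v d 2 p) ≤
      d ^ 2 * γ * α 0 * (3 * K * l2 (fun k => α (q k) * v k)) ^ d := by
  classical
  induction d with
  | zero =>
    simp only [convPow]
    simp [l2]
  | succ d ih =>
    set ν := l2 (fun k => α (q k) * v k) with hν
    have hone : (K * ν) ^ d ≤ (3 * K * ν) ^ d := by
      refine pow_le_pow_left' ?_ d
      rw [mul_assoc]
      exact le_mul_of_one_le_left' (by norm_num)
    have h1 : l2 (fun k => α (q k) * if H k then v k else 0) ≤ ν := by
      refine l2_mono fun k => ?_
      split_ifs <;> simp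
    have h2 : l2 (fun p => α p * convPow q H v d 1 p) ≤ α 0 * (3 * K * ν) ^ d :=
      (l2_mono fun p => mul_le_mul_right (convPow_antitone H v d 0 p) _).trans
        (l2_convPow_le hw H v d)
    calc l2 (fun p => α p * convPow q H v (d + 1) 2 p)
        ≤ l2 (fun p => α p * conv q v (convPow q H v d 2) p) +
          l2 (fun p => α p *
            conv q (fun k => if H k then v k else 0) (convPow q H v d 1) p) := by
          refine (l2_mono fun p => ?_).trans (l2_add_le _ _)
          rw [← mul_add]
          exact mul_le_mul_right (convPow_succ_le H v d 1 p) _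
      _ ≤ 3 * K * ν * (d ^ 2 * γ * α 0 * (3 * K * ν) ^ d) +
          (2 * (d * γ * α 0 * (3 * K * ν) ^ d) * (K * ν) +
            (γ * (K * ν)) * (α 0 * (3 * K * ν) ^ d)) := by
          refine add_le_add ((l2_conv_le' hw _ _).trans (mul_le_mul_right ih _))
            ((l2_conv_le hw _ _).trans (add_le_add ?_ ?_))
          · refine mul_le_mul' (mul_le_mul_right ?_ _) (h1.trans (le_mul_of_one_le_left' hw.one_le))
            exact (l1_convPow_one_le hw hH v d).trans (mul_le_mul_right hone _)
          · exact mul_le_mul' (hH v) h2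
      -- Inflating the last two terms by 3 makes the coefficients add up to d² + 2 d + 1 = (d + 1)².
      _ ≤ 3 * K * ν * (d ^ 2 * γ * α 0 * (3 * K * ν) ^ d) +
          (3 * (2 * (d * γ * α 0 * (3 * K * ν) ^ d) * (K * ν)) +
            3 * ((γ * (K * ν)) * (α 0 * (3 * K * ν) ^ d))) := by
          refine add_le_add le_rfl (add_le_add ?_ ?_) <;>
            exact le_mul_of_one_le_left' (by norm_num)
      _ = _ := by push_cast; ring

/-- The difference of the `d`-fold products of two families, majorised recursively:
`y` bounds both families and `δ` bounds their difference. -/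
noncomputable def convDiff (q : ι → G) (y δ : ι → ℝ≥0∞) : ℕ → G → ℝ≥0∞
  | 0, _ => 0
  | d + 1, p => conv q y (convDiff q y δ d) p + conv q δ (convPow q (fun _ => False) y d 0) p

/-- Replacing one factor at a time gives d + 1 products, each with a single factor δ and d factors
y. -/
theorem l2_convDiff_le (hw : TameWeight q α β K) (y δ : ι → ℝ≥0∞) (d : ℕ) :
    l2 (fun p => α p * convDiff q y δ (d + 1) p) ≤
      (d + 1) * (3 * K) * α 0 * (3 * K * l2 (fun k => α (q k) * y k)) ^ d *
        l2 (fun k => α (q k) * δ k) := by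
  have hstep : ∀ d, l2 (fun p => α p * convDiff q y δ (d + 1) p) ≤
      l2 (fun p => α p * conv q y (convDiff q y δ d) p) +
        l2 (fun p => α p * conv q δ (convPow q (fun _ => False) y d 0) p) := fun d => by
    refine (l2_mono fun p => ?_).trans (l2_add_le _ _)
    rw [convDiff, mul_add]
  set ν := l2 (fun k => α (q k) * y k)
  set ν' := l2 (fun k => α (q k) * δ k)
  have hsec : ∀ d, l2 (fun p => α p * conv q δ (convPow q (fun _ => False) y d 0) p) ≤
      3 * K * ν' * (α 0 * (3 * K * ν) ^ d) := fun d =>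
    (l2_conv_le' hw _ _).trans (mul_le_mul_right (l2_convPow_le hw _ y d) _)
  induction d with
  | zero =>
    refine (hstep 0).trans ((add_le_add ((l2_conv_le' hw _ _)) (hsec 0)).trans ?_)
    have h0 : l2 (fun p => α p * convDiff q y δ 0 p) = 0 := by simp [convDiff, l2]
    rw [h0]
    simp only [mul_zero, zero_add, Nat.cast_zero, pow_zero]
    exact le_of_eq (by ring)
  | succ d ih =>
    refine (hstep (d + 1)).trans ((add_le_add ((l2_conv_le' hw _ _).trans
      (mul_le_mul_right ih _)) (hsec (d + 1))).trans (le_of_eq ?_))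
    push_cast
    ring

end Conv

open MvPolynomial
open Finset.HasAntidiagonal (antidiagonal)

set_option linter.unusedSectionVars false

/-! ### Hamiltonian polynomials in finitely many variables -/

/-- A finite set of modes: conjugation `bar`, the coefficients `c J = -i σ` of the Poisson
structure and the momentum `q J = σ j`. -/
structure Phase (ι G : Type*) [AddCommGroup G] where
  bar : ι → ι
  bar_bar : ∀ J, bar (bar J) = J
  c : ι → ℂ
  c_bar : ∀ J, c (bar J) = -c J
  norm_c : ∀ J, ‖c J‖ = 1
  q : ι → G
  q_bar : ∀ J, q (bar J) = -q J

/-! ### Reindexing of triple sums and causal recursions -/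

theorem sum_antidiagonal_antidiagonal_fst {M : Type*} [AddCommMonoid M] (F : ℕ → ℕ → ℕ → M)
    (k : ℕ) :
    ∑ x ∈ antidiagonal k, ∑ y ∈ antidiagonal x.1, F y.1 y.2 x.2 =
      ∑ x ∈ antidiagonal k, ∑ y ∈ antidiagonal x.1, F y.1 x.2 y.2 := by
  rw [Finset.sum_sigma', Finset.sum_sigma']
  refine Finset.sum_nbij' (fun z => ⟨(z.2.1 + z.1.2, z.2.2), (z.2.1, z.1.2)⟩)
    (fun z => ⟨(z.2.1 + z.1.2, z.2.2), (z.2.1, z.1.2)⟩) ?_ ?_ ?_ ?_ ?_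
  all_goals
    rintro ⟨⟨a, b⟩, ⟨i, j⟩⟩ h
    simp only [Finset.mem_sigma, Finset.HasAntidiagonal.mem_antidiagonal] at h ⊢
    try obtain ⟨rfl, rfl⟩ := h
    try first
      | rfl
      | exact ⟨by ring, trivial⟩

theorem sum_antidiagonal_antidiagonal_snd {M : Type*} [AddCommMonoid M] (F : ℕ → ℕ → ℕ → M)
    (k : ℕ) :
    ∑ x ∈ antidiagonal k, ∑ y ∈ antidiagonal x.1, F y.1 y.2 x.2 =
      ∑ x ∈ antidiagonal k, ∑ y ∈ antidiagonal x.2, F x.1 y.1 y.2 := by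
  rw [Finset.sum_sigma', Finset.sum_sigma']
  refine Finset.sum_nbij' (fun z => ⟨(z.2.1, z.2.2 + z.1.2), (z.2.2, z.1.2)⟩)
    (fun z => ⟨(z.1.1 + z.2.1, z.2.2), (z.1.1, z.2.1)⟩) ?_ ?_ ?_ ?_ ?_
  all_goals
    rintro ⟨⟨a, b⟩, ⟨i, j⟩⟩ h
    simp only [Finset.mem_sigma, Finset.HasAntidiagonal.mem_antidiagonal] at h ⊢
    try obtain ⟨rfl, rfl⟩ := h
    try first
      | rfl
      | exact ⟨by ring, trivial⟩

/-- A recursion in which the `k`-th value depends on the earlier values only has a solution. -/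
theorem exists_eq_of_causal {X : Type*} [Inhabited X] (Φ : (ℕ → X) → ℕ → X)
    (h : ∀ k x y, (∀ j < k, x j = y j) → Φ x k = Φ y k) : ∃ x : ℕ → X, ∀ k, x k = Φ x k := by
  let F : (k : ℕ) → ((j : ℕ) → j < k → X) → X :=
    fun k x => Φ (fun j => if hj : j < k then x j hj else default) k
  let x : ℕ → X := fun k => Nat.strongRec F k
  refine ⟨x, fun k => ?_⟩
  have : x k = F k (fun j _ => x j) := Nat.strongRec_eq F k
  rw [this]
  refine h k _ _ fun j hj => ?_
  simp [hj]

section Algebra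

variable {ι G : Type*} [Fintype ι] [DecidableEq ι] [AddCommGroup G] (p : Phase ι G)

theorem Phase.sum_bar {M : Type*} [AddCommMonoid M] (F : ι → M) :
    ∑ J, F (p.bar J) = ∑ J, F J :=
  (Equiv.sum_comp (Function.Involutive.toPerm p.bar p.bar_bar) F)

/-- The Hamiltonian derivation `A ↦ {χ, A} = ∑ c_J ∂χ/∂u_{bar J} ∂A/∂u_J`. -/
noncomputable def Phase.ham (χ : MvPolynomial ι ℂ) :
    Derivation ℂ (MvPolynomial ι ℂ) (MvPolynomial ι ℂ) :=
  ∑ J, (C (p.c J) * pderiv (p.bar J) χ) • pderiv J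

theorem Phase.ham_apply (χ A : MvPolynomial ι ℂ) :
    p.ham χ A = ∑ J, C (p.c J) * pderiv (p.bar J) χ * pderiv J A := by
  unfold Phase.ham
  rw [← Derivation.coeFnAddMonoidHom_apply, map_sum, Finset.sum_apply]
  rfl

theorem Phase.ham_X (χ : MvPolynomial ι ℂ) (J : ι) :
    p.ham χ (X J) = C (p.c J) * pderiv (p.bar J) χ := by
  rw [p.ham_apply, Finset.sum_eq_single J]
  · simp
  · intro K _ hK
    rw [pderiv_X_of_ne hK.symm, mul_zero]
  · simp

theorem Phase.ham_antisymm (A B : MvPolynomial ι ℂ) : p.ham A B = -p.ham B A := by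
  rw [p.ham_apply, p.ham_apply, ← p.sum_bar, ← Finset.sum_neg_distrib]
  refine Finset.sum_congr rfl fun J _ => ?_
  rw [p.bar_bar, p.c_bar, C_neg]
  ring

theorem Phase.ham_add (A A' B : MvPolynomial ι ℂ) : p.ham (A + A') B = p.ham A B + p.ham A' B := by
  rw [p.ham_antisymm, map_add, neg_add, ← p.ham_antisymm, ← p.ham_antisymm]

theorem Phase.ham_smul (a : ℂ) (A B : MvPolynomial ι ℂ) : p.ham (a • A) B = a • p.ham A B := by
  rw [p.ham_antisymm, Derivation.map_smul, ← smul_neg, ← p.ham_antisymm]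

/-- The Poisson bracket as a bilinear map. -/
noncomputable def Phase.br : MvPolynomial ι ℂ →ₗ[ℂ] MvPolynomial ι ℂ →ₗ[ℂ] MvPolynomial ι ℂ :=
  LinearMap.mk₂ ℂ (fun A B => p.ham A B) p.ham_add p.ham_smul
    (fun _ B B' => map_add _ B B') (fun a _ B => Derivation.map_smul _ a B)

theorem Phase.br_apply (A B : MvPolynomial ι ℂ) : p.br A B = p.ham A B := rfl

/-- The commutator of two derivations is a derivation, and this one vanishes on the variables. -/
theorem pderiv_comm (i j : ι) (A : MvPolynomial ι ℂ) :
    pderiv i (pderiv j A) = pderiv j (pderiv i A) := by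
  have h : ⁅(pderiv i : Derivation ℂ (MvPolynomial ι ℂ) (MvPolynomial ι ℂ)),
      (pderiv j : Derivation ℂ (MvPolynomial ι ℂ) (MvPolynomial ι ℂ))⁆ = 0 := by
    refine MvPolynomial.derivation_ext fun k => ?_
    rw [Derivation.commutator_apply]
    simp only [pderiv_X, Pi.single_apply]
    split_ifs <;> simp
  have h2 := congrArg (fun D : Derivation ℂ (MvPolynomial ι ℂ) (MvPolynomial ι ℂ) => D A) h
  rw [Derivation.commutator_apply] at h2
  exact sub_eq_zero.1 h2

/-- The Jacobi identity. -/
theorem Phase.ham_ham (χ A B : MvPolynomial ι ℂ) :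
    p.ham χ (p.ham A B) = p.ham (p.ham χ A) B + p.ham A (p.ham χ B) := by
  -- As an identity between derivations it has to be checked on the variables only.
  have h : ⁅p.ham χ, p.ham A⁆ = p.ham (p.ham χ A) := by
    refine MvPolynomial.derivation_ext fun K => ?_
    have e1 : ∀ E F : MvPolynomial ι ℂ, ∀ a : ℂ, p.ham E (C a * F) = C a * p.ham E F := by
      intro E F a
      rw [Derivation.leibniz]
      simp
    rw [Derivation.commutator_apply, p.ham_X, p.ham_X, p.ham_X, e1, e1, ← mul_sub]
    congr 1
    rw [p.ham_apply χ A, map_sum]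
    simp only [Derivation.leibniz, smul_eq_mul, pderiv_C, mul_zero, add_zero]
    rw [Finset.sum_add_distrib, sub_eq_add_neg, ← p.ham_antisymm]
    congr 1
    · rw [p.ham_apply]
      exact Finset.sum_congr rfl fun J _ => by rw [pderiv_comm]
    · rw [p.ham_apply]
      refine Finset.sum_congr rfl fun J _ => ?_
      rw [pderiv_comm (p.bar J)]
      ring
  have h2 := congrArg (fun D : Derivation ℂ (MvPolynomial ι ℂ) (MvPolynomial ι ℂ) => D B) h
  rw [Derivation.commutator_apply] at h2
  rw [← h2]
  ring

/-! ### Diagonal operators and quadratic Hamiltonians -/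

/-- Multiplication of the coefficients of a polynomial by the values of `g`. -/
noncomputable def diag (g : (ι →₀ ℕ) → ℂ) (A : MvPolynomial ι ℂ) : MvPolynomial ι ℂ :=
  ∑ m ∈ A.support, monomial m (g m * coeff m A)

theorem coeff_diag (g : (ι →₀ ℕ) → ℂ) (A : MvPolynomial ι ℂ) (m : ι →₀ ℕ) :
    coeff m (diag g A) = g m * coeff m A := by
  unfold diag
  rw [coeff_sum]
  simp only [coeff_monomial, Finset.sum_ite_eq', mem_support_iff]
  by_cases h : coeff m A = 0 <;> simp [h]

theorem coeff_X_mul_pderiv (J : ι) (A : MvPolynomial ι ℂ) (m : ι →₀ ℕ) :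
    coeff m (X J * pderiv J A) = m J * coeff m A := by
  rw [coeff_X_mul']
  split_ifs with h
  · have h1 : 1 ≤ m J := Nat.one_le_iff_ne_zero.2 (Finsupp.mem_support_iff.1 h)
    have h2 : m - Finsupp.single J 1 + Finsupp.single J 1 = m :=
      tsub_add_cancel_of_le (Finsupp.single_le_iff.2 h1)
    rw [coeff_pderiv, h2, mul_comm]
    congr 1
    simp only [Finsupp.coe_tsub, Pi.sub_apply, Finsupp.single_eq_same]
    rw [Nat.cast_sub h1]
    simp
  · rw [Finsupp.notMem_support_iff.1 h]
    simp

/-- The quadratic Hamiltonian `∑ w_J u_J u_{bar J}`. -/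
noncomputable def Phase.quad (w : ι → ℂ) : MvPolynomial ι ℂ :=
  ∑ J, C (w J) * (X J * X (p.bar J))

theorem Phase.pderiv_quad {w : ι → ℂ} (hw : ∀ J, w (p.bar J) = w J) (K : ι) :
    pderiv K (p.quad w) = C (2 * w K) * X (p.bar K) := by
  unfold Phase.quad
  rw [map_sum]
  have h : ∀ J, pderiv K (C (w J) * (X J * X (p.bar J)) : MvPolynomial ι ℂ) =
      C (w J) * X (p.bar J) * pderiv K (X J) +
        C (w (p.bar J)) * X (p.bar (p.bar J)) * pderiv K (X (p.bar J)) := by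
    intro J
    rw [pderiv_C_mul, pderiv_mul, hw, p.bar_bar]
    ring
  simp only [h]
  rw [Finset.sum_add_distrib,
    p.sum_bar (fun J => C (w J) * X (p.bar J) * pderiv K (X J : MvPolynomial ι ℂ)),
    Finset.sum_eq_single K]
  · rw [pderiv_X_self, C_mul, show (C (2 : ℂ) : MvPolynomial ι ℂ) = 2 from map_ofNat C 2]
    ring
  · intro J _ hJ
    rw [pderiv_X_of_ne hJ, mul_zero]
  · simp

/-- `X J * pderiv J` multiplies a monomial by its exponent of J, and the bracket with a quadratic
Hamiltonian is a combination of these operators. For w = ω / 2 the eigenvalues are the small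
divisors. -/
theorem Phase.ham_quad {w : ι → ℂ} (hw : ∀ J, w (p.bar J) = w J) (A : MvPolynomial ι ℂ) :
    p.ham (p.quad w) A = diag (fun m => 2 * ∑ J, p.c J * w J * m J) A := by
  ext m
  rw [p.ham_apply, coeff_diag, coeff_sum, mul_assoc, Finset.sum_mul, Finset.mul_sum]
  refine Finset.sum_congr rfl fun J _ => ?_
  rw [p.pderiv_quad hw, p.bar_bar, hw, ← mul_assoc, ← C_mul, mul_assoc, coeff_C_mul,
    coeff_X_mul_pderiv]
  ring

/-- Exchanging J with its conjugate changes the sign of the bracket, since c is odd and both weights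
are even. -/
theorem Phase.ham_quad_quad {w w' : ι → ℂ} (hw : ∀ J, w (p.bar J) = w J)
    (hw' : ∀ J, w' (p.bar J) = w' J) : p.ham (p.quad w) (p.quad w') = 0 := by
  have h : p.ham (p.quad w) (p.quad w') = -p.ham (p.quad w) (p.quad w') := by
    conv_lhs => rw [p.ham_apply, ← p.sum_bar]
    rw [p.ham_apply, ← Finset.sum_neg_distrib]
    refine Finset.sum_congr rfl fun J _ => ?_
    rw [p.pderiv_quad hw, p.pderiv_quad hw', p.pderiv_quad hw, p.pderiv_quad hw', p.c_bar,
      p.bar_bar, hw, hw', C_neg]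
    ring
  exact self_eq_neg.1 h

open Classical in
/-- The number of factors in `H` of a monomial. -/
noncomputable def highCount (H : ι → Prop) (m : ι →₀ ℕ) : ℕ := ∑ J, if H J then m J else 0

open Classical in
/-- The part of a polynomial that consists of monomials with at least `h` factors in `H`. -/
noncomputable def highPart (H : ι → Prop) (h : ℕ) (A : MvPolynomial ι ℂ) : MvPolynomial ι ℂ :=
  diag (fun m => if h ≤ highCount H m then 1 else 0) A

open Classical in
theorem coeff_X_mul_highPart_pderiv (H : ι → Prop) (h : ℕ) (J : ι) (A : MvPolynomial ι ℂ)
    (m : ι →₀ ℕ) : coeff m (X J * highPart H h (pderiv J A)) =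
      (if h ≤ highCount H (m - Finsupp.single J 1) then 1 else 0) * (m J * coeff m A) := by
  rw [← coeff_X_mul_pderiv, coeff_X_mul', coeff_X_mul']
  split_ifs with h1 h2 <;> simp_all [highPart, coeff_diag]

/-- The bracket of a Hamiltonian in normal form with the weighted norm. -/
theorem Phase.ham_quad_of_normal {w : ι → ℂ} (hw : ∀ J, w (p.bar J) = w J) (H : ι → Prop)
    (A : MvPolynomial ι ℂ)
    (hA : ∀ m, coeff m A ≠ 0 → ∑ J, p.c J * w J * m J = ∑ J,
      (open Classical in if 2 ≤ highCount H (m - Finsupp.single J 1) then p.c J * w J * m J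
        else 0)) :
    p.ham A (p.quad w) = ∑ J, C (-2 * (p.c J * w J)) * (X J * highPart H 2 (pderiv J A)) := by
  rw [p.ham_antisymm, p.ham_quad hw]
  ext m
  rw [coeff_neg, coeff_diag, coeff_sum]
  simp only [coeff_C_mul, coeff_X_mul_highPart_pderiv]
  by_cases h0 : coeff m A = 0
  · simp [h0]
  · rw [hA m h0, mul_assoc, Finset.sum_mul, Finset.mul_sum, ← Finset.sum_neg_distrib]
    refine Finset.sum_congr rfl fun J _ => ?_
    split_ifs <;> ring

/-! ### Lie series -/

/-- The operators `Ψ_k` of the Lie series generated by `χ`: `Ψ_0 = id` and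
`k Ψ_k = ∑_{m = 1}^k Ψ_{k - m} ∘ {χ_m, ·}`. -/
noncomputable def Phase.lie (χ : ℕ → MvPolynomial ι ℂ) :
    ℕ → MvPolynomial ι ℂ →ₗ[ℂ] MvPolynomial ι ℂ
  | 0 => LinearMap.id
  | k + 1 => ((k + 1 : ℕ) : ℂ)⁻¹ • ∑ m : Fin (k + 1),
      (Phase.lie χ (k - m)).comp (p.ham (χ (m + 1)) : MvPolynomial ι ℂ →ₗ[ℂ] MvPolynomial ι ℂ)

theorem Phase.lie_zero (χ : ℕ → MvPolynomial ι ℂ) (A : MvPolynomial ι ℂ) : p.lie χ 0 A = A := by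
  rw [Phase.lie]; rfl

theorem Phase.lie_succ (χ : ℕ → MvPolynomial ι ℂ) (k : ℕ) (A : MvPolynomial ι ℂ) :
    p.lie χ (k + 1) A = ((k + 1 : ℕ) : ℂ)⁻¹ •
      ∑ m ∈ Finset.range (k + 1), p.lie χ (k - m) (p.ham (χ (m + 1)) A) := by
  rw [Phase.lie, LinearMap.smul_apply, LinearMap.sum_apply,
    Finset.sum_range (fun m => p.lie χ (k - m) (p.ham (χ (m + 1)) A))]
  rfl

theorem Phase.smul_lie_succ (χ : ℕ → MvPolynomial ι ℂ) (k : ℕ) (A : MvPolynomial ι ℂ) :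
    ((k + 1 : ℕ) : ℂ) • p.lie χ (k + 1) A =
      ∑ x ∈ antidiagonal k, p.lie χ x.1 (p.ham (χ (x.2 + 1)) A) := by
  rw [Phase.lie_succ, smul_smul, mul_inv_cancel₀ (Nat.cast_ne_zero.2 k.succ_ne_zero), one_smul,
    Finset.Nat.sum_antidiagonal_eq_sum_range_succ_mk, ← Finset.sum_range_reflect]
  refine Finset.sum_congr rfl fun m hm => ?_
  have : m ≤ k := Nat.lt_succ_iff.1 (Finset.mem_range.1 hm)
  simp only [Nat.add_sub_cancel]
  rw [Nat.sub_sub_self this]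

/-- Since Ψ_k sees the generators of order at most k only, the normal form equations can be solved
recursively. -/
theorem Phase.lie_congr {χ χ' : ℕ → MvPolynomial ι ℂ} (k : ℕ)
    (h : ∀ j, 1 ≤ j → j ≤ k → χ j = χ' j) (A : MvPolynomial ι ℂ) :
    p.lie χ k A = p.lie χ' k A := by
  induction k using Nat.strong_induction_on generalizing A with
  | _ k ih =>
    cases k with
    | zero => rw [p.lie_zero, p.lie_zero]
    | succ k =>
      rw [p.lie_succ, p.lie_succ]
      congr 1
      refine Finset.sum_congr rfl fun m hm => ?_
      have hm' := Finset.mem_range.1 hm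
      rw [h (m + 1) (by omega) (by omega)]
      exact ih (k - m) (by omega) (fun j h1 h2 => h j h1 (by omega)) _

/-- The Lie series respects every bilinear operation for which all `{χ_m, ·}` are derivations. -/
theorem Phase.lie_bilinear (χ : ℕ → MvPolynomial ι ℂ)
    (b : MvPolynomial ι ℂ →ₗ[ℂ] MvPolynomial ι ℂ →ₗ[ℂ] MvPolynomial ι ℂ)
    (hb : ∀ m A B, p.ham (χ m) (b A B) = b (p.ham (χ m) A) B + b A (p.ham (χ m) B)) (k : ℕ)
    (A B : MvPolynomial ι ℂ) :
    p.lie χ k (b A B) = ∑ x ∈ antidiagonal k, b (p.lie χ x.1 A) (p.lie χ x.2 B) := by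
  induction k using Nat.strong_induction_on generalizing A B with
  | _ k ih =>
    cases k with
    | zero => simp [p.lie_zero]
    | succ k =>
      have hk : ((k + 1 : ℕ) : ℂ) ≠ 0 := Nat.cast_ne_zero.2 k.succ_ne_zero
      refine smul_right_injective _ hk ?_
      simp only
      have hL : ((k + 1 : ℕ) : ℂ) • p.lie χ (k + 1) (b A B) =
          (∑ x ∈ antidiagonal k, ∑ y ∈ antidiagonal x.1,
            b (p.lie χ y.1 (p.ham (χ (x.2 + 1)) A)) (p.lie χ y.2 B)) +
          ∑ x ∈ antidiagonal k, ∑ y ∈ antidiagonal x.1,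
            b (p.lie χ y.1 A) (p.lie χ y.2 (p.ham (χ (x.2 + 1)) B)) := by
        rw [p.smul_lie_succ, ← Finset.sum_add_distrib]
        refine Finset.sum_congr rfl fun x hx => ?_
        have hx' := Finset.HasAntidiagonal.mem_antidiagonal.1 hx
        rw [hb, map_add, ih x.1 (by omega), ih x.1 (by omega)]
      -- Writing k + 1 = x.1 + x.2 distributes the factor over the two arguments, and each half
      -- becomes the defining recursion of Ψ. Comparison with `hL` is then a reindexing of triples.
      have hR : ((k + 1 : ℕ) : ℂ) •
          ∑ x ∈ antidiagonal (k + 1), b (p.lie χ x.1 A) (p.lie χ x.2 B) =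
          (∑ x ∈ antidiagonal (k + 1),
            b ((x.1 : ℂ) • p.lie χ x.1 A) (p.lie χ x.2 B)) +
          ∑ x ∈ antidiagonal (k + 1),
            b (p.lie χ x.1 A) ((x.2 : ℂ) • p.lie χ x.2 B) := by
        rw [← Finset.sum_add_distrib, Finset.smul_sum]
        refine Finset.sum_congr rfl fun x hx => ?_
        rw [← Finset.HasAntidiagonal.mem_antidiagonal.1 hx, map_smul, map_smul, LinearMap.smul_apply,
          ← add_smul, Nat.cast_add]
      rw [hL, hR, Finset.Nat.sum_antidiagonal_succ, Finset.Nat.sum_antidiagonal_succ' (n := k)]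
      simp only [Nat.cast_zero, zero_smul, map_zero, LinearMap.zero_apply, zero_add,
        p.smul_lie_succ, map_sum, LinearMap.sum_apply]
      rw [sum_antidiagonal_antidiagonal_fst
        (fun i j m => b (p.lie χ i (p.ham (χ (m + 1)) A)) (p.lie χ j B)),
        sum_antidiagonal_antidiagonal_snd
        (fun i j m => b (p.lie χ i A) (p.lie χ j (p.ham (χ (m + 1)) B)))]

theorem Phase.lie_mul (χ : ℕ → MvPolynomial ι ℂ) (k : ℕ) (A B : MvPolynomial ι ℂ) :
    p.lie χ k (A * B) = ∑ x ∈ antidiagonal k, p.lie χ x.1 A * p.lie χ x.2 B :=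
  p.lie_bilinear χ (LinearMap.mul ℂ _) (fun m A B => by
    simp only [LinearMap.mul_apply', Derivation.leibniz, smul_eq_mul]; ring) k A B

/-- The Jacobi identity is the Leibniz rule for the bracket, so the Lie series is formally
canonical. -/
theorem Phase.lie_ham (χ : ℕ → MvPolynomial ι ℂ) (k : ℕ) (A B : MvPolynomial ι ℂ) :
    p.lie χ k (p.ham A B) =
      ∑ x ∈ antidiagonal k, p.ham (p.lie χ x.1 A) (p.lie χ x.2 B) :=
  p.lie_bilinear χ p.br (fun _ A B => p.ham_ham _ A B) k A B

theorem Phase.lie_one (χ : ℕ → MvPolynomial ι ℂ) (k : ℕ) :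
    p.lie χ (k + 1) 1 = 0 := by
  rw [p.lie_succ]
  simp

/-! ### The normal form -/

open Classical in
/-- The part of `Q` that is kept in the normal form. -/
noncomputable def keepPart (elim : (ι →₀ ℕ) → Prop) (Q : MvPolynomial ι ℂ) : MvPolynomial ι ℂ :=
  diag (fun m => if elim m then 0 else 1) Q

open Classical in
/-- The generator that eliminates the rest of `Q` in the step `k`. -/
noncomputable def generator (elim : (ι →₀ ℕ) → Prop) (dv : (ι →₀ ℕ) → ℂ) (k : ℕ)
    (Q : MvPolynomial ι ℂ) : MvPolynomial ι ℂ :=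
  diag (fun m => if elim m then -k / dv m else 0) Q

/-- Existence of the normal form. -/
theorem Phase.exists_normalForm (H : ℕ → MvPolynomial ι ℂ) (elim : (ι →₀ ℕ) → Prop)
    (dv : (ι →₀ ℕ) → ℂ) (hdv : ∀ m, elim m → dv m ≠ 0)
    (hH : ∀ A, p.ham (H 0) A = diag dv A) :
    ∃ Q : ℕ → MvPolynomial ι ℂ,
      (∀ k, 1 ≤ k → Q k = H k - ∑ b ∈ Finset.Ico 1 k,
        p.lie (fun m => generator elim dv m (Q m)) (k - b)
          (keepPart elim (Q b) + ((b : ℂ) / k) • (Q b - keepPart elim (Q b)))) ∧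
      ∀ k, 1 ≤ k → H k = p.lie (fun m => generator elim dv m (Q m)) k (H 0) +
        ∑ b ∈ Finset.Icc 1 k, p.lie (fun m => generator elim dv m (Q m)) (k - b)
          (keepPart elim (Q b)) := by
  obtain ⟨Q, hQ⟩ := exists_eq_of_causal (fun (Q : ℕ → MvPolynomial ι ℂ) k => H k -
    ∑ b ∈ Finset.Ico 1 k, p.lie (fun m => generator elim dv m (Q m)) (k - b)
      (keepPart elim (Q b) + ((b : ℂ) / k) • (Q b - keepPart elim (Q b)))) (by
    intro k Q Q' h
    congr 1
    refine Finset.sum_congr rfl fun b hb => ?_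
    have hb' := Finset.mem_Ico.1 hb
    rw [h b hb'.2]
    refine p.lie_congr _ (fun j h1 h2 => ?_) _
    rw [h j (by omega)])
  refine ⟨Q, fun k _ => hQ k, fun k hk => ?_⟩
  set χ := fun m => generator elim dv m (Q m) with hχ
  -- The homological equation: dividing by the divisor inverts the bracket with H_0 on the monomials
  -- to be eliminated.
  have hgen : ∀ m, p.ham (χ m) (H 0) = (m : ℂ) • (Q m - keepPart elim (Q m)) := by
    intro m
    rw [p.ham_antisymm, hH]
    ext e
    simp only [hχ, generator, keepPart, coeff_neg, coeff_diag, coeff_smul, coeff_sub, smul_eq_mul]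
    split_ifs with he
    · have := hdv e he
      field_simp
      ring
    · ring
  obtain ⟨k, rfl⟩ : ∃ l, k = l + 1 := ⟨k - 1, by omega⟩
  have hk0 : ((k + 1 : ℕ) : ℂ) ≠ 0 := Nat.cast_ne_zero.2 k.succ_ne_zero
  -- The weights b / k in the recursion for Q originate here: the definition of Ψ_k divides by k,
  -- while the homological equation contributes b.
  have hlie : p.lie χ (k + 1) (H 0) = ∑ b ∈ Finset.Icc 1 (k + 1), p.lie χ (k + 1 - b)
      (((b : ℂ) / ((k + 1 : ℕ) : ℂ)) • (Q b - keepPart elim (Q b))) := by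
    rw [p.lie_succ, ← Finset.Ico_succ_right_eq_Icc, Finset.sum_Ico_eq_sum_range, Finset.smul_sum]
    refine Finset.sum_congr (by simp) fun m hm => ?_
    rw [hgen, map_smul, map_smul, smul_smul, add_comm 1 m, Nat.add_sub_add_right]
    congr 1
    field_simp
  have hsplit : Finset.Icc 1 (k + 1) = insert (k + 1) (Finset.Ico 1 (k + 1)) := by
    ext
    simp only [Finset.mem_Icc, Finset.mem_insert, Finset.mem_Ico]
    omega
  rw [hlie, ← Finset.sum_add_distrib, hsplit, Finset.sum_insert (by simp), Nat.sub_self,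
    p.lie_zero, p.lie_zero, div_self hk0, one_smul, sub_add_cancel]
  have hb : ∀ b ∈ Finset.Ico 1 (k + 1), p.lie χ (k + 1 - b)
      (keepPart elim (Q b) + ((b : ℂ) / ((k + 1 : ℕ) : ℂ)) • (Q b - keepPart elim (Q b))) =
      p.lie χ (k + 1 - b) (((b : ℂ) / ((k + 1 : ℕ) : ℂ)) • (Q b - keepPart elim (Q b))) +
        p.lie χ (k + 1 - b) (keepPart elim (Q b)) := fun b _ => by rw [map_add, add_comm]
  rw [← Finset.sum_congr rfl hb]
  exact (sub_eq_iff_eq_add.1 (hQ (k + 1)).symm)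

end Algebra

/-! ### Majorants -/

section Majorant

variable {ι : Type*} [Fintype ι] [DecidableEq ι]

/-- Coefficientwise order of polynomials with nonnegative coefficients. -/
def CoeffLE (A B : MvPolynomial ι ℝ≥0) : Prop := ∀ m, coeff m A ≤ coeff m B

/-- `B` is a majorant of `A`. -/
def Maj (A : MvPolynomial ι ℂ) (B : MvPolynomial ι ℝ≥0) : Prop :=
  ∀ m, ‖coeff m A‖₊ ≤ coeff m B

theorem CoeffLE.rfl {A : MvPolynomial ι ℝ≥0} : CoeffLE A A := fun _ => le_refl _

theorem CoeffLE.trans {A B E : MvPolynomial ι ℝ≥0} (h : CoeffLE A B) (h' : CoeffLE B E) :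
    CoeffLE A E := fun m => (h m).trans (h' m)

theorem CoeffLE.mul {A B A' B' : MvPolynomial ι ℝ≥0} (h : CoeffLE A B) (h' : CoeffLE A' B') :
    CoeffLE (A * A') (B * B') := fun m => by
  rw [coeff_mul, coeff_mul]
  exact Finset.sum_le_sum fun x _ => mul_le_mul' (h _) (h' _)

theorem CoeffLE.sum {κ : Type*} {s : Finset κ} {A B : κ → MvPolynomial ι ℝ≥0}
    (h : ∀ k ∈ s, CoeffLE (A k) (B k)) : CoeffLE (∑ k ∈ s, A k) (∑ k ∈ s, B k) := fun m => by
  rw [coeff_sum, coeff_sum]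
  exact Finset.sum_le_sum fun k hk => h k hk m

theorem CoeffLE.smul {a b : ℝ≥0} {A B : MvPolynomial ι ℝ≥0} (hab : a ≤ b) (h : CoeffLE A B) :
    CoeffLE (a • A) (b • B) := fun m => by
  rw [coeff_smul, coeff_smul]
  exact mul_le_mul' hab (h m)

theorem Maj.trans {A : MvPolynomial ι ℂ} {B B' : MvPolynomial ι ℝ≥0} (h : Maj A B)
    (h' : CoeffLE B B') : Maj A B' := fun m => (h m).trans (h' m)

theorem Maj.add {A A' : MvPolynomial ι ℂ} {B B' : MvPolynomial ι ℝ≥0} (h : Maj A B)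
    (h' : Maj A' B') : Maj (A + A') (B + B') := fun m => by
  rw [coeff_add, coeff_add]
  exact (nnnorm_add_le _ _).trans (add_le_add (h m) (h' m))

theorem Maj.neg {A : MvPolynomial ι ℂ} {B : MvPolynomial ι ℝ≥0} (h : Maj A B) : Maj (-A) B :=
  fun m => by
  rw [coeff_neg, nnnorm_neg]
  exact h m

theorem Maj.sum {κ : Type*} {s : Finset κ} {A : κ → MvPolynomial ι ℂ}
    {B : κ → MvPolynomial ι ℝ≥0} (h : ∀ k ∈ s, Maj (A k) (B k)) :
    Maj (∑ k ∈ s, A k) (∑ k ∈ s, B k) := fun m => by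
  rw [coeff_sum, coeff_sum]
  exact (nnnorm_sum_le _ _).trans (Finset.sum_le_sum fun k hk => h k hk m)

theorem Maj.smul (a : ℂ) {A : MvPolynomial ι ℂ} {B : MvPolynomial ι ℝ≥0} (h : Maj A B) :
    Maj (a • A) (‖a‖₊ • B) := fun m => by
  rw [coeff_smul, coeff_smul, smul_eq_mul, nnnorm_mul]
  exact mul_le_mul_right (h m) _

theorem Maj.mul {A A' : MvPolynomial ι ℂ} {B B' : MvPolynomial ι ℝ≥0} (h : Maj A B)
    (h' : Maj A' B') : Maj (A * A') (B * B') := fun m => by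
  rw [coeff_mul, coeff_mul]
  refine (nnnorm_sum_le _ _).trans (Finset.sum_le_sum fun x _ => ?_)
  rw [nnnorm_mul]
  exact mul_le_mul' (h _) (h' _)

theorem Maj.pderiv {A : MvPolynomial ι ℂ} {B : MvPolynomial ι ℝ≥0} (h : Maj A B) (J : ι) :
    Maj (pderiv J A) (pderiv J B) := fun m => by
  rw [coeff_pderiv, coeff_pderiv, nnnorm_mul]
  refine mul_le_mul' (h _) (le_of_eq ?_)
  have : (m J : ℂ) + 1 = ((m J + 1 : ℕ) : ℂ) := by push_cast; rfl
  rw [this, Complex.nnnorm_natCast]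
  push_cast; rfl

/-- Passage to a polynomial with controlled coefficients. -/
theorem Maj.of_coeff_le {A A' : MvPolynomial ι ℂ} {B : MvPolynomial ι ℝ≥0} {a : ℝ≥0}
    (h : Maj A B) (hA : ∀ m, ‖coeff m A'‖₊ ≤ a * ‖coeff m A‖₊) : Maj A' (a • B) := fun m => by
  rw [coeff_smul]
  exact (hA m).trans (mul_le_mul_right (h m) _)

/-- A subadditive function of `A` that is multiplicatively bounded on monomials is bounded by
the value of a majorant. -/
theorem Maj.apply_le {A : MvPolynomial ι ℂ} {B : MvPolynomial ι ℝ≥0} (h : Maj A B)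
    (N : MvPolynomial ι ℂ → ℝ≥0) (y : ι → ℝ≥0) (h0 : N 0 = 0)
    (hadd : ∀ A B, N (A + B) ≤ N A + N B)
    (hmon : ∀ m a, N (monomial m a) ≤ ‖a‖₊ * ∏ i ∈ m.support, y i ^ m i) : N A ≤ eval y B := by
  have hsum : ∀ s : Finset (ι →₀ ℕ), N (∑ m ∈ s, monomial m (coeff m A)) ≤
      ∑ m ∈ s, coeff m B * ∏ i ∈ m.support, y i ^ m i := by
    intro s
    induction s using Finset.induction_on with
    | empty => simp [h0]
    | insert m s hm ih =>
      rw [Finset.sum_insert hm, Finset.sum_insert hm]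
      exact (hadd _ _).trans (add_le_add ((hmon _ _).trans (mul_le_mul_left (h m) _)) ih)
  rw [eval_eq]
  conv_lhs => rw [A.as_sum]
  refine (hsum _).trans (Finset.sum_le_sum_of_subset fun m hm => ?_)
  rw [mem_support_iff] at hm ⊢
  intro h1
  have := h m
  rw [h1, nonpos_iff_eq_zero, nnnorm_eq_zero] at this
  exact hm this

theorem Maj.eval_le {A : MvPolynomial ι ℂ} {B : MvPolynomial ι ℝ≥0} (h : Maj A B) (v : ι → ℂ) :
    ‖eval v A‖₊ ≤ eval (fun J => ‖v J‖₊) B := by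
  refine h.apply_le (fun A => ‖eval v A‖₊) _ (by simp) (fun A B => ?_) fun m a => ?_
  · rw [map_add]
    exact nnnorm_add_le _ _
  · rw [eval_monomial, nnnorm_mul, Finsupp.prod, nnnorm_prod]
    simp only [nnnorm_pow]
    exact le_refl _

end Majorant

/-! ### Universal majorants of given degree, momentum and number of high factors -/

section Theta

variable {ι G : Type*} [Fintype ι] [DecidableEq ι] [AddCommGroup G] (p : Phase ι G)
  (H : ι → Prop)

open Classical in
/-- The sum of all monomials of degree `d` with momentum `g` and at least `h` factors in `H`,
each counted with the number of its multi-indices. -/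
noncomputable def Phase.theta : ℕ → ℕ → G → MvPolynomial ι ℝ≥0
  | 0, h, g => if h = 0 ∧ g = 0 then 1 else 0
  | d + 1, h, g => ∑ J, X J * Phase.theta d (if H J then h - 1 else h) (g - p.q J)

/-- Through this identity coefficient bounds become norm bounds that do not depend on the number of
modes. -/
theorem Phase.eval_theta (v : ι → ℝ≥0) (d h : ℕ) (g : G) :
    (eval v (p.theta H d h g) : ℝ≥0∞) = convPow p.q H (fun J => (v J : ℝ≥0∞)) d h g := by
  induction d generalizing h g with
  | zero =>
    rw [Phase.theta, convPow]
    split_ifs <;> simp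
  | succ d ih =>
    rw [Phase.theta, convPow, tsum_fintype, map_sum, ENNReal.ofNNReal_finsetSum]
    refine Finset.sum_congr rfl fun J _ => ?_
    rw [map_mul, eval_X, ENNReal.coe_mul, ih]

theorem Phase.theta_succ_zero (d : ℕ) (g : G) :
    p.theta H (d + 1) 0 g = ∑ J, X J * p.theta H d 0 (g - p.q J) := by
  rw [Phase.theta]
  simp

/-- Each of the d + 1 positions may carry K, and all give the same contribution. Derivatives thus
stay in the family of majorants. -/
theorem Phase.pderiv_theta (d : ℕ) (g : G) (K : ι) :
    pderiv K (p.theta H (d + 1) 0 g) = ((d + 1 : ℕ) : ℝ≥0) • p.theta H d 0 (g - p.q K) := by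
  induction d generalizing g with
  | zero =>
    rw [p.theta_succ_zero, map_sum, Finset.sum_eq_single K]
    · rw [pderiv_mul, pderiv_X_self, one_mul, zero_add, Nat.cast_one, one_smul, Phase.theta]
      split_ifs <;> simp
    · intro J _ hJ
      rw [pderiv_mul, pderiv_X_of_ne hJ, Phase.theta]
      split_ifs <;> simp
    · simp
  | succ d ih =>
    rw [p.theta_succ_zero, map_sum]
    simp only [pderiv_mul, ih]
    rw [Finset.sum_add_distrib, Finset.sum_eq_single K (fun J _ hJ => by
      rw [pderiv_X_of_ne hJ, zero_mul]) (by simp), pderiv_X_self, one_mul]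
    have : ∑ J, X J * (((d + 1 : ℕ) : ℝ≥0) • p.theta H d 0 (g - p.q J - p.q K)) =
        ((d + 1 : ℕ) : ℝ≥0) • p.theta H (d + 1) 0 (g - p.q K) := by
      rw [p.theta_succ_zero H d (g - p.q K), Finset.smul_sum]
      refine Finset.sum_congr rfl fun J _ => ?_
      rw [mul_smul_comm, sub_right_comm]
    rw [this]
    nth_rewrite 1 [← one_smul ℝ≥0 (p.theta H (d + 1) 0 (g - p.q K))]
    rw [← add_smul]
    congr 1
    push_cast
    ring

/-- A multi-index of length a + b splits uniquely into its first a and last b entries, and the split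
determines g'. Equality may fail because F need not contain all values of g'. -/
theorem Phase.sum_theta_mul_le (a b : ℕ) (F : Finset G) (g : G) :
    CoeffLE (∑ g' ∈ F, p.theta H a 0 g' * p.theta H b 0 (g - g')) (p.theta H (a + b) 0 g) := by
  classical
  induction a generalizing F g with
  | zero =>
    rw [zero_add]
    have : ∑ g' ∈ F, p.theta H 0 0 g' * p.theta H b 0 (g - g') =
        if (0 : G) ∈ F then p.theta H b 0 g else 0 := by
      simp only [Phase.theta, true_and, ite_mul, one_mul, zero_mul]
      rw [Finset.sum_ite_eq' F (0 : G) (fun g' => p.theta H b 0 (g - g'))]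
      simp
    rw [this]
    intro m
    split_ifs <;> simp
  | succ a ih =>
    have : ∑ g' ∈ F, p.theta H (a + 1) 0 g' * p.theta H b 0 (g - g') =
        ∑ J, X J * ∑ g' ∈ F.image (fun g' => g' - p.q J),
          p.theta H a 0 g' * p.theta H b 0 (g - p.q J - g') := by
      simp only [p.theta_succ_zero, Finset.sum_mul]
      rw [Finset.sum_comm]
      refine Finset.sum_congr rfl fun J _ => ?_
      rw [Finset.sum_image (fun x _ y _ h => sub_left_injective h), Finset.mul_sum]
      refine Finset.sum_congr rfl fun g' _ => ?_
      rw [mul_assoc, sub_sub_sub_cancel_right]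
    rw [this, add_right_comm, p.theta_succ_zero]
    exact CoeffLE.sum fun J _ => CoeffLE.rfl.mul (ih _ _)

/-- At most two modes have the same momentum. -/
def Phase.Fiber (p : Phase ι G) : Prop :=
  ∀ y : G → ℝ≥0, ∀ F : Finset G, (∀ J, p.q J ∈ F) → ∑ J, y (p.q J) ≤ 2 * ∑ g ∈ F, y g

/-- This is the contraction in a Poisson bracket. Passing from a sum over modes to a sum over
momenta costs the factor 2. -/
theorem Phase.sum_theta_mul_theta_le (hp : p.Fiber) (a b : ℕ) (g : G) :
    CoeffLE (∑ J, p.theta H a 0 (p.q J) * p.theta H b 0 (g - p.q J))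
      ((2 : ℝ≥0) • p.theta H (a + b) 0 g) := by
  classical
  intro m
  rw [coeff_sum, coeff_smul]
  refine (hp (fun g' => coeff m (p.theta H a 0 g' * p.theta H b 0 (g - g')))
    (Finset.univ.image p.q) (fun J => Finset.mem_image_of_mem _ (Finset.mem_univ _))).trans ?_
  rw [← coeff_sum]
  exact mul_le_mul_right (p.sum_theta_mul_le H a b _ g m) _

theorem highCount_tsub_single (J : ι) (m : ι →₀ ℕ) (hJ : J ∈ m.support) :
    (open Classical in if H J then highCount H m - 1 else highCount H m) ≤
      highCount H (m - Finsupp.single J 1) := by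
  classical
  have hm : m - Finsupp.single J 1 + Finsupp.single J 1 = m := tsub_add_cancel_of_le
    (Finsupp.single_le_iff.2 (Nat.one_le_iff_ne_zero.2 (Finsupp.mem_support_iff.1 hJ)))
  have : highCount H m = highCount H (m - Finsupp.single J 1) + if H J then 1 else 0 := by
    conv_lhs => rw [← hm]
    unfold highCount
    have hs : (if H J then 1 else 0) = ∑ K, if K = J then (if H K then 1 else 0) else 0 := by
      simp
    rw [hs, ← Finset.sum_add_distrib]
    refine Finset.sum_congr rfl fun K _ => ?_
    by_cases hK : H K
    · simp [hK, Finsupp.single_apply, eq_comm]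
    · simp [hK]
  rw [this]
  split_ifs <;> omega

/-- All multi-indices of a monomial have the same number of entries in H, so the requirement of h
such entries discards none of them. -/
theorem Phase.theta_high (d h : ℕ) (g : G) (m : ι →₀ ℕ) (hm : h ≤ highCount H m) :
    coeff m (p.theta H d 0 g) ≤ coeff m (p.theta H d h g) := by
  classical
  induction d generalizing h g m with
  | zero =>
    rw [Phase.theta, Phase.theta]
    by_cases hg : g = 0
    · by_cases hh : h = 0
      · simp [hh]
      · have : m ≠ 0 := by
          rintro rfl
          simp [highCount] at hm
          exact hh hm
        simp [hg, hh, coeff_one, this.symm]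
    · simp [hg]
  | succ d ih =>
    rw [p.theta_succ_zero, Phase.theta, coeff_sum, coeff_sum]
    refine Finset.sum_le_sum fun J _ => ?_
    rw [coeff_X_mul', coeff_X_mul']
    split_ifs with h1 h2
    · refine ih _ _ _ (le_trans ?_ (highCount_tsub_single H J m h1))
      simp only [h2, if_true]; omega
    · refine ih _ _ _ (le_trans ?_ (highCount_tsub_single H J m h1))
      simpa only [h2, if_false]
    · exact le_refl _

/-! ### Polynomials of fixed degree and momentum -/

/-- `A` is homogeneous of degree `d`, has momentum `g`, and its coefficients, normalised by the
number of multi-indices of the monomial, are bounded by `a`. -/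
def Phase.Bound (d : ℕ) (g : G) (a : ℝ≥0) (A : MvPolynomial ι ℂ) : Prop :=
  Maj A (a • p.theta H d 0 g)

variable {p H}

theorem Phase.Bound.mono {d : ℕ} {g : G} {a b : ℝ≥0} {A : MvPolynomial ι ℂ}
    (h : p.Bound H d g a A) (hab : a ≤ b) : p.Bound H d g b A :=
  Maj.trans h (CoeffLE.rfl.smul hab)

theorem Phase.Bound.smul {d : ℕ} {g : G} {a : ℝ≥0} {A : MvPolynomial ι ℂ}
    (h : p.Bound H d g a A) (c : ℂ) : p.Bound H d g (‖c‖₊ * a) (c • A) := by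
  have := Maj.smul c h
  rwa [smul_smul] at this

theorem Phase.Bound.sum {d : ℕ} {g : G} {κ : Type*} {s : Finset κ} {a : κ → ℝ≥0}
    {A : κ → MvPolynomial ι ℂ} (h : ∀ k ∈ s, p.Bound H d g (a k) (A k)) :
    p.Bound H d g (∑ k ∈ s, a k) (∑ k ∈ s, A k) := by
  have := Maj.sum h
  rwa [← Finset.sum_smul] at this

theorem Phase.Bound.sub {d : ℕ} {g : G} {a b : ℝ≥0} {A B : MvPolynomial ι ℂ}
    (h : p.Bound H d g a A) (h' : p.Bound H d g b B) : p.Bound H d g (a + b) (A - B) := by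
  have := Maj.add h h'.neg
  rwa [← add_smul, ← sub_eq_add_neg] at this

theorem Phase.Bound.of_coeff_le {d : ℕ} {g : G} {a c : ℝ≥0} {A A' : MvPolynomial ι ℂ}
    (h : p.Bound H d g a A) (hA : ∀ m, ‖coeff m A'‖₊ ≤ c * ‖coeff m A‖₊) :
    p.Bound H d g (c * a) A' := by
  have := Maj.of_coeff_le h hA
  rwa [smul_smul] at this

theorem Phase.Bound.pderiv {d : ℕ} {g : G} {a : ℝ≥0} {A : MvPolynomial ι ℂ}
    (h : p.Bound H (d + 1) g a A) (J : ι) :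
    p.Bound H d (g - p.q J) (a * (d + 1 : ℕ)) (pderiv J A) := by
  have := Maj.pderiv h J
  rwa [Derivation.map_smul, p.pderiv_theta, smul_smul] at this

/-- The two derivatives give the factors e + 1 and d + 1. As χ has momentum zero, the sum over the
contracted mode is a convolution in the momentum, and it costs the fibre constant 2 only. -/
theorem Phase.Bound.ham (hp : p.Fiber) {d e : ℕ} {g : G} {a b : ℝ≥0} {χ A : MvPolynomial ι ℂ}
    (hχ : p.Bound H (e + 1) 0 a χ) (hA : p.Bound H (d + 1) g b A) :
    p.Bound H (e + d) g (2 * ((e + 1 : ℕ) * (d + 1 : ℕ)) * (a * b)) (p.ham χ A) := by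
  have h : Maj (p.ham χ A) (∑ J, ((a * (e + 1 : ℕ)) * (b * (d + 1 : ℕ))) •
      (p.theta H e 0 (p.q J) * p.theta H d 0 (g - p.q J))) := by
    rw [p.ham_apply]
    refine Maj.sum fun J _ => ?_
    have h1 := (hχ.pderiv (p.bar J)).smul (p.c J)
    have h2 := Maj.mul h1 (hA.pderiv J)
    rw [p.q_bar, zero_sub, neg_neg] at h2
    rw [smul_eq_C_mul] at h2
    convert h2 using 1
    rw [smul_mul_smul_comm]
    congr 1
    have : ‖p.c J‖₊ = 1 := NNReal.eq (p.norm_c J)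
    rw [this]
    ring
  rw [← Finset.smul_sum] at h
  refine Maj.trans (h.trans (CoeffLE.rfl.smul le_rfl)) ?_
  refine (CoeffLE.smul le_rfl (p.sum_theta_mul_theta_le H hp e d g)).trans ?_
  rw [smul_smul]
  refine CoeffLE.rfl.smul (le_of_eq (by ring))

theorem Phase.Bound.X (J : ι) : p.Bound H 1 (p.q J) 1 (X J) := by
  classical
  intro m
  rw [one_smul, p.theta_succ_zero, coeff_sum]
  refine le_trans ?_ (Finset.single_le_sum (fun _ _ => zero_le) (Finset.mem_univ J))
  rw [Phase.theta, sub_self, if_pos ⟨rfl, rfl⟩, mul_one, coeff_X, coeff_X]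
  split_ifs <;> simp

/-- Bound for the operators of the Lie series. -/
theorem Phase.Bound.lie (hp : p.Fiber) {r K : ℕ} {B : ℝ≥0} {χ : ℕ → MvPolynomial ι ℂ}
    (hχ : ∀ m, 1 ≤ m → m ≤ K → p.Bound H (m + 2) 0 (m / (8 * (r + 2) ^ 4) * B ^ m) (χ m))
    (k : ℕ) (hk : k ≤ K) {d : ℕ} (hd : d + 1 + k ≤ r + 2) {g : G} {a : ℝ≥0}
    {A : MvPolynomial ι ℂ} (hA : p.Bound H (d + 1) g a A) :
    p.Bound H (d + k + 1) g ((if k = 0 then (1 : ℝ≥0) else (2 * (r + 2 : ℝ≥0))⁻¹) * B ^ k * a)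
      (p.lie χ k A) := by
  induction k using Nat.strong_induction_on generalizing d a A with
  | _ k ih =>
    cases k with
    | zero =>
      rw [p.lie_zero]
      simpa using hA
    | succ k =>
      rw [p.lie_succ, if_neg k.succ_ne_zero]
      have hone : ∀ j : ℕ, (if j = 0 then (1 : ℝ≥0) else (2 * (r + 2 : ℝ≥0))⁻¹) ≤ 1 := by
        intro j
        split_ifs
        · exact le_refl _
        · refine inv_le_one_of_one_le₀ ?_
          calc (1 : ℝ≥0) ≤ 2 * (0 + 2) := by norm_num
            _ ≤ 2 * (r + 2) := by gcongr; exact zero_le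
      have hterm : ∀ m ∈ Finset.range (k + 1), p.Bound H (d + (k + 1) + 1) g
          ((2 * (r + 2 : ℝ≥0))⁻¹ * B ^ (k + 1) * a) (p.lie χ (k - m) (p.ham (χ (m + 1)) A)) := by
        intro m hm
        have hm' : m ≤ k := Nat.lt_succ_iff.1 (Finset.mem_range.1 hm)
        have h1 := Phase.Bound.ham hp (hχ (m + 1) (by omega) (by omega)) hA
        rw [show m + 1 + 1 + d = d + m + 1 + 1 by ring] at h1
        have h2 := ih (k - m) (by omega) (by omega) (by omega) h1
        rw [show d + m + 1 + (k - m) + 1 = d + (k + 1) + 1 by omega] at h2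
        refine h2.mono ?_
        have e1 : ((m + 1 + 1 + 1 : ℕ) : ℝ≥0) ≤ 2 * (r + 2) := by
          exact_mod_cast (by omega : m + 1 + 1 + 1 ≤ 2 * (r + 2))
        have e2 : ((d + 1 : ℕ) : ℝ≥0) ≤ r + 2 := by
          exact_mod_cast (by omega : d + 1 ≤ r + 2)
        have e3 : ((m + 1 : ℕ) : ℝ≥0) ≤ r + 2 := by
          exact_mod_cast (by omega : m + 1 ≤ r + 2)
        have hr : (r + 2 : ℝ≥0) ≠ 0 := by positivity
        -- The bracket and the numerator of the bound for the generator cost 4 (r + 2)³ in all;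
        -- against 8 (r + 2)⁴ this leaves 1 / (2 (r + 2)). The average over the k + 1 terms costs
        -- nothing.
        calc _ ≤ 1 * B ^ (k - m) * (2 * (2 * (r + 2) * (r + 2)) *
              ((r + 2) / (8 * (r + 2) ^ 4) * B ^ (m + 1) * a)) := by
              gcongr
              exact hone _
          _ = (2 * (2 * (r + 2) * (r + 2)) * ((r + 2) / (8 * (r + 2) ^ 4))) *
              (B ^ (k - m) * B ^ (m + 1)) * a := by ring
          _ = _ := by
              rw [← pow_add, show k - m + (m + 1) = k + 1 by omega]
              congr 2
              field_simp
              norm_num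
      refine (Phase.Bound.smul (Phase.Bound.sum hterm) _).mono (le_of_eq ?_)
      rw [Finset.sum_const, Finset.card_range, nsmul_eq_mul, nnnorm_inv, Complex.nnnorm_natCast,
        ← mul_assoc, inv_mul_cancel₀ (Nat.cast_ne_zero.2 k.succ_ne_zero), one_mul]

/-- Bounds for the normal form. -/
theorem Phase.Bound.normalForm (hp : p.Fiber) {r : ℕ} {R D : ℝ≥0} (hD : 1 ≤ D)
    {h Q : ℕ → MvPolynomial ι ℂ} {elim : (ι →₀ ℕ) → Prop} {dv : (ι →₀ ℕ) → ℂ}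
    (hdv : ∀ m, elim m → 1 ≤ D * ‖dv m‖₊)
    (hh : ∀ k, 1 ≤ k → k ≤ r → p.Bound H (k + 2) 0 (R ^ k / 2) (h k))
    (hQ : ∀ k, 1 ≤ k → Q k = h k - ∑ b ∈ Finset.Ico 1 k,
        p.lie (fun m => generator elim dv m (Q m)) (k - b)
          (keepPart elim (Q b) + ((b : ℂ) / k) • (Q b - keepPart elim (Q b))))
    (k : ℕ) (hk1 : 1 ≤ k) (hkr : k ≤ r) :
    p.Bound H (k + 2) 0 (R ^ k * (D * (8 * (r + 2) ^ 4)) ^ (k - 1)) (Q k) ∧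
    p.Bound H (k + 2) 0 (k / (8 * (r + 2) ^ 4) * (R * (D * (8 * (r + 2) ^ 4))) ^ k)
      (generator elim dv k (Q k)) := by
  set A0 : ℝ≥0 := 8 * (r + 2) ^ 4 with hA0
  have hA0pos : A0 ≠ 0 := by positivity
  induction k using Nat.strong_induction_on with
  | _ k ih =>
    have h1 : p.Bound H (k + 2) 0 (R ^ k * (D * A0) ^ (k - 1)) (Q k) := by
      have hA1 : 1 ≤ D * A0 := by
        refine one_le_mul hD ?_
        rw [hA0]
        calc (1 : ℝ≥0) ≤ 8 * (0 + 2) ^ 4 := by norm_num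
          _ ≤ 8 * (r + 2) ^ 4 := by gcongr; exact zero_le
      have hb : ∀ b ∈ Finset.Ico 1 k, p.Bound H (k + 2) 0
          ((2 * (r + 2 : ℝ≥0))⁻¹ * (R ^ k * (D * A0) ^ (k - 1)))
          (p.lie (fun m => generator elim dv m (Q m)) (k - b)
          (keepPart elim (Q b) + ((b : ℂ) / k) • (Q b - keepPart elim (Q b)))) := by
        intro b hb
        obtain ⟨hb1, hb2⟩ := Finset.mem_Ico.1 hb
        have hQb := (ih b hb2 hb1 (by omega)).1
        have hc : p.Bound H (b + 1 + 1) 0 (1 * (R ^ b * (D * A0) ^ (b - 1)))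
            (keepPart elim (Q b) + ((b : ℂ) / k) • (Q b - keepPart elim (Q b))) := by
          refine hQb.of_coeff_le fun m => ?_
          simp only [keepPart, coeff_add, coeff_smul, coeff_sub, coeff_diag, smul_eq_mul]
          split_ifs
          · rw [zero_mul, zero_add, sub_zero, nnnorm_mul]
            refine mul_le_mul_left ?_ _
            rw [nnnorm_div, Complex.nnnorm_natCast, Complex.nnnorm_natCast]
            exact div_le_one_of_le₀ (by exact_mod_cast hb2.le) zero_le
          · simp
        have h2 := Phase.Bound.lie hp (r := r) (K := k - 1)
          (χ := fun m => generator elim dv m (Q m))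
          (fun m hm1 hm2 => (ih m (by omega) hm1 (by omega)).2) (k - b) (by omega)
          (by omega) hc
        rw [if_neg (by omega), show b + 1 + (k - b) + 1 = k + 2 by omega] at h2
        refine h2.mono (le_of_eq ?_)
        rw [one_mul, mul_assoc, mul_pow R, mul_mul_mul_comm, ← pow_add, ← pow_add,
          show k - b + b = k by omega, show k - b + (b - 1) = k - 1 by omega]
      rw [hQ k hk1]
      refine ((hh k hk1 hkr).sub (Phase.Bound.sum hb)).mono ?_
      rw [Finset.sum_const, nsmul_eq_mul, Nat.card_Ico]
      -- Fewer than r + 2 corrections, each with the factor 1 / (2 (r + 2)), use up half of the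
      -- bound. The other half is taken by `h k`, which explains the 1 / 2 in its hypothesis.
      have h3 : ((k - 1 : ℕ) : ℝ≥0) * (2 * (r + 2 : ℝ≥0))⁻¹ ≤ 1 / 2 := by
        have : ((k - 1 : ℕ) : ℝ≥0) ≤ r + 2 := by exact_mod_cast (by omega : k - 1 ≤ r + 2)
        have hr : (r + 2 : ℝ≥0) ≠ 0 := by positivity
        calc ((k - 1 : ℕ) : ℝ≥0) * (2 * (r + 2 : ℝ≥0))⁻¹ ≤ (r + 2) * (2 * (r + 2 : ℝ≥0))⁻¹ := by gcongr
          _ = 1 / 2 := by field_simp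
      calc _ ≤ R ^ k * (D * A0) ^ (k - 1) / 2 + 1 / 2 * (R ^ k * (D * A0) ^ (k - 1)) := by
            rw [← mul_assoc]
            gcongr
            exact le_mul_of_one_le_right' (one_le_pow₀ hA1)
        _ = R ^ k * (D * A0) ^ (k - 1) := by
            rw [div_eq_mul_inv, mul_comm _ (2 : ℝ≥0)⁻¹, one_div, ← add_mul]
            have : (2 : ℝ≥0)⁻¹ + 2⁻¹ = 1 := by rw [← two_mul]; exact mul_inv_cancel₀ two_ne_zero
            rw [this, one_mul]
    refine ⟨h1, ?_⟩
    have h2 : p.Bound H (k + 2) 0 (k * D * (R ^ k * (D * A0) ^ (k - 1)))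
        (generator elim dv k (Q k)) := by
      refine h1.of_coeff_le fun m => ?_
      rw [generator, coeff_diag, nnnorm_mul]
      refine mul_le_mul_left ?_ _
      split_ifs with hm
      · have h0 : ‖dv m‖₊ ≠ 0 := by
          intro h0
          have := hdv m hm
          rw [h0, mul_zero] at this
          exact absurd this (by norm_num)
        rw [nnnorm_div, nnnorm_neg, Complex.nnnorm_natCast, div_le_iff₀ (pos_iff_ne_zero.2 h0),
          mul_assoc]
        exact le_mul_of_one_le_right' (hdv m hm)
      · simp
    refine h2.mono (le_of_eq ?_)
    obtain ⟨j, rfl⟩ : ∃ j, k = j + 1 := ⟨k - 1, by omega⟩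
    rw [Nat.add_sub_cancel, mul_pow R, pow_succ (D * A0)]
    field_simp

end Theta

/-! ### The modified energy -/

theorem sum_range_antidiagonal_le {R : Type*} [CommSemiring R] [PartialOrder R]
    [CanonicallyOrderedAdd R] [IsOrderedAddMonoid R] (F : ℕ → ℕ → R) (r : ℕ) :
    ∑ k ∈ Finset.range r, ∑ x ∈ antidiagonal k, F x.1 x.2 ≤
      ∑ a ∈ Finset.range r, ∑ b ∈ Finset.range r, F a b := by
  rw [Finset.sum_sigma', ← Finset.sum_product']
  refine (Finset.sum_image (s := (Finset.range r).sigma fun k => antidiagonal k)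
    (g := fun z : (_ : ℕ) × ℕ × ℕ => z.2) (f := fun x : ℕ × ℕ => F x.1 x.2) ?_).symm.trans_le ?_
  · rintro ⟨k, x⟩ hx ⟨l, y⟩ hy h
    simp only [Finset.coe_sigma, Set.mem_sigma_iff, Finset.mem_coe,
      Finset.HasAntidiagonal.mem_antidiagonal] at hx hy h
    subst h
    obtain rfl : k = l := hx.2.symm.trans hy.2
    rfl
  · refine Finset.sum_le_sum_of_subset fun x hx => ?_
    obtain ⟨⟨k, y⟩, hy, rfl⟩ := Finset.mem_image.1 hx
    simp only [Finset.mem_sigma, Finset.mem_range, Finset.HasAntidiagonal.mem_antidiagonal] at hy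
    simp only [Finset.mem_product, Finset.mem_range]
    omega

theorem sum_geometric_le_two {x : ℝ≥0∞} (hx : x ≤ 1 / 2) (n : ℕ) :
    ∑ a ∈ Finset.range n, x ^ a ≤ 2 := by
  calc ∑ a ∈ Finset.range n, x ^ a ≤ ∑ a ∈ Finset.range n, (2⁻¹ : ℝ≥0∞) ^ a := by
        rw [one_div] at hx
        gcongr
    _ ≤ ∑' a, (2⁻¹ : ℝ≥0∞) ^ a := ENNReal.sum_le_tsum _
    _ = 2 := by rw [ENNReal.tsum_geometric, ENNReal.one_sub_inv_two, inv_inv]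

section Energy

variable {ι G : Type*} [Fintype ι] [DecidableEq ι] [AddCommGroup G]

/-- The derivative of a polynomial at the point `v` in the direction `V`. -/
noncomputable def dEval (v V : ι → ℂ) : MvPolynomial ι ℂ →ₗ[ℂ] ℂ where
  toFun A := ∑ J, eval v (pderiv J A) * V J
  map_add' A B := by simp [add_mul, Finset.sum_add_distrib]
  map_smul' a A := by simp [Finset.mul_sum, mul_assoc]

theorem dEval_apply (v V : ι → ℂ) (A : MvPolynomial ι ℂ) :
    dEval v V A = ∑ J, eval v (pderiv J A) * V J := rfl

theorem dEval_mul (v V : ι → ℂ) (A B : MvPolynomial ι ℂ) :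
    dEval v V (A * B) = dEval v V A * eval v B + eval v A * dEval v V B := by
  simp only [dEval_apply, pderiv_mul, map_add, map_mul, add_mul, Finset.sum_add_distrib,
    Finset.sum_mul, Finset.mul_sum]
  congr 1 <;> exact Finset.sum_congr rfl fun J _ => by ring

theorem dEval_add_right (v V V' : ι → ℂ) (A : MvPolynomial ι ℂ) :
    dEval v (fun J => V J + V' J) A = dEval v V A + dEval v V' A := by
  simp only [dEval_apply, mul_add, Finset.sum_add_distrib]

theorem dEval_sum_right {κ : Type*} (s : Finset κ) (v : ι → ℂ) (V : κ → ι → ℂ)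
    (A : MvPolynomial ι ℂ) :
    dEval v (fun J => ∑ k ∈ s, V k J) A = ∑ k ∈ s, dEval v (V k) A := by
  simp only [dEval_apply, Finset.mul_sum]
  exact Finset.sum_comm

/-- The Hamiltonian vector field at `v`. -/
noncomputable def Phase.field (p : Phase ι G) (v : ι → ℂ) (A : MvPolynomial ι ℂ) (J : ι) : ℂ :=
  p.c J * eval v (pderiv (p.bar J) A)

theorem Phase.dEval_field (p : Phase ι G) (v : ι → ℂ) (A B : MvPolynomial ι ℂ) :
    dEval v (p.field v A) B = eval v (p.ham A B) := by
  rw [dEval_apply, p.ham_apply, map_sum]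
  refine Finset.sum_congr rfl fun J _ => ?_
  simp only [Phase.field, map_mul, eval_C]
  ring

/-- The sum of the values of the first terms of the Lie series. -/
noncomputable def Phase.lieSum (p : Phase ι G) (χ : ℕ → MvPolynomial ι ℂ) (v : ι → ℂ) (r : ℕ)
    (A : MvPolynomial ι ℂ) : ℝ≥0 :=
  ∑ a ∈ Finset.range (r + 1), ‖eval v (p.lie χ a A)‖₊

/-! ### Submultiplicativity of the truncated Lie series -/

section LieSum

variable {p : Phase ι G} {χ : ℕ → MvPolynomial ι ℂ} {v : ι → ℂ} {r : ℕ}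

theorem Phase.lieSum_add (A B : MvPolynomial ι ℂ) :
    p.lieSum χ v r (A + B) ≤ p.lieSum χ v r A + p.lieSum χ v r B := by
  unfold Phase.lieSum
  rw [← Finset.sum_add_distrib]
  refine Finset.sum_le_sum fun a _ => ?_
  rw [map_add, map_add]
  exact nnnorm_add_le _ _

theorem Phase.lieSum_sum {κ : Type*} (s : Finset κ) (A : κ → MvPolynomial ι ℂ) :
    p.lieSum χ v r (∑ k ∈ s, A k) ≤ ∑ k ∈ s, p.lieSum χ v r (A k) := by
  unfold Phase.lieSum
  rw [Finset.sum_comm]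
  refine Finset.sum_le_sum fun a _ => ?_
  rw [map_sum, map_sum]
  exact nnnorm_sum_le _ _

theorem Phase.lieSum_C_mul (c : ℂ) (A : MvPolynomial ι ℂ) :
    p.lieSum χ v r (C c * A) = ‖c‖₊ * p.lieSum χ v r A := by
  unfold Phase.lieSum
  rw [Finset.mul_sum]
  refine Finset.sum_congr rfl fun a _ => ?_
  rw [← smul_eq_C_mul, map_smul, smul_eval, nnnorm_mul]

/-- A term of order at most r of a product pairs terms of order at most r of the factors; completing
to all pairs only adds nonnegative terms. -/
theorem Phase.lieSum_mul (A B : MvPolynomial ι ℂ) :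
    p.lieSum χ v r (A * B) ≤ p.lieSum χ v r A * p.lieSum χ v r B := by
  unfold Phase.lieSum
  rw [Finset.sum_mul_sum]
  refine le_trans (Finset.sum_le_sum fun a _ => ?_) (sum_range_antidiagonal_le
    (fun a b => ‖eval v (p.lie χ a A)‖₊ * ‖eval v (p.lie χ b B)‖₊) (r + 1))
  rw [p.lie_mul, map_sum]
  refine (nnnorm_sum_le _ _).trans (le_of_eq ?_)
  simp only [map_mul, nnnorm_mul]

theorem Phase.lieSum_one : p.lieSum χ v r 1 = 1 := by
  unfold Phase.lieSum
  rw [Finset.sum_range_succ']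
  simp [p.lie_one, p.lie_zero]

theorem Phase.lieSum_monomial (m : ι →₀ ℕ) (a : ℂ) : p.lieSum χ v r (monomial m a) ≤
    ‖a‖₊ * ∏ i ∈ m.support, p.lieSum χ v r (X i) ^ m i := by
  have hpow : ∀ (A : MvPolynomial ι ℂ) (k : ℕ),
      p.lieSum χ v r (A ^ k) ≤ p.lieSum χ v r A ^ k := by
    intro A k
    induction k with
    | zero => rw [pow_zero, pow_zero, Phase.lieSum_one]
    | succ k ih =>
      rw [pow_succ, pow_succ]
      exact (Phase.lieSum_mul _ _).trans (mul_le_mul_left ih _)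
  have hprod : ∀ s : Finset ι, p.lieSum χ v r (∏ i ∈ s, X i ^ m i) ≤
      ∏ i ∈ s, p.lieSum χ v r (X i) ^ m i := by
    intro s
    induction s using Finset.induction_on with
    | empty => rw [Finset.prod_empty, Finset.prod_empty, Phase.lieSum_one]
    | insert i s hi ih =>
      rw [Finset.prod_insert hi, Finset.prod_insert hi]
      exact (Phase.lieSum_mul _ _).trans (mul_le_mul' (hpow _ _) ih)
  rw [monomial_eq, Phase.lieSum_C_mul]
  exact mul_le_mul_right (hprod _) _

/-- A submultiplicative seminorm is controlled by its values on the variables. The effect is that of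
substituting the transformed coordinates into the majorant. -/
theorem Phase.lieSum_le_of_maj {A : MvPolynomial ι ℂ} {B : MvPolynomial ι ℝ≥0} (h : Maj A B) :
    p.lieSum χ v r A ≤ eval (fun J => p.lieSum χ v r (X J)) B :=
  h.apply_le (p.lieSum χ v r) _ (by simp [Phase.lieSum]) Phase.lieSum_add Phase.lieSum_monomial

end LieSum

/-- The data of the normal form of order `r`: Hamiltonians `h k` of degree `k + 2`, generators
`χ k`, terms `Z k` in normal form, and the weight `w` of the energy `∑ w_J u_J u_{bar J}`. -/
structure NormalForm (p : Phase ι G) (H : ι → Prop) (r : ℕ) (B : ℝ≥0) (w : ι → ℝ≥0)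
    (h χ Z : ℕ → MvPolynomial ι ℂ) : Prop where
  fiber : p.Fiber
  w_bar : ∀ J, w (p.bar J) = w J
  bound_h : ∀ k, 1 ≤ k → k ≤ r → p.Bound H (k + 2) 0 (B ^ k) (h k)
  bound_χ : ∀ k, 1 ≤ k → k ≤ r → p.Bound H (k + 2) 0 (k / (8 * (r + 2) ^ 4) * B ^ k) (χ k)
  bound_Z : ∀ k, 1 ≤ k → k ≤ r → p.Bound H (k + 2) 0 (B ^ k) (Z k)
  h_eq : ∀ k ≤ r, h k = ∑ x ∈ antidiagonal k, p.lie χ x.1 (Z x.2)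
  ham_zero : p.ham (Z 0) (p.quad fun J => (w J : ℂ)) = 0
  ham_Z : ∀ k, 1 ≤ k → k ≤ r → p.ham (Z k) (p.quad fun J => (w J : ℂ)) =
    ∑ J, C (-2 * (p.c J * w J)) * (X J * highPart H 2 (pderiv J (Z k)))

/-- The modified energy. -/
noncomputable def Phase.energy (p : Phase ι G) (χ : ℕ → MvPolynomial ι ℂ) (w : ι → ℝ≥0) (r : ℕ) :
    MvPolynomial ι ℂ :=
  ∑ k ∈ Finset.range (r + 1), p.lie χ k (p.quad fun J => (w J : ℂ))

variable {p : Phase ι G} {H : ι → Prop} {r : ℕ} {B : ℝ≥0} {w : ι → ℝ≥0}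
  {h χ Z : ℕ → MvPolynomial ι ℂ} {α β : G → ℝ≥0∞} {K M γ : ℝ≥0∞}

/-- The weighted norm of a vector. -/
noncomputable def Phase.nrm (p : Phase ι G) (α : G → ℝ≥0∞) (x : ι → ℝ≥0∞) : ℝ≥0∞ :=
  l2 fun J => α (p.q J) * x J

theorem Phase.nrm_bar (hα : ∀ g, α (-g) = α g) (x : ι → ℝ≥0∞) :
    p.nrm α (fun J => x (p.bar J)) = p.nrm α x := by
  unfold Phase.nrm l2
  congr 1
  rw [tsum_fintype, tsum_fintype, ← p.sum_bar]
  simp only [p.q_bar, hα, p.bar_bar]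

theorem Phase.sum_weight_le (hα : ∀ g, α (-g) = α g) (hwM : ∀ J, (w J : ℝ≥0∞) ≤ M * α (p.q J) ^ 2)
    (x y : ι → ℝ≥0∞) : ∑ J, (w J : ℝ≥0∞) * (x J * y (p.bar J)) ≤ M * (p.nrm α x * p.nrm α y) := by
  calc ∑ J, (w J : ℝ≥0∞) * (x J * y (p.bar J))
      ≤ ∑ J, M * ((α (p.q J) * x J) * (α (p.q J) * y (p.bar J))) := by
        refine Finset.sum_le_sum fun J _ => (mul_le_mul_left (hwM J) _).trans (le_of_eq (by ring))
    _ ≤ _ := by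
        rw [← Finset.mul_sum, ← p.nrm_bar hα y, ← tsum_fintype (L := .unconditional ι)]
        exact mul_le_mul_right (tsum_mul_le_l2 _ _) _

theorem Phase.nrm_momentum_le (hw : TameWeight p.q α β K) (g : G → ℝ≥0∞) :
    p.nrm α (fun J => g (p.q J)) ≤ 2 * l2 fun g' => α g' * g g' :=
  l2_momentum_le hw g

theorem Phase.Bound.enorm_eval_le {d : ℕ} {g : G} {a : ℝ≥0} {A : MvPolynomial ι ℂ}
    (hA : p.Bound H d g a A) (v : ι → ℂ) :
    ‖eval v A‖ₑ ≤ a * convPow p.q H (fun J => ‖v J‖ₑ) d 0 g := by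
  have h1 := Maj.eval_le hA v
  rw [smul_eval] at h1
  have h2 : (‖eval v A‖₊ : ℝ≥0∞) ≤ _ := ENNReal.coe_le_coe.2 h1
  rw [ENNReal.coe_mul, p.eval_theta] at h2
  exact h2

theorem NormalForm.bound_lie_X (nf : NormalForm p H r B w h χ Z) {a : ℕ} (ha : a ≤ r) (J : ι) :
    p.Bound H (a + 1) (p.q J) (B ^ a) (p.lie χ a (X J)) := by
  have h1 := Phase.Bound.lie nf.fiber (r := r) (K := r) nf.bound_χ a ha (d := 0) (by omega)
    (Phase.Bound.X (p := p) (H := H) J)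
  rw [zero_add] at h1
  refine h1.mono ?_
  rw [mul_one]
  refine mul_le_of_le_one_left' ?_
  split_ifs
  · exact le_refl _
  · refine inv_le_one_of_one_le₀ ?_
    calc (1 : ℝ≥0) ≤ 2 * (0 + 2) := by norm_num
      _ ≤ 2 * (r + 2) := by gcongr; exact zero_le

/-- The size of a term of the transformed coordinates. -/
theorem NormalForm.nrm_lie_X_le (nf : NormalForm p H r B w h χ Z) (hw : TameWeight p.q α β K)
    {a : ℕ} (ha : a ≤ r) {v : ι → ℂ} {ρ : ℝ≥0∞} (hv : p.nrm α (fun J => ‖v J‖ₑ) ≤ ρ) :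
    p.nrm α (fun J => ‖eval v (p.lie χ a (X J))‖ₑ) ≤ 6 * K * α 0 * ρ * (3 * K * B * ρ) ^ a := by
  calc _ ≤ p.nrm α (fun J => (B : ℝ≥0∞) ^ a * convPow p.q H (fun J => ‖v J‖ₑ) (a + 1) 0 (p.q J)) := by
        refine l2_mono fun J => mul_le_mul_right ?_ _
        have := (nf.bound_lie_X ha J).enorm_eval_le v
        rwa [ENNReal.coe_pow] at this
    _ = (B : ℝ≥0∞) ^ a * p.nrm α (fun J => convPow p.q H (fun J => ‖v J‖ₑ) (a + 1) 0 (p.q J)) := by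
        rw [Phase.nrm, Phase.nrm, ← l2_const_mul]
        congr 1
        funext J
        ring
    _ ≤ (B : ℝ≥0∞) ^ a * (2 * (α 0 * (3 * K * ρ) ^ (a + 1))) := by
        gcongr
        refine (Phase.nrm_momentum_le hw _).trans (mul_le_mul_right ((l2_convPow_le hw _ _ _).trans
          ?_) _)
        gcongr
        exact hv
    _ = _ := by ring

/-- The derivative of a term of the transformed coordinates. -/
theorem NormalForm.nrm_dEval_lie_X_le (nf : NormalForm p H r B w h χ Z)
    (hw : TameWeight p.q α β K) {a : ℕ} (ha : a ≤ r) {v : ι → ℂ} {ρ : ℝ≥0∞}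
    (hv : p.nrm α (fun J => ‖v J‖ₑ) ≤ ρ) (V : ι → ℂ) :
    p.nrm α (fun J => ‖dEval v V (p.lie χ a (X J))‖ₑ) ≤
      6 * K * α 0 * p.nrm α (fun J => ‖V J‖ₑ) * ((a + 1) * (3 * K * B * ρ) ^ a) := by
  have hpt : ∀ J, ‖dEval v V (p.lie χ a (X J))‖ₑ ≤ ((B : ℝ≥0∞) ^ a * (a + 1)) *
      conv p.q (fun J => ‖V J‖ₑ) (convPow p.q H (fun J => ‖v J‖ₑ) a 0) (p.q J) := by
    intro J
    rw [dEval_apply, conv, tsum_fintype, Finset.mul_sum]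
    refine (enorm_sum_le _ _).trans (Finset.sum_le_sum fun L _ => ?_)
    rw [enorm_mul, mul_left_comm, mul_comm]
    refine mul_le_mul_right ?_ _
    have := ((nf.bound_lie_X ha J).pderiv L).enorm_eval_le v
    push_cast at this
    exact this
  calc _ ≤ p.nrm α (fun J => ((B : ℝ≥0∞) ^ a * (a + 1)) *
        conv p.q (fun J => ‖V J‖ₑ) (convPow p.q H (fun J => ‖v J‖ₑ) a 0) (p.q J)) :=
        l2_mono fun J => mul_le_mul_right (hpt J) _
    _ = ((B : ℝ≥0∞) ^ a * (a + 1)) * p.nrm α (fun J =>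
        conv p.q (fun J => ‖V J‖ₑ) (convPow p.q H (fun J => ‖v J‖ₑ) a 0) (p.q J)) := by
        rw [Phase.nrm, Phase.nrm, ← l2_const_mul]
        congr 1
        funext J
        ring
    _ ≤ ((B : ℝ≥0∞) ^ a * (a + 1)) *
        (2 * (3 * K * p.nrm α (fun J => ‖V J‖ₑ) * (α 0 * (3 * K * ρ) ^ a))) := by
        gcongr
        refine (Phase.nrm_momentum_le hw _).trans (mul_le_mul_right ((l2_conv_le' hw _ _).trans
          (mul_le_mul_right ((l2_convPow_le hw _ _ _).trans ?_) _)) _)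
        gcongr
        exact hv
    _ = _ := by ring

theorem Phase.lie_quad (χ : ℕ → MvPolynomial ι ℂ) (w : ι → ℂ) (k : ℕ) : p.lie χ k (p.quad w) =
    ∑ J, C (w J) * ∑ x ∈ antidiagonal k, p.lie χ x.1 (X J) * p.lie χ x.2 (X (p.bar J)) := by
  unfold Phase.quad
  rw [map_sum]
  refine Finset.sum_congr rfl fun J _ => ?_
  rw [← smul_eq_C_mul, map_smul, smul_eq_C_mul, p.lie_mul]

/-- The derivative of a term of the energy. -/
theorem NormalForm.enorm_dEval_lie_quad_le (nf : NormalForm p H r B w h χ Z)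
    (hw : TameWeight p.q α β K) (hα : ∀ g, α (-g) = α g)
    (hwM : ∀ J, (w J : ℝ≥0∞) ≤ M * α (p.q J) ^ 2) {k : ℕ} (hk : k ≤ r) {v : ι → ℂ} {ρ : ℝ≥0∞}
    (hv : p.nrm α (fun J => ‖v J‖ₑ) ≤ ρ) (V : ι → ℂ) :
    ‖dEval v V (p.lie χ k (p.quad fun J => (w J : ℂ)))‖ₑ ≤
      72 * M * K ^ 2 * α 0 ^ 2 * ρ * p.nrm α (fun J => ‖V J‖ₑ) *
        ((k + 1) ^ 2 * (3 * K * B * ρ) ^ k) := by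
  have hterm : ∀ x ∈ antidiagonal k,
      ∑ J, (w J : ℝ≥0∞) * (‖dEval v V (p.lie χ x.1 (X J))‖ₑ *
        ‖eval v (p.lie χ x.2 (X (p.bar J)))‖ₑ) ≤
      36 * M * K ^ 2 * α 0 ^ 2 * ρ * p.nrm α (fun J => ‖V J‖ₑ) *
        ((k + 1) * (3 * K * B * ρ) ^ k) := by
    intro x hx
    have hx' := Finset.HasAntidiagonal.mem_antidiagonal.1 hx
    refine (Phase.sum_weight_le hα hwM (fun J => ‖dEval v V (p.lie χ x.1 (X J))‖ₑ)
      (fun J => ‖eval v (p.lie χ x.2 (X J))‖ₑ)).trans ?_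
    calc _ ≤ M * ((6 * K * α 0 * p.nrm α (fun J => ‖V J‖ₑ) *
          (((x.1 : ℝ≥0∞) + 1) * (3 * K * B * ρ) ^ x.1)) *
          (6 * K * α 0 * ρ * (3 * K * B * ρ) ^ x.2)) := by
          gcongr
          · exact nf.nrm_dEval_lie_X_le hw (by omega) hv V
          · exact nf.nrm_lie_X_le hw (by omega) hv
      _ ≤ M * ((6 * K * α 0 * p.nrm α (fun J => ‖V J‖ₑ) *
          (((k : ℝ≥0∞) + 1) * (3 * K * B * ρ) ^ x.1)) *
          (6 * K * α 0 * ρ * (3 * K * B * ρ) ^ x.2)) := by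
          gcongr
          exact_mod_cast (by omega : x.1 ≤ k)
      _ = _ := by
          rw [← hx', pow_add]
          ring
  have hsum : dEval v V (p.lie χ k (p.quad fun J => (w J : ℂ))) =
      ∑ x ∈ antidiagonal k, ∑ J, 2 * ((w J : ℂ) * (dEval v V (p.lie χ x.1 (X J)) *
        eval v (p.lie χ x.2 (X (p.bar J))))) := by
    have e1 : dEval v V (p.lie χ k (p.quad fun J => (w J : ℂ))) =
        (∑ x ∈ antidiagonal k, ∑ J, (w J : ℂ) * (dEval v V (p.lie χ x.1 (X J)) *
          eval v (p.lie χ x.2 (X (p.bar J))))) +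
        ∑ x ∈ antidiagonal k, ∑ J, (w J : ℂ) * (dEval v V (p.lie χ x.2 (X (p.bar J))) *
          eval v (p.lie χ x.1 (X J))) := by
      rw [p.lie_quad, map_sum, Finset.sum_comm, Finset.sum_comm (s := antidiagonal k),
        ← Finset.sum_add_distrib]
      refine Finset.sum_congr rfl fun J _ => ?_
      rw [← smul_eq_C_mul, map_smul, map_sum, smul_eq_mul, Finset.mul_sum,
        ← Finset.sum_add_distrib]
      refine Finset.sum_congr rfl fun x _ => ?_
      rw [dEval_mul]
      ring
    -- Exchanging the two orders and conjugating J identifies the two halves of the product rule.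
    have e2 : ∑ x ∈ antidiagonal k, ∑ J, (w J : ℂ) * (dEval v V (p.lie χ x.2 (X (p.bar J))) *
          eval v (p.lie χ x.1 (X J))) = ∑ x ∈ antidiagonal k, ∑ J, (w J : ℂ) *
          (dEval v V (p.lie χ x.1 (X J)) * eval v (p.lie χ x.2 (X (p.bar J)))) := by
      rw [← Finset.Nat.sum_antidiagonal_swap]
      refine Finset.sum_congr rfl fun x _ => ?_
      rw [← p.sum_bar]
      refine Finset.sum_congr rfl fun J _ => ?_
      rw [p.bar_bar, nf.w_bar]
      rfl
    rw [e1, e2, ← two_mul, Finset.mul_sum]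
    refine Finset.sum_congr rfl fun x _ => ?_
    rw [Finset.mul_sum]
  rw [hsum]
  refine (enorm_sum_le _ _).trans ?_
  calc _ ≤ ∑ x ∈ antidiagonal k, 2 * (36 * M * K ^ 2 * α 0 ^ 2 * ρ * p.nrm α (fun J => ‖V J‖ₑ) *
        ((k + 1) * (3 * K * B * ρ) ^ k)) := by
        refine Finset.sum_le_sum fun x hx => (enorm_sum_le _ _).trans ?_
        refine le_trans (le_of_eq ?_) (mul_le_mul_right (hterm x hx) 2)
        rw [Finset.mul_sum]
        refine Finset.sum_congr rfl fun J _ => ?_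
        have e2 : ‖(2 : ℂ)‖ₑ = 2 := by simp [enorm_eq_nnnorm]
        have ew : ‖((w J : ℝ) : ℂ)‖ₑ = w J := by
          rw [enorm_eq_nnnorm]
          congr 1
          ext
          simp
        rw [enorm_mul, enorm_mul, enorm_mul, e2, ew]
    _ = _ := by
        rw [Finset.sum_const, Finset.Nat.card_antidiagonal, nsmul_eq_mul]
        push_cast
        ring

end Energy

theorem sum_range_antidiagonal_eq {R : Type*} [AddCommMonoid R] (F : ℕ → ℕ → R) (n : ℕ) :
    ∑ k ∈ Finset.range n, ∑ x ∈ antidiagonal k, F x.1 x.2 =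
      ∑ a ∈ Finset.range n, ∑ b ∈ Finset.range n, if a + b < n then F a b else 0 := by
  rw [Finset.sum_sigma', ← Finset.sum_product', ← Finset.sum_filter]
  refine Finset.sum_bij' (fun z _ => z.2) (fun x _ => ⟨x.1 + x.2, x⟩) ?_ ?_ ?_ ?_ ?_
  · rintro ⟨k, x⟩ hx
    simp only [Finset.mem_sigma, Finset.mem_range, Finset.HasAntidiagonal.mem_antidiagonal] at hx
    simp only [Finset.mem_filter, Finset.mem_product, Finset.mem_range]
    omega
  · rintro x hx
    simp only [Finset.mem_filter] at hx
    simp only [Finset.mem_sigma, Finset.mem_range, Finset.HasAntidiagonal.mem_antidiagonal]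
    exact ⟨hx.2, trivial⟩
  · rintro ⟨k, x⟩ hx
    simp only [Finset.mem_sigma, Finset.HasAntidiagonal.mem_antidiagonal] at hx
    obtain ⟨_, rfl⟩ := hx
    rfl
  · intro x _
    rfl
  · intro x _
    rfl

theorem succ_sq_le_four_pow (k : ℕ) : (k + 1) ^ 2 ≤ 4 ^ k := by
  have h : k + 1 ≤ 2 ^ k := Nat.lt_two_pow_self
  calc (k + 1) ^ 2 ≤ (2 ^ k) ^ 2 := Nat.pow_le_pow_left h 2
    _ = 4 ^ k := by rw [← pow_mul, mul_comm, pow_mul]; norm_num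

section Energy

variable {ι G : Type*} [Fintype ι] [DecidableEq ι] [AddCommGroup G]
  {p : Phase ι G} {H : ι → Prop} {r : ℕ} {B : ℝ≥0} {w : ι → ℝ≥0}
  {h χ Z : ℕ → MvPolynomial ι ℂ} {α β : G → ℝ≥0∞} {K M γ ρ : ℝ≥0∞} {v : ι → ℂ}

theorem Phase.nrm_sum_le {κ : Type*} (s : Finset κ) (x : κ → ι → ℝ≥0∞) :
    p.nrm α (fun J => ∑ k ∈ s, x k J) ≤ ∑ k ∈ s, p.nrm α (x k) := by
  unfold Phase.nrm
  simp only [Finset.mul_sum]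
  exact l2_sum_le s _

theorem enorm_coe_nnreal (a : ℝ≥0) : ‖((a : ℝ) : ℂ)‖ₑ = a := by
  rw [enorm_eq_nnnorm]
  congr 1
  ext
  simp

theorem Phase.coe_lieSum (A : MvPolynomial ι ℂ) : (p.lieSum χ v r A : ℝ≥0∞) =
    ∑ a ∈ Finset.range (r + 1), ‖eval v (p.lie χ a A)‖ₑ := by
  unfold Phase.lieSum
  push_cast
  rfl

theorem NormalForm.nrm_lieSum_le (nf : NormalForm p H r B w h χ Z) (hw : TameWeight p.q α β K)
    (hv : p.nrm α (fun J => ‖v J‖ₑ) ≤ ρ) (hx : 3 * K * B * ρ ≤ 1 / 2) :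
    p.nrm α (fun J => p.lieSum χ v r (X J)) ≤ 12 * K * α 0 * ρ := by
  simp only [Phase.coe_lieSum]
  refine (Phase.nrm_sum_le _ _).trans ?_
  calc _ ≤ ∑ a ∈ Finset.range (r + 1), 6 * K * α 0 * ρ * (3 * K * B * ρ) ^ a :=
        Finset.sum_le_sum fun a ha =>
          nf.nrm_lie_X_le hw (Nat.lt_succ_iff.1 (Finset.mem_range.1 ha)) hv
    _ ≤ 6 * K * α 0 * ρ * 2 := by
        rw [← Finset.mul_sum]
        gcongr
        exact sum_geometric_le_two hx _
    _ = _ := by ring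

/-- The modified energy is close to the quadratic one. -/
theorem NormalForm.enorm_energy_sub_le (nf : NormalForm p H r B w h χ Z)
    (hw : TameWeight p.q α β K) (hα : ∀ g, α (-g) = α g)
    (hwM : ∀ J, (w J : ℝ≥0∞) ≤ M * α (p.q J) ^ 2)
    (hv : p.nrm α (fun J => ‖v J‖ₑ) ≤ ρ) (hx : 3 * K * B * ρ ≤ 1 / 2) :
    ‖eval v (p.energy χ w r) - eval v (p.quad fun J => (w J : ℂ))‖ₑ ≤
      156 * M * K ^ 2 * α 0 ^ 2 * ρ ^ 2 * (3 * K * B * ρ) := by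
  set n : ℕ → ι → ℝ≥0∞ := fun a J => ‖eval v (p.lie χ a (X J))‖ₑ with hn
  set z : ι → ℝ≥0∞ := fun J => ∑ a ∈ Finset.range r, n (a + 1) J with hz
  set y : ι → ℝ≥0∞ := fun J => p.lieSum χ v r (X J) with hy
  have hyn : ∀ J, y J = ∑ a ∈ Finset.range (r + 1), n a J := fun J => Phase.coe_lieSum _
  have hznrm : p.nrm α z ≤ 12 * K * α 0 * ρ * (3 * K * B * ρ) := by
    refine (Phase.nrm_sum_le _ _).trans ?_
    calc _ ≤ ∑ a ∈ Finset.range r, 6 * K * α 0 * ρ * (3 * K * B * ρ) ^ (a + 1) :=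
          Finset.sum_le_sum fun a ha => nf.nrm_lie_X_le hw (Finset.mem_range.1 ha) hv
      _ = 6 * K * α 0 * ρ * (3 * K * B * ρ) * ∑ a ∈ Finset.range r, (3 * K * B * ρ) ^ a := by
          rw [Finset.mul_sum]
          exact Finset.sum_congr rfl fun a _ => by rw [pow_succ]; ring
      _ ≤ 6 * K * α 0 * ρ * (3 * K * B * ρ) * 2 := by
          gcongr
          exact sum_geometric_le_two hx _
      _ = _ := by ring
  have hynrm := nf.nrm_lieSum_le hw hv hx
  -- At positive total order one of the two factors has positive order, and this supplies the small
  -- factor 3 K B ρ.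
  have hterm : ∀ J, ∑ k ∈ Finset.range r, ∑ x ∈ antidiagonal (k + 1), n x.1 J * n x.2 (p.bar J) ≤
      n 0 J * z (p.bar J) + z J * y (p.bar J) := by
    intro J
    simp only [Finset.Nat.sum_antidiagonal_succ]
    rw [Finset.sum_add_distrib, ← Finset.mul_sum]
    refine add_le_add le_rfl ((sum_range_antidiagonal_le
      (fun a b => n (a + 1) J * n b (p.bar J)) r).trans ?_)
    rw [← Finset.sum_mul_sum, hyn]
    refine mul_le_mul_right (Finset.sum_le_sum_of_subset (Finset.range_subset_range.2 ?_)) _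
    omega
  calc _ ≤ ∑ k ∈ Finset.range r, ∑ J, (w J : ℝ≥0∞) *
        ∑ x ∈ antidiagonal (k + 1), n x.1 J * n x.2 (p.bar J) := by
        rw [Phase.energy, Finset.sum_range_succ', p.lie_zero, map_add, add_sub_cancel_right,
          map_sum]
        refine (enorm_sum_le _ _).trans (Finset.sum_le_sum fun k _ => ?_)
        rw [p.lie_quad, map_sum]
        refine (enorm_sum_le _ _).trans (Finset.sum_le_sum fun J _ => ?_)
        rw [map_mul, eval_C, enorm_mul, enorm_coe_nnreal, map_sum]
        refine mul_le_mul_right ((enorm_sum_le _ _).trans (le_of_eq ?_)) _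
        exact Finset.sum_congr rfl fun x _ => by rw [map_mul, enorm_mul]
    _ = ∑ J, (w J : ℝ≥0∞) * ∑ k ∈ Finset.range r,
        ∑ x ∈ antidiagonal (k + 1), n x.1 J * n x.2 (p.bar J) := by
        rw [Finset.sum_comm]
        simp only [Finset.mul_sum]
    _ ≤ ∑ J, ((w J : ℝ≥0∞) * (n 0 J * z (p.bar J)) + (w J : ℝ≥0∞) * (z J * y (p.bar J))) := by
        refine Finset.sum_le_sum fun J _ => ?_
        rw [← mul_add]
        exact mul_le_mul_right (hterm J) _
    _ ≤ M * (ρ * (12 * K * α 0 * ρ * (3 * K * B * ρ))) +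
        M * ((12 * K * α 0 * ρ * (3 * K * B * ρ)) * (12 * K * α 0 * ρ)) := by
        rw [Finset.sum_add_distrib]
        refine add_le_add ((Phase.sum_weight_le hα hwM _ _).trans ?_)
          ((Phase.sum_weight_le hα hwM _ _).trans ?_)
        · gcongr
          simpa [hn, p.lie_zero] using hv
        · gcongr
    _ = 12 * M * (1 * (K * α 0)) * ρ ^ 2 * (3 * K * B * ρ) +
        144 * M * (K * α 0) ^ 2 * ρ ^ 2 * (3 * K * B * ρ) := by ring
    _ ≤ 12 * M * ((K * α 0) * (K * α 0)) * ρ ^ 2 * (3 * K * B * ρ) +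
        144 * M * (K * α 0) ^ 2 * ρ ^ 2 * (3 * K * B * ρ) := by
        gcongr
        exact one_le_mul hw.one_le hw.one_le_zero
    _ = _ := by ring

theorem Phase.Bound.highPart {d : ℕ} {g : G} {a : ℝ≥0} {A : MvPolynomial ι ℂ}
    (hA : p.Bound H d g a A) (k : ℕ) : Maj (highPart H k A) (a • p.theta H d k g) := by
  classical
  intro m
  rw [UltraDiff.highPart, coeff_diag]
  split_ifs with hm
  · rw [one_mul]
    refine (hA m).trans ?_
    rw [coeff_smul, coeff_smul]
    exact mul_le_mul_right (p.theta_high H d k g m hm) _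
  · simp

/-- The terms in normal form contribute little to the derivative of the energy. -/
theorem NormalForm.lieSum_ham_Z_le (nf : NormalForm p H r B w h χ Z) (hw : TameWeight p.q α β K)
    (hα : ∀ g, α (-g) = α g) (hwM : ∀ J, (w J : ℝ≥0∞) ≤ M * α (p.q J) ^ 2)
    (hH : HighGain p.q α β K H γ)
    (hv : p.nrm α (fun J => ‖v J‖ₑ) ≤ ρ) (hx : 3 * K * B * ρ ≤ 1 / 2) {j : ℕ} (hj : j ≤ r) :
    (p.lieSum χ v r (p.ham (Z j) (p.quad fun J => (w J : ℂ))) : ℝ≥0∞) ≤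
      3456 * M * K ^ 3 * α 0 ^ 3 * γ * ρ ^ 2 * (288 * K ^ 2 * α 0 * B * ρ) ^ j := by
  rcases Nat.eq_zero_or_pos j with rfl | hj0
  · rw [nf.ham_zero]
    simp [Phase.lieSum]
  set y : ι → ℝ≥0 := fun J => p.lieSum χ v r (X J) with hy
  have hynrm : p.nrm α (fun J => (y J : ℝ≥0∞)) ≤ 12 * K * α 0 * ρ := nf.nrm_lieSum_le hw hv hx
  set F : G → ℝ≥0∞ := convPow p.q H (fun J => (y J : ℝ≥0∞)) (j + 1) 2 with hF
  have hY : ∀ J, (p.lieSum χ v r (UltraDiff.highPart H 2 (pderiv J (Z j))) : ℝ≥0∞) ≤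
      (B : ℝ≥0∞) ^ j * (j + 2) * F (p.q (p.bar J)) := by
    intro J
    have h1 := ((nf.bound_Z j hj0 hj).pderiv J).highPart 2
    have h2 := ENNReal.coe_le_coe.2 (Phase.lieSum_le_of_maj (p := p) (χ := χ) (v := v) (r := r) h1)
    rw [smul_eval, ENNReal.coe_mul, p.eval_theta, zero_sub, ← p.q_bar] at h2
    refine h2.trans (le_of_eq ?_)
    push_cast
    rw [add_assoc]
    norm_num
    rfl
  -- The gain γ enters here, through the two high factors left in the derivative of `Z j`.
  have hFn : p.nrm α (fun J => F (p.q J)) ≤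
      2 * (((j + 1 : ℕ) : ℝ≥0∞) ^ 2 * γ * α 0 * (3 * K * (12 * K * α 0 * ρ)) ^ (j + 1)) := by
    refine (Phase.nrm_momentum_le hw _).trans (mul_le_mul_right
      ((l2_convPow_two_le hw hH _ _).trans ?_) _)
    gcongr
    exact hynrm
  calc (p.lieSum χ v r (p.ham (Z j) (p.quad fun J => (w J : ℂ))) : ℝ≥0∞)
      ≤ ∑ J, 2 * ((w J : ℝ≥0∞) * (y J * ((B : ℝ≥0∞) ^ j * (j + 2) * F (p.q (p.bar J))))) := by
        rw [nf.ham_Z j hj0 hj]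
        refine (ENNReal.coe_le_coe.2 (Phase.lieSum_sum _ _)).trans ?_
        rw [ENNReal.ofNNReal_finsetSum]
        refine Finset.sum_le_sum fun J _ => ?_
        rw [Phase.lieSum_C_mul, ENNReal.coe_mul]
        have hc : ((‖-2 * (p.c J * (w J : ℂ))‖₊ : ℝ≥0) : ℝ≥0∞) = 2 * w J := by
          have h2 : ‖(-2 : ℂ)‖₊ = 2 := by simp
          have h3 : ‖p.c J‖₊ = 1 := NNReal.eq (p.norm_c J)
          have h4 : ‖((w J : ℝ) : ℂ)‖₊ = w J := by ext; simp
          rw [nnnorm_mul, nnnorm_mul, h2, h3, one_mul, h4]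
          push_cast
          rfl
        rw [hc, mul_assoc]
        refine mul_le_mul_right (mul_le_mul_right ((ENNReal.coe_le_coe.2
          (Phase.lieSum_mul _ _)).trans ?_) _) _
        rw [ENNReal.coe_mul]
        exact mul_le_mul_right (hY J) _
    _ = 2 * ((B : ℝ≥0∞) ^ j * (j + 2)) *
          ∑ J, (w J : ℝ≥0∞) * (y J * F (p.q (p.bar J))) := by
        rw [Finset.mul_sum]
        exact Finset.sum_congr rfl fun J _ => by ring
    _ ≤ 2 * ((B : ℝ≥0∞) ^ j * (j + 2)) * (M * ((12 * K * α 0 * ρ) *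
          (2 * (((j + 1 : ℕ) : ℝ≥0∞) ^ 2 * γ * α 0 * (3 * K * (12 * K * α 0 * ρ)) ^ (j + 1))))) := by
        gcongr
        refine (Phase.sum_weight_le hα hwM _ (fun J => F (p.q J))).trans ?_
        gcongr
    _ = 1728 * M * K ^ 3 * α 0 ^ 3 * γ * ρ ^ 2 * (((j + 2 : ℕ) * ((j + 1 : ℕ) : ℝ≥0∞) ^ 2) *
          (36 * K ^ 2 * α 0 * B * ρ) ^ j) := by
        push_cast
        ring
    _ ≤ 1728 * M * K ^ 3 * α 0 ^ 3 * γ * ρ ^ 2 * ((2 * 8 ^ j) *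
          (36 * K ^ 2 * α 0 * B * ρ) ^ j) := by
        refine mul_le_mul_right (mul_le_mul_left ?_ _) _
        have h1 : j + 2 ≤ 2 * 2 ^ j := by
          have : j + 1 ≤ 2 ^ j := Nat.lt_two_pow_self
          omega
        have h2 : (j + 2) * (j + 1) ^ 2 ≤ 2 * 8 ^ j := by
          calc (j + 2) * (j + 1) ^ 2 ≤ (2 * 2 ^ j) * 4 ^ j :=
                Nat.mul_le_mul h1 (succ_sq_le_four_pow j)
            _ = 2 * 8 ^ j := by rw [mul_assoc, ← mul_pow]; norm_num
        exact_mod_cast h2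
    _ = _ := by
        rw [mul_assoc 2, ← mul_pow]
        rw [show 8 * (36 * K ^ 2 * α 0 * B * ρ) = 288 * K ^ 2 * α 0 * B * ρ by ring]
        ring

theorem NormalForm.nrm_field_le (nf : NormalForm p H r B w h χ Z) (hw : TameWeight p.q α β K)
    (hv : p.nrm α (fun J => ‖v J‖ₑ) ≤ ρ) {a : ℕ} (ha1 : 1 ≤ a) (ha : a ≤ r) :
    p.nrm α (fun J => ‖p.field v (h a) J‖ₑ) ≤
      6 * K * α 0 * ρ * ((a + 2) * (3 * K * B * ρ) ^ a) := by
  have hpt : ∀ J, ‖p.field v (h a) J‖ₑ ≤ ((B : ℝ≥0∞) ^ a * (a + 2)) *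
      convPow p.q H (fun J => ‖v J‖ₑ) (a + 1) 0 (p.q J) := by
    intro J
    have h1 := ((nf.bound_h a ha1 ha).pderiv (p.bar J)).enorm_eval_le v
    have hc : ‖p.c J‖ₑ = 1 := by
      rw [enorm_eq_nnnorm, show ‖p.c J‖₊ = 1 from NNReal.eq (p.norm_c J), ENNReal.coe_one]
    rw [Phase.field, enorm_mul, hc, one_mul]
    rw [p.q_bar, zero_sub, neg_neg] at h1
    refine h1.trans (le_of_eq ?_)
    push_cast
    rw [add_assoc]
    norm_num
  calc _ ≤ p.nrm α (fun J => ((B : ℝ≥0∞) ^ a * (a + 2)) *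
        convPow p.q H (fun J => ‖v J‖ₑ) (a + 1) 0 (p.q J)) :=
        l2_mono fun J => mul_le_mul_right (hpt J) _
    _ = ((B : ℝ≥0∞) ^ a * (a + 2)) *
        p.nrm α (fun J => convPow p.q H (fun J => ‖v J‖ₑ) (a + 1) 0 (p.q J)) := by
        rw [Phase.nrm, Phase.nrm, ← l2_const_mul]
        congr 1
        funext J
        ring
    _ ≤ ((B : ℝ≥0∞) ^ a * (a + 2)) * (2 * (α 0 * (3 * K * ρ) ^ (a + 1))) := by
        gcongr
        refine (Phase.nrm_momentum_le hw _).trans (mul_le_mul_right ((l2_convPow_le hw _ _ _).trans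
          ?_) _)
        gcongr
        exact hv
    _ = _ := by ring

/-- Order by order, {Ψ Z, Ψ A} = Ψ {Z, A}. This replaces the conjugation by a canonical change of
variables. -/
theorem NormalForm.sum_ham_eq (nf : NormalForm p H r B w h χ Z) {k : ℕ} (hk : k ≤ r)
    (A : MvPolynomial ι ℂ) :
    ∑ x ∈ antidiagonal k, p.ham (h x.1) (p.lie χ x.2 A) =
      ∑ x ∈ antidiagonal k, p.lie χ x.1 (p.ham (Z x.2) A) := by
  have h1 : ∀ x ∈ antidiagonal k, p.ham (h x.1) (p.lie χ x.2 A) =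
      ∑ y ∈ antidiagonal x.1, p.br (p.lie χ y.1 (Z y.2)) (p.lie χ x.2 A) := by
    intro x hx
    have hx' := Finset.HasAntidiagonal.mem_antidiagonal.1 hx
    rw [nf.h_eq x.1 (by omega), ← p.br_apply, map_sum, LinearMap.sum_apply]
  rw [Finset.sum_congr rfl h1, sum_antidiagonal_antidiagonal_fst
    (fun i j m => p.br (p.lie χ i (Z j)) (p.lie χ m A))]
  refine Finset.sum_congr rfl fun x _ => ?_
  rw [p.lie_ham]
  rfl

/-- The derivative of the modified energy along the perturbed Hamiltonian flow. -/
theorem NormalForm.enorm_dEval_energy_le (nf : NormalForm p H r B w h χ Z)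
    (hw : TameWeight p.q α β K) (hα : ∀ g, α (-g) = α g)
    (hwM : ∀ J, (w J : ℝ≥0∞) ≤ M * α (p.q J) ^ 2) (hH : HighGain p.q α β K H γ)
    (hv : p.nrm α (fun J => ‖v J‖ₑ) ≤ ρ) (hx : 300 * K ^ 2 * α 0 * B * ρ ≤ 1 / 2) (η : ι → ℂ) :
    ‖dEval v (fun J => ∑ a ∈ Finset.range (r + 1), p.field v (h a) J + η J)
      (p.energy χ w r)‖ₑ ≤
      7000 * M * K ^ 3 * α 0 ^ 3 * (γ * ρ ^ 2 + ρ ^ 2 * (300 * K ^ 2 * α 0 * B * ρ) ^ (r + 1) +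
        ρ * p.nrm α fun J => ‖η J‖ₑ) := by
  have hKα : 1 ≤ K * α 0 := one_le_mul hw.one_le hw.one_le_zero
  have hxx : ∀ c : ℝ≥0∞, c ≤ 300 → c * K * B * ρ ≤ 300 * K ^ 2 * α 0 * B * ρ := by
    intro c hc
    calc c * K * B * ρ = c * K * 1 * B * ρ := by ring
      _ ≤ 300 * K * (K * α 0) * B * ρ := by gcongr
      _ = _ := by ring
  have hx3 : 3 * K * B * ρ ≤ 1 / 2 := (hxx 3 (by norm_num)).trans hx
  have hx12 : 4 * (3 * K * B * ρ) ≤ 1 / 2 := by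
    refine le_trans (le_of_eq ?_) ((hxx 12 (by norm_num)).trans hx)
    ring
  set N := p.quad fun J => (w J : ℂ) with hN
  set T : ℕ → ℕ → ℂ := fun a k => eval v (p.ham (h a) (p.lie χ k N)) with hT
  -- Pairs of total order at most r regroup into Lie series of {Z, N}; the pairs of higher total
  -- order form the remainder, and η acts on the energy directly.
  have hsplit : dEval v (fun J => ∑ a ∈ Finset.range (r + 1), p.field v (h a) J + η J)
      (p.energy χ w r) =
      (∑ k ∈ Finset.range (r + 1), ∑ x ∈ antidiagonal k,
        eval v (p.lie χ x.1 (p.ham (Z x.2) N))) +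
      (∑ a ∈ Finset.range (r + 1), ∑ k ∈ Finset.range (r + 1),
        if a + k < r + 1 then 0 else T a k) +
      ∑ k ∈ Finset.range (r + 1), dEval v η (p.lie χ k N) := by
    rw [dEval_add_right, dEval_sum_right, Phase.energy, map_sum (dEval v η)]
    congr 1
    have e1 : ∑ k ∈ Finset.range (r + 1), ∑ x ∈ antidiagonal k,
        eval v (p.lie χ x.1 (p.ham (Z x.2) N)) = ∑ k ∈ Finset.range (r + 1),
        ∑ x ∈ antidiagonal k, T x.1 x.2 := by
      refine Finset.sum_congr rfl fun k hk => ?_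
      rw [← map_sum, ← map_sum, nf.sum_ham_eq (Nat.lt_succ_iff.1 (Finset.mem_range.1 hk))]
    rw [e1, sum_range_antidiagonal_eq, ← Finset.sum_add_distrib]
    refine Finset.sum_congr rfl fun a _ => ?_
    rw [map_sum, ← Finset.sum_add_distrib]
    refine Finset.sum_congr rfl fun k _ => ?_
    rw [Phase.dEval_field]
    split_ifs <;> simp only [hT, hN, add_zero, zero_add]
  have h1 : ‖∑ k ∈ Finset.range (r + 1), ∑ x ∈ antidiagonal k,
      eval v (p.lie χ x.1 (p.ham (Z x.2) N))‖ₑ ≤ 7000 * M * K ^ 3 * α 0 ^ 3 * (γ * ρ ^ 2) := by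
    calc _ ≤ ∑ k ∈ Finset.range (r + 1), ∑ x ∈ antidiagonal k,
          ‖eval v (p.lie χ x.1 (p.ham (Z x.2) N))‖ₑ :=
          (enorm_sum_le _ _).trans (Finset.sum_le_sum fun k _ => enorm_sum_le _ _)
      _ ≤ ∑ j ∈ Finset.range (r + 1), (p.lieSum χ v r (p.ham (Z j) N) : ℝ≥0∞) := by
          refine (sum_range_antidiagonal_le
            (fun a j => ‖eval v (p.lie χ a (p.ham (Z j) N))‖ₑ) _).trans (le_of_eq ?_)
          rw [Finset.sum_comm]
          exact Finset.sum_congr rfl fun j _ => (Phase.coe_lieSum _).symm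
      _ ≤ ∑ j ∈ Finset.range (r + 1), 3456 * M * K ^ 3 * α 0 ^ 3 * γ * ρ ^ 2 *
          (288 * K ^ 2 * α 0 * B * ρ) ^ j := Finset.sum_le_sum fun j hj =>
            nf.lieSum_ham_Z_le hw hα hwM hH hv hx3 (Nat.lt_succ_iff.1 (Finset.mem_range.1 hj))
      _ ≤ 3456 * M * K ^ 3 * α 0 ^ 3 * γ * ρ ^ 2 * 2 := by
          rw [← Finset.mul_sum]
          gcongr
          refine sum_geometric_le_two (le_trans ?_ hx) _
          gcongr
          norm_num
      _ = 6912 * M * K ^ 3 * α 0 ^ 3 * (γ * ρ ^ 2) := by ring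
      _ ≤ _ := by gcongr; norm_num
  have hfour : ∀ k : ℕ, ((k : ℝ≥0∞) + 1) ^ 2 ≤ 4 ^ k := fun k => by
    exact_mod_cast succ_sq_le_four_pow k
  have hfour' : ∀ k : ℕ, ((k : ℝ≥0∞) + 2) ≤ 2 * 4 ^ k := fun k => by
    have h0 : k + 1 ≤ 2 ^ k := Nat.lt_two_pow_self
    have h1 : 2 ^ k ≤ 4 ^ k := Nat.pow_le_pow_left (by norm_num) k
    exact_mod_cast (by omega : k + 2 ≤ 2 * 4 ^ k)
  have h2 : ‖∑ a ∈ Finset.range (r + 1), ∑ k ∈ Finset.range (r + 1),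
      if a + k < r + 1 then 0 else T a k‖ₑ ≤ 7000 * M * K ^ 3 * α 0 ^ 3 *
        (ρ ^ 2 * (300 * K ^ 2 * α 0 * B * ρ) ^ (r + 1)) := by
    calc _ ≤ ∑ a ∈ Finset.range (r + 1), ∑ k ∈ Finset.range (r + 1),
          864 * M * K ^ 3 * α 0 ^ 3 * ρ ^ 2 * (4 * (3 * K * B * ρ)) ^ (r + 1) := by
          refine (enorm_sum_le _ _).trans (Finset.sum_le_sum fun a ha =>
            (enorm_sum_le _ _).trans (Finset.sum_le_sum fun k hk => ?_))
          have ha' := Nat.lt_succ_iff.1 (Finset.mem_range.1 ha)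
          have hk' := Nat.lt_succ_iff.1 (Finset.mem_range.1 hk)
          split_ifs with hak
          · simp
          · rw [hT]
            simp only
            rw [← Phase.dEval_field]
            calc _ ≤ 72 * M * K ^ 2 * α 0 ^ 2 * ρ * (6 * K * α 0 * ρ *
                  ((a + 2) * (3 * K * B * ρ) ^ a)) * ((k + 1) ^ 2 * (3 * K * B * ρ) ^ k) := by
                  refine (nf.enorm_dEval_lie_quad_le hw hα hwM hk' hv _).trans ?_
                  gcongr
                  exact nf.nrm_field_le hw hv (by omega) ha'
              _ ≤ 72 * M * K ^ 2 * α 0 ^ 2 * ρ * (6 * K * α 0 * ρ *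
                  ((2 * 4 ^ a) * (3 * K * B * ρ) ^ a)) * (4 ^ k * (3 * K * B * ρ) ^ k) := by
                  exact mul_le_mul' (mul_le_mul_right (mul_le_mul_right (mul_le_mul_left
                    (hfour' a) _) _) _) (mul_le_mul_left (hfour k) _)
              _ = 864 * M * K ^ 3 * α 0 ^ 3 * ρ ^ 2 * (4 * (3 * K * B * ρ)) ^ (a + k) := by
                  generalize 3 * K * B * ρ = y
                  rw [mul_pow, pow_add, pow_add]
                  ring
              _ ≤ _ := by
                  refine mul_le_mul_right (pow_le_pow_right_of_le_one' ?_ (by omega)) _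
                  exact hx12.trans (by simp)
      _ = 864 * M * K ^ 3 * α 0 ^ 3 * ρ ^ 2 * (((r : ℝ≥0∞) + 1) ^ 2 *
            (4 * (3 * K * B * ρ)) ^ (r + 1)) := by
          simp only [Finset.sum_const, Finset.card_range, nsmul_eq_mul]
          push_cast
          ring
      _ ≤ 864 * M * K ^ 3 * α 0 ^ 3 * ρ ^ 2 * (4 ^ (r + 1) *
            (4 * (3 * K * B * ρ)) ^ (r + 1)) := by
          exact mul_le_mul_right (mul_le_mul_left
            ((hfour r).trans (pow_le_pow_right' (by norm_num) (Nat.le_succ r))) _) _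
      _ = 864 * M * K ^ 3 * α 0 ^ 3 * (ρ ^ 2 * (48 * K * B * ρ) ^ (r + 1)) := by
          rw [← mul_pow, show 4 * (4 * (3 * K * B * ρ)) = 48 * K * B * ρ by ring]
          ring
      _ ≤ 7000 * M * K ^ 3 * α 0 ^ 3 * (ρ ^ 2 * (300 * K ^ 2 * α 0 * B * ρ) ^ (r + 1)) :=
          mul_le_mul' (by gcongr; norm_num)
            (mul_le_mul_right (pow_le_pow_left' (hxx 48 (by norm_num)) _) _)
  have h3 : ‖∑ k ∈ Finset.range (r + 1), dEval v η (p.lie χ k N)‖ₑ ≤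
      7000 * M * K ^ 3 * α 0 ^ 3 * (ρ * p.nrm α fun J => ‖η J‖ₑ) := by
    calc _ ≤ ∑ k ∈ Finset.range (r + 1), 72 * M * K ^ 2 * α 0 ^ 2 * ρ *
          p.nrm α (fun J => ‖η J‖ₑ) * (4 * (3 * K * B * ρ)) ^ k := by
          refine (enorm_sum_le _ _).trans (Finset.sum_le_sum fun k hk => ?_)
          have hk' := Nat.lt_succ_iff.1 (Finset.mem_range.1 hk)
          refine (nf.enorm_dEval_lie_quad_le hw hα hwM hk' hv _).trans ?_
          rw [mul_pow 4]
          exact mul_le_mul_right (mul_le_mul_left (hfour k) _) _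
      _ ≤ 72 * M * K ^ 2 * α 0 ^ 2 * ρ * p.nrm α (fun J => ‖η J‖ₑ) * 2 := by
          rw [← Finset.mul_sum]
          gcongr
          exact sum_geometric_le_two hx12 _
      _ = 144 * M * K ^ 2 * 1 * α 0 ^ 2 * 1 * (ρ * p.nrm α (fun J => ‖η J‖ₑ)) := by ring
      _ ≤ 7000 * M * K ^ 2 * K * α 0 ^ 2 * α 0 * (ρ * p.nrm α (fun J => ‖η J‖ₑ)) := by
          gcongr
          · norm_num
          · exact hw.one_le
          · exact hw.one_le_zero
      _ = _ := by ring
  rw [hsplit, mul_add, mul_add]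
  exact (enorm_add_le _ _).trans (add_le_add ((enorm_add_le _ _).trans (add_le_add h1 h2)) h3)

end Energy

/-! ### Lengths of lattice points -/

section Length

variable {n : ℕ}

theorem len_eq_norm (j : Fin n → ℤ) :
    len j = ‖(WithLp.toLp 2 fun l => (j l : ℝ) : EuclideanSpace ℝ (Fin n))‖ := by
  rw [EuclideanSpace.norm_eq, len]
  simp

theorem len_nonneg (j : Fin n → ℤ) : 0 ≤ len j := Real.sqrt_nonneg _

theorem len_zero : len (0 : Fin n → ℤ) = 0 := by simp [len]

theorem len_neg (j : Fin n → ℤ) : len (-j) = len j := by simp [len]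

theorem len_add_le (j k : Fin n → ℤ) : len (j + k) ≤ len j + len k := by
  simp only [len_eq_norm]
  refine le_trans (le_of_eq ?_) (norm_add_le _ _)
  congr 1
  ext l
  simp

theorem len_sum_le {κ : Type*} (t : Finset κ) (j : κ → Fin n → ℤ) :
    len (∑ l ∈ t, j l) ≤ ∑ l ∈ t, len (j l) :=
  Finset.le_sum_of_subadditive _ len_zero.le len_add_le _ _

theorem eq_zero_of_len_eq_zero {j : Fin n → ℤ} (h : len j = 0) : j = 0 := by
  rw [len_eq_norm, norm_eq_zero] at h
  funext l
  have := congrArg (fun x : EuclideanSpace ℝ (Fin n) => x l) h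
  simpa using this

theorem abs_le_len (j : Fin n → ℤ) (l : Fin n) : |(j l : ℝ)| ≤ len j := by
  rw [len]
  refine Real.abs_le_sqrt ?_
  exact Finset.single_le_sum (f := fun l => (j l : ℝ) ^ 2) (fun _ _ => sq_nonneg _)
    (Finset.mem_univ l)

theorem finite_len_le (R : ℝ) : {j : Fin n → ℤ | len j ≤ R}.Finite := by
  refine Set.Finite.subset (Set.finite_Icc (fun _ => -⌈R⌉) (fun _ => ⌈R⌉)) fun j hj => ?_
  have h : ∀ l, |j l| ≤ ⌈R⌉ := fun l => by
    have : |(j l : ℝ)| ≤ (⌈R⌉ : ℝ) := (abs_le_len j l).trans (le_trans hj (Int.le_ceil R))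
    exact_mod_cast this
  exact ⟨fun l => (abs_le.1 (h l)).1, fun l => (abs_le.1 (h l)).2⟩

/-- The momentum `σ j` of an index. -/
def mom (J : Index n) : Fin n → ℤ := (J.2 : ℤ) • J.1

theorem mom_bar (J : Index n) : mom (bar J) = -mom J := by
  simp [mom, bar]

theorem bar_bar (J : Index n) : bar (bar J) = J := by
  simp [bar]

theorem mom_eq (J : Index n) : mom J = J.1 ∨ mom J = -J.1 := by
  rcases Int.units_eq_one_or J.2 with h | h <;> simp [mom, h]

theorem len_mom (J : Index n) : len (mom J) = len J.1 := by
  rcases mom_eq J with h | h <;> simp [h, len_neg]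

theorem bracket_mom (c : ℝ) (J : Index n) : bracket c (mom J) = bracket c J.1 := by
  rw [bracket, len_mom, bracket]

/-- The momentum p comes from the two indices (p, 1) and (-p, -1) only. -/
theorem tsum_mom_le {ι : Type*} {e : ι → Index n} (he : Function.Injective e)
    (y : (Fin n → ℤ) → ℝ≥0∞) : ∑' k, y (mom (e k)) ≤ 2 * ∑' p, y p := by
  refine (ENNReal.tsum_comp_le_tsum_of_injective he fun J => y (mom J)).trans (le_of_eq ?_)
  rw [ENNReal.tsum_prod', ENNReal.tsum_comm, tsum_fintype (L := .unconditional ℤˣ)]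
  have h : (Finset.univ : Finset ℤˣ) = {1, -1} := rfl
  rw [h, Finset.sum_pair (by decide), two_mul]
  congr 1
  · simp [mom]
  · rw [← (Equiv.neg (Fin n → ℤ)).tsum_eq y]
    simp [mom]

end Length

/-! ### The weights -/

/-- A weight function together with the constants that are used in the estimates. -/
structure GoodWeight (n : ℕ) (f : ℝ → ℝ) (c s κ : ℝ) (K : ℝ≥0) : Prop where
  c_pos : 0 < c
  s_pos : 0 < s
  pos : ∀ x, c ≤ x → 0 < f x
  mono : MonotoneOn f (Set.Ici c)
  κ_nonneg : 0 ≤ κ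
  κ_lt : κ < 1
  subadd : ∀ x y, c ≤ y → y ≤ x → f (x + y) ≤ f x + κ * f y
  one_le : 1 ≤ K
  sum_le : ∑' J : Index n, ENNReal.ofReal (Real.exp (-(s * (1 - κ)) * f (bracket c J.1))) ≤
    (K : ℝ≥0∞) ^ 2

/-- The weight `e^{s f(⟨p⟩)}`. -/
noncomputable def wt {n : ℕ} (f : ℝ → ℝ) (c s : ℝ) (p : Fin n → ℤ) : ℝ≥0∞ :=
  ENNReal.ofReal (Real.exp (s * f (bracket c p)))

section Weight

variable {n : ℕ} {f : ℝ → ℝ} {c s κ : ℝ} {K : ℝ≥0}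

theorem wt_neg (p : Fin n → ℤ) : wt f c s (-p) = wt f c s p := by
  rw [wt, wt, bracket, len_neg, bracket]

theorem wt_mom (J : Index n) : wt f c s (mom J) = wt f c s J.1 := by
  rw [wt, wt, bracket_mom]

theorem wt_ne_zero (p : Fin n → ℤ) : wt f c s p ≠ 0 := by
  simp [wt, Real.exp_pos]

theorem wt_ne_top (p : Fin n → ℤ) : wt f c s p ≠ ∞ := ENNReal.ofReal_ne_top

theorem wt_zero (hc : 0 < c) : wt f c s (0 : Fin n → ℤ) = ENNReal.ofReal (Real.exp (s * f c)) := by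
  rw [wt, bracket, len_zero, max_eq_right hc.le]

theorem le_bracket (p : Fin n → ℤ) : c ≤ bracket c p := le_max_right _ _

theorem bracket_add_le (hc : 0 < c) (p p' : Fin n → ℤ) :
    bracket c (p + p') ≤ bracket c p + bracket c p' := by
  refine max_le ((len_add_le _ _).trans (add_le_add (le_max_left _ _) (le_max_left _ _))) ?_
  have h1 := le_bracket (c := c) p
  have h2 := le_bracket (c := c) p'
  linarith

namespace GoodWeight

theorem add_le (hg : GoodWeight n f c s κ K) {x y : ℝ} (hx : c ≤ x) (hy : c ≤ y) :
    f (x + y) ≤ f x + f y := by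
  rcases le_total y x with h | h
  · have h1 := hg.subadd x y hy h
    have h2 := hg.pos y hy
    nlinarith [hg.κ_lt]
  · have h1 := hg.subadd y x hx h
    have h2 := hg.pos x hx
    rw [add_comm y x] at h1
    nlinarith [hg.κ_lt]

theorem bracket_add (hg : GoodWeight n f c s κ K) (p p' : Fin n → ℤ) :
    f (bracket c (p + p')) ≤ f (bracket c p) + κ * f (bracket c p') ∨
      f (bracket c (p + p')) ≤ κ * f (bracket c p) + f (bracket c p') := by
  have h : f (bracket c (p + p')) ≤ f (bracket c p + bracket c p') :=
    hg.mono (le_bracket _) (le_trans (le_bracket p)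
      (le_add_of_nonneg_right (hg.c_pos.le.trans (le_bracket _)))) (bracket_add_le hg.c_pos _ _)
  rcases le_total (bracket c p') (bracket c p) with h' | h'
  · exact Or.inl (h.trans (hg.subadd _ _ (le_bracket _) h'))
  · right
    have := hg.subadd _ _ (le_bracket _) h'
    rw [add_comm (bracket c p')] at this
    linarith

theorem f_pos (hg : GoodWeight n f c s κ K) (p : Fin n → ℤ) : 0 < f (bracket c p) :=
  hg.pos _ (le_bracket _)

theorem l2_le (hg : GoodWeight n f c s κ K) {ι : Type*} {e : ι → Index n}
    (he : Function.Injective e) :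
    l2 (fun k => ENNReal.ofReal (Real.exp (-(s * (1 - κ) / 2) * f (bracket c (e k).1)))) ≤ K := by
  refine l2_le_of_sq_le (le_trans (ENNReal.tsum_le_tsum fun k => ?_)
    ((ENNReal.tsum_comp_le_tsum_of_injective he _).trans hg.sum_le))
  rw [← ENNReal.ofReal_pow (Real.exp_pos _).le, ← Real.exp_nat_mul]
  refine le_of_eq ?_
  congr 2
  push_cast
  ring

/-- The gap s (1 - κ) between the exponents is split in half: one half pays for Cauchy–Schwarz, the
other yields the gain on high modes. -/
theorem wt_split (p : Fin n → ℤ) :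
    wt f c (s * κ) p = ENNReal.ofReal (Real.exp (-(s * (1 - κ) / 2) * f (bracket c p))) *
      (ENNReal.ofReal (Real.exp (-(s * (1 - κ) / 2) * f (bracket c p))) * wt f c s p) := by
  rw [wt, wt, ← ENNReal.ofReal_mul (Real.exp_pos _).le, ← ENNReal.ofReal_mul (Real.exp_pos _).le,
    ← Real.exp_add, ← Real.exp_add]
  congr 2
  ring

/-- The gain from restricting a sum to indices with large weight. -/
theorem highGain (hg : GoodWeight n f c s κ K) {ι : Type*} {e : ι → Index n}
    (he : Function.Injective e) (H : ι → Prop) (a : ℝ)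
    (hH : ∀ k, H k → a ≤ f (bracket c (e k).1)) :
    HighGain (fun k => mom (e k)) (wt f c s) (wt f c (s * κ)) K H
      (ENNReal.ofReal (Real.exp (-(s * (1 - κ) / 2) * a))) := by
  classical
  intro x
  calc _ ≤ ∑' k, ENNReal.ofReal (Real.exp (-(s * (1 - κ) / 2) * a)) *
        (ENNReal.ofReal (Real.exp (-(s * (1 - κ) / 2) * f (bracket c (e k).1))) *
          (wt f c s (mom (e k)) * x k)) := by
        refine ENNReal.tsum_le_tsum fun k => ?_
        split_ifs with h
        · rw [wt_mom, wt_mom, wt_split, mul_assoc, mul_assoc]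
          refine mul_le_mul_left (ENNReal.ofReal_le_ofReal (Real.exp_le_exp.2 ?_)) _
          have := hH k h
          have h2 : 0 ≤ s * (1 - κ) / 2 := by
            have := hg.s_pos; have := hg.κ_lt
            have : 0 ≤ 1 - κ := by linarith
            positivity
          nlinarith
        · simp
    _ ≤ _ := by
        rw [ENNReal.tsum_mul_left]
        exact mul_le_mul_right ((tsum_mul_le_l2 _ _).trans (mul_le_mul_left (hg.l2_le he) _)) _

theorem embed (hg : GoodWeight n f c s κ K) {ι : Type*} {e : ι → Index n}
    (he : Function.Injective e) (x : ι → ℝ≥0∞) :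
    ∑' k, wt f c (s * κ) (mom (e k)) * x k ≤ K * l2 fun k => wt f c s (mom (e k)) * x k := by
  have := hg.highGain he (fun _ => True) 0 (fun k _ => (hg.f_pos _).le) x
  simpa using this

/-- The coefficient κ on the smaller argument in the subadditivity of f is what permits the smaller
exponent s κ on one of two factors. -/
theorem tameWeight (hg : GoodWeight n f c s κ K) {ι : Type*} {e : ι → Index n}
    (he : Function.Injective e) :
    TameWeight (fun k => mom (e k)) (wt f c s) (wt f c (s * κ)) K where
  fiber := tsum_mom_le he
  tame p p' := by
    rw [wt, wt, wt, wt, wt, ← ENNReal.ofReal_mul (Real.exp_pos _).le,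
      ← ENNReal.ofReal_mul (Real.exp_pos _).le, ← Real.exp_add, ← Real.exp_add,
      ← ENNReal.ofReal_add (Real.exp_pos _).le (Real.exp_pos _).le]
    refine ENNReal.ofReal_le_ofReal ?_
    have hs := hg.s_pos
    rcases hg.bracket_add p p' with h | h
    · refine le_trans (Real.exp_le_exp.2 ?_) (le_add_of_nonneg_right (Real.exp_pos _).le)
      nlinarith
    · refine le_trans (Real.exp_le_exp.2 ?_) (le_add_of_nonneg_left (Real.exp_pos _).le)
      nlinarith
  submul p p' := by
    rw [wt, wt, wt, ← ENNReal.ofReal_mul (Real.exp_pos _).le, ← Real.exp_add, ← mul_add]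
    refine ENNReal.ofReal_le_ofReal (Real.exp_le_exp.2 (mul_le_mul_of_nonneg_left ?_
      (mul_nonneg hg.s_pos.le hg.κ_nonneg)))
    have h1 := hg.f_pos p
    have h2 := hg.f_pos p'
    have h3 := hg.κ_lt
    rcases hg.bracket_add p p' with h | h <;> nlinarith
  embed := hg.embed he
  embedG x := by
    have := hg.embed (ι := Fin n → ℤ) (e := fun p => (p, 1)) (fun p p' h => (Prod.ext_iff.1 h).1) x
    simpa [mom] using this
  one_le := by exact_mod_cast hg.one_le
  one_le_zero := by
    rw [wt_zero hg.c_pos, ENNReal.one_le_ofReal, Real.one_le_exp_iff]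
    exact mul_nonneg hg.s_pos.le (hg.pos _ le_rfl).le
  le_zero := by
    rw [wt_zero hg.c_pos, wt_zero hg.c_pos]
    refine ENNReal.ofReal_le_ofReal (Real.exp_le_exp.2 ?_)
    have h1 := hg.s_pos
    have h2 := hg.pos _ le_rfl
    have h3 := hg.κ_lt
    have : 0 < s * f c := by positivity
    nlinarith

end GoodWeight

/-- Largeness of s is needed for s (1 - κ) ≥ s₀ alone, which makes the ratio between the squares of
the weak and the strong weight, of order e^{-2 s (1 - κ) f}, summable even after half of the gap is
given away. -/
theorem WeightA0.exists_goodWeight (hf : WeightA0 f c)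
    (hs₀ : ∃ s₀ : ℝ, Summable (fun J : Index n => Real.exp (-s₀ * f (bracket c J.1)))) :
    ∃ S κ : ℝ, ∀ s, S < s → ∃ K, GoodWeight n f c s κ K := by
  obtain ⟨s₀, hs₀⟩ := hs₀
  obtain ⟨κ, hκ1, hsub⟩ := hf.subadd
  have hpair : ∀ x y, c ≤ y → y ≤ x → f (x + y) ≤ f x + κ * f y := fun x y hy hyx => by
    have h := hsub 2 ![x, y] 0 (fun l => by fin_cases l <;> simp <;> linarith)
      (fun l => by fin_cases l <;> simp [hyx])
    have e : (Finset.univ.erase (0 : Fin 2)) = {1} := by decide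
    simpa [e, Fin.sum_univ_two] using h
  -- From f(c) ≤ f(2c) ≤ (1 + κ) f(c) and f(c) > 0.
  have hκ0 : 0 ≤ κ := by
    have h1 := hpair c c le_rfl le_rfl
    have h2 := hf.mono (Set.mem_Ici.2 le_rfl) (Set.mem_Ici.2 (by linarith [hf.c_pos] : c ≤ c + c))
      (by linarith [hf.c_pos] : c ≤ c + c)
    have h3 := hf.pos c le_rfl
    by_contra h
    push Not at h
    nlinarith
  refine ⟨max 0 (s₀ / (1 - κ)), κ, fun s hs => ?_⟩
  have hspos : 0 < s := (le_max_left _ _).trans_lt hs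
  have h1κ : 0 < 1 - κ := by linarith
  have hs1 : s₀ ≤ s * (1 - κ) := by
    have := (le_max_right 0 (s₀ / (1 - κ))).trans_lt hs
    exact ((div_lt_iff₀ h1κ).1 this).le
  have hfin : ∑' J : Index n, ENNReal.ofReal (Real.exp (-(s * (1 - κ)) * f (bracket c J.1))) ≠ ∞ := by
    have hsum : Summable fun J : Index n => Real.exp (-(s * (1 - κ)) * f (bracket c J.1)) := by
      refine Summable.of_nonneg_of_le (fun _ => (Real.exp_pos _).le) (fun J => ?_) hs₀
      refine Real.exp_le_exp.2 ?_
      have := hf.pos _ (le_bracket (c := c) J.1)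
      nlinarith
    rw [← ENNReal.ofReal_tsum_of_nonneg (fun _ => (Real.exp_pos _).le) hsum]
    exact ENNReal.ofReal_ne_top
  refine ⟨max 1 (∑' J : Index n, ENNReal.ofReal
    (Real.exp (-(s * (1 - κ)) * f (bracket c J.1)))).toNNReal, hf.c_pos, hspos, hf.pos, hf.mono,
    hκ0, hκ1, hpair, le_max_left _ _, ?_⟩
  set A := ∑' J : Index n, ENNReal.ofReal (Real.exp (-(s * (1 - κ)) * f (bracket c J.1)))
  have h1 : A ≤ ((max 1 A.toNNReal : ℝ≥0) : ℝ≥0∞) := by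
    rw [← ENNReal.coe_toNNReal hfin]
    exact_mod_cast le_max_right _ _
  have h2 : (1 : ℝ≥0∞) ≤ ((max 1 A.toNNReal : ℝ≥0) : ℝ≥0∞) := by
    exact_mod_cast le_max_left _ _
  refine h1.trans ?_
  rw [sq]
  exact le_mul_of_one_le_left' h2

end Weight

/-! ### Lower bounds on the divisors -/

/-- The division into blocks, in terms of a representative of every block. -/
structure Blocks {n : ℕ} (ω : (Fin n → ℤ) → ℝ) (rep : (Fin n → ℤ) → Fin n → ℤ) (C C₂ δ : ℝ) :
    Prop where
  C_nonneg : 0 ≤ C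
  C₂_pos : 0 < C₂
  δ_pos : 0 < δ
  len_le : ∀ j, len j ≤ len (rep j) + C
  len_rep_le : ∀ j, len (rep j) ≤ len j + C
  gap : ∀ j k, rep j ≠ rep k → C₂ * (len j ^ δ + len k ^ δ) ≤ |ω j - ω k|

section Divisor

variable {n : ℕ} {ω : (Fin n → ℤ) → ℝ} {rep : (Fin n → ℤ) → Fin n → ℤ} {C C₂ δ β p : ℝ}

/-- Blocks are read off from the indices with sign 1, and a representative is a chosen preimage
under the block map. The exceptional block has bounded lengths, so it merely enlarges C. -/
theorem FreqA3.exists_blocks (h : FreqA3 ω) : ∃ rep C C₂ δ, Blocks ω rep C C₂ δ := by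
  obtain ⟨block, C₀, C₁, C₂, δ, hC₂, hδ, h0, h1, h2⟩ := h
  set blk : (Fin n → ℤ) → ℕ := fun j => block (j, 1) with hblk
  set rep : (Fin n → ℤ) → Fin n → ℤ := fun j => Function.invFun blk (blk j) with hrep
  have hr : ∀ j, blk (rep j) = blk j := fun j => Function.invFun_eq ⟨j, rfl⟩
  have hlen : ∀ j k, blk j = blk k → len j ≤ len k + max |C₀| |C₁| := by
    intro j k hjk
    by_cases hz : blk j = 0
    · have h3 : len j ≤ C₀ := h0 (j, 1) hz
      linarith [le_abs_self C₀, le_max_left |C₀| |C₁|, len_nonneg k]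
    · have h3 : len j - len k ≤ C₁ := h1 (j, 1) (k, 1) hjk hz
      linarith [le_abs_self C₁, le_max_right |C₀| |C₁|]
  refine ⟨rep, max |C₀| |C₁|, C₂, δ, le_max_of_le_left (abs_nonneg _), hC₂, hδ,
    fun j => hlen _ _ (hr j).symm, fun j => hlen _ _ (hr j), fun j k hjk => ?_⟩
  refine h2 (j, 1) (k, 1) fun hb => hjk ?_
  have : blk j = blk k := hb
  simp only [hrep, this]

/-- The gap between different blocks is positive unless both indices have length zero, in which case
they coincide. -/
theorem Blocks.rep_eq (hb : Blocks ω rep C C₂ δ) {j k : Fin n → ℤ} (h : ω j = ω k) :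
    rep j = rep k := by
  by_contra hne
  have h1 := hb.gap j k hne
  rw [h, sub_self, abs_zero] at h1
  have hj : 0 ≤ len j ^ δ := Real.rpow_nonneg (len_nonneg j) δ
  have hk : 0 ≤ len k ^ δ := Real.rpow_nonneg (len_nonneg k) δ
  have hzero : ∀ i : Fin n → ℤ, len i ^ δ ≤ 0 → i = 0 := fun i hi => by
    refine eq_zero_of_len_eq_zero ?_
    by_contra hi0
    exact absurd hi (not_le.2 (Real.rpow_pos_of_pos
      (lt_of_le_of_ne (len_nonneg i) (Ne.symm hi0)) δ))
  have hC := hb.C₂_pos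
  refine hne ?_
  rw [hzero j (by nlinarith), hzero k (by nlinarith)]

/-- Only finitely many lattice points escape the asymptotic comparison; the constants absorb them.
-/
theorem FreqA1.exists_bounds (h : FreqA1 ω β) (hβ : 0 < β) :
    ∃ c₀ C₀ m : ℝ, 0 < c₀ ∧ 0 < C₀ ∧ 0 ≤ m ∧ (∀ j, |ω j| ≤ C₀ * (1 + len j) ^ β) ∧
      ∀ j, c₀ * len j ^ β - m ≤ ω j := by
  obtain ⟨C₀, hC₀, R, hR⟩ := h
  have hfin := finite_len_le (n := n) (max R 1)
  obtain ⟨b, hb⟩ := (hfin.image fun j => |ω j|).bddAbove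
  have hb' : ∀ j, len j ≤ max R 1 → |ω j| ≤ |b| := fun j hj =>
    (hb ⟨j, hj, rfl⟩).trans (le_abs_self b)
  have hlarge : ∀ j, max R 1 < len j → 1 / C₀ * len j ^ β ≤ ω j ∧ ω j ≤ C₀ * len j ^ β := by
    intro j hj
    have hpos : 0 < len j ^ β := Real.rpow_pos_of_pos
      (by linarith [le_max_right R 1]) β
    obtain ⟨h1, h2⟩ := hR j ((le_max_left R 1).trans hj.le)
    exact ⟨(le_div_iff₀ hpos).1 h1, (div_le_iff₀ hpos).1 h2⟩
  have hone : ∀ j : Fin n → ℤ, 1 ≤ (1 + len j) ^ β := fun j =>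
    Real.one_le_rpow (by linarith [len_nonneg j]) hβ.le
  refine ⟨1 / C₀, C₀ + |b|, |b| + 1 / C₀ * (max R 1) ^ β, by positivity, by positivity, ?_, ?_, ?_⟩
  · have : 0 ≤ (max R 1) ^ β := Real.rpow_nonneg (le_max_of_le_right zero_le_one) β
    positivity
  · intro j
    rcases le_or_gt (len j) (max R 1) with hj | hj
    · have h1 := hb' j hj
      have h2 := hone j
      nlinarith [abs_nonneg b]
    · obtain ⟨h1, h2⟩ := hlarge j hj
      have h3 : 0 ≤ len j ^ β := Real.rpow_nonneg (len_nonneg j) β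
      have h4 : len j ^ β ≤ (1 + len j) ^ β :=
        Real.rpow_le_rpow (len_nonneg j) (by linarith) hβ.le
      have h5 : 0 ≤ ω j := le_trans (by positivity) h1
      rw [abs_of_nonneg h5]
      nlinarith [abs_nonneg b]
  · intro j
    rcases le_or_gt (len j) (max R 1) with hj | hj
    · have h1 := (abs_le.1 (hb' j hj)).1
      have h2 : len j ^ β ≤ (max R 1) ^ β := Real.rpow_le_rpow (len_nonneg j) hj hβ.le
      have h3 : 1 / C₀ * len j ^ β ≤ 1 / C₀ * (max R 1) ^ β := by gcongr
      linarith
    · have h1 := (hlarge j hj).1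
      have h3 : 0 ≤ 1 / C₀ * (max R 1) ^ β := by
        have : 0 ≤ (max R 1) ^ β := Real.rpow_nonneg (le_max_of_le_right zero_le_one) β
        positivity
      linarith [abs_nonneg b]

theorem abs_sgn (σ : ℤˣ) : |sgn σ| = 1 := by
  rcases Int.units_eq_one_or σ with h | h <;> simp [sgn, h]

theorem sgn_neg (σ : ℤˣ) : sgn (-σ) = -sgn σ := by simp [sgn]

open Classical in
/-- The number of entries with large representative. -/
noncomputable def highNum (rep : (Fin n → ℤ) → Fin n → ℤ) (N : ℝ) {d : ℕ} (𝒥 : Fin d → Index n) :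
    ℕ := (Finset.univ.filter fun l => N < len (rep (𝒥 l).1)).card

open Classical in
/-- The contribution to `∑ σ_l W_{j_l}` of those entries that leave at least two entries with large
representative. -/
noncomputable def restSum (rep : (Fin n → ℤ) → Fin n → ℤ) (N : ℝ) (W : (Fin n → ℤ) → ℝ) {d : ℕ}
    (𝒥 : Fin d → Index n) : ℝ :=
  ∑ l, if 2 ≤ highNum rep N 𝒥 - (if N < len (rep (𝒥 l).1) then 1 else 0) then
    sgn (𝒥 l).2 * W (rep (𝒥 l).1) else 0

theorem CancelsInPairs.sum_eq_zero {d : ℕ} {𝒥 : Fin d → Index n} (h : CancelsInPairs ω 𝒥)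
    (hb : Blocks ω rep C C₂ δ) (g : (Fin n → ℤ) → ℝ) :
    ∑ l, sgn (𝒥 l).2 * g (rep (𝒥 l).1) = 0 := by
  obtain ⟨m, e, he⟩ := h
  rw [← e.sum_comp, Fintype.sum_sum_type, ← Finset.sum_add_distrib]
  refine Finset.sum_eq_zero fun i _ => ?_
  obtain ⟨h1, h2⟩ := he i
  rw [hb.rep_eq h1, h2, sgn_neg]
  ring

/-- Whether an entry leaves two large ones depends on its representative alone, so paired terms
still cancel. -/
theorem CancelsInPairs.restSum_eq_zero {d : ℕ} {𝒥 : Fin d → Index n} (h : CancelsInPairs ω 𝒥)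
    (hb : Blocks ω rep C C₂ δ) (N : ℝ) (W : (Fin n → ℤ) → ℝ) : restSum rep N W 𝒥 = 0 := by
  classical
  rw [← h.sum_eq_zero hb fun j => if 2 ≤ highNum rep N 𝒥 - (if N < len j then 1 else 0) then
    W j else 0]
  refine Finset.sum_congr rfl fun l _ => ?_
  rw [mul_ite, mul_zero]

theorem Blocks.len_le_of_low (hb : Blocks ω rep C C₂ δ) {N : ℝ} {j : Fin n → ℤ}
    (h : ¬ N < len (rep j)) : len j ≤ N + C :=
  (hb.len_le j).trans (by linarith)

theorem len_le_of_momentum {d : ℕ} {𝒥 : Fin d → Index n} (h : momentum 𝒥 = 0) (l₀ : Fin d) :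
    len (𝒥 l₀).1 ≤ ∑ l ∈ Finset.univ.erase l₀, len (𝒥 l).1 := by
  have h1 : mom (𝒥 l₀) = -∑ l ∈ Finset.univ.erase l₀, mom (𝒥 l) := by
    rw [eq_neg_iff_add_eq_zero, Finset.add_sum_erase _ (fun l => mom (𝒥 l)) (Finset.mem_univ l₀)]
    exact h
  rw [← len_mom, h1, len_neg]
  exact (len_sum_le _ _).trans (Finset.sum_le_sum fun l _ => (len_mom _).le)

/-- A multi-index with a very large entry has a large divisor, or can be kept. -/
theorem Blocks.one_le_divisor (hb : Blocks ω rep C C₂ δ) {c₀ C₀ m : ℝ} (hβ : 0 < β) (hc₀ : 0 < c₀)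
    (hC₀ : 0 < C₀) (hup : ∀ j, |ω j| ≤ C₀ * (1 + len j) ^ β)
    (hlow : ∀ j, c₀ * len j ^ β - m ≤ ω j) {N N' Y : ℝ} {r d : ℕ} (hd : d ≤ r + 2) (hN : 0 ≤ N)
    (hY : (r + 2) * (N + C + 1) ≤ Y) (hYN : Y ≤ N')
    (h1 : C₀ * Y ^ (β + 1) + 2 * m + 1 ≤ c₀ * N' ^ β) (h2 : C₀ * Y ^ (β + 1) + 1 ≤ C₂ * N' ^ δ)
    {𝒥 : Fin d → Index n} (hmom : momentum 𝒥 = 0) {l₀ : Fin d} (hl₀ : N' < len (𝒥 l₀).1)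
    (W : (Fin n → ℤ) → ℝ)
    (hW : ∑ l, sgn (𝒥 l).2 * W (rep (𝒥 l).1) ≠ restSum rep N W 𝒥) : 1 ≤ |divisor ω 𝒥| := by
  classical
  have hC := hb.C_nonneg
  have hdr : (d : ℝ) ≤ r + 2 := by exact_mod_cast hd
  have hNC : N + C + 1 ≤ Y := le_trans (by nlinarith) hY
  have hY1 : 0 < Y := by linarith
  set F := Finset.univ.filter fun l => N < len (rep (𝒥 l).1) with hF
  have hFcard : highNum rep N 𝒥 = F.card := rfl
  have hmemF : ∀ l, l ∈ F ↔ N < len (rep (𝒥 l).1) := fun l => by simp [hF]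
  have hl₀F : l₀ ∈ F := by
    by_contra h
    have := hb.len_le_of_low (mt (hmemF l₀).2 h)
    linarith
  have hlowlen : ∀ l, l ∉ F → len (𝒥 l).1 ≤ N + C := fun l hl =>
    hb.len_le_of_low (mt (hmemF l).2 hl)
  -- With three large entries the removal of any entry leaves two, and the two sums in `hW` agree.
  have hcard3 : ¬ 3 ≤ F.card := by
    intro h3
    refine hW (Finset.sum_congr rfl fun l _ => ?_)
    rw [if_pos]
    rw [hFcard]
    split_ifs <;> omega
  -- A single large entry cannot be balanced by at most r + 1 small ones if the momentum vanishes.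
  have hcard1 : F.card ≠ 1 := by
    intro hc
    obtain ⟨a, ha⟩ := Finset.card_eq_one.1 hc
    have ha0 : a = l₀ := by
      have := hl₀F
      rw [ha, Finset.mem_singleton] at this
      exact this.symm
    subst ha0
    have h3 : len (𝒥 a).1 ≤ ∑ l ∈ Finset.univ.erase a, (N + C) :=
      (len_le_of_momentum hmom a).trans (Finset.sum_le_sum fun l hl => hlowlen l (by
        rw [ha, Finset.mem_singleton]
        exact Finset.ne_of_mem_erase hl))
    rw [Finset.sum_const, nsmul_eq_mul] at h3
    have h4 : ((Finset.univ.erase a).card : ℝ) ≤ r + 2 := by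
      refine le_trans ?_ hdr
      exact_mod_cast (Finset.card_le_univ _).trans (by simp)
    have h5 : ((Finset.univ.erase a).card : ℝ) * (N + C) ≤ (r + 2) * (N + C + 1) := by
      refine mul_le_mul h4 (by linarith) (by linarith) (by positivity)
    linarith
  have hcard2 : F.card = 2 := by
    have : 0 < F.card := Finset.card_pos.2 ⟨l₀, hl₀F⟩
    omega
  obtain ⟨l₁, hl₁, hFeq⟩ : ∃ l₁, l₁ ≠ l₀ ∧ F = {l₀, l₁} := by
    have h3 : (F.erase l₀).card = 1 := by rw [Finset.card_erase_of_mem hl₀F, hcard2]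
    obtain ⟨a, ha⟩ := Finset.card_eq_one.1 h3
    refine ⟨a, ?_, ?_⟩
    · have : a ∈ F.erase l₀ := by rw [ha]; exact Finset.mem_singleton_self a
      exact Finset.ne_of_mem_erase this
    · rw [← Finset.insert_erase hl₀F, ha]
  have hsplit : ∀ g : Fin d → ℝ, ∑ l, g l = g l₀ + g l₁ +
      ∑ l ∈ (Finset.univ.erase l₀).erase l₁, g l := fun g => by
    rw [← Finset.add_sum_erase _ g (Finset.mem_univ l₀),
      ← Finset.add_sum_erase _ g (Finset.mem_erase.2 ⟨hl₁, Finset.mem_univ l₁⟩), add_assoc]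
  have hrestF : ∀ l ∈ (Finset.univ.erase l₀).erase l₁, l ∉ F := fun l hl => by
    rw [hFeq, Finset.mem_insert, Finset.mem_singleton]
    rw [Finset.mem_erase, Finset.mem_erase] at hl
    tauto
  have hrest : |∑ l ∈ (Finset.univ.erase l₀).erase l₁, sgn (𝒥 l).2 * ω (𝒥 l).1| ≤
      C₀ * Y ^ (β + 1) := by
    refine (Finset.abs_sum_le_sum_abs _ _).trans ((Finset.sum_le_sum fun l hl => ?_ :
      _ ≤ ∑ l ∈ (Finset.univ.erase l₀).erase l₁, C₀ * (N + C + 1) ^ β).trans ?_)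
    · rw [abs_mul, abs_sgn, one_mul]
      refine (hup _).trans (mul_le_mul_of_nonneg_left (Real.rpow_le_rpow
        (by linarith [len_nonneg (𝒥 l).1]) ?_ hβ.le) hC₀.le)
      linarith [hlowlen l (hrestF l hl)]
    · rw [Finset.sum_const, nsmul_eq_mul, mul_left_comm]
      refine mul_le_mul_of_nonneg_left ?_ hC₀.le
      have h4 : (((Finset.univ.erase l₀).erase l₁).card : ℝ) ≤ Y := by
        have h5 : (((Finset.univ.erase l₀).erase l₁).card : ℝ) ≤ r + 2 := by
          refine le_trans ?_ hdr
          exact_mod_cast (Finset.card_le_univ _).trans (by simp)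
        refine h5.trans (le_trans ?_ hY)
        have : (0 : ℝ) ≤ r := Nat.cast_nonneg r
        nlinarith
      rw [Real.rpow_add_one hY1.ne', mul_comm]
      exact mul_le_mul (Real.rpow_le_rpow (by linarith) hNC hβ.le) h4 (Nat.cast_nonneg _)
        (Real.rpow_nonneg hY1.le _)
  have hmain : C₀ * Y ^ (β + 1) + 1 ≤
      |sgn (𝒥 l₀).2 * ω (𝒥 l₀).1 + sgn (𝒥 l₁).2 * ω (𝒥 l₁).1| := by
    have hN'0 : 0 ≤ N' := by linarith
    have hsgn : (𝒥 l₁).2 = (𝒥 l₀).2 ∨ (𝒥 l₁).2 = -(𝒥 l₀).2 := by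
      rcases Int.units_eq_one_or (𝒥 l₀).2 with h | h <;>
        rcases Int.units_eq_one_or (𝒥 l₁).2 with h' | h' <;> simp [h, h']
    -- With equal signs the two large frequencies add up, and their growth gives the bound.
    rcases hsgn with hs | hs
    · rw [hs, ← mul_add, abs_mul, abs_sgn, one_mul]
      have h3 := hlow (𝒥 l₀).1
      have h4 := hlow (𝒥 l₁).1
      have h5 : N' ^ β ≤ len (𝒥 l₀).1 ^ β := Real.rpow_le_rpow hN'0 hl₀.le hβ.le
      have h6 : 0 ≤ len (𝒥 l₁).1 ^ β := Real.rpow_nonneg (len_nonneg _) _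
      refine le_trans ?_ (le_abs_self _)
      nlinarith
    -- With opposite signs a common block is impossible: the two large terms would cancel in the
    -- full sum and are absent from `restSum`, while every other entry leaves both large ones. The
    -- gap between different blocks therefore applies.
    · have hne : rep (𝒥 l₀).1 ≠ rep (𝒥 l₁).1 := by
        intro heq
        refine hW ?_
        rw [restSum, hsplit, hsplit, hFcard, hcard2, if_neg, if_neg, hs, heq, sgn_neg]
        · congr 1
          · ring
          · refine Finset.sum_congr rfl fun l hl => ?_
            rw [if_pos]
            rw [if_neg (mt (hmemF l).2 (hrestF l hl))]
        · rw [if_pos ((hmemF l₁).1 (by simp [hFeq]))]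
          omega
        · rw [if_pos ((hmemF l₀).1 hl₀F)]
          omega
      have h3 : sgn (𝒥 l₀).2 * ω (𝒥 l₀).1 + sgn (𝒥 l₁).2 * ω (𝒥 l₁).1 =
          sgn (𝒥 l₀).2 * (ω (𝒥 l₀).1 - ω (𝒥 l₁).1) := by
        rw [hs, sgn_neg]
        ring
      rw [h3, abs_mul, abs_sgn, one_mul]
      refine h2.trans (le_trans ?_ (hb.gap _ _ hne))
      have h5 : N' ^ δ ≤ len (𝒥 l₀).1 ^ δ := Real.rpow_le_rpow hN'0 hl₀.le hb.δ_pos.le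
      have h6 : 0 ≤ len (𝒥 l₁).1 ^ δ := Real.rpow_nonneg (len_nonneg _) _
      have := hb.C₂_pos
      nlinarith
  rw [divisor, hsplit]
  have h7 := abs_sub_abs_le_abs_sub (sgn (𝒥 l₀).2 * ω (𝒥 l₀).1 + sgn (𝒥 l₁).2 * ω (𝒥 l₁).1)
    (-∑ l ∈ (Finset.univ.erase l₀).erase l₁, sgn (𝒥 l).2 * ω (𝒥 l).1)
  rw [abs_neg, sub_neg_eq_add] at h7
  linarith

set_option maxHeartbeats 800000 in
/-- The lower bound on all divisors that occur in the normal form. -/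
theorem Blocks.exists_divisor_bound (hb : Blocks ω rep C C₂ δ) (hβ : 0 < β) (hp : 0 < p)
    (hA1 : FreqA1 ω β) (hA2 : FreqA2 ω p) : ∃ γ τ A : ℝ, 0 < γ ∧ γ ≤ 1 ∧ 0 ≤ τ ∧ 1 ≤ A ∧
      ∀ (N : ℝ) (r d : ℕ) (𝒥 : Fin d → Index n) (W : (Fin n → ℤ) → ℝ), 0 ≤ N → 1 ≤ d →
        d ≤ r + 2 → momentum 𝒥 = 0 →
        ∑ l, sgn (𝒥 l).2 * W (rep (𝒥 l).1) ≠ restSum rep N W 𝒥 →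
        γ * Real.exp (-(τ * (r + 2) ^ p * Real.log ((r + 2) * (N + A)))) ≤ |divisor ω 𝒥| := by
  obtain ⟨c₀, C₀, m, hc₀, hC₀, hm, hup, hlow⟩ := hA1.exists_bounds hβ
  obtain ⟨⟨γ, τ, hγ, N₀, hN₀⟩, hpair⟩ := hA2
  have hC := hb.C_nonneg
  have hC₂ := hb.C₂_pos
  have hδ := hb.δ_pos
  -- The exponent makes Y^(M β) and Y^(M δ) dominate Y^(β + 2), that is, the small entries with a
  -- factor Y to spare for the constants.
  set M : ℝ := (β + 2) / β + (β + 2) / δ + 1 with hM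
  have hM1 : 1 ≤ M := by
    rw [hM]
    have : 0 ≤ (β + 2) / β + (β + 2) / δ := by positivity
    linarith
  have hMβ : β + 2 ≤ M * β := by
    have h1 : 0 ≤ ((β + 2) / δ + 1) * β := by positivity
    have h2 : M * β = (β + 2) / β * β + ((β + 2) / δ + 1) * β := by rw [hM]; ring
    rw [h2, div_mul_cancel₀ _ hβ.ne']
    linarith
  have hMδ : β + 2 ≤ M * δ := by
    have h1 : 0 ≤ ((β + 2) / β + 1) * δ := by positivity
    have h2 : M * δ = (β + 2) / δ * δ + ((β + 2) / β + 1) * δ := by rw [hM]; ring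
    rw [h2, div_mul_cancel₀ _ hδ.ne']
    linarith
  set A : ℝ := C + 2 + N₀ + (C₀ + 2 * m + 1) / c₀ + (C₀ + 1) / C₂ with hA
  have hq1 : 0 ≤ (C₀ + 2 * m + 1) / c₀ := by positivity
  have hq2 : 0 ≤ (C₀ + 1) / C₂ := by positivity
  have hN₀' : (0 : ℝ) ≤ N₀ := Nat.cast_nonneg _
  refine ⟨min γ 1, (M + 1) * max τ 0, A, lt_min hγ one_pos, min_le_right _ _, by positivity,
    by linarith, ?_⟩
  intro N r d 𝒥 W hN hd1 hd hmom hW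
  set Y : ℝ := (r + 2) * (N + A) with hY
  have hr : (0 : ℝ) ≤ r := Nat.cast_nonneg r
  have hYA : A ≤ Y := by rw [hY]; nlinarith
  have hY2 : 2 ≤ Y := by linarith
  have hY0 : 0 < Y := by linarith
  -- The threshold between the two regimes: A.2 below it, `Blocks.one_le_divisor` above it. It is
  -- only a power of Y, so its logarithm changes the exponent by a constant factor.
  set N' : ℕ := ⌈Y ^ M⌉₊ with hN'
  have hN'1 : Y ^ M ≤ N' := Nat.le_ceil _
  have hYM : Y ≤ Y ^ M := by
    conv_lhs => rw [← Real.rpow_one Y]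
    exact Real.rpow_le_rpow_of_exponent_le (by linarith) hM1
  have hN'2 : (N' : ℝ) ≤ Y ^ (M + 1) := by
    have h1 : (N' : ℝ) < Y ^ M + 1 := Nat.ceil_lt_add_one (by positivity)
    rw [Real.rpow_add_one hY0.ne']
    nlinarith
  have hexp1 : min γ 1 * Real.exp (-((M + 1) * max τ 0 * (r + 2) ^ p * Real.log Y)) ≤ 1 := by
    refine mul_le_one₀ (min_le_right _ _) (Real.exp_pos _).le (Real.exp_le_one_iff.2 ?_)
    have : 0 ≤ Real.log Y := Real.log_nonneg (by linarith)
    have h3 : (0 : ℝ) ≤ (r + 2) ^ p := Real.rpow_nonneg (by positivity) _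
    have : 0 ≤ (M + 1) * max τ 0 * (r + 2) ^ p * Real.log Y := by positivity
    linarith
  by_cases hall : ∀ l, len (𝒥 l).1 ≤ N'
  -- A vanishing divisor forces cancellation in pairs, and then both sums in `hW` are zero.
  · have hne : divisor ω 𝒥 ≠ 0 := fun h0 => by
      have hc := hpair d 𝒥 h0
      exact hW ((hc.sum_eq_zero hb W).trans (hc.restSum_eq_zero hb N W).symm)
    have hNN : N₀ ≤ N' := by
      have : (N₀ : ℝ) ≤ N' := by linarith
      exact_mod_cast this
    refine le_trans ?_ (hN₀ N' hNN d 𝒥 hd1 hall hne)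
    have hN'pos : (1 : ℝ) ≤ N' := by linarith
    rw [div_eq_mul_inv, ← Real.rpow_neg (by linarith)]
    refine mul_le_mul (min_le_left _ _) ?_ (Real.exp_pos _).le hγ.le
    have hd0 : (0 : ℝ) ≤ (d : ℝ) ^ p := Real.rpow_nonneg (Nat.cast_nonneg _) _
    have hdp : (d : ℝ) ^ p ≤ (r + 2) ^ p :=
      Real.rpow_le_rpow (Nat.cast_nonneg _) (by exact_mod_cast hd) hp.le
    have h4 : τ * (d : ℝ) ^ p ≤ max τ 0 * (r + 2) ^ p :=
      (mul_le_mul_of_nonneg_right (le_max_left τ 0) hd0).trans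
        (mul_le_mul_of_nonneg_left hdp (le_max_right τ 0))
    have h5 : (N' : ℝ) ^ (τ * (d : ℝ) ^ p) ≤ Real.exp ((M + 1) * max τ 0 * (r + 2) ^ p * Real.log Y) := by
      calc (N' : ℝ) ^ (τ * (d : ℝ) ^ p) ≤ (N' : ℝ) ^ (max τ 0 * (r + 2) ^ p) :=
            Real.rpow_le_rpow_of_exponent_le hN'pos h4
        _ ≤ (Y ^ (M + 1)) ^ (max τ 0 * (r + 2) ^ p) :=
            Real.rpow_le_rpow (by linarith) hN'2
              (mul_nonneg (le_max_right _ _) (hd0.trans hdp))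
        _ = _ := by
            rw [← Real.rpow_mul hY0.le, Real.rpow_def_of_pos hY0]
            congr 1
            ring
    rw [Real.rpow_neg (by linarith), Real.exp_neg]
    exact inv_anti₀ (Real.rpow_pos_of_pos (by linarith) _) h5
  · push Not at hall
    obtain ⟨l₀, hl₀⟩ := hall
    refine hexp1.trans (hb.one_le_divisor hβ hc₀ hC₀ hup hlow hd hN (Y := Y) (N' := N') ?_
      (hYM.trans hN'1) ?_ ?_ hmom hl₀ W hW)
    · rw [hY]
      refine mul_le_mul_of_nonneg_left ?_ (by positivity)
      linarith
    · have h1 : c₀ * Y ^ (β + 2) ≤ c₀ * (N' : ℝ) ^ β := by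
        refine mul_le_mul_of_nonneg_left ?_ hc₀.le
        calc Y ^ (β + 2) ≤ Y ^ (M * β) := Real.rpow_le_rpow_of_exponent_le (by linarith) hMβ
          _ = (Y ^ M) ^ β := Real.rpow_mul hY0.le _ _
          _ ≤ _ := Real.rpow_le_rpow (by positivity) hN'1 hβ.le
      have h2 : C₀ + 2 * m + 1 ≤ c₀ * Y := by
        have : (C₀ + 2 * m + 1) / c₀ ≤ Y := by linarith
        rw [div_le_iff₀ hc₀] at this
        linarith
      have h3 : Y ^ (β + 2) = Y ^ (β + 1) * Y := by
        rw [← Real.rpow_add_one hY0.ne']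
        congr 1
        ring
      have h4 : 1 ≤ Y ^ (β + 1) := Real.one_le_rpow (by linarith) (by linarith)
      rw [h3] at h1
      refine le_trans ?_ h1
      have h5 := mul_le_mul_of_nonneg_right h2 (zero_le_one.trans h4)
      have h6 : (2 * m + 1) * 1 ≤ (2 * m + 1) * Y ^ (β + 1) :=
        mul_le_mul_of_nonneg_left h4 (by linarith)
      linarith
    · have h1 : C₂ * Y ^ (β + 2) ≤ C₂ * (N' : ℝ) ^ δ := by
        refine mul_le_mul_of_nonneg_left ?_ hC₂.le
        calc Y ^ (β + 2) ≤ Y ^ (M * δ) := Real.rpow_le_rpow_of_exponent_le (by linarith) hMδ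
          _ = (Y ^ M) ^ δ := Real.rpow_mul hY0.le _ _
          _ ≤ _ := Real.rpow_le_rpow (by positivity) hN'1 hδ.le
      have h2 : C₀ + 1 ≤ C₂ * Y := by
        have : (C₀ + 1) / C₂ ≤ Y := by linarith
        rw [div_le_iff₀ hC₂] at this
        linarith
      have h3 : Y ^ (β + 2) = Y ^ (β + 1) * Y := by
        rw [← Real.rpow_add_one hY0.ne']
        congr 1
        ring
      have h4 : 1 ≤ Y ^ (β + 1) := Real.one_le_rpow (by linarith) (by linarith)
      rw [h3] at h1
      refine le_trans ?_ h1
      have h5 := mul_le_mul_of_nonneg_right h2 (zero_le_one.trans h4)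
      linarith

end Divisor

/-! ### Polynomials written as sums over multi-indices -/

section Multi

variable {ι G : Type*} [Fintype ι] [DecidableEq ι] [AddCommGroup G] {p : Phase ι G} {H : ι → Prop}

/-- The exponent of the monomial `u_{J_1} ⋯ u_{J_d}`. -/
noncomputable def expo {d : ℕ} (𝒥 : Fin d → ι) : ι →₀ ℕ := ∑ l, Finsupp.single (𝒥 l) 1

theorem sum_expo {R : Type*} [CommSemiring R] {d : ℕ} (𝒥 : Fin d → ι) (g : ι → R) :
    ∑ J, g J * expo 𝒥 J = ∑ l, g (𝒥 l) := by
  simp only [expo, Finsupp.finsetSum_apply, Nat.cast_sum, Finset.mul_sum]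
  rw [Finset.sum_comm]
  refine Finset.sum_congr rfl fun l _ => ?_
  rw [Finset.sum_eq_single (𝒥 l)]
  · simp
  · intro J _ hJ
    simp [hJ.symm]
  · simp

theorem prod_X_eq_monomial {R : Type*} [CommSemiring R] {d : ℕ} (𝒥 : Fin d → ι) :
    ∏ l, (X (𝒥 l) : MvPolynomial ι R) = monomial (expo 𝒥) 1 := by
  rw [expo]
  induction (Finset.univ : Finset (Fin d)) using Finset.induction_on with
  | empty => simp
  | insert l t hl ih => rw [Finset.prod_insert hl, Finset.sum_insert hl, ih, X, monomial_mul, one_mul]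

open Classical in
theorem Phase.theta_eq_sum (d : ℕ) (g : G) : p.theta H d 0 g =
    ∑ 𝒥 : Fin d → ι, if ∑ l, p.q (𝒥 l) = g then ∏ l, X (𝒥 l) else 0 := by
  induction d generalizing g with
  | zero => simp [Phase.theta, eq_comm]
  | succ d ih =>
    rw [p.theta_succ_zero, ← (Fin.consEquiv fun _ => ι).sum_comp, Fintype.sum_prod_type]
    refine Finset.sum_congr rfl fun J _ => ?_
    rw [ih, Finset.mul_sum]
    refine Finset.sum_congr rfl fun 𝒥 _ => ?_
    simp only [Fin.consEquiv_apply, Fin.sum_univ_succ, Fin.prod_univ_succ, Fin.cons_zero,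
      Fin.cons_succ, mul_ite, mul_zero, eq_sub_iff_add_eq']

/-- A monomial below the majorant arises from a multi-index of that degree and momentum, to which
the divisor bound can be applied. -/
theorem Phase.Bound.exists_expo {d : ℕ} {g : G} {a : ℝ≥0} {A : MvPolynomial ι ℂ}
    (h : p.Bound H d g a A) {m : ι →₀ ℕ} (hm : coeff m A ≠ 0) :
    ∃ 𝒥 : Fin d → ι, m = expo 𝒥 ∧ ∑ l, p.q (𝒥 l) = g := by
  classical
  have h1 := h m
  have h2 : coeff m (p.theta H d 0 g) ≠ 0 := by
    intro h0
    rw [coeff_smul, h0, smul_zero, nonpos_iff_eq_zero, nnnorm_eq_zero] at h1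
    exact hm h1
  rw [p.theta_eq_sum, coeff_sum] at h2
  obtain ⟨𝒥, -, h3⟩ := Finset.exists_ne_zero_of_sum_ne_zero h2
  split_ifs at h3 with hg
  · rw [prod_X_eq_monomial, coeff_monomial] at h3
    split_ifs at h3 with he
    · exact ⟨𝒥, he.symm, hg⟩
    · simp at h3
  · simp at h3

theorem Phase.Bound.sum_multi {d : ℕ} {g : G} {a : ℝ≥0} {P : (Fin d → ι) → ℂ}
    (hP : ∀ 𝒥, ‖P 𝒥‖₊ ≤ a) (hP0 : ∀ 𝒥, ∑ l, p.q (𝒥 l) ≠ g → P 𝒥 = 0) :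
    p.Bound H d g a (∑ 𝒥 : Fin d → ι, C (P 𝒥) * ∏ l, MvPolynomial.X (𝒥 l)) := by
  classical
  unfold Phase.Bound
  rw [p.theta_eq_sum, Finset.smul_sum]
  refine Maj.sum fun 𝒥 _ m => ?_
  split_ifs with hg
  · rw [prod_X_eq_monomial, prod_X_eq_monomial, coeff_C_mul, coeff_smul, coeff_monomial,
      coeff_monomial]
    split_ifs
    · simpa using hP 𝒥
    · simp
  · simp [hP0 𝒥 hg]

theorem highCount_sub_single (J : ι) (m : ι →₀ ℕ) (hJ : m J ≠ 0) :
    highCount H (m - Finsupp.single J 1) =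
      highCount H m - (open Classical in if H J then 1 else 0) := by
  classical
  have hm : m - Finsupp.single J 1 + Finsupp.single J 1 = m := tsub_add_cancel_of_le
    (Finsupp.single_le_iff.2 (Nat.one_le_iff_ne_zero.2 hJ))
  have : highCount H m = highCount H (m - Finsupp.single J 1) + if H J then 1 else 0 := by
    conv_lhs => rw [← hm]
    unfold highCount
    have hs : (if H J then 1 else 0) = ∑ K, if K = J then (if H K then 1 else 0) else 0 := by
      simp
    rw [hs, ← Finset.sum_add_distrib]
    refine Finset.sum_congr rfl fun K _ => ?_
    by_cases hK : H K
    · by_cases h : K = J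
      · subst h
        simp [hK]
      · simp [h]
    · by_cases h : K = J
      · simp [hK]
      · simp [hK]
  omega

theorem highCount_expo {d : ℕ} (𝒥 : Fin d → ι) : highCount H (expo 𝒥) =
    (open Classical in (Finset.univ.filter fun l => H (𝒥 l)).card) := by
  classical
  have := sum_expo 𝒥 (fun J => if H J then (1 : ℕ) else 0)
  rw [Finset.card_filter, ← this, highCount]
  refine Finset.sum_congr rfl fun J _ => ?_
  split_ifs <;> simp

end Multi

/-! ### The truncated system -/

section Modes

variable {n : ℕ}

/-- The modes in a box. -/
noncomputable def boxModes (n k : ℕ) : Finset (Index n) :=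
  (Fintype.piFinset fun _ => Finset.Icc (-(k : ℤ)) k) ×ˢ Finset.univ

theorem mem_boxModes {k : ℕ} {J : Index n} : J ∈ boxModes n k ↔ ∀ l, |J.1 l| ≤ k := by
  rw [boxModes, Finset.mem_product, Fintype.mem_piFinset]
  simp only [Finset.mem_Icc, abs_le, Finset.mem_univ, and_true]

theorem boxModes_mono {k k' : ℕ} (h : k ≤ k') : boxModes n k ⊆ boxModes n k' := fun J hJ => by
  rw [mem_boxModes] at hJ ⊢
  exact fun l => (hJ l).trans (by exact_mod_cast h)

theorem exists_mem_boxModes (J : Index n) : ∃ k, J ∈ boxModes n k := by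
  refine ⟨∑ l, (J.1 l).natAbs, mem_boxModes.2 fun l => ?_⟩
  rw [Int.abs_eq_natAbs]
  exact_mod_cast Finset.single_le_sum (f := fun l => (J.1 l).natAbs) (fun _ _ => Nat.zero_le _)
    (Finset.mem_univ l)

theorem bar_mem_boxModes {k : ℕ} {J : Index n} (h : J ∈ boxModes n k) : bar J ∈ boxModes n k :=
  mem_boxModes.2 fun l => mem_boxModes.1 h l

/-- The index set of the truncated system. -/
abbrev Mode (n k : ℕ) : Type := {J : Index n // J ∈ boxModes n k}

/-- The truncated phase space. -/
noncomputable def modePhase (n k : ℕ) : Phase (Mode n k) (Fin n → ℤ) where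
  bar J := ⟨bar J.1, bar_mem_boxModes J.2⟩
  bar_bar J := Subtype.ext (bar_bar _)
  c J := -(sgn J.1.2 : ℂ) * Complex.I
  c_bar J := by simp [bar, sgn_neg]
  norm_c J := by
    rw [norm_mul, Complex.norm_I, mul_one, norm_neg, Complex.norm_real, Real.norm_eq_abs, abs_sgn]
  q J := mom J.1
  q_bar J := mom_bar _

theorem modePhase_fiber (n k : ℕ) : (modePhase n k).Fiber := by
  classical
  intro y F hF
  have h := tsum_mom_le (e := ((↑) : Mode n k → Index n)) Subtype.val_injective
    (fun g => if g ∈ F then (y g : ℝ≥0∞) else 0)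
  rw [tsum_fintype (L := .unconditional (Mode n k)), tsum_eq_sum (s := F)
    (fun g hg => by simp [hg])] at h
  have e1 : ∑ J : Mode n k, (if mom J.1 ∈ F then (y (mom J.1) : ℝ≥0∞) else 0) =
      ((∑ J, y ((modePhase n k).q J) : ℝ≥0) : ℝ≥0∞) := by
    rw [ENNReal.ofNNReal_finsetSum]
    exact Finset.sum_congr rfl fun J _ => if_pos (hF J)
  have e2 : ∑ g ∈ F, (if g ∈ F then (y g : ℝ≥0∞) else 0) = ((∑ g ∈ F, y g : ℝ≥0) : ℝ≥0∞) := by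
    rw [ENNReal.ofNNReal_finsetSum]
    exact Finset.sum_congr rfl fun J hJ => if_pos hJ
  rw [e1, e2] at h
  exact_mod_cast h

/-- The homogeneous parts of the truncated Hamiltonian, of degrees `2, 3, …`. -/
noncomputable def modeHam (ω : (Fin n → ℤ) → ℝ) (P : FormalSeries n) (k : ℕ) :
    ℕ → MvPolynomial (Mode n k) ℂ
  | 0 => (modePhase n k).quad fun J => (ω J.1.1 : ℂ) / 2
  | a + 1 => ∑ 𝒥 : Fin (a + 3) → Mode n k, C (P (a + 3) fun l => (𝒥 l).1) * ∏ l, X (𝒥 l)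

/-- The modes whose block lies outside of the ball of radius `N`. -/
def modeHigh (rep : (Fin n → ℤ) → Fin n → ℤ) (N : ℝ) (k : ℕ) (J : Mode n k) : Prop :=
  N < len (rep J.1.1)

/-- The weights of the modified energy, constant on blocks. -/
noncomputable def modeWeight (f : ℝ → ℝ) (c s : ℝ) (rep : (Fin n → ℤ) → Fin n → ℤ) (k : ℕ)
    (J : Mode n k) : ℝ≥0 :=
  (Real.exp (2 * s * f (bracket c (rep J.1.1)))).toNNReal

theorem coe_modeWeight (f : ℝ → ℝ) (c s : ℝ) (rep : (Fin n → ℤ) → Fin n → ℤ) (k : ℕ)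
    (J : Mode n k) : (modeWeight f c s rep k J : ℝ) =
      Real.exp (2 * s * f (bracket c (rep J.1.1))) :=
  Real.coe_toNNReal _ (Real.exp_pos _).le

theorem modeHam_bound {ω : (Fin n → ℤ) → ℝ} {P : FormalSeries n} {a R : ℝ≥0} (hP : MemP3 P)
    (hb : ∀ d 𝒥, ‖P d 𝒥‖₊ ≤ a * R ^ d) {k : ℕ} {H : Mode n k → Prop} {R' : ℝ≥0}
    (hR' : ∀ m, 1 ≤ m → a * R ^ (m + 2) ≤ R' ^ m / 2) {m : ℕ} (hm : 1 ≤ m) :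
    (modePhase n k).Bound H (m + 2) 0 (R' ^ m / 2) (modeHam ω P k m) := by
  obtain ⟨m, rfl⟩ : ∃ j, m = j + 1 := ⟨m - 1, by omega⟩
  exact Phase.Bound.sum_multi (fun 𝒥 => (hb _ _).trans (hR' _ hm))
    fun 𝒥 h𝒥 => hP.momentum_conservation _ _ h𝒥

/-- A monomial is eliminated if its bracket with the weighted norm is not carried by terms that keep
two high factors; for those monomials `hdiv` provides a lower bound. The resulting constants do not
depend on k. -/
theorem exists_normalForm {ω : (Fin n → ℤ) → ℝ} {P : FormalSeries n} {a R : ℝ≥0} (hP : MemP3 P)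
    (hb : ∀ d 𝒥, ‖P d 𝒥‖₊ ≤ a * R ^ d) {R' D : ℝ≥0}
    (hR' : ∀ m, 1 ≤ m → a * R ^ (m + 2) ≤ R' ^ m / 2) (hD : 1 ≤ D)
    {rep : (Fin n → ℤ) → Fin n → ℤ} {N : ℝ} {r : ℕ} (f : ℝ → ℝ) (c s : ℝ)
    (hdiv : ∀ (d : ℕ) (𝒥 : Fin d → Index n), 3 ≤ d → d ≤ r + 2 → momentum 𝒥 = 0 →
      ∑ l, sgn (𝒥 l).2 * Real.exp (2 * s * f (bracket c (rep (𝒥 l).1))) ≠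
        restSum rep N (fun j => Real.exp (2 * s * f (bracket c j))) 𝒥 →
      1 ≤ D * |divisor ω 𝒥|) (k : ℕ) :
    ∃ χ Z, NormalForm (modePhase n k) (modeHigh rep N k) r (R' * (D * (8 * (r + 2) ^ 4)))
      (modeWeight f c s rep k) (modeHam ω P k) χ Z := by
  classical
  set p := modePhase n k with hp
  set H := modeHigh rep N k with hH
  set w := modeWeight f c s rep k with hw
  have hwbar : ∀ J, w (p.bar J) = w J := fun J => rfl
  set dv : (Mode n k →₀ ℕ) → ℂ := fun m => ∑ J, p.c J * (ω J.1.1 : ℂ) * m J with hdv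
  -- Degree and momentum are restricted to the range in which `hdiv` is available.
  set elim : (Mode n k →₀ ℕ) → Prop := fun m => ∃ (d : ℕ) (𝒥 : Fin d → Mode n k), 3 ≤ d ∧
    d ≤ r + 2 ∧ m = expo 𝒥 ∧ ∑ l, p.q (𝒥 l) = 0 ∧
    ∑ J, p.c J * ((w J : ℝ) : ℂ) * m J ≠ ∑ J,
      (if 2 ≤ highCount H (m - Finsupp.single J 1) then p.c J * ((w J : ℝ) : ℂ) * m J else 0)
    with helim
  have hdvb : ∀ m, elim m → 1 ≤ D * ‖dv m‖₊ := by
    rintro m ⟨d, 𝒥, hd3, hdr, rfl, hq, hne⟩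
    -- Since c_J = -i σ, sums over modes weighted by exponents are -i times signed sums over the
    -- entries of the multi-index.
    have hI : ∀ (g : Mode n k → ℝ), ∑ J, p.c J * (g J : ℂ) * (expo 𝒥 J : ℕ) =
        -Complex.I * ((∑ l, sgn (𝒥 l).1.2 * g (𝒥 l) : ℝ) : ℂ) := fun g => by
      rw [sum_expo 𝒥 fun J => p.c J * (g J : ℂ), Complex.ofReal_sum, Finset.mul_sum]
      refine Finset.sum_congr rfl fun l _ => ?_
      push_cast
      simp only [hp, modePhase]
      ring
    have h1 := hdiv d (fun l => (𝒥 l).1) hd3 hdr hq (by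
      intro heq
      apply hne
      have hrest : ∀ J, (if 2 ≤ highCount H (expo 𝒥 - Finsupp.single J 1) then
          p.c J * ((w J : ℝ) : ℂ) * (expo 𝒥 J : ℕ) else 0) = p.c J *
          ((if 2 ≤ highNum rep N (fun l => (𝒥 l).1) - (if N < len (rep J.1.1) then 1 else 0) then
            (w J : ℝ) else 0 : ℝ) : ℂ) * (expo 𝒥 J : ℕ) := fun J => by
        by_cases h0 : expo 𝒥 J = 0
        · simp [h0]
        · rw [highCount_sub_single J _ h0, highCount_expo]
          have e : (highNum rep N (fun l => (𝒥 l).1) - if N < len (rep J.1.1) then 1 else 0) =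
              (Finset.univ.filter fun l => H (𝒥 l)).card - if H J then 1 else 0 := by
            rfl
          rw [e]
          split_ifs <;> simp
      rw [Finset.sum_congr rfl fun J _ => hrest J, hI, hI]
      congr 2
      simp only [restSum, hw, coe_modeWeight] at heq ⊢
      rw [heq]
      exact Finset.sum_congr rfl fun l _ => by rw [mul_ite, mul_zero])
    have h2 : ‖dv (expo 𝒥)‖ = |divisor ω fun l => (𝒥 l).1| := by
      simp only [hdv]
      rw [hI fun J => ω J.1.1, norm_mul, norm_neg, Complex.norm_I, one_mul, Complex.norm_real,
        Real.norm_eq_abs, divisor]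
    rw [← h2] at h1
    exact_mod_cast h1
  have hdv0 : ∀ m, elim m → dv m ≠ 0 := fun m hm h0 => by
    have := hdvb m hm
    rw [h0, nnnorm_zero, mul_zero] at this
    exact absurd this (by norm_num)
  have hham0 : ∀ A, p.ham (modeHam ω P k 0) A = diag dv A := fun A => by
    rw [modeHam, p.ham_quad (w := fun J => (ω J.1.1 : ℂ) / 2) (fun J => rfl)]
    congr 1
    funext m
    rw [Finset.mul_sum]
    exact Finset.sum_congr rfl fun J _ => by ring
  obtain ⟨Q, hQ1, hQ2⟩ := p.exists_normalForm (modeHam ω P k) elim dv hdv0 hham0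
  have hbound := Phase.Bound.normalForm (r := r) (H := H) (modePhase_fiber n k) hD hdvb
    (fun m h1 h2 => modeHam_bound (ω := ω) hP hb hR' h1) hQ1
  set B : ℝ≥0 := R' * (D * (8 * (r + 2) ^ 4)) with hB
  have hA1 : 1 ≤ D * (8 * ((r : ℝ≥0) + 2) ^ 4) := by
    refine one_le_mul hD ?_
    calc (1 : ℝ≥0) ≤ 8 * (0 + 2) ^ 4 := by norm_num
      _ ≤ 8 * (r + 2) ^ 4 := by gcongr; exact zero_le
  have hZ : ∀ m, 1 ≤ m → m ≤ r → p.Bound H (m + 2) 0 (B ^ m) (keepPart elim (Q m)) := by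
    intro m h1 h2
    have h3 : p.Bound H (m + 2) 0 (1 * _) (keepPart elim (Q m)) :=
      (hbound m h1 h2).1.of_coeff_le fun e => by
        rw [keepPart, coeff_diag, nnnorm_mul]
        refine mul_le_mul_left ?_ _
        split_ifs <;> simp
    refine h3.mono ?_
    rw [one_mul, hB, mul_pow R']
    exact mul_le_mul_right (pow_le_pow_right₀ hA1 (Nat.sub_le _ _)) _
  refine ⟨fun m => generator elim dv m (Q m),
    fun m => if m = 0 then modeHam ω P k 0 else keepPart elim (Q m), modePhase_fiber n k, hwbar,
    fun m h1 _ => (modeHam_bound hP hb hR' h1).mono ?_, fun m h1 h2 => (hbound m h1 h2).2,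
    fun m h1 h2 => ?_, fun m hm => ?_, ?_, fun m h1 h2 => ?_⟩
  · refine (NNReal.half_le_self _).trans ?_
    rw [hB, mul_pow R']
    exact le_mul_of_one_le_right' (one_le_pow₀ hA1)
  · rw [if_neg (by omega)]
    exact hZ m h1 h2
  · rcases Nat.eq_zero_or_pos m with rfl | h1
    · simp [p.lie_zero]
    · rw [hQ2 m h1, Finset.Nat.sum_antidiagonal_eq_sum_range_succ
        (fun i j => p.lie (fun m => generator elim dv m (Q m)) i
          (if j = 0 then modeHam ω P k 0 else keepPart elim (Q j))), Finset.sum_range_succ,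
        Nat.sub_self, if_pos rfl, add_comm]
      congr 1
      refine Finset.sum_nbij' (fun b => m - b) (fun b => m - b) ?_ ?_ ?_ ?_ ?_
      · intro b hb; rw [Finset.mem_Icc] at hb; rw [Finset.mem_range]; omega
      · intro b hb; rw [Finset.mem_range] at hb; rw [Finset.mem_Icc]; omega
      · intro b hb; rw [Finset.mem_Icc] at hb; omega
      · intro b hb; rw [Finset.mem_range] at hb; omega
      · intro b hb
        rw [Finset.mem_Icc] at hb
        rw [if_neg (by omega), Nat.sub_sub_self hb.2]
  · rw [if_pos rfl]
    exact p.ham_quad_quad (w := fun J => (ω J.1.1 : ℂ) / 2) (fun J => rfl) (fun J => rfl)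
  · rw [if_neg (by omega)]
    refine p.ham_quad_of_normal (w := fun J => ((w J : ℝ) : ℂ)) (fun J => rfl) H _ fun e he => ?_
    -- Degree and momentum of a kept monomial satisfy the restrictions in `elim`, so it can escape
    -- elimination only through the last clause.
    obtain ⟨𝒥, he1, he2⟩ := (hZ m h1 h2).exists_expo he
    have hne : ¬ elim e := fun hel => by
      rw [keepPart, coeff_diag, if_pos hel, zero_mul] at he
      exact he rfl
    by_contra hcon
    exact hne ⟨m + 2, 𝒥, by omega, by omega, he1, he2, hcon⟩

end Modes

/-! ### Estimates for the vector field -/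

theorem enorm_prod_eq {κ : Type*} (t : Finset κ) (u : κ → ℂ) :
    ‖∏ l ∈ t, u l‖ₑ = ∏ l ∈ t, ‖u l‖ₑ := by
  simp only [enorm_eq_nnnorm, nnnorm_prod, ENNReal.ofNNReal_finsetProd]

theorem tsum_eq_tsum_add {g : ℕ → ℝ≥0∞} {m : ℕ} (hg : ∀ d < m, g d = 0) :
    ∑' d, g d = ∑' d, g (d + m) := by
  rw [← ENNReal.summable.sum_add_tsum_nat_add' (f := g) (k := m), Finset.sum_eq_zero, zero_add]
  exact fun d hd => hg d (Finset.mem_range.1 hd)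

/-! ### Sums over multi-indices as iterated convolutions -/

section MultiSum

variable {ι G : Type*} [AddCommGroup G] {q : ι → G}

open Classical in
theorem tsum_prod_eq_convPow (H : ι → Prop) (x : ι → ℝ≥0∞) (d : ℕ) (g : G) :
    ∑' 𝒥 : Fin d → ι, (if ∑ l, q (𝒥 l) = g then ∏ l, x (𝒥 l) else 0) = convPow q H x d 0 g := by
  induction d generalizing g with
  | zero => simp [convPow, eq_comm]
  | succ d ih =>
    rw [convPow_zero_succ, conv, ← (Fin.consEquiv fun _ => ι).tsum_eq, ENNReal.tsum_prod']
    refine tsum_congr fun J => ?_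
    rw [← ih, ← ENNReal.tsum_mul_left]
    refine tsum_congr fun 𝒥 => ?_
    simp only [Fin.consEquiv_apply, Fin.sum_univ_succ, Fin.prod_univ_succ, Fin.cons_zero,
      Fin.cons_succ, mul_ite, mul_zero, eq_sub_iff_add_eq']

-- Induction on u ∏u - v ∏v = u (∏u - ∏v) + (u - v) ∏v, which has the shape of the recursion for
-- `convDiff`.
open Classical in
theorem tsum_prod_sub_le_convDiff {u v : ι → ℂ} {y δ : ι → ℝ≥0∞} (hu : ∀ J, ‖u J‖ₑ ≤ y J)
    (hv : ∀ J, ‖v J‖ₑ ≤ y J) (huv : ∀ J, ‖u J - v J‖ₑ ≤ δ J) (d : ℕ) (g : G) :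
    ∑' 𝒥 : Fin d → ι, (if ∑ l, q (𝒥 l) = g then ‖∏ l, u (𝒥 l) - ∏ l, v (𝒥 l)‖ₑ else 0) ≤
      convDiff q y δ d g := by
  induction d generalizing g with
  | zero => simp [convDiff]
  | succ d ih =>
    rw [convDiff, conv, conv, ← (Fin.consEquiv fun _ => ι).tsum_eq, ENNReal.tsum_prod',
      ← ENNReal.tsum_add]
    refine ENNReal.tsum_le_tsum fun J => ?_
    rw [← tsum_prod_eq_convPow]
    refine le_trans ?_ (add_le_add_left (mul_le_mul_right (ih _) _) _)
    rw [← ENNReal.tsum_mul_left, ← ENNReal.tsum_mul_left, ← ENNReal.tsum_add]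
    refine ENNReal.tsum_le_tsum fun 𝒥 => ?_
    simp only [Fin.consEquiv_apply, Fin.sum_univ_succ, Fin.prod_univ_succ, Fin.cons_zero,
      Fin.cons_succ, ← eq_sub_iff_add_eq']
    split_ifs
    · have e : u J * ∏ l, u (𝒥 l) - v J * ∏ l, v (𝒥 l) =
          u J * (∏ l, u (𝒥 l) - ∏ l, v (𝒥 l)) + (u J - v J) * ∏ l, v (𝒥 l) := by ring
      rw [e]
      refine (enorm_add_le _ _).trans ?_
      rw [enorm_mul, enorm_mul]
      refine add_le_add (mul_le_mul_left (hu J) _) (mul_le_mul' (huv J) ?_)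
      rw [enorm_prod_eq]
      exact Finset.prod_le_prod' fun l _ => hv _
    · simp

end MultiSum

/-! ### Convergence and Lipschitz bounds of the gradient series -/

section Gradient

variable {n : ℕ} {f : ℝ → ℝ} {c s κ : ℝ} {K A R : ℝ≥0} {P : FormalSeries n}

-- Once the entry `bar J` is split off, zero total momentum means that the others have momentum `mom
-- J`. Each of the d + 1 positions contributes the same bound.
open Classical in
theorem tsum_position_le {d : ℕ} (J : Index n)
    (T : Fin (d + 1) × (Fin (d + 1) → Index n) → ℝ≥0∞) (a : ℝ≥0∞) (F : (Fin d → Index n) → ℝ≥0∞)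
    (hT : ∀ l 𝒥, T (l, 𝒥) ≤ if 𝒥 l = bar J ∧ momentum 𝒥 = 0 then
      a * F (fun i => 𝒥 (l.succAbove i)) else 0) :
    ∑' q, T q ≤ (d + 1) * (a * ∑' 𝒥, if ∑ i, mom (𝒥 i) = mom J then F 𝒥 else 0) := by
  rw [ENNReal.tsum_prod', tsum_fintype (L := .unconditional (Fin (d + 1)))]
  refine (Finset.sum_le_card_nsmul _ _
    (a * ∑' 𝒥, if ∑ i, mom (𝒥 i) = mom J then F 𝒥 else 0) fun l _ => ?_).trans (le_of_eq ?_)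
  · rw [← (Fin.insertNthEquiv (fun _ => Index n) l).tsum_eq, ENNReal.tsum_prod',
      tsum_eq_single (bar J)]
    · rw [← ENNReal.tsum_mul_left]
      refine ENNReal.tsum_le_tsum fun 𝒥 => (hT _ _).trans ?_
      simp only [Fin.insertNthEquiv_apply, Fin.insertNth_apply_same,
        Fin.insertNth_apply_succAbove, true_and]
      have h : momentum (Fin.insertNthEquiv (fun _ => Index n) l (bar J, 𝒥)) =
          -mom J + ∑ i, mom (𝒥 i) := by
        rw [← mom_bar]
        unfold momentum
        rw [Fin.sum_univ_succAbove _ l]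
        simp [mom]
      simp only [h, neg_add_eq_zero, eq_comm (a := mom J)]
      split_ifs <;> simp
    · intro J' hJ'
      rw [ENNReal.tsum_eq_zero]
      intro 𝒥
      refine le_antisymm ((hT _ _).trans (le_of_eq ?_)) zero_le
      rw [if_neg]
      rintro ⟨h, -⟩
      simp only [Fin.insertNthEquiv_apply, Fin.insertNth_apply_same] at h
      exact hJ' h
  · simp

theorem prod_erase_eq {M : Type*} [CommMonoid M] {d : ℕ} (l : Fin (d + 1)) (g : Fin (d + 1) → M) :
    ∏ i ∈ Finset.univ.erase l, g i = ∏ i, g (l.succAbove i) := by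
  rw [← Finset.compl_singleton, ← Fin.image_succAbove_univ, Finset.prod_image]
  exact fun i _ j _ h => Fin.succAbove_right_injective h

/-- The sum of the absolute values of the terms of degree `d` of a component of the field. -/
noncomputable def gradNorm (P : FormalSeries n) (d : ℕ) (u : Index n → ℂ) (J : Index n) : ℝ≥0∞ :=
  ∑' q : Fin d × (Fin d → Index n), ‖gradTerm P (bar J) u ⟨d, q⟩‖ₑ

/-- The same for the difference of two fields. -/
noncomputable def gradDiff (P : FormalSeries n) (d : ℕ) (u v : Index n → ℂ) (J : Index n) : ℝ≥0∞ :=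
  ∑' q : Fin d × (Fin d → Index n), ‖gradTerm P (bar J) u ⟨d, q⟩ - gradTerm P (bar J) v ⟨d, q⟩‖ₑ

theorem gradNorm_le (hP : MemP3 P) (hb : ∀ d 𝒥, ‖P d 𝒥‖₊ ≤ A * R ^ d) (d : ℕ) (u : Index n → ℂ)
    (J : Index n) : gradNorm P (d + 1) u J ≤ (d + 1) * ((A * R ^ (d + 1)) *
      convPow mom (fun _ => False) (fun J => ‖u J‖ₑ) d 0 (mom J)) := by
  classical
  rw [← tsum_prod_eq_convPow]
  refine (tsum_position_le J _ (A * R ^ (d + 1)) (fun 𝒥 => ∏ l, ‖u (𝒥 l)‖ₑ)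
    fun l 𝒥 => ?_).trans (le_of_eq (by congr!))
  simp only [gradTerm]
  by_cases hm : momentum 𝒥 = 0
  · simp only [hm, and_true]
    split_ifs
    · rw [enorm_mul, prod_erase_eq, enorm_prod_eq]
      refine mul_le_mul_left ?_ _
      rw [enorm_eq_nnnorm]
      exact_mod_cast hb _ _
    · simp
  · rw [hP.momentum_conservation _ _ hm]
    simp

theorem gradDiff_le (hP : MemP3 P) (hb : ∀ d 𝒥, ‖P d 𝒥‖₊ ≤ A * R ^ d) (d : ℕ) {u v : Index n → ℂ}
    {y δ : Index n → ℝ≥0∞} (hu : ∀ J, ‖u J‖ₑ ≤ y J)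
    (hv : ∀ J, ‖v J‖ₑ ≤ y J) (huv : ∀ J, ‖u J - v J‖ₑ ≤ δ J) (J : Index n) :
    gradDiff P (d + 1) u v J ≤ (d + 1) * ((A * R ^ (d + 1)) * convDiff mom y δ d (mom J)) := by
  classical
  refine le_trans ?_ (mul_le_mul_right (mul_le_mul_right
    (tsum_prod_sub_le_convDiff hu hv huv d (mom J)) _) _)
  refine (tsum_position_le J _ (A * R ^ (d + 1))
    (fun 𝒥 => ‖∏ l, u (𝒥 l) - ∏ l, v (𝒥 l)‖ₑ) fun l 𝒥 => ?_).trans (le_of_eq (by congr!))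
  simp only [gradTerm]
  by_cases hm : momentum 𝒥 = 0
  · simp only [hm, and_true]
    split_ifs
    · rw [← mul_sub, enorm_mul, prod_erase_eq, prod_erase_eq]
      refine mul_le_mul_left ?_ _
      rw [enorm_eq_nnnorm]
      exact_mod_cast hb _ _
    · simp
  · rw [hP.momentum_conservation _ _ hm]
    simp

theorem gradTerm_of_lt (hP : MemP3 P) {d : ℕ} (hd : d < 3) (J : Index n) (u : Index n → ℂ)
    (q : Fin d × (Fin d → Index n)) : gradTerm P J u ⟨d, q⟩ = 0 := by
  simp [gradTerm, hP.degree d hd]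

theorem gradNorm_of_lt (hP : MemP3 P) {d : ℕ} (hd : d < 3) (u : Index n → ℂ) (J : Index n) :
    gradNorm P d u J = 0 := by
  simp [gradNorm, gradTerm_of_lt hP hd]

theorem gradDiff_of_lt (hP : MemP3 P) {d : ℕ} (hd : d < 3) (u v : Index n → ℂ) (J : Index n) :
    gradDiff P d u v J = 0 := by
  simp [gradDiff, gradTerm_of_lt hP hd]

/-- The weighted norm on all indices. -/
noncomputable def wnorm (f : ℝ → ℝ) (c s : ℝ) (x : Index n → ℝ≥0∞) : ℝ≥0∞ :=
  l2 fun J => wt f c s (mom J) * x J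

theorem wnorm_mono {x y : Index n → ℝ≥0∞} (h : ∀ J, x J ≤ y J) : wnorm f c s x ≤ wnorm f c s y :=
  l2_mono fun J => mul_le_mul_right (h J) _

theorem wnorm_tsum_le {κ' : Type*} (x : κ' → Index n → ℝ≥0∞) :
    wnorm f c s (fun J => ∑' k, x k J) ≤ ∑' k, wnorm f c s (x k) := by
  unfold wnorm
  simp only [← ENNReal.tsum_mul_left]
  exact l2_tsum_le _

theorem wnorm_const_mul (a : ℝ≥0∞) (x : Index n → ℝ≥0∞) :
    wnorm f c s (fun J => a * x J) = a * wnorm f c s x := by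
  unfold wnorm
  rw [← l2_const_mul]
  congr 1
  funext J
  ring

theorem wnorm_add_le (x y : Index n → ℝ≥0∞) :
    wnorm f c s (fun J => x J + y J) ≤ wnorm f c s x + wnorm f c s y := by
  unfold wnorm
  simp only [mul_add]
  exact l2_add_le _ _

theorem succ_le_two_pow (d : ℕ) : ((d : ℝ≥0∞) + 1) ≤ 2 ^ d := by
  exact_mod_cast Nat.succ_le_of_lt (Nat.lt_two_pow_self)

theorem wnorm_gradNorm_le (hg : GoodWeight n f c s κ K) (hP : MemP3 P)
    (hb : ∀ d 𝒥, ‖P d 𝒥‖₊ ≤ A * R ^ d) (d : ℕ) {u : Index n → ℂ} {ρ : ℝ≥0∞}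
    (hu : wnorm f c s (fun J => ‖u J‖ₑ) ≤ ρ) : wnorm f c s (gradNorm P (d + 1) u) ≤
      2 * A * R * wt f c s (0 : Fin n → ℤ) * (6 * K * R * ρ) ^ d := by
  have hw := hg.tameWeight (e := (id : Index n → Index n)) Function.injective_id
  calc _ ≤ wnorm f c s (fun J => ((d + 1) * (A * R ^ (d + 1)) : ℝ≥0∞) *
        convPow mom (fun _ => False) (fun J => ‖u J‖ₑ) d 0 (mom J)) :=
        wnorm_mono fun J => (gradNorm_le hP hb d u J).trans (le_of_eq (by ring))
    _ ≤ (2 ^ d * (A * R ^ (d + 1))) * (2 * (wt f c s (0 : Fin n → ℤ) * (3 * K * ρ) ^ d)) := by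
        rw [wnorm_const_mul]
        refine mul_le_mul' (mul_le_mul_left (succ_le_two_pow d) _)
          ((l2_momentum_le hw _).trans (mul_le_mul_right ((l2_convPow_le hw _ _ d).trans ?_) _))
        exact mul_le_mul_right (pow_le_pow_left' (mul_le_mul_right hu _) d) _
    _ = _ := by
        rw [show (6 * K * R * ρ : ℝ≥0∞) = 2 * R * (3 * K * ρ) by ring, mul_pow _ (3 * K * ρ),
          mul_pow 2, pow_succ]
        ring

theorem wnorm_gradDiff_le (hg : GoodWeight n f c s κ K) (hP : MemP3 P)
    (hb : ∀ d 𝒥, ‖P d 𝒥‖₊ ≤ A * R ^ d) (d : ℕ) {u v : Index n → ℂ} {y δ : Index n → ℝ≥0∞}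
    (hu : ∀ J, ‖u J‖ₑ ≤ y J) (hv : ∀ J, ‖v J‖ₑ ≤ y J) (huv : ∀ J, ‖u J - v J‖ₑ ≤ δ J)
    {ρ : ℝ≥0∞} (hy : wnorm f c s y ≤ ρ) : wnorm f c s (gradDiff P (d + 2) u v) ≤
      12 * A * R ^ 2 * K * wt f c s (0 : Fin n → ℤ) * (12 * K * R * ρ) ^ d * wnorm f c s δ := by
  have hw := hg.tameWeight (e := (id : Index n → Index n)) Function.injective_id
  have hd : ((d : ℝ≥0∞) + 2) * (d + 1) ≤ 2 * 4 ^ d := by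
    have h1 : ((d : ℝ≥0∞) + 2) ≤ 2 * 2 ^ d := by
      calc ((d : ℝ≥0∞) + 2) ≤ 2 * (d + 1) := by
            rw [mul_add, two_mul (d : ℝ≥0∞), mul_one]
            exact add_le_add_left (le_add_of_nonneg_right zero_le) _
        _ ≤ _ := mul_le_mul_right (succ_le_two_pow d) _
    calc _ ≤ (2 * 2 ^ d) * 2 ^ d := mul_le_mul' h1 (succ_le_two_pow d)
      _ = 2 * (2 * 2) ^ d := by rw [mul_pow]; ring
      _ = _ := by norm_num
  calc _ ≤ wnorm f c s (fun J => ((d + 2) * (A * R ^ (d + 2)) : ℝ≥0∞) *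
        convDiff mom y δ (d + 1) (mom J)) :=
        wnorm_mono fun J => (gradDiff_le hP hb (d + 1) hu hv huv J).trans
          (le_of_eq (by push_cast; ring))
    _ ≤ ((d + 2) * (A * R ^ (d + 2))) * (2 * ((d + 1) * (3 * K) * wt f c s (0 : Fin n → ℤ) *
          (3 * K * ρ) ^ d * wnorm f c s δ)) := by
        rw [wnorm_const_mul]
        refine mul_le_mul_right ((l2_momentum_le hw _).trans (mul_le_mul_right
          ((l2_convDiff_le hw _ _ d).trans ?_) _)) _
        exact mul_le_mul_left (mul_le_mul_right (pow_le_pow_left' (mul_le_mul_right hy _) d) _) _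
    _ = (((d : ℝ≥0∞) + 2) * (d + 1)) * (6 * A * R ^ (d + 2) * K * wt f c s (0 : Fin n → ℤ) *
          (3 * K * ρ) ^ d * wnorm f c s δ) := by ring
    _ ≤ (2 * 4 ^ d) * (6 * A * R ^ (d + 2) * K * wt f c s (0 : Fin n → ℤ) *
          (3 * K * ρ) ^ d * wnorm f c s δ) := mul_le_mul_left hd _
    _ = _ := by
        rw [show (12 * K * R * ρ : ℝ≥0∞) = 4 * R * (3 * K * ρ) by ring, mul_pow _ (3 * K * ρ),
          mul_pow 4, pow_add]
        ring

theorem tsum_geometric_le_two {x : ℝ≥0∞} (hx : x ≤ 1 / 2) : ∑' k, x ^ k ≤ 2 := by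
  rw [ENNReal.tsum_eq_iSup_nat]
  exact iSup_le fun k => sum_geometric_le_two hx k

/-- The shift serves two purposes: m = 2 gives the whole field, which starts at degree 3, and m = r
+ 2 gives the part that is missing in the truncated Hamiltonian. -/
theorem wnorm_tsum_gradNorm_le (hg : GoodWeight n f c s κ K) (hP : MemP3 P)
    (hb : ∀ d 𝒥, ‖P d 𝒥‖₊ ≤ A * R ^ d) (m : ℕ) {u : Index n → ℂ} {ρ : ℝ≥0∞}
    (hu : wnorm f c s (fun J => ‖u J‖ₑ) ≤ ρ) (hρ : 12 * K * R * ρ ≤ 1 / 2) :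
    wnorm f c s (fun J => ∑' d, gradNorm P (d + m + 1) u J) ≤
      4 * A * R * wt f c s (0 : Fin n → ℤ) * (6 * K * R * ρ) ^ m := by
  have h6 : 6 * K * R * ρ ≤ 1 / 2 := by
    refine le_trans ?_ hρ
    gcongr
    norm_num
  calc _ ≤ ∑' d, 2 * A * R * wt f c s (0 : Fin n → ℤ) * (6 * K * R * ρ) ^ m *
        (6 * K * R * ρ) ^ d :=
        (wnorm_tsum_le _).trans (ENNReal.tsum_le_tsum fun d =>
          (wnorm_gradNorm_le hg hP hb (d + m) hu).trans (le_of_eq (by rw [pow_add]; ring)))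
    _ ≤ 2 * A * R * wt f c s (0 : Fin n → ℤ) * (6 * K * R * ρ) ^ m * 2 := by
        rw [ENNReal.tsum_mul_left]
        exact mul_le_mul_right (tsum_geometric_le_two h6) _
    _ = _ := by ring

theorem wnorm_tsum_gradDiff_le (hg : GoodWeight n f c s κ K) (hP : MemP3 P)
    (hb : ∀ d 𝒥, ‖P d 𝒥‖₊ ≤ A * R ^ d) {u v : Index n → ℂ} {y δ : Index n → ℝ≥0∞}
    (hu : ∀ J, ‖u J‖ₑ ≤ y J) (hv : ∀ J, ‖v J‖ₑ ≤ y J) (huv : ∀ J, ‖u J - v J‖ₑ ≤ δ J)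
    {ρ : ℝ≥0∞} (hy : wnorm f c s y ≤ ρ) (hρ : 12 * K * R * ρ ≤ 1 / 2) :
    wnorm f c s (fun J => ∑' d, gradDiff P d u v J) ≤
      24 * A * R ^ 2 * K * wt f c s (0 : Fin n → ℤ) * wnorm f c s δ := by
  have h0 : ∀ J, ∑' d, gradDiff P d u v J = ∑' d, gradDiff P (d + 2) u v J := fun J =>
    tsum_eq_tsum_add fun _ hd => gradDiff_of_lt hP (by omega) u v J
  simp only [h0]
  calc _ ≤ ∑' d, (12 * A * R ^ 2 * K * wt f c s (0 : Fin n → ℤ) * wnorm f c s δ) *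
        (12 * K * R * ρ) ^ d :=
        (wnorm_tsum_le _).trans (ENNReal.tsum_le_tsum fun d =>
          (wnorm_gradDiff_le hg hP hb d hu hv huv hy).trans (le_of_eq (by ring)))
    _ ≤ (12 * A * R ^ 2 * K * wt f c s (0 : Fin n → ℤ) * wnorm f c s δ) * 2 := by
        rw [ENNReal.tsum_mul_left]
        exact mul_le_mul_right (tsum_geometric_le_two hρ) _
    _ = _ := by ring

theorem tsum_enorm_gradTerm (u : Index n → ℂ) (J : Index n) :
    ∑' q, ‖gradTerm P (bar J) u q‖ₑ = ∑' d, gradNorm P d u J :=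
  ENNReal.tsum_sigma' _

theorem tsum_gradNorm_eq (hP : MemP3 P) (u : Index n → ℂ) (J : Index n) :
    ∑' d, gradNorm P d u J = ∑' d, gradNorm P (d + 2 + 1) u J :=
  tsum_eq_tsum_add (m := 3) fun _ hd => gradNorm_of_lt hP hd u J

theorem wnorm_tsum_gradNorm_le' (hg : GoodWeight n f c s κ K) (hP : MemP3 P)
    (hb : ∀ d 𝒥, ‖P d 𝒥‖₊ ≤ A * R ^ d) {u : Index n → ℂ} {ρ : ℝ≥0∞}
    (hu : wnorm f c s (fun J => ‖u J‖ₑ) ≤ ρ) (hρ : 12 * K * R * ρ ≤ 1 / 2) :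
    wnorm f c s (fun J => ∑' d, gradNorm P d u J) ≤ 4 * A * R * wt f c s (0 : Fin n → ℤ) := by
  simp only [tsum_gradNorm_eq hP]
  refine (wnorm_tsum_gradNorm_le hg hP hb 2 hu hρ).trans ?_
  refine mul_le_of_le_one_right zero_le (pow_le_one' ?_ 2)
  calc 6 * K * R * ρ ≤ 12 * K * R * ρ := by gcongr; norm_num
    _ ≤ 1 := hρ.trans (by norm_num)

theorem ne_top_of_wnorm_le {x : Index n → ℝ≥0∞} {b : ℝ≥0∞} (h : wnorm f c s x ≤ b) (hb : b ≠ ∞)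
    (J : Index n) : x J ≠ ∞ := by
  intro h0
  have h1 := (le_l2 (fun J => wt f c s (mom J) * x J) J).trans h
  simp only [h0] at h1
  rw [ENNReal.mul_top (wt_ne_zero _)] at h1
  exact hb (top_le_iff.1 h1)

theorem summable_gradTerm (hg : GoodWeight n f c s κ K) (hP : MemP3 P)
    (hb : ∀ d 𝒥, ‖P d 𝒥‖₊ ≤ A * R ^ d) {u : Index n → ℂ} {ρ : ℝ≥0∞}
    (hu : wnorm f c s (fun J => ‖u J‖ₑ) ≤ ρ) (hρ : 12 * K * R * ρ ≤ 1 / 2) (J : Index n) :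
    Summable (gradTerm P J u) := by
  refine Summable.of_enorm ?_
  rw [← bar_bar J, tsum_enorm_gradTerm]
  refine ne_top_of_wnorm_le (wnorm_tsum_gradNorm_le' hg hP hb hu hρ) ?_ _
  exact ENNReal.mul_ne_top (by simp [ENNReal.mul_eq_top]) (wt_ne_top _)

theorem enorm_gradP_le (u : Index n → ℂ) (J : Index n) :
    ‖gradP P (bar J) u‖ₑ ≤ ∑' d, gradNorm P d u J := by
  rw [← tsum_enorm_gradTerm]
  exact enorm_tsum_le_tsum_enorm

theorem enorm_gradP_sub_le {u v : Index n → ℂ} {J : Index n}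
    (hu : Summable (gradTerm P (bar J) u)) (hv : Summable (gradTerm P (bar J) v)) :
    ‖gradP P (bar J) u - gradP P (bar J) v‖ₑ ≤ ∑' d, gradDiff P d u v J := by
  rw [gradP, gradP, ← hu.tsum_sub hv]
  refine enorm_tsum_le_tsum_enorm.trans (le_of_eq ?_)
  exact ENNReal.tsum_sigma' _

/-- The part of degree `d` of the derivative. -/
noncomputable def gradDeg (P : FormalSeries n) (d : ℕ) (J : Index n) (u : Index n → ℂ) : ℂ :=
  ∑' q : Fin d × (Fin d → Index n), gradTerm P J u ⟨d, q⟩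

theorem enorm_gradP_sub_sum_le {v : Index n → ℂ} {J : Index n}
    (hv : Summable (gradTerm P (bar J) v)) (m : ℕ) :
    ‖gradP P (bar J) v - ∑ d ∈ Finset.range m, gradDeg P d (bar J) v‖ₑ ≤
      ∑' d, gradNorm P (d + m) v J := by
  have h1 : gradP P (bar J) v = ∑' d, gradDeg P d (bar J) v := hv.tsum_sigma
  have h2 : Summable fun d => gradDeg P d (bar J) v := hv.sigma
  rw [h1, ← h2.sum_add_tsum_nat_add m, add_sub_cancel_left]
  exact enorm_tsum_le_tsum_enorm.trans
    (ENNReal.tsum_le_tsum fun d => enorm_tsum_le_tsum_enorm)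

end Gradient

/-! ### The truncated field -/

section ModeField

variable {n : ℕ} {P : FormalSeries n}

theorem pderiv_prod_X {ι : Type*} [DecidableEq ι] {d : ℕ} (𝒥 : Fin d → ι) (J : ι)
    (t : Finset (Fin d)) : pderiv J (∏ l ∈ t, X (𝒥 l) : MvPolynomial ι ℂ) =
      ∑ l ∈ t, if 𝒥 l = J then ∏ i ∈ t.erase l, X (𝒥 i) else 0 := by
  induction t using Finset.induction_on with
  | empty => simp
  | insert a t ha ih =>
    rw [Finset.prod_insert ha, pderiv_mul, ih, Finset.sum_insert ha, Finset.erase_insert ha,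
      Finset.mul_sum]
    congr 1
    · split_ifs with h
      · rw [h, pderiv_X_self, one_mul]
      · rw [pderiv_X_of_ne h, zero_mul]
    · refine Finset.sum_congr rfl fun l hl => ?_
      have hla : a ≠ l := fun h => ha (h ▸ hl)
      rw [Finset.erase_insert_of_ne hla, Finset.prod_insert (fun h => ha (Finset.mem_of_mem_erase h)),
        mul_ite, mul_zero]

open Classical in
/-- A finite vector, extended by zero. -/
noncomputable def extend {k : ℕ} (v : Mode n k → ℂ) (J : Index n) : ℂ :=
  if h : J ∈ boxModes n k then v ⟨J, h⟩ else 0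

theorem extend_coe {k : ℕ} (v : Mode n k → ℂ) (J : Mode n k) : extend v J.1 = v J := by
  simp [extend]

/-- The extension vanishes outside the box, so only multi-indices within the box survive, and the
infinite sum is the derivative of a polynomial. -/
theorem gradDeg_extend {k : ℕ} (ω : (Fin n → ℤ) → ℝ) (v : Mode n k → ℂ) (a : ℕ) (J : Mode n k) :
    gradDeg P (a + 3) J.1 (extend v) = eval v (pderiv J (modeHam ω P k (a + 1))) := by
  classical
  have hinj : Function.Injective (fun q : Fin (a + 3) × (Fin (a + 3) → Mode n k) =>
      (q.1, fun l => (q.2 l).1)) := fun q q' h => by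
    obtain ⟨h1, h2⟩ := Prod.ext_iff.1 h
    exact Prod.ext h1 (funext fun l => Subtype.ext (congrFun h2 l))
  have hsupp : Function.support (fun q => gradTerm P J.1 (extend v) ⟨a + 3, q⟩) ⊆
      Set.range (fun q : Fin (a + 3) × (Fin (a + 3) → Mode n k) =>
        (q.1, fun l => (q.2 l).1)) := by
    rintro ⟨l, 𝒥⟩ hq
    rw [Function.mem_support] at hq
    simp only [gradTerm] at hq
    split_ifs at hq with hl
    · have hmem : ∀ i, 𝒥 i ∈ boxModes n k := fun i => by
        by_cases hi : i = l
        · rw [hi, hl]; exact J.2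
        · by_contra hni
          refine hq (mul_eq_zero_of_right _ (Finset.prod_eq_zero
            (Finset.mem_erase.2 ⟨hi, Finset.mem_univ i⟩) ?_))
          rw [extend, dif_neg hni]
      exact ⟨(l, fun i => ⟨𝒥 i, hmem i⟩), rfl⟩
    · exact absurd rfl hq
  rw [gradDeg, ← hinj.tsum_eq hsupp, tsum_fintype, Fintype.sum_prod_type, Finset.sum_comm, modeHam,
    map_sum, map_sum]
  refine Finset.sum_congr rfl fun 𝒥 _ => ?_
  rw [pderiv_C_mul, pderiv_prod_X, map_mul, map_sum, eval_C, Finset.mul_sum]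
  refine Finset.sum_congr rfl fun l _ => ?_
  simp only [gradTerm, extend_coe]
  have : ((𝒥 l).1 = J.1) = (𝒥 l = J) := propext (Subtype.ext_iff).symm
  simp only [this]
  split_ifs
  · rw [map_prod]
    simp
  · simp

theorem gradDeg_of_lt (hP : MemP3 P) {d : ℕ} (hd : d < 3) (J : Index n) (u : Index n → ℂ) :
    gradDeg P d J u = 0 := by
  simp [gradDeg, gradTerm_of_lt hP hd]

theorem sum_field_modeHam (hP : MemP3 P) {k : ℕ} (ω : (Fin n → ℤ) → ℝ) (v : Mode n k → ℂ) (r : ℕ)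
    (J : Mode n k) : ∑ a ∈ Finset.range (r + 1), (modePhase n k).field v (modeHam ω P k a) J =
      -(sgn J.1.2 : ℂ) * Complex.I * ((ω J.1.1 : ℂ) * v J +
        ∑ d ∈ Finset.range (r + 3), gradDeg P d (bar J.1) (extend v)) := by
  have h1 : ∑ d ∈ Finset.range (r + 3), gradDeg P d (bar J.1) (extend v) =
      ∑ a ∈ Finset.range r, eval v (pderiv ((modePhase n k).bar J) (modeHam ω P k (a + 1))) := by
    rw [add_comm r 3, Finset.sum_range_add, Finset.sum_eq_zero, zero_add]
    · refine Finset.sum_congr rfl fun a _ => ?_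
      rw [← gradDeg_extend, add_comm 3 a]
      rfl
    · exact fun d hd => gradDeg_of_lt hP (Finset.mem_range.1 hd) _ _
  rw [h1, Finset.sum_range_succ', mul_add, add_comm, Finset.mul_sum]
  congr 1
  -- The weight ω / 2 is compensated by the 2 in `Phase.pderiv_quad`: each conjugate pair occurs
  -- twice in the quadratic form.
  rw [Phase.field, modeHam, (modePhase n k).pderiv_quad (w := fun J => (ω J.1.1 : ℂ) / 2)
    (fun J => rfl), (modePhase n k).bar_bar, map_mul, eval_C, eval_X]
  simp only [modePhase, bar]
  ring

end ModeField

/-! ### The weighted space as a Hilbert space -/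

/-- The space of square summable sequences. -/
abbrev Seq (n : ℕ) : Type := lp (fun _ : Index n => ℂ) 2

section Space

variable {n : ℕ} {f : ℝ → ℝ} {c s : ℝ}

theorem l2_ne_top_iff {κ : Type*} {x : κ → ℝ≥0∞} : l2 x ≠ ∞ ↔ ∑' k, x k ^ 2 ≠ ∞ := by
  rw [← l2_sq, ENNReal.pow_ne_top_iff]
  simp

theorem memℓp_of_l2_ne_top {x : Index n → ℂ} (h : l2 (fun J => ‖x J‖ₑ) ≠ ∞) : Memℓp x 2 := by
  rw [l2_ne_top_iff] at h
  refine memℓp_gen ?_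
  have h1 : Summable fun J => ‖x J‖₊ ^ 2 := by
    rw [← ENNReal.tsum_coe_ne_top_iff_summable]
    simpa [enorm_eq_nnnorm] using h
  have h2 : Summable fun J => ((‖x J‖₊ ^ 2 : ℝ≥0) : ℝ) := NNReal.summable_coe.2 h1
  simpa using h2

theorem l2_enorm (z : Seq n) : l2 (fun J => ‖z J‖ₑ) = ‖z‖ₑ := by
  have h2 : (0 : ℝ) < (2 : ℝ≥0∞).toReal := by norm_num
  have hsum : Summable fun J => ‖z J‖ ^ 2 := by
    have := (memℓp_gen_iff h2).1 (lp.memℓp z)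
    simpa using this
  have h1 : ‖z‖ ^ 2 = ∑' J, ‖z J‖ ^ 2 := by
    have := lp.norm_rpow_eq_tsum h2 z
    simpa using this
  apply (ENNReal.pow_right_strictMono two_ne_zero).injective
  show l2 (fun J => ‖z J‖ₑ) ^ 2 = ‖z‖ₑ ^ 2
  rw [l2_sq]
  have e : ∀ x : ℝ, 0 ≤ x → ENNReal.ofReal (x ^ 2) = ENNReal.ofReal x ^ 2 := fun x hx =>
    ENNReal.ofReal_pow hx 2
  rw [← ofReal_norm z, ← e _ (norm_nonneg _), h1,
    ENNReal.ofReal_tsum_of_nonneg (fun _ => sq_nonneg _) hsum]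
  refine tsum_congr fun J => ?_
  rw [e _ (norm_nonneg _), ofReal_norm]

/-- The weight `e^{s f(⟨j⟩)}` as a real number. -/
noncomputable def wtR (f : ℝ → ℝ) (c s : ℝ) (J : Index n) : ℝ := Real.exp (s * f (bracket c J.1))

theorem wtR_pos (J : Index n) : 0 < wtR f c s J := Real.exp_pos _

theorem enorm_wtR_mul (J : Index n) (z : ℂ) :
    ‖(wtR f c s J : ℂ) * z‖ₑ = wt f c s (mom J) * ‖z‖ₑ := by
  rw [enorm_mul, wt_mom, wt, ← ofReal_norm, Complex.norm_real, Real.norm_eq_abs,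
    abs_of_pos (wtR_pos J), wtR]

/-- The norm of a sequence in the weighted space. -/
noncomputable def wenorm (f : ℝ → ℝ) (c s : ℝ) (u : Index n → ℂ) : ℝ≥0∞ :=
  wnorm f c s fun J => ‖u J‖ₑ

theorem wenorm_eq (u : Index n → ℂ) :
    wenorm f c s u = l2 fun J => ‖(wtR f c s J : ℂ) * u J‖ₑ := by
  simp only [enorm_wtR_mul]
  rfl

theorem wenorm_sq (u : Index n → ℂ) :
    wenorm f c s u ^ 2 = ∑' J, ENNReal.ofReal (weightedSq f c s u J) := by
  rw [wenorm_eq, l2_sq]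
  refine tsum_congr fun J => ?_
  rw [← ofReal_norm, ← ENNReal.ofReal_pow (norm_nonneg _), norm_mul, Complex.norm_real,
    Real.norm_eq_abs, abs_of_pos (wtR_pos J), mul_pow, wtR, ← Real.exp_nat_mul, weightedSq, mul_comm]
  congr 3
  push_cast
  ring

theorem weightedSq_nonneg (u : Index n → ℂ) (J : Index n) : 0 ≤ weightedSq f c s u J :=
  mul_nonneg (sq_nonneg _) (Real.exp_pos _).le

theorem memW_iff {u : Index n → ℂ} : MemW f c s u ↔ wenorm f c s u ≠ ∞ := by
  have h : wenorm f c s u ≠ ∞ ↔ wenorm f c s u ^ 2 ≠ ∞ := by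
    rw [ENNReal.pow_ne_top_iff]
    simp
  rw [h, wenorm_sq]
  constructor
  · intro hu
    rw [← ENNReal.ofReal_tsum_of_nonneg (weightedSq_nonneg u) hu]
    exact ENNReal.ofReal_ne_top
  · intro hu
    have := ENNReal.summable_toReal hu
    simp only [ENNReal.toReal_ofReal (weightedSq_nonneg u _)] at this
    exact this

theorem ofReal_normW {u : Index n → ℂ} (hu : MemW f c s u) :
    ENNReal.ofReal (normW f c s u) = wenorm f c s u := by
  apply (ENNReal.pow_right_strictMono two_ne_zero).injective
  show ENNReal.ofReal (normW f c s u) ^ 2 = wenorm f c s u ^ 2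
  rw [wenorm_sq, normW, ← ENNReal.ofReal_pow (Real.sqrt_nonneg _),
    Real.sq_sqrt (tsum_nonneg (weightedSq_nonneg u)),
    ENNReal.ofReal_tsum_of_nonneg (weightedSq_nonneg u) hu]

open Classical in
/-- A sequence of the weighted space as an element of the Hilbert space. -/
noncomputable def toSeq (f : ℝ → ℝ) (c s : ℝ) (u : Index n → ℂ) : Seq n :=
  if h : wenorm f c s u ≠ ∞ then
    ⟨fun J => (wtR f c s J : ℂ) * u J, memℓp_of_l2_ne_top (by rwa [wenorm_eq] at h)⟩
  else 0

theorem toSeq_apply {u : Index n → ℂ} (h : wenorm f c s u ≠ ∞) (J : Index n) :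
    toSeq f c s u J = (wtR f c s J : ℂ) * u J := by
  rw [toSeq, dif_pos h]

/-- The sequence of the weighted space that belongs to an element of the Hilbert space. -/
noncomputable def ofSeq (f : ℝ → ℝ) (c s : ℝ) (z : Seq n) (J : Index n) : ℂ :=
  (wtR f c s J : ℂ)⁻¹ * z J

theorem wtR_ne_zero (J : Index n) : (wtR f c s J : ℂ) ≠ 0 :=
  Complex.ofReal_ne_zero.2 (wtR_pos J).ne'

theorem wenorm_ofSeq (z : Seq n) : wenorm f c s (ofSeq f c s z) = ‖z‖ₑ := by
  rw [wenorm_eq, ← l2_enorm]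
  congr 1
  funext J
  rw [ofSeq, mul_inv_cancel_left₀ (wtR_ne_zero J)]

theorem wenorm_ofSeq_ne_top (z : Seq n) : wenorm f c s (ofSeq f c s z) ≠ ∞ := by
  rw [wenorm_ofSeq]
  exact enorm_ne_top

theorem toSeq_ofSeq (z : Seq n) : toSeq f c s (ofSeq f c s z) = z := by
  ext J
  rw [toSeq_apply (wenorm_ofSeq_ne_top z), ofSeq, mul_inv_cancel_left₀ (wtR_ne_zero J)]

theorem ofSeq_toSeq {u : Index n → ℂ} (h : wenorm f c s u ≠ ∞) :
    ofSeq f c s (toSeq f c s u) = u := by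
  funext J
  rw [ofSeq, toSeq_apply h, inv_mul_cancel_left₀ (wtR_ne_zero J)]

theorem ofSeq_sub (z z' : Seq n) : ofSeq f c s (z - z') = ofSeq f c s z - ofSeq f c s z' := by
  funext J
  simp [ofSeq, mul_sub]

theorem memW_ofSeq (z : Seq n) : MemW f c s (ofSeq f c s z) := memW_iff.2 (wenorm_ofSeq_ne_top z)

theorem normW_ofSeq (z : Seq n) : normW f c s (ofSeq f c s z) = ‖z‖ := by
  have h := ofReal_normW (memW_ofSeq (f := f) (c := c) (s := s) z)
  rw [wenorm_ofSeq, ← ofReal_norm] at h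
  exact (ENNReal.ofReal_eq_ofReal_iff (Real.sqrt_nonneg _) (norm_nonneg _)).1 h

theorem norm_toSeq {u : Index n → ℂ} (hu : MemW f c s u) : ‖toSeq f c s u‖ = normW f c s u := by
  rw [← normW_ofSeq (f := f) (c := c) (s := s), ofSeq_toSeq (memW_iff.1 hu)]

end Space

/-! ### Rotations -/

section Rotation

variable {n : ℕ} {ω : (Fin n → ℤ) → ℝ}

/-- The factor of the linear flow. -/
noncomputable def phase (ω : (Fin n → ℤ) → ℝ) (t : ℝ) (J : Index n) : ℂ :=
  Complex.exp (-(sgn J.2 : ℂ) * Complex.I * ω J.1 * t)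

theorem norm_phase (t : ℝ) (J : Index n) : ‖phase ω t J‖ = 1 := by
  have : (-(sgn J.2 : ℂ) * Complex.I * ω J.1 * t) =
      ((-(sgn J.2 * ω J.1 * t) : ℝ) : ℂ) * Complex.I := by
    push_cast
    ring
  rw [phase, this, Complex.norm_exp_ofReal_mul_I]

theorem phase_neg_mul (t : ℝ) (J : Index n) : phase ω (-t) J * phase ω t J = 1 := by
  rw [phase, phase, ← Complex.exp_add, ← Complex.exp_zero]
  congr 1
  push_cast
  ring

theorem hasDerivAt_phase (t : ℝ) (J : Index n) : HasDerivAt (fun t => phase ω t J)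
    (-(sgn J.2 : ℂ) * Complex.I * ω J.1 * phase ω t J) t := by
  have h1 : HasDerivAt (fun t : ℝ => -(sgn J.2 : ℂ) * Complex.I * ω J.1 * (t : ℂ))
      (-(sgn J.2 : ℂ) * Complex.I * ω J.1 * 1) t :=
    (Complex.ofRealCLM.hasDerivAt (x := t)).const_mul _
  have := h1.cexp
  rw [mul_one] at this
  rw [mul_comm]
  exact this

/-- The linear flow. -/
noncomputable def rot (ω : (Fin n → ℤ) → ℝ) (t : ℝ) (z : Seq n) : Seq n :=
  ⟨fun J => phase ω t J * z J, memℓp_of_l2_ne_top (by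
    simp only [enorm_mul]
    have : ∀ J, ‖phase ω t J‖ₑ = 1 := fun J => by rw [← ofReal_norm, norm_phase]; simp
    simp only [this, one_mul, l2_enorm]
    exact enorm_ne_top)⟩

theorem rot_apply (t : ℝ) (z : Seq n) (J : Index n) : rot ω t z J = phase ω t J * z J := rfl

theorem norm_rot (t : ℝ) (z : Seq n) : ‖rot ω t z‖ = ‖z‖ := by
  have h : ‖rot ω t z‖ₑ = ‖z‖ₑ := by
    rw [← l2_enorm, ← l2_enorm]
    congr 1
    funext J
    rw [rot_apply, enorm_mul, ← ofReal_norm (phase ω t J), norm_phase]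
    simp
  rw [← toReal_enorm, h, toReal_enorm]

theorem rot_sub (t : ℝ) (z z' : Seq n) : rot ω t (z - z') = rot ω t z - rot ω t z' := by
  ext J
  simp [rot_apply, mul_sub]

theorem rot_neg_rot (t : ℝ) (z : Seq n) : rot ω (-t) (rot ω t z) = z := by
  ext J
  rw [rot_apply, rot_apply, ← mul_assoc, phase_neg_mul, one_mul]

theorem rot_rot_neg (t : ℝ) (z : Seq n) : rot ω t (rot ω (-t) z) = z := by
  conv_lhs => rw [← neg_neg t, neg_neg (-t)]
  exact rot_neg_rot (-t) z

theorem rot_zero_time (z : Seq n) : rot ω 0 z = z := by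
  ext J
  simp [rot_apply, phase]

/-- With unbounded frequencies only strong continuity can be expected; it follows by dominated
convergence. -/
theorem tendsto_rot (t₀ : ℝ) (z : Seq n) :
    Tendsto (fun t => rot ω t z) (𝓝 t₀) (𝓝 (rot ω t₀ z)) := by
  rw [tendsto_iff_norm_sub_tendsto_zero]
  have h2 : (0 : ℝ) < (2 : ℝ≥0∞).toReal := by norm_num
  have hsq : Tendsto (fun t => ‖rot ω t z - rot ω t₀ z‖ ^ 2) (𝓝 t₀) (𝓝 0) := by
    have he : ∀ t, ‖rot ω t z - rot ω t₀ z‖ ^ 2 =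
        ∑' J, (‖phase ω t J - phase ω t₀ J‖ * ‖z J‖) ^ 2 := fun t => by
      have := lp.norm_rpow_eq_tsum h2 (rot ω t z - rot ω t₀ z)
      simp only [ENNReal.toReal_ofNat, Real.rpow_ofNat] at this
      rw [this]
      refine tsum_congr fun J => ?_
      rw [lp.coeFn_sub, Pi.sub_apply, rot_apply, rot_apply, ← sub_mul, norm_mul]
    simp only [he]
    have hsum : Summable fun J => (2 * ‖z J‖) ^ 2 := by
      have := (memℓp_gen_iff h2).1 (lp.memℓp z)
      simp only [ENNReal.toReal_ofNat, Real.rpow_ofNat] at this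
      simp only [mul_pow]
      exact this.mul_left _
    have h0 : (0 : ℝ) = ∑' J : Index n, 0 := by simp
    rw [h0]
    refine tendsto_tsum_of_dominated_convergence hsum (fun J => ?_)
      (Eventually.of_forall fun t J => ?_)
    · have hc : Tendsto (fun t => phase ω t J) (𝓝 t₀) (𝓝 (phase ω t₀ J)) :=
        (hasDerivAt_phase t₀ J).continuousAt
      have := (((hc.sub_const (phase ω t₀ J)).norm).mul_const ‖z J‖).pow 2
      simpa using this
    · rw [Real.norm_of_nonneg (sq_nonneg _)]
      have : ‖phase ω t J - phase ω t₀ J‖ ≤ 2 := by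
        refine (norm_sub_le _ _).trans ?_
        rw [norm_phase, norm_phase]
        norm_num
      gcongr
  have := hsq.sqrt
  simpa [Real.sqrt_sq (norm_nonneg _)] using this

/-- Strong continuity of a family of linear isometries gives joint continuity. -/
theorem continuous_rot : Continuous fun x : ℝ × Seq n => rot ω x.1 x.2 := by
  rw [continuous_iff_continuousAt]
  rintro ⟨t₀, z₀⟩
  rw [ContinuousAt, tendsto_iff_norm_sub_tendsto_zero]
  have h1 : Tendsto (fun x : ℝ × Seq n => ‖x.2 - z₀‖ + ‖rot ω x.1 z₀ - rot ω t₀ z₀‖)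
      (𝓝 (t₀, z₀)) (𝓝 (0 + 0)) := by
    refine Tendsto.add ?_ ?_
    · have : Tendsto (fun x : ℝ × Seq n => x.2) (𝓝 (t₀, z₀)) (𝓝 z₀) := continuousAt_snd
      exact tendsto_iff_norm_sub_tendsto_zero.1 this
    · exact (tendsto_iff_norm_sub_tendsto_zero.1 (tendsto_rot t₀ z₀)).comp
        (continuousAt_fst : Tendsto Prod.fst (𝓝 (t₀, z₀)) (𝓝 t₀))
  rw [add_zero] at h1
  refine squeeze_zero (fun _ => norm_nonneg _) (fun x => ?_) h1
  calc ‖rot ω x.1 x.2 - rot ω t₀ z₀‖ = ‖rot ω x.1 (x.2 - z₀) + (rot ω x.1 z₀ - rot ω t₀ z₀)‖ := by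
        rw [rot_sub]
        congr 1
        abel
    _ ≤ _ := by
        refine (norm_add_le _ _).trans ?_
        rw [norm_rot]

end Rotation

/-! ### The nonlinear field on the Hilbert space -/

section Retract

variable {E : Type*} [NormedAddCommGroup E] [NormedSpace ℝ E]

/-- The radial retraction onto a ball. -/
noncomputable def retract (ρ : ℝ) (z : E) : E := (ρ / max ρ ‖z‖) • z

theorem retract_of_le {ρ : ℝ} (hρ : 0 < ρ) {z : E} (hz : ‖z‖ ≤ ρ) : retract ρ z = z := by
  rw [retract, max_eq_left hz, div_self hρ.ne', one_smul]

theorem norm_retract_le {ρ : ℝ} (hρ : 0 < ρ) (z : E) : ‖retract ρ z‖ ≤ ρ := by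
  have h : 0 < max ρ ‖z‖ := lt_max_of_lt_left hρ
  rw [retract, norm_smul, Real.norm_of_nonneg (by positivity), div_mul_eq_mul_div, div_le_iff₀ h]
  exact mul_le_mul_of_nonneg_left (le_max_right _ _) hρ.le

theorem norm_retract_sub_le {ρ : ℝ} (hρ : 0 < ρ) (z z' : E) :
    ‖retract ρ z - retract ρ z'‖ ≤ 2 * ‖z - z'‖ := by
  set a := max ρ ‖z‖ with ha
  set b := max ρ ‖z'‖ with hb
  have ha0 : 0 < a := lt_max_of_lt_left hρ
  have hb0 : 0 < b := lt_max_of_lt_left hρ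
  have e : retract ρ z - retract ρ z' = (ρ / a) • (z - z') + (ρ / a - ρ / b) • z' := by
    rw [retract, retract, smul_sub, sub_smul]
    abel
  have hab : |b - a| ≤ ‖z - z'‖ := by
    rw [abs_sub_comm]
    refine (abs_max_sub_max_le_max _ _ _ _).trans ?_
    rw [sub_self, abs_zero]
    exact max_le (norm_nonneg _) (abs_norm_sub_norm_le _ _)
  have h1 : ρ / a ≤ 1 := (div_le_one ha0).2 (le_max_left _ _)
  have h2 : |ρ / a - ρ / b| * ‖z'‖ ≤ ‖z - z'‖ := by
    have e2 : ρ / a - ρ / b = (ρ / a) * ((b - a) / b) := by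
      field_simp
    rw [e2, abs_mul, abs_div (b - a), abs_of_pos hb0, abs_of_pos (div_pos hρ ha0)]
    calc ρ / a * (|b - a| / b) * ‖z'‖ ≤ 1 * (|b - a| / b) * b := by
          gcongr
          exact le_max_right _ _
      _ = |b - a| := by field_simp
      _ ≤ _ := hab
  rw [e, two_mul]
  refine (norm_add_le _ _).trans (add_le_add ?_ ?_)
  · rw [norm_smul, Real.norm_of_nonneg (by positivity)]
    exact mul_le_of_le_one_left (norm_nonneg _) h1
  · rw [norm_smul, Real.norm_eq_abs]
    exact h2

end Retract

section Field

variable {n : ℕ} {f : ℝ → ℝ} {c s κ : ℝ} {K A R : ℝ≥0} {P : FormalSeries n}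

/-- The field of the nonlinear part. -/
noncomputable def nonlin (P : FormalSeries n) (u : Index n → ℂ) (J : Index n) : ℂ :=
  -(sgn J.2 : ℂ) * Complex.I * gradP P (bar J) u

theorem vectorField_eq (ω : (Fin n → ℤ) → ℝ) (u : Index n → ℂ) (J : Index n) :
    vectorField ω P u J = -(sgn J.2 : ℂ) * Complex.I * ω J.1 * u J + nonlin P u J := by
  rw [vectorField, gradH, bar_bar, nonlin]
  simp only [bar]
  ring

theorem enorm_sgn_mul (σ : ℤˣ) (z : ℂ) : ‖-(sgn σ : ℂ) * Complex.I * z‖ₑ = ‖z‖ₑ := by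
  rw [← ofReal_norm, norm_mul, norm_mul, norm_neg, Complex.norm_real, Real.norm_eq_abs,
    abs_sgn, Complex.norm_I, one_mul, one_mul, ofReal_norm]

theorem wenorm_nonlin_le (hg : GoodWeight n f c s κ K) (hP : MemP3 P)
    (hb : ∀ d 𝒥, ‖P d 𝒥‖₊ ≤ A * R ^ d) {u : Index n → ℂ} {ρ : ℝ≥0∞}
    (hu : wenorm f c s u ≤ ρ) (hρ : 12 * K * R * ρ ≤ 1 / 2) :
    wenorm f c s (nonlin P u) ≤ 4 * A * R * wt f c s (0 : Fin n → ℤ) := by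
  refine (wnorm_mono fun J => ?_).trans (wnorm_tsum_gradNorm_le' hg hP hb hu hρ)
  rw [nonlin, enorm_sgn_mul]
  exact enorm_gradP_le u J

theorem wenorm_nonlin_sub_le (hg : GoodWeight n f c s κ K) (hP : MemP3 P)
    (hb : ∀ d 𝒥, ‖P d 𝒥‖₊ ≤ A * R ^ d) {u v : Index n → ℂ} {ρ : ℝ≥0∞}
    (hu : wenorm f c s u ≤ ρ) (hv : wenorm f c s v ≤ ρ) (hρ : 24 * K * R * ρ ≤ 1 / 2) :
    wenorm f c s (nonlin P u - nonlin P v) ≤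
      24 * A * R ^ 2 * K * wt f c s (0 : Fin n → ℤ) * wenorm f c s (u - v) := by
  have hρ' : 12 * K * R * ρ ≤ 1 / 2 := by
    refine le_trans ?_ hρ
    gcongr
    norm_num
  -- The common majorant |u| + |v| has norm up to 2 ρ, hence 24 in place of 12.
  have h2 : 12 * K * R * (2 * ρ) ≤ 1 / 2 := le_trans (le_of_eq (by ring)) hρ
  have hy : wnorm f c s (fun J => ‖u J‖ₑ + ‖v J‖ₑ) ≤ 2 * ρ := by
    rw [two_mul]
    exact (wnorm_add_le _ _).trans (add_le_add hu hv)
  refine le_trans (wnorm_mono fun J => ?_) (wnorm_tsum_gradDiff_le hg hP hb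
    (u := u) (v := v) (δ := fun J => ‖(u - v) J‖ₑ) (fun J => le_self_add)
    (fun J => le_add_self) (fun J => le_rfl) hy h2)
  rw [Pi.sub_apply, nonlin, nonlin, ← mul_sub, enorm_sgn_mul]
  exact enorm_gradP_sub_le (summable_gradTerm hg hP hb hu hρ' _)
    (summable_gradTerm hg hP hb hv hρ' _)

theorem wt_zero_ne_top : wt f c s (0 : Fin n → ℤ) ≠ ∞ := wt_ne_top _

/-- A bounded and Lipschitz continuous field that agrees with the nonlinear part on a ball. -/
theorem exists_field (hg : GoodWeight n f c s κ K) (hP : MemP3 P)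
    (hb : ∀ d 𝒥, ‖P d 𝒥‖₊ ≤ A * R ^ d) {ρ : ℝ≥0} (hρ0 : 0 < ρ)
    (hρ : 24 * K * R * (ρ : ℝ≥0∞) ≤ 1 / 2) : ∃ (g : Seq n → Seq n) (L : ℝ≥0), LipschitzWith L g ∧
      (∀ z, ‖g z‖ ≤ L) ∧ ∀ z, ‖z‖ ≤ ρ → ofSeq f c s (g z) = nonlin P (ofSeq f c s z) := by
  have hρ0' : (0 : ℝ) < ρ := hρ0
  have hρ' : 12 * K * R * (ρ : ℝ≥0∞) ≤ 1 / 2 := by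
    refine le_trans ?_ hρ
    gcongr
    norm_num
  have hball : ∀ z : Seq n, wenorm f c s (ofSeq f c s (retract (ρ : ℝ) z)) ≤ ρ := fun z => by
    rw [wenorm_ofSeq, enorm_eq_nnnorm]
    exact_mod_cast norm_retract_le hρ0' z
  have htop1 : (4 * A * R * wt f c s (0 : Fin n → ℤ) : ℝ≥0∞) ≠ ∞ :=
    ENNReal.mul_ne_top (by simp [ENNReal.mul_eq_top]) wt_zero_ne_top
  have htop2 : (24 * A * R ^ 2 * K * wt f c s (0 : Fin n → ℤ) : ℝ≥0∞) ≠ ∞ :=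
    ENNReal.mul_ne_top (by simp [ENNReal.mul_eq_top]) wt_zero_ne_top
  have hfin : ∀ z : Seq n, wenorm f c s (nonlin P (ofSeq f c s (retract (ρ : ℝ) z))) ≠ ∞ :=
    fun z => ne_top_of_le_ne_top htop1 (wenorm_nonlin_le hg hP hb (hball z) hρ')
  set g : Seq n → Seq n := fun z => toSeq f c s (nonlin P (ofSeq f c s (retract (ρ : ℝ) z))) with hgdef
  have hofg : ∀ z, ofSeq f c s (g z) = nonlin P (ofSeq f c s (retract (ρ : ℝ) z)) := fun z =>
    ofSeq_toSeq (hfin z)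
  lift (4 * A * R * wt f c s (0 : Fin n → ℤ) : ℝ≥0∞) to ℝ≥0 using htop1 with L₁ hL₁
  lift (24 * A * R ^ 2 * K * wt f c s (0 : Fin n → ℤ) : ℝ≥0∞) to ℝ≥0 using htop2 with L₂ hL₂
  refine ⟨g, max L₁ (L₂ * 2), ?_, fun z => ?_, fun z hz => ?_⟩
  · refine (LipschitzWith.of_dist_le_mul (K := L₂ * 2) fun z z' => ?_).weaken (le_max_right _ _)
    rw [dist_eq_norm, dist_eq_norm]
    have h1 : ‖g z - g z'‖ₑ ≤ L₂ * ‖retract (ρ : ℝ) z - retract (ρ : ℝ) z'‖ₑ := by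
      rw [hL₂, ← wenorm_ofSeq (f := f) (c := c) (s := s), ofSeq_sub, hofg, hofg,
        ← wenorm_ofSeq (f := f) (c := c) (s := s) (retract (ρ : ℝ) z - _), ofSeq_sub]
      exact wenorm_nonlin_sub_le hg hP hb (hball z) (hball z') hρ
    have h2 : ‖g z - g z'‖ ≤ L₂ * ‖retract (ρ : ℝ) z - retract (ρ : ℝ) z'‖ := by
      rw [enorm_eq_nnnorm, enorm_eq_nnnorm] at h1
      exact_mod_cast h1
    refine h2.trans ?_
    rw [NNReal.coe_mul, mul_assoc]
    exact mul_le_mul_of_nonneg_left (norm_retract_sub_le hρ0' z z') L₂.2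
  · have h1 : ‖g z‖ₑ ≤ L₁ := by
      rw [hL₁, ← wenorm_ofSeq (f := f) (c := c) (s := s), hofg]
      exact wenorm_nonlin_le hg hP hb (hball z) hρ'
    rw [enorm_eq_nnnorm] at h1
    have h2 : ‖g z‖₊ ≤ L₁ := by exact_mod_cast h1
    exact le_trans (by exact_mod_cast h2) (NNReal.coe_le_coe.2 (le_max_left L₁ _))
  · rw [hofg, retract_of_le hρ0' hz]

end Field

/-! ### Existence and uniqueness of solutions -/

section Ode

variable {n : ℕ} {ω : (Fin n → ℤ) → ℝ} {g : Seq n → Seq n} {L : ℝ≥0}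

/-- The field in rotating coordinates. -/
noncomputable def rotField (ω : (Fin n → ℤ) → ℝ) (g : Seq n → Seq n) (t : ℝ) (z : Seq n) : Seq n :=
  rot ω (-t) (g (rot ω t z))

theorem lipschitzWith_rotField (hg : LipschitzWith L g) (t : ℝ) :
    LipschitzWith L (rotField ω g t) := by
  refine LipschitzWith.of_dist_le_mul fun z z' => ?_
  rw [dist_eq_norm, dist_eq_norm, rotField, rotField, ← rot_sub, norm_rot, ← norm_rot (ω := ω) t (z - z'),
    rot_sub, ← dist_eq_norm, ← dist_eq_norm]
  exact hg.dist_le_mul _ _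

theorem continuous_rotField (hg : LipschitzWith L g) :
    Continuous (Function.uncurry (rotField ω g)) := by
  have h1 : Continuous fun x : ℝ × Seq n => g (rot ω x.1 x.2) := hg.continuous.comp continuous_rot
  exact continuous_rot.comp (continuous_fst.neg.prodMk h1)

/-- The field is bounded by L everywhere, so a solution stays within distance L T of its initial
value, and a single application of Picard–Lindelöf covers the whole interval. -/
theorem exists_rotField_solution (hg : LipschitzWith L g) (hL : ∀ z, ‖g z‖ ≤ L) {T : ℝ} (hT : 0 ≤ T)
    (z₀ : Seq n) : ∃ z : ℝ → Seq n, z 0 = z₀ ∧ ∀ t ∈ Set.Icc (-T) T,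
      HasDerivWithinAt z (rotField ω g t (z t)) (Set.Icc (-T) T) t := by
  have h0 : (0 : ℝ) ∈ Set.Icc (-T) T := ⟨by linarith, hT⟩
  have hpl : IsPicardLindelof (rotField ω g) (⟨0, h0⟩ : Set.Icc (-T) T) z₀
      (L * T.toNNReal) 0 L L := by
    refine ⟨fun t _ => (lipschitzWith_rotField hg t).lipschitzOnWith, fun x _ => ?_,
      fun t _ x _ => ?_, ?_⟩
    · exact ((continuous_rotField hg).comp (continuous_id.prodMk continuous_const)).continuousOn
    · rw [rotField, norm_rot]
      exact hL _
    · simp [Real.coe_toNNReal _ hT]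
  exact hpl.exists_eq_forall_mem_Icc_hasDerivWithinAt₀

theorem eqOn_of_rotField_solution (hg : LipschitzWith L g) {T : ℝ} {z z' : ℝ → Seq n}
    (hz : ∀ t ∈ Set.Icc (-T) T, HasDerivWithinAt z (rotField ω g t (z t)) (Set.Icc (-T) T) t)
    (hz' : ∀ t ∈ Set.Icc (-T) T, HasDerivWithinAt z' (rotField ω g t (z' t)) (Set.Icc (-T) T) t)
    (h0 : z 0 = z' 0) : Set.EqOn z z' (Set.Icc (-T) T) := by
  rcases le_or_gt T 0 with hT | hT
  · intro t ht
    have : t = 0 := by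
      have h1 := ht.1
      have h2 := ht.2
      linarith
    rw [this, h0]
  · refine ODE_solution_unique_of_mem_Icc (v := rotField ω g) (s := fun _ => Set.univ) (K := L)
      (t₀ := 0) (fun t _ => (lipschitzWith_rotField hg t).lipschitzOnWith)
      ⟨by linarith, hT⟩ (fun t ht => (hz t ht).continuousWithinAt) (fun t ht => ?_)
      (fun _ _ => Set.mem_univ _) (fun t ht => (hz' t ht).continuousWithinAt) (fun t ht => ?_)
      (fun _ _ => Set.mem_univ _) h0
    · exact (hz t (Set.Ioo_subset_Icc_self ht)).hasDerivAt (Icc_mem_nhds ht.1 ht.2)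
    · exact (hz' t (Set.Ioo_subset_Icc_self ht)).hasDerivAt (Icc_mem_nhds ht.1 ht.2)

/-- The evaluation of a component. -/
noncomputable def evalSeq (J : Index n) : Seq n →L[ℝ] ℂ :=
  (lp.evalCLM ℂ (fun _ : Index n => ℂ) 2 J).restrictScalars ℝ

end Ode

/-! ### Solutions in the rotating frame, uniqueness and reality -/

section Solution

variable {n : ℕ} {f : ℝ → ℝ} {c s κ : ℝ} {K A R ρ L : ℝ≥0} {P : FormalSeries n}
  {ω : (Fin n → ℤ) → ℝ} {g : Seq n → Seq n}

theorem IsSolutionOn.mono {I I' : Set ℝ} {u : ℝ → Index n → ℂ}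
    (h : IsSolutionOn f c s ω P I u) (hI : I' ⊆ I) : IsSolutionOn f c s ω P I' u where
  mem t ht := h.mem t (hI ht)
  continuous t ht := (h.continuous t (hI ht)).mono_left (nhdsWithin_mono _ hI)
  summable t ht := h.summable t (hI ht)
  equation t ht J := (h.equation t (hI ht) J).mono hI

theorem toSeq_sub {u v : Index n → ℂ} (hu : MemW f c s u) (hv : MemW f c s v) :
    toSeq f c s u - toSeq f c s v = toSeq f c s (u - v) := by
  have h : ofSeq f c s (toSeq f c s u - toSeq f c s v) = u - v := by
    rw [ofSeq_sub, ofSeq_toSeq (memW_iff.1 hu), ofSeq_toSeq (memW_iff.1 hv)]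
  rw [← h, toSeq_ofSeq]

theorem memW_sub {u v : Index n → ℂ} (hu : MemW f c s u) (hv : MemW f c s v) :
    MemW f c s (u - v) := by
  rw [← ofSeq_toSeq (memW_iff.1 hu), ← ofSeq_toSeq (memW_iff.1 hv), ← ofSeq_sub]
  exact memW_ofSeq _

theorem IsSolutionOn.continuousOn_toSeq {I : Set ℝ} {u : ℝ → Index n → ℂ}
    (h : IsSolutionOn f c s ω P I u) : ContinuousOn (fun t => toSeq f c s (u t)) I := by
  intro t ht
  rw [ContinuousWithinAt, tendsto_iff_norm_sub_tendsto_zero]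
  refine (h.continuous t ht).congr' ?_
  filter_upwards [self_mem_nhdsWithin] with τ hτ
  rw [toSeq_sub (h.mem τ hτ) (h.mem t ht), norm_toSeq (memW_sub (h.mem τ hτ) (h.mem t ht))]

theorem hasDerivWithinAt_seq_apply {z : ℝ → Seq n} {z' : Seq n} {I : Set ℝ} {t : ℝ}
    (h : HasDerivWithinAt z z' I t) (J : Index n) :
    HasDerivWithinAt (fun τ => z τ J) (z' J) I t :=
  (evalSeq J).hasFDerivAt.comp_hasDerivWithinAt t h

/-- The unbounded linear part reappears when the rotation is differentiated component by component;
in the rotating frame the field is a bounded one. -/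
theorem isSolutionOn_of_rotField (hgw : GoodWeight n f c s κ K) (hP : MemP3 P)
    (hb : ∀ d 𝒥, ‖P d 𝒥‖₊ ≤ A * R ^ d) (hρ : 24 * K * R * (ρ : ℝ≥0∞) ≤ 1 / 2)
    (hg : ∀ z, ‖z‖ ≤ ρ → ofSeq f c s (g z) = nonlin P (ofSeq f c s z)) {I : Set ℝ} {z : ℝ → Seq n}
    (hz : ∀ t ∈ I, HasDerivWithinAt z (rotField ω g t (z t)) I t) (hzρ : ∀ t ∈ I, ‖z t‖ ≤ ρ) :
    IsSolutionOn f c s ω P I fun t => ofSeq f c s (rot ω t (z t)) where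
  mem t _ := memW_ofSeq _
  continuous t ht := by
    have hc0 : ContinuousAt (fun x : ℝ × Seq n => rot ω x.1 x.2) (t, z t) :=
      continuous_rot.continuousAt
    have hc1 : ContinuousWithinAt (fun t => (t, z t)) I t :=
      continuousWithinAt_id.prodMk (hz t ht).continuousWithinAt
    have hc := hc0.tendsto.comp hc1
    have h1 := tendsto_iff_norm_sub_tendsto_zero.1 hc
    refine h1.congr fun τ => ?_
    rw [← ofSeq_sub, normW_ofSeq]
    rfl
  summable t ht J := by
    refine summable_gradTerm hgw hP hb (ρ := ρ) ?_ ?_ J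
    · change wenorm f c s _ ≤ _
      rw [wenorm_ofSeq, enorm_eq_nnnorm]
      have := hzρ t ht
      rw [← norm_rot (ω := ω) t] at this
      exact_mod_cast this
    · refine le_trans ?_ hρ
      gcongr
      norm_num
  equation t ht J := by
    have h1 : HasDerivWithinAt (fun τ => z τ J) (rotField ω g t (z t) J) I t :=
      hasDerivWithinAt_seq_apply (hz t ht) J
    have h2 := (((hasDerivAt_phase (ω := ω) t J).hasDerivWithinAt (s := I)).mul h1).const_mul
      ((wtR f c s J : ℂ)⁻¹)
    have hn : ‖rot ω t (z t)‖ ≤ ρ := by rw [norm_rot]; exact hzρ t ht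
    rw [vectorField_eq, ← hg _ hn]
    refine h2.congr_deriv ?_
    simp only [ofSeq, rot_apply, rotField]
    have h3 := phase_neg_mul (ω := ω) t J
    linear_combination ((wtR f c s J : ℂ)⁻¹ * g (rot ω t (z t)) J) * h3

theorem IsSolutionOn.hasDerivWithinAt_rot_apply {I : Set ℝ} {u : ℝ → Index n → ℂ}
    (hg : ∀ z, ‖z‖ ≤ ρ → ofSeq f c s (g z) = nonlin P (ofSeq f c s z))
    (hu : IsSolutionOn f c s ω P I u)
    (huρ : ∀ t ∈ I, normW f c s (u t) ≤ ρ) (t : ℝ) (ht : t ∈ I) (J : Index n) :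
    HasDerivWithinAt (fun t => rot ω (-t) (toSeq f c s (u t)) J)
      (rotField ω g t (rot ω (-t) (toSeq f c s (u t))) J) I t := by
  have h1 : HasDerivWithinAt (fun τ => phase ω (-τ) J)
      (-(-(sgn J.2 : ℂ) * Complex.I * ω J.1 * phase ω (-t) J)) I t := by
    have := (hasDerivAt_phase (ω := ω) (-t) J).scomp t (hasDerivAt_neg t)
    simpa [Function.comp_def] using this.hasDerivWithinAt
  have h2 := h1.mul ((hu.equation t ht J).const_mul (wtR f c s J : ℂ))
  have e : ∀ τ ∈ I, rot ω (-τ) (toSeq f c s (u τ)) J =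
      phase ω (-τ) J * ((wtR f c s J : ℂ) * u τ J) := fun τ hτ => by
    rw [rot_apply, toSeq_apply (memW_iff.1 (hu.mem τ hτ))]
  refine (h2.congr e (e t ht)).congr_deriv ?_
  have hnorm : ‖toSeq f c s (u t)‖ ≤ ρ := by
    rw [norm_toSeq (hu.mem t ht)]
    exact huρ t ht
  have h4 := congrFun (hg _ hnorm) J
  rw [ofSeq_toSeq (memW_iff.1 (hu.mem t ht)), ofSeq,
    inv_mul_eq_iff_eq_mul₀ (wtR_ne_zero J)] at h4
  rw [rotField, rot_rot_neg, rot_apply, h4, vectorField_eq]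
  ring

/-- A solution satisfies the equation componentwise only. Its field along the curve is continuous in
the Hilbert space, and the primitive of this field has the same components as z. -/
theorem hasDerivWithinAt_of_apply {T : ℝ} (hT : 0 ≤ T) (hg' : LipschitzWith L g) {z : ℝ → Seq n}
    (hzc : ContinuousOn z (Set.Icc (-T) T))
    (hcomp : ∀ t ∈ Set.Icc (-T) T, ∀ J, HasDerivWithinAt (fun τ => z τ J)
      (rotField ω g t (z t) J) (Set.Icc (-T) T) t) (t : ℝ) (ht : t ∈ Set.Icc (-T) T) :
    HasDerivWithinAt z (rotField ω g t (z t)) (Set.Icc (-T) T) t := by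
  have h0 : (0 : ℝ) ∈ Set.Icc (-T) T := ⟨by linarith, hT⟩
  have hc1 : ContinuousOn (fun t => (t, z t)) (Set.Icc (-T) T) := continuousOn_id.prodMk hzc
  -- As a field that ignores the state, G turns `ODE.picard` into a plain primitive.
  obtain ⟨G, hG⟩ : ∃ G : ℝ → Seq n, G = fun t => rotField ω g t (z t) := ⟨_, rfl⟩
  have hGt : ∀ t, rotField ω g t (z t) = G t := fun t => (congrFun hG t).symm
  have hGc : ContinuousOn G (Set.Icc (-T) T) := by
    have h := (continuous_rotField (ω := ω) hg').comp_continuousOn hc1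
    rw [hG]
    exact h
  have hGc' : ContinuousOn (Function.uncurry fun t (_ : Seq n) => G t)
      (Set.Icc (-T) T ×ˢ Set.univ) := hGc.comp continuousOn_fst fun x hx => hx.1
  have hZd : ∀ t ∈ Set.Icc (-T) T, HasDerivWithinAt
      (ODE.picard (fun t _ => G t) 0 (z 0) z) (G t) (Set.Icc (-T) T) t := fun t ht =>
    ODE.hasDerivWithinAt_picard_Icc (u := Set.univ) h0 hGc' hzc (fun _ _ => Set.mem_univ _) (z 0) ht
  have hZ0 : ODE.picard (fun t _ => G t) 0 (z 0) z 0 = z 0 := by simp [ODE.picard]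
  generalize ODE.picard (fun t _ => G t) 0 (z 0) z = Z at hZd hZ0
  simp only [hGt] at hcomp ⊢
  have hzZ : ∀ t ∈ Set.Icc (-T) T, z t = Z t := by
    intro t ht
    ext J
    have hd : ∀ τ ∈ Set.Icc (-T) T,
        HasDerivWithinAt (fun τ => z τ J - Z τ J) 0 (Set.Icc (-T) T) τ := fun τ hτ => by
      have h1 := hasDerivWithinAt_seq_apply (hZd τ hτ) J
      have h2 := (hcomp τ hτ J).sub h1
      rw [sub_self] at h2
      exact h2
    have h2 := (convex_Icc (-T) T).norm_image_sub_le_of_norm_hasDerivWithin_le (C := 0) hd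
      (fun τ _ => by simp) h0 ht
    rw [hZ0, sub_self, sub_zero, zero_mul, norm_le_zero_iff, sub_eq_zero] at h2
    exact h2
  exact (hZd t ht).congr hzZ (hzZ t ht)

theorem IsSolutionOn.hasDerivWithinAt_rot {T : ℝ} (hT : 0 ≤ T) {u : ℝ → Index n → ℂ}
    (hg' : LipschitzWith L g)
    (hg : ∀ z, ‖z‖ ≤ ρ → ofSeq f c s (g z) = nonlin P (ofSeq f c s z))
    (hu : IsSolutionOn f c s ω P (Set.Icc (-T) T) u)
    (huρ : ∀ t ∈ Set.Icc (-T) T, normW f c s (u t) ≤ ρ) (t : ℝ) (ht : t ∈ Set.Icc (-T) T) :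
    HasDerivWithinAt (fun t => rot ω (-t) (toSeq f c s (u t)))
      (rotField ω g t (rot ω (-t) (toSeq f c s (u t)))) (Set.Icc (-T) T) t := by
  have hc1 : ContinuousOn (fun t => (-t, toSeq f c s (u t))) (Set.Icc (-T) T) :=
    continuousOn_id.neg.prodMk hu.continuousOn_toSeq
  have hc := (continuous_rot (ω := ω)).comp_continuousOn hc1
  exact hasDerivWithinAt_of_apply hT hg' hc (hu.hasDerivWithinAt_rot_apply hg huρ) t ht

theorem IsSolutionOn.eq_of_le {T : ℝ} {u v : ℝ → Index n → ℂ}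
    (hg' : LipschitzWith L g)
    (hg : ∀ z, ‖z‖ ≤ ρ → ofSeq f c s (g z) = nonlin P (ofSeq f c s z))
    (hu : IsSolutionOn f c s ω P (Set.Icc (-T) T) u)
    (hv : IsSolutionOn f c s ω P (Set.Icc (-T) T) v)
    (huρ : ∀ t ∈ Set.Icc (-T) T, normW f c s (u t) ≤ ρ)
    (hvρ : ∀ t ∈ Set.Icc (-T) T, normW f c s (v t) ≤ ρ) (h0 : v 0 = u 0) (t : ℝ)
    (ht : t ∈ Set.Icc (-T) T) : v t = u t := by
  have hT : 0 ≤ T := by have := ht.1; have := ht.2; linarith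
  have h := eqOn_of_rotField_solution hg' (hv.hasDerivWithinAt_rot hT hg' hg hvρ)
    (hu.hasDerivWithinAt_rot hT hg' hg huρ) (by simp only [h0]) ht
  have h1 : toSeq f c s (v t) = toSeq f c s (u t) := by
    have := congrArg (rot ω t) h
    simpa only [rot_rot_neg] using this
  rw [← ofSeq_toSeq (memW_iff.1 (hv.mem t ht)), h1, ofSeq_toSeq (memW_iff.1 (hu.mem t ht))]

/-- A continuity argument. -/
theorem forall_lt_of_forall_le {T b : ℝ} {φ : ℝ → ℝ}
    (hφ : ContinuousOn φ (Set.Icc (-T) T)) (h0 : φ 0 < b)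
    (h : ∀ t, 0 ≤ t → t ≤ T → (∀ τ ∈ Set.Icc (-t) t, φ τ ≤ b) → ∀ τ ∈ Set.Icc (-t) t, φ τ < b) :
    ∀ t ∈ Set.Icc (-T) T, φ t < b := by
  by_contra hcon
  push Not at hcon
  obtain ⟨t₁, ht₁, hb⟩ := hcon
  set I := Set.Icc (-T) T
  set B : Set ℝ := {t | t ∈ I ∧ b ≤ φ t} with hB
  have hBcl : IsClosed B := hφ.preimage_isClosed_of_isClosed isClosed_Icc isClosed_Ici
  have hBc : IsCompact B := isCompact_Icc.of_isClosed_subset hBcl fun t ht => ht.1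
  -- A time of least modulus at which the bound is violated; on the open interval before it the
  -- hypothesis of `h` holds, and by continuity on the closed one.
  obtain ⟨t₂, ht₂, hmin⟩ := hBc.exists_isMinOn ⟨t₁, ht₁, hb⟩ (f := fun t => |t|)
    continuous_abs.continuousOn
  have hT₂ : |t₂| ≤ T := abs_le.2 ht₂.1
  have hpos : 0 < |t₂| := by
    rw [abs_pos]
    rintro rfl
    exact absurd h0 (not_lt.2 ht₂.2)
  have hsub : Set.Icc (-|t₂|) |t₂| ⊆ I := Set.Icc_subset_Icc (by linarith) hT₂
  have hopen : ∀ τ ∈ Set.Ioo (-|t₂|) |t₂|, φ τ ≤ b := by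
    intro τ hτ
    by_contra hτb
    have h1 : τ ∈ B := ⟨hsub (Set.Ioo_subset_Icc_self hτ), (not_le.1 hτb).le⟩
    have h2 : |t₂| ≤ |τ| := hmin h1
    exact absurd (abs_lt.2 hτ) (not_lt.2 h2)
  have hclosed : ∀ τ ∈ Set.Icc (-|t₂|) |t₂|, φ τ ≤ b := by
    intro τ hτ
    have h1 : τ ∈ closure (Set.Ioo (-|t₂|) |t₂|) := by
      rwa [closure_Ioo (by linarith)]
    have h2 : ContinuousOn φ (closure (Set.Ioo (-|t₂|) |t₂|)) := by
      rw [closure_Ioo (by linarith)]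
      exact hφ.mono hsub
    exact le_on_closure hopen h2 continuousOn_const h1
  exact absurd (h |t₂| hpos.le hT₂ hclosed t₂ ⟨neg_abs_le _, le_abs_self _⟩) (not_lt.2 ht₂.2)

/-- Solutions in the interior of the ball are unique among all solutions. -/
theorem IsSolutionOn.unique {T : ℝ} {u v : ℝ → Index n → ℂ} (hρ : 0 < ρ)
    (hg' : LipschitzWith L g)
    (hg : ∀ z, ‖z‖ ≤ ρ → ofSeq f c s (g z) = nonlin P (ofSeq f c s z))
    (hu : IsSolutionOn f c s ω P (Set.Icc (-T) T) u)
    (hv : IsSolutionOn f c s ω P (Set.Icc (-T) T) v)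
    (huρ : ∀ t ∈ Set.Icc (-T) T, normW f c s (u t) ≤ ρ / 2) (h0 : v 0 = u 0) (t : ℝ)
    (ht : t ∈ Set.Icc (-T) T) : v t = u t := by
  have hT : 0 ≤ T := by have := ht.1; have := ht.2; linarith
  have hρ' : (0 : ℝ) < ρ := hρ
  set φ : ℝ → ℝ := fun t => ‖toSeq f c s (v t) - toSeq f c s (u t)‖ with hφ
  have hφc : ContinuousOn φ (Set.Icc (-T) T) :=
    (hv.continuousOn_toSeq.sub hu.continuousOn_toSeq).norm
  have hvle : ∀ τ ∈ Set.Icc (-T) T, φ τ ≤ ρ / 2 → normW f c s (v τ) ≤ ρ := fun τ hτ h1 => by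
    rw [← norm_toSeq (hv.mem τ hτ)]
    have h2 := huρ τ hτ
    rw [← norm_toSeq (hu.mem τ hτ)] at h2
    have h3 := norm_le_norm_add_norm_sub' (toSeq f c s (v τ)) (toSeq f c s (u τ))
    linarith
  have huρ' : ∀ t ∈ Set.Icc (-T) T, normW f c s (u t) ≤ ρ := fun t ht =>
    (huρ t ht).trans (by linarith)
  -- While the distance is at most ρ / 2, v lies in the ball of radius ρ; there uniqueness holds and
  -- the distance is zero.
  have hlt := forall_lt_of_forall_le (b := ρ / 2) hφc (by simp [hφ, h0, hρ]) (by
    intro t' ht'0 ht'T hle τ hτ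
    have hsub : Set.Icc (-t') t' ⊆ Set.Icc (-T) T := Set.Icc_subset_Icc (by linarith) ht'T
    have := (hu.mono hsub).eq_of_le hg' hg (hv.mono hsub) (fun x hx => huρ' x (hsub hx))
      (fun x hx => hvle x (hsub hx) (hle x hx)) h0 τ hτ
    simp only [hφ, this, sub_self, norm_zero]
    linarith)
  exact hu.eq_of_le hg' hg hv huρ' (fun x hx => hvle x hx (hlt x hx).le) h0 t ht

/-! ### Reality -/

/-- The conjugate sequence; real sequences are its fixed points. -/
noncomputable def conjSeq (u : Index n → ℂ) (J : Index n) : ℂ := (starRingEnd ℂ) (u (bar J))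

theorem conjSeq_eq_iff {u : Index n → ℂ} : conjSeq u = u ↔ IsRealSeq u := by
  constructor
  · intro h J
    have := congrFun h (bar J)
    rw [conjSeq, bar_bar] at this
    exact this.symm
  · intro h
    funext J
    rw [conjSeq, ← h, bar_bar]

/-- The conjugation of indices, as a permutation. -/
def barEquiv (n : ℕ) : Index n ≃ Index n where
  toFun := bar
  invFun := bar
  left_inv := bar_bar
  right_inv := bar_bar

theorem weightedSq_conjSeq (u : Index n → ℂ) (J : Index n) :
    weightedSq f c s (conjSeq u) J = weightedSq f c s u (bar J) := by
  simp [weightedSq, conjSeq, bar]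

theorem memW_conjSeq {u : Index n → ℂ} (hu : MemW f c s u) : MemW f c s (conjSeq u) := by
  unfold MemW
  simp only [funext (weightedSq_conjSeq (f := f) (c := c) (s := s) u)]
  exact (barEquiv n).summable_iff.2 hu

theorem normW_conjSeq (u : Index n → ℂ) : normW f c s (conjSeq u) = normW f c s u := by
  unfold normW
  rw [← (barEquiv n).tsum_eq]
  simp only [weightedSq_conjSeq]
  simp [barEquiv, bar_bar]

theorem conjSeq_sub (u v : Index n → ℂ) : conjSeq (u - v) = conjSeq u - conjSeq v := by
  funext J
  simp [conjSeq]

/-- The reindexing of the terms of the gradient under conjugation. -/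
def termEquiv (n : ℕ) : ((d : ℕ) × (Fin d × (Fin d → Index n))) ≃
    ((d : ℕ) × (Fin d × (Fin d → Index n))) :=
  Equiv.sigmaCongrRight fun _ => (Equiv.refl _).prodCongr (Equiv.arrowCongr (Equiv.refl _) (barEquiv n))

theorem gradTerm_conjSeq (hP : MemP3 P) (u : Index n → ℂ) (J : Index n)
    (q : (d : ℕ) × (Fin d × (Fin d → Index n))) :
    gradTerm P J (conjSeq u) (termEquiv n q) = (starRingEnd ℂ) (gradTerm P (bar J) u q) := by
  obtain ⟨d, l, 𝒥⟩ := q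
  have e : termEquiv n ⟨d, l, 𝒥⟩ = ⟨d, l, fun i => bar (𝒥 i)⟩ := rfl
  rw [e]
  simp only [gradTerm]
  have h : (bar (𝒥 l) = J) = (𝒥 l = bar J) := propext
    ⟨fun h => by rw [← h, bar_bar], fun h => by rw [h, bar_bar]⟩
  simp only [h]
  split_ifs
  · rw [map_mul, hP.reality, map_prod]
    simp only [conjSeq, bar_bar]
  · simp

theorem summable_gradTerm_conjSeq (hP : MemP3 P) {u : Index n → ℂ} {J : Index n}
    (h : Summable (gradTerm P (bar J) u)) : Summable (gradTerm P J (conjSeq u)) := by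
  rw [← (termEquiv n).summable_iff]
  have : gradTerm P J (conjSeq u) ∘ termEquiv n =
      fun q => (starRingEnd ℂ) (gradTerm P (bar J) u q) := funext (gradTerm_conjSeq hP u J)
  rw [this]
  exact Complex.summable_conj.2 h

theorem gradP_conjSeq (hP : MemP3 P) (u : Index n → ℂ) (J : Index n) :
    gradP P J (conjSeq u) = (starRingEnd ℂ) (gradP P (bar J) u) := by
  rw [gradP, ← (termEquiv n).tsum_eq, tsum_congr (gradTerm_conjSeq hP u J), gradP, Complex.conj_tsum]

theorem vectorField_conjSeq (hP : MemP3 P) (u : Index n → ℂ) (J : Index n) :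
    vectorField ω P (conjSeq u) J = (starRingEnd ℂ) (vectorField ω P u (bar J)) := by
  rw [vectorField, vectorField, gradH, gradH, gradP_conjSeq hP]
  simp [conjSeq, bar, sgn_neg, map_mul]

theorem IsSolutionOn.conjSeq (hP : MemP3 P) {I : Set ℝ} {u : ℝ → Index n → ℂ}
    (h : IsSolutionOn f c s ω P I u) : IsSolutionOn f c s ω P I fun t => conjSeq (u t) where
  mem t ht := memW_conjSeq (h.mem t ht)
  continuous t ht := by
    refine (h.continuous t ht).congr fun τ => ?_
    rw [← conjSeq_sub, normW_conjSeq]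
  summable t ht J := summable_gradTerm_conjSeq hP (h.summable t ht _)
  equation t ht J := by
    rw [vectorField_conjSeq hP]
    exact Complex.conjCLE.toContinuousLinearMap.hasFDerivAt.comp_hasDerivWithinAt t
      (h.equation t ht (bar J))

/-- The conjugate curve solves the same equation with the same initial value, so uniqueness applies.
-/
theorem IsSolutionOn.isRealSeq {T : ℝ} {u : ℝ → Index n → ℂ} (hP : MemP3 P)
    (hg' : LipschitzWith L g)
    (hg : ∀ z, ‖z‖ ≤ ρ → ofSeq f c s (g z) = nonlin P (ofSeq f c s z))
    (hu : IsSolutionOn f c s ω P (Set.Icc (-T) T) u)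
    (huρ : ∀ t ∈ Set.Icc (-T) T, normW f c s (u t) ≤ ρ) (h0 : IsRealSeq (u 0)) (t : ℝ)
    (ht : t ∈ Set.Icc (-T) T) : IsRealSeq (u t) := by
  rw [← conjSeq_eq_iff] at h0 ⊢
  exact hu.eq_of_le hg' hg (hu.conjSeq hP) huρ
    (fun t ht => (normW_conjSeq (u t)).trans_le (huρ t ht)) h0 t ht

end Solution

/-! ### Truncation -/

section Tail

variable {n : ℕ} {f : ℝ → ℝ} {c s : ℝ}

open Classical in
/-- The part of a sequence outside of a box. -/
noncomputable def tail (k : ℕ) (z : Seq n) : Seq n :=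
  ⟨fun J => if J ∈ boxModes n k then 0 else z J, memℓp_of_l2_ne_top (ne_top_of_le_ne_top
    (b := ‖z‖ₑ) enorm_ne_top (by
      rw [← l2_enorm]
      refine l2_mono fun J => ?_
      split_ifs
      · simp
      · exact le_rfl))⟩

open Classical in
theorem tail_apply (k : ℕ) (z : Seq n) (J : Index n) :
    tail k z J = if J ∈ boxModes n k then 0 else z J := rfl

theorem norm_le_of_forall_enorm_le {z z' : Seq n} (h : ∀ J, ‖z J‖ₑ ≤ ‖z' J‖ₑ) : ‖z‖ ≤ ‖z'‖ := by
  have h1 : ‖z‖ₑ ≤ ‖z'‖ₑ := by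
    rw [← l2_enorm, ← l2_enorm]
    exact l2_mono h
  rw [enorm_eq_nnnorm, enorm_eq_nnnorm] at h1
  exact_mod_cast h1

theorem norm_tail_le (k : ℕ) (z : Seq n) : ‖tail k z‖ ≤ ‖z‖ :=
  norm_le_of_forall_enorm_le fun J => by
    rw [tail_apply]
    split_ifs
    · simp
    · exact le_rfl

theorem norm_tail_anti {k k' : ℕ} (h : k ≤ k') (z : Seq n) : ‖tail k' z‖ ≤ ‖tail k z‖ :=
  norm_le_of_forall_enorm_le fun J => by
    rw [tail_apply, tail_apply]
    by_cases h1 : J ∈ boxModes n k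
    · rw [if_pos h1, if_pos (boxModes_mono h h1)]
    · rw [if_neg h1]
      split_ifs
      · simp
      · exact le_rfl

theorem tail_sub (k : ℕ) (z z' : Seq n) : tail k (z - z') = tail k z - tail k z' := by
  ext J
  rw [lp.coeFn_sub, Pi.sub_apply, tail_apply, tail_apply, tail_apply]
  split_ifs
  · simp
  · rfl

theorem continuous_tail (k : ℕ) : Continuous (tail (n := n) k) := by
  refine (LipschitzWith.of_dist_le_mul (K := 1) fun z z' => ?_).continuous
  rw [dist_eq_norm, dist_eq_norm, ← tail_sub, NNReal.coe_one, one_mul]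
  exact norm_tail_le _ _

theorem tendsto_norm_tail (z : Seq n) : Tendsto (fun k => ‖tail k z‖) atTop (𝓝 0) := by
  have h2 : (0 : ℝ) < (2 : ℝ≥0∞).toReal := by norm_num
  have hsq : Tendsto (fun k => ‖tail k z‖ ^ 2) atTop (𝓝 0) := by
    have he : ∀ k, ‖tail k z‖ ^ 2 = ∑' J, ‖tail k z J‖ ^ 2 := fun k => by
      have := lp.norm_rpow_eq_tsum h2 (tail k z)
      simpa only [ENNReal.toReal_ofNat, Real.rpow_ofNat] using this
    simp only [he]
    have hsum : Summable fun J => ‖z J‖ ^ 2 := by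
      have := (memℓp_gen_iff h2).1 (lp.memℓp z)
      simpa only [ENNReal.toReal_ofNat, Real.rpow_ofNat] using this
    have h0 : (0 : ℝ) = ∑' J : Index n, 0 := by simp
    rw [h0]
    refine tendsto_tsum_of_dominated_convergence hsum (fun J => ?_)
      (Eventually.of_forall fun k J => ?_)
    · obtain ⟨k₀, hk₀⟩ := exists_mem_boxModes J
      refine tendsto_const_nhds.congr' ?_
      filter_upwards [eventually_ge_atTop k₀] with k hk
      rw [tail_apply, if_pos (boxModes_mono hk hk₀)]
      simp
    · rw [Real.norm_of_nonneg (sq_nonneg _), tail_apply]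
      split_ifs
      · simp
      · exact le_rfl
  have := hsq.sqrt
  simpa [Real.sqrt_sq (norm_nonneg _)] using this

/-- On a compact set of times the tails of a continuous curve are uniformly small. -/
theorem exists_norm_tail_lt {z : ℝ → Seq n} {I : Set ℝ} (hI : IsCompact I) (hz : ContinuousOn z I)
    {δ : ℝ} (hδ : 0 < δ) : ∃ k₀, ∀ k ≥ k₀, ∀ t ∈ I, ‖tail k (z t)‖ < δ := by
  -- Dini's theorem: the norms of the tails decrease in k and converge pointwise to the continuous
  -- limit zero.
  have h1 : TendstoLocallyUniformlyOn (fun k t => ‖tail k (z t)‖) (fun _ => (0 : ℝ)) atTop I := by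
    refine Antitone.tendstoLocallyUniformlyOn_of_forall_tendsto (fun k => ?_)
      (fun t _ k k' h => norm_tail_anti h (z t)) continuousOn_const
      (fun t _ => tendsto_norm_tail (z t))
    have := (continuous_tail (n := n) k).norm.comp_continuousOn hz
    exact this
  have h2 := (tendstoLocallyUniformlyOn_iff_tendstoUniformlyOn_of_compact hI).1 h1
  obtain ⟨k₀, hk₀⟩ := eventually_atTop.1 (Metric.tendstoUniformlyOn_iff.1 h2 δ hδ)
  refine ⟨k₀, fun k hk t ht => ?_⟩
  have := hk₀ k hk t ht
  simpa using this

theorem sub_extend_eq {u : Index n → ℂ} (hu : wenorm f c s u ≠ ∞) (k : ℕ) :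
    (u - extend fun J : Mode n k => u J.1) = ofSeq f c s (tail k (toSeq f c s u)) := by
  classical
  funext J
  rw [Pi.sub_apply, ofSeq, tail_apply, extend]
  split_ifs with h
  · simp
  · rw [toSeq_apply hu, inv_mul_cancel_left₀ (wtR_ne_zero J), sub_zero]

theorem wenorm_sub_extend {u : Index n → ℂ} (hu : wenorm f c s u ≠ ∞) (k : ℕ) :
    wenorm f c s (u - extend fun J : Mode n k => u J.1) =
      ENNReal.ofReal ‖tail k (toSeq f c s u)‖ := by
  rw [sub_extend_eq hu, wenorm_ofSeq, ofReal_norm]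

theorem wenorm_extend_le (u : Index n → ℂ) (k : ℕ) :
    wenorm f c s (extend fun J : Mode n k => u J.1) ≤ wenorm f c s u := by
  classical
  refine wnorm_mono fun J => ?_
  rw [extend]
  split_ifs
  · exact le_rfl
  · simp

theorem nrm_le_wnorm {k : ℕ} {y : Mode n k → ℝ≥0∞} {x : Index n → ℝ≥0∞} (h : ∀ J, y J ≤ x J.1) :
    (modePhase n k).nrm (wt f c s) y ≤ wnorm f c s x := by
  refine (ENNReal.pow_le_pow_left_iff two_ne_zero).1 ?_
  rw [Phase.nrm, wnorm, l2_sq, l2_sq]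
  refine le_trans (ENNReal.tsum_le_tsum fun J => ?_) (ENNReal.tsum_comp_le_tsum_of_injective
    (f := ((↑) : Mode n k → Index n)) Subtype.val_injective fun J => (wt f c s (mom J) * x J) ^ 2)
  have := h J
  simp only [modePhase]
  gcongr

theorem nrm_le_wenorm (u : Index n → ℂ) (k : ℕ) :
    (modePhase n k).nrm (wt f c s) (fun J => ‖u J.1‖ₑ) ≤ wenorm f c s u :=
  nrm_le_wnorm fun _ => le_rfl

theorem wenorm_sq_le_of_forall_nrm {u : Index n → ℂ} {b : ℝ≥0∞} {k₀ : ℕ}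
    (h : ∀ k ≥ k₀, (modePhase n k).nrm (wt f c s) (fun J => ‖u J.1‖ₑ) ^ 2 ≤ b) :
    wenorm f c s u ^ 2 ≤ b := by
  rw [wenorm, wnorm, l2_sq, ENNReal.tsum_eq_iSup_sum' (fun k => boxModes n (k + k₀)) fun t => ?_]
  · refine iSup_le fun k => le_trans (le_of_eq ?_) (h (k + k₀) (Nat.le_add_left _ _))
    rw [Phase.nrm, l2_sq, tsum_fintype (L := .unconditional (Mode n (k + k₀))),
      ← Finset.sum_coe_sort]
    rfl
  · choose g hg using exists_mem_boxModes (n := n)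
    exact ⟨t.sup g, fun J hJ =>
      boxModes_mono ((Finset.le_sup hJ).trans (Nat.le_add_right _ _)) (hg J)⟩

end Tail

/-! ### The energy estimate -/

section Energy

theorem hasDerivWithinAt_eval {ι : Type*} [Fintype ι] [DecidableEq ι] {v : ℝ → ι → ℂ} {v' : ι → ℂ}
    {I : Set ℝ} {t : ℝ} (h : ∀ J, HasDerivWithinAt (fun τ => v τ J) (v' J) I t)
    (A : MvPolynomial ι ℂ) :
    HasDerivWithinAt (fun τ => eval (v τ) A) (dEval (v t) v' A) I t := by
  induction A using MvPolynomial.induction_on with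
  | C a => simpa [dEval_apply] using hasDerivWithinAt_const t I a
  | add A B hA hB =>
    simp only [map_add]
    exact hA.add hB
  | mul_X A J hA =>
    have hX : dEval (v t) v' (X J) = v' J := by
      rw [dEval_apply, Finset.sum_eq_single J]
      · simp
      · intro K _ hK
        simp [pderiv_X, hK]
      · simp
    simp only [map_mul, eval_X, dEval_mul, hX]
    exact hA.mul (h J)

variable {n : ℕ} {f : ℝ → ℝ} {c s κ : ℝ} {K A R : ℝ≥0} {P : FormalSeries n}
  {ω : (Fin n → ℤ) → ℝ} {rep : (Fin n → ℤ) → Fin n → ℤ} {N : ℝ} {r : ℕ} {B : ℝ≥0} {M ρ : ℝ≥0∞}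

/-- The difference of the field and the field of a truncated system. -/
noncomputable def fieldError (ω : (Fin n → ℤ) → ℝ) (P : FormalSeries n) (r k : ℕ) (u : Index n → ℂ)
    (J : Mode n k) : ℂ :=
  vectorField ω P u J.1 -
    ∑ a ∈ Finset.range (r + 1), (modePhase n k).field (fun J => u J.1) (modeHam ω P k a) J

/-- Two sources of error: restricting u to the box, which costs the Lipschitz constant of the field,
and dropping the Hamiltonian terms of degree larger than r + 2. -/
theorem nrm_fieldError_le (hgw : GoodWeight n f c s κ K) (hP : MemP3 P)
    (hb : ∀ d 𝒥, ‖P d 𝒥‖₊ ≤ A * R ^ d) {u : Index n → ℂ} (hu : wenorm f c s u ≤ ρ)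
    (hρ : 24 * K * R * ρ ≤ 1 / 2) (r k : ℕ) :
    (modePhase n k).nrm (wt f c s) (fun J => ‖fieldError ω P r k u J‖ₑ) ≤
      24 * A * R ^ 2 * K * wt f c s (0 : Fin n → ℤ) *
        wenorm f c s (u - extend fun J : Mode n k => u J.1) +
      4 * A * R * wt f c s (0 : Fin n → ℤ) * (6 * K * R * ρ) ^ (r + 2) := by
  set v : Index n → ℂ := extend fun J : Mode n k => u J.1 with hv
  have hvρ : wenorm f c s v ≤ ρ := (wenorm_extend_le u k).trans hu
  have hρ' : 12 * K * R * ρ ≤ 1 / 2 := by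
    refine le_trans ?_ hρ
    gcongr
    norm_num
  refine le_trans (nrm_le_wnorm (x := fun J => ‖(nonlin P u - nonlin P v) J‖ₑ +
    ∑' d, gradNorm P (d + (r + 2) + 1) v J) fun J => ?_) ((wnorm_add_le _ _).trans (add_le_add
      (wenorm_nonlin_sub_le hgw hP hb hu hvρ hρ) (wnorm_tsum_gradNorm_le hgw hP hb (r + 2) hvρ hρ')))
  have e : fieldError ω P r k u J = (nonlin P u - nonlin P v) J.1 +
      -(sgn J.1.2 : ℂ) * Complex.I * (gradP P (bar J.1) v -
        ∑ d ∈ Finset.range (r + 3), gradDeg P d (bar J.1) v) := by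
    rw [fieldError, sum_field_modeHam hP, vectorField_eq, Pi.sub_apply, nonlin, nonlin]
    ring
  rw [e]
  refine (enorm_add_le _ _).trans (add_le_add le_rfl ?_)
  rw [enorm_sgn_mul]
  exact enorm_gradP_sub_sum_le (summable_gradTerm hgw hP hb hvρ hρ' _) (r + 3)

/-- Reality turns u_J u_{bar J} into |u_J|², so the quadratic energy is a weighted norm. -/
theorem enorm_eval_quad {k : ℕ} {w : Mode n k → ℝ≥0} {u : Index n → ℂ} (hu : IsRealSeq u) :
    ‖eval (fun J : Mode n k => u J.1) ((modePhase n k).quad fun J => ((w J : ℝ) : ℂ))‖ₑ =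
      ∑ J, (w J : ℝ≥0∞) * ‖u J.1‖ₑ ^ 2 := by
  have e : eval (fun J : Mode n k => u J.1) ((modePhase n k).quad fun J => ((w J : ℝ) : ℂ)) =
      (((∑ J, w J * ‖u J.1‖₊ ^ 2 : ℝ≥0) : ℝ) : ℂ) := by
    rw [Phase.quad, map_sum]
    push_cast
    refine Finset.sum_congr rfl fun J _ => ?_
    simp only [map_mul, eval_C, eval_X]
    rw [show u ((modePhase n k).bar J).1 = (starRingEnd ℂ) (u J.1) from hu J.1, Complex.mul_conj,
      Complex.normSq_eq_norm_sq]
    push_cast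
    rfl
  rw [e, enorm_eq_nnnorm, Complex.nnnorm_real, NNReal.nnnorm_eq]
  push_cast
  rfl

theorem enorm_sub_le_of_enorm_deriv_le {F F' : ℝ → ℂ} {T t : ℝ} {D : ℝ≥0∞} (hD : D ≠ ∞)
    (hF : ∀ τ ∈ Set.Icc (-T) T, HasDerivWithinAt F (F' τ) (Set.Icc (-T) T) τ)
    (hF' : ∀ τ ∈ Set.Icc (-T) T, ‖F' τ‖ₑ ≤ D) (ht : t ∈ Set.Icc (-T) T) :
    ‖F t - F 0‖ₑ ≤ ENNReal.ofReal T * D := by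
  have hT : 0 ≤ T := by have := ht.1; have := ht.2; linarith
  have h := (convex_Icc (-T) T).norm_image_sub_le_of_norm_hasDerivWithin_le (C := D.toReal) hF
    (fun τ hτ => by
      rw [← toReal_enorm]
      exact ENNReal.toReal_mono hD (hF' τ hτ)) (x := 0) (y := t) ⟨by linarith, hT⟩ ht
  rw [sub_zero, Real.norm_eq_abs] at h
  rw [← ofReal_norm]
  refine (ENNReal.ofReal_le_ofReal (h.trans (mul_le_mul_of_nonneg_left (abs_le.2 ht)
    ENNReal.toReal_nonneg))).trans ?_
  rw [mul_comm, ENNReal.ofReal_mul hT, ENNReal.ofReal_toReal hD]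

theorem hasDerivWithinAt_eval_of_isSolutionOn {I : Set ℝ} {u : ℝ → Index n → ℂ}
    (hu : IsSolutionOn f c s ω P I u) {t : ℝ} (ht : t ∈ I) (k : ℕ)
    (E : MvPolynomial (Mode n k) ℂ) :
    HasDerivWithinAt (fun τ => eval (fun J : Mode n k => u τ J.1) E)
      (dEval (fun J : Mode n k => u t J.1) (fun J => ∑ a ∈ Finset.range (r + 1),
        (modePhase n k).field (fun J => u t J.1) (modeHam ω P k a) J +
          fieldError ω P r k (u t) J) E) I t := by
  refine hasDerivWithinAt_eval (v := fun τ (J : Mode n k) => u τ J.1) (fun J => ?_) E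
  simp only [fieldError, add_sub_cancel]
  exact hu.equation t ht J.1

theorem modeWeight_le {k : ℕ} {M : ℝ≥0∞}
    (hM : ∀ j, ENNReal.ofReal (Real.exp (2 * s * f (bracket c (rep j)))) ≤ M * wt f c s j ^ 2)
    (J : Mode n k) : (modeWeight f c s rep k J : ℝ≥0∞) ≤ M * wt f c s ((modePhase n k).q J) ^ 2 := by
  simp only [modePhase]
  rw [wt_mom]
  exact hM J.1.1

theorem enorm_quad_le {k : ℕ} {M : ℝ≥0∞} {u : Index n → ℂ} (hu : IsRealSeq u)
    (hM : ∀ j, ENNReal.ofReal (Real.exp (2 * s * f (bracket c (rep j)))) ≤ M * wt f c s j ^ 2) :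
    ‖eval (fun J : Mode n k => u J.1)
      ((modePhase n k).quad fun J => ((modeWeight f c s rep k J : ℝ) : ℂ))‖ₑ ≤
      M * (modePhase n k).nrm (wt f c s) (fun J => ‖u J.1‖ₑ) ^ 2 := by
  rw [enorm_eval_quad hu, Phase.nrm, l2_sq, tsum_fintype (L := .unconditional (Mode n k)),
    Finset.mul_sum]
  refine Finset.sum_le_sum fun J _ => ?_
  rw [mul_pow, ← mul_assoc]
  exact mul_le_mul_left (modeWeight_le hM J) _

theorem nrm_sq_le_quad {k : ℕ} {M : ℝ≥0∞} {u : Index n → ℂ} (hu : IsRealSeq u)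
    (hM : ∀ j, wt f c s j ^ 2 ≤ M * ENNReal.ofReal (Real.exp (2 * s * f (bracket c (rep j))))) :
    (modePhase n k).nrm (wt f c s) (fun J => ‖u J.1‖ₑ) ^ 2 ≤
      M * ‖eval (fun J : Mode n k => u J.1)
        ((modePhase n k).quad fun J => ((modeWeight f c s rep k J : ℝ) : ℂ))‖ₑ := by
  rw [enorm_eval_quad hu, Phase.nrm, l2_sq, tsum_fintype (L := .unconditional (Mode n k)),
    Finset.mul_sum]
  refine Finset.sum_le_sum fun J _ => ?_
  rw [mul_pow, ← mul_assoc]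
  refine mul_le_mul_left ?_ _
  simp only [modePhase]
  rw [wt_mom]
  exact hM J.1.1

/-- The three contributions are the initial energy, twice the distance between modified and
quadratic energy, and the drift over a time T. The outer factor M converts block weights back to the
weights of `W_s`. -/
theorem nrm_sq_le (hgw : GoodWeight n f c s κ K) (hP : MemP3 P)
    (hb : ∀ d 𝒥, ‖P d 𝒥‖₊ ≤ A * R ^ d) {M ρ δ : ℝ≥0}
    (hM : ∀ j, ENNReal.ofReal (Real.exp (2 * s * f (bracket c (rep j)))) ≤ M * wt f c s j ^ 2)
    (hM' : ∀ j, wt f c s j ^ 2 ≤ M * ENNReal.ofReal (Real.exp (2 * s * f (bracket c (rep j)))))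
    {k : ℕ} {χ Z : ℕ → MvPolynomial (Mode n k) ℂ}
    (nf : NormalForm (modePhase n k) (modeHigh rep N k) r B (modeWeight f c s rep k)
      (modeHam ω P k) χ Z) {a : ℝ} (ha : ∀ j, N < len (rep j) → a ≤ f (bracket c j))
    {T t : ℝ} {u : ℝ → Index n → ℂ} (hu : IsSolutionOn f c s ω P (Set.Icc (-T) T) u)
    (hreal : ∀ τ ∈ Set.Icc (-T) T, IsRealSeq (u τ))
    (huρ : ∀ τ ∈ Set.Icc (-T) T, wenorm f c s (u τ) ≤ ρ)
    (hδ : ∀ τ ∈ Set.Icc (-T) T,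
      wenorm f c s (u τ - extend fun J : Mode n k => u τ J.1) ≤ δ)
    (hρ : 24 * K * R * (ρ : ℝ≥0∞) ≤ 1 / 2)
    (hx : 300 * K ^ 2 * wt f c s (0 : Fin n → ℤ) * B * (ρ : ℝ≥0∞) ≤ 1 / 2)
    (ht : t ∈ Set.Icc (-T) T) :
    (modePhase n k).nrm (wt f c s) (fun J => ‖u t J.1‖ₑ) ^ 2 ≤
      M * (M * wenorm f c s (u 0) ^ 2 +
        312 * M * K ^ 2 * wt f c s (0 : Fin n → ℤ) ^ 2 * ρ ^ 2 * (3 * K * B * ρ) +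
        ENNReal.ofReal T * (7000 * M * K ^ 3 * wt f c s (0 : Fin n → ℤ) ^ 3 *
          (ENNReal.ofReal (Real.exp (-(s * (1 - κ) / 2) * a)) * ρ ^ 2 +
            ρ ^ 2 * (300 * K ^ 2 * wt f c s (0 : Fin n → ℤ) * B * ρ) ^ (r + 1) +
            ρ * (24 * A * R ^ 2 * K * wt f c s (0 : Fin n → ℤ) * δ +
              4 * A * R * wt f c s (0 : Fin n → ℤ) * (6 * K * R * ρ) ^ (r + 2))))) := by
  have hT : 0 ≤ T := by have := ht.1; have := ht.2; linarith
  have h0 : (0 : ℝ) ∈ Set.Icc (-T) T := ⟨by linarith, hT⟩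
  have hw := hgw.tameWeight (e := ((↑) : Mode n k → Index n)) Subtype.val_injective
  have hH := hgw.highGain (e := ((↑) : Mode n k → Index n)) Subtype.val_injective
    (modeHigh rep N k) a fun J hJ => ha _ hJ
  have hα : ∀ g : Fin n → ℤ, wt f c s (-g) = wt f c s g := wt_neg
  have hα0 : wt f c s (0 : Fin n → ℤ) ≠ ∞ := wt_ne_top _
  have hx3 : 3 * K * B * (ρ : ℝ≥0∞) ≤ 1 / 2 := by
    refine le_trans ?_ hx
    have h1 : (1 : ℝ≥0∞) ≤ K * wt f c s (0 : Fin n → ℤ) := one_le_mul hw.one_le hw.one_le_zero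
    calc 3 * K * B * (ρ : ℝ≥0∞) = 3 * K * 1 * B * ρ := by ring
      _ ≤ 300 * K * (K * wt f c s (0 : Fin n → ℤ)) * B * ρ := by gcongr; norm_num
      _ = _ := by ring
  have hv : ∀ τ ∈ Set.Icc (-T) T,
      (modePhase n k).nrm (wt f c s) (fun J => ‖u τ J.1‖ₑ) ≤ ρ := fun τ hτ =>
    (nrm_le_wenorm _ k).trans (huρ τ hτ)
  set Q := (modePhase n k).quad fun J => ((modeWeight f c s rep k J : ℝ) : ℂ) with hQ
  set E := (modePhase n k).energy χ (modeWeight f c s rep k) r with hE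
  set F : ℝ → ℂ := fun τ => eval (fun J : Mode n k => u τ J.1) E with hF
  set q : ℝ → ℂ := fun τ => eval (fun J : Mode n k => u τ J.1) Q with hq
  have hdiff : ∀ τ ∈ Set.Icc (-T) T, ‖F τ - q τ‖ₑ ≤
      156 * M * K ^ 2 * wt f c s (0 : Fin n → ℤ) ^ 2 * ρ ^ 2 * (3 * K * B * ρ) := fun τ hτ =>
    nf.enorm_energy_sub_le hw hα (modeWeight_le hM) (hv τ hτ) hx3
  have hdrift := enorm_sub_le_of_enorm_deriv_le (t := t) (F := F)
    (D := 7000 * M * K ^ 3 * wt f c s (0 : Fin n → ℤ) ^ 3 *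
          (ENNReal.ofReal (Real.exp (-(s * (1 - κ) / 2) * a)) * ρ ^ 2 +
            ρ ^ 2 * (300 * K ^ 2 * wt f c s (0 : Fin n → ℤ) * B * ρ) ^ (r + 1) +
            ρ * (24 * A * R ^ 2 * K * wt f c s (0 : Fin n → ℤ) * δ +
              4 * A * R * wt f c s (0 : Fin n → ℤ) * (6 * K * R * ρ) ^ (r + 2))))
    (by finiteness)
    (fun τ hτ => hasDerivWithinAt_eval_of_isSolutionOn (r := r) hu hτ k E) (fun τ hτ => by
      refine (nf.enorm_dEval_energy_le hw hα (modeWeight_le hM) hH (hv τ hτ) hx _).trans ?_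
      refine mul_le_mul_right (add_le_add le_rfl (mul_le_mul_right ?_ _)) _
      refine (nrm_fieldError_le hgw hP hb (huρ τ hτ) hρ r k).trans
        (add_le_add (mul_le_mul_right (hδ τ hτ) _) le_rfl)) ht
  have hq0 : ‖q 0‖ₑ ≤ M * wenorm f c s (u 0) ^ 2 :=
    (enorm_quad_le (hreal 0 h0) hM).trans
      (mul_le_mul_right (pow_le_pow_left' (nrm_le_wenorm _ k) 2) _)
  refine (nrm_sq_le_quad (hreal t ht) hM').trans (mul_le_mul_right ?_ _)
  -- The quadratic energy changes by the drift of F plus two comparison errors; these turn 156 into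
  -- 312.
  have e : q t = q 0 + (F 0 - q 0) - (F t - q t) + (F t - F 0) := by ring
  change ‖q t‖ₑ ≤ _
  rw [e]
  refine (enorm_add_le _ _).trans (add_le_add ?_ hdrift)
  refine enorm_sub_le.trans ?_
  refine (add_le_add ((enorm_add_le _ _).trans (add_le_add hq0 (hdiff 0 h0))) (hdiff t ht)).trans
    (le_of_eq ?_)
  ring

/-- The energy estimate for solutions of the full system. -/
theorem IsSolutionOn.wenorm_sq_le (hgw : GoodWeight n f c s κ K) (hP : MemP3 P)
    (hb : ∀ d 𝒥, ‖P d 𝒥‖₊ ≤ A * R ^ d) {M ρ : ℝ≥0}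
    (hM : ∀ j, ENNReal.ofReal (Real.exp (2 * s * f (bracket c (rep j)))) ≤ M * wt f c s j ^ 2)
    (hM' : ∀ j, wt f c s j ^ 2 ≤ M * ENNReal.ofReal (Real.exp (2 * s * f (bracket c (rep j)))))
    (hnf : ∀ k, ∃ χ Z, NormalForm (modePhase n k) (modeHigh rep N k) r B
      (modeWeight f c s rep k) (modeHam ω P k) χ Z)
    {a : ℝ} (ha : ∀ j, N < len (rep j) → a ≤ f (bracket c j))
    {T t : ℝ} {u : ℝ → Index n → ℂ} (hu : IsSolutionOn f c s ω P (Set.Icc (-T) T) u)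
    (hreal : ∀ τ ∈ Set.Icc (-T) T, IsRealSeq (u τ))
    (huρ : ∀ τ ∈ Set.Icc (-T) T, wenorm f c s (u τ) ≤ ρ)
    (hρ : 24 * K * R * (ρ : ℝ≥0∞) ≤ 1 / 2)
    (hx : 300 * K ^ 2 * wt f c s (0 : Fin n → ℤ) * B * (ρ : ℝ≥0∞) ≤ 1 / 2)
    (ht : t ∈ Set.Icc (-T) T) {δ : ℝ≥0} (hδ : 0 < δ) :
    wenorm f c s (u t) ^ 2 ≤
      M * (M * wenorm f c s (u 0) ^ 2 +
        312 * M * K ^ 2 * wt f c s (0 : Fin n → ℤ) ^ 2 * ρ ^ 2 * (3 * K * B * ρ) +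
        ENNReal.ofReal T * (7000 * M * K ^ 3 * wt f c s (0 : Fin n → ℤ) ^ 3 *
          (ENNReal.ofReal (Real.exp (-(s * (1 - κ) / 2) * a)) * ρ ^ 2 +
            ρ ^ 2 * (300 * K ^ 2 * wt f c s (0 : Fin n → ℤ) * B * ρ) ^ (r + 1) +
            ρ * (24 * A * R ^ 2 * K * wt f c s (0 : Fin n → ℤ) * δ +
              4 * A * R * wt f c s (0 : Fin n → ℤ) * (6 * K * R * ρ) ^ (r + 2))))) := by
  -- The box is chosen after δ. The constants are the same on all larger boxes, so the bound passes
  -- to the full norm.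
  obtain ⟨k₀, hk₀⟩ := exists_norm_tail_lt isCompact_Icc hu.continuousOn_toSeq
    (δ := (δ : ℝ)) hδ
  refine wenorm_sq_le_of_forall_nrm (k₀ := k₀) fun k hk => ?_
  obtain ⟨χ, Z, nf⟩ := hnf k
  refine nrm_sq_le hgw hP hb hM hM' nf ha hu hreal huρ (fun τ hτ => ?_) hρ hx ht
  rw [wenorm_sub_extend (memW_iff.1 (hu.mem τ hτ)), ← ENNReal.ofReal_coe_nnreal]
  exact ENNReal.ofReal_le_ofReal (hk₀ k hk τ hτ).le

end Energy

/-! ### Solutions with an a priori bound -/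

section Apriori

variable {n : ℕ} {f : ℝ → ℝ} {c s κ : ℝ} {K A R : ℝ≥0} {P : FormalSeries n}
  {ω : (Fin n → ℤ) → ℝ}

/-- The cut-off field has a solution on all of [-T, T], which solves the true equation as long as it
stays in the ball. The a priori bound prevents it from ever leaving. -/
theorem exists_solution_of_apriori (hgw : GoodWeight n f c s κ K) (hP : MemP3 P)
    (hb : ∀ d 𝒥, ‖P d 𝒥‖₊ ≤ A * R ^ d) {ρ : ℝ≥0} (hρ0 : 0 < ρ)
    (hρ : 24 * K * R * (ρ : ℝ≥0∞) ≤ 1 / 2) {b T : ℝ} (hT : 0 ≤ T) (hbρ : b ≤ ρ / 2)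
    {u₀ : Index n → ℂ} (hu₀ : MemW f c s u₀) (hreal : IsRealSeq u₀) (hu₀b : normW f c s u₀ < b)
    (hap : ∀ t u, 0 ≤ t → t ≤ T → IsSolutionOn f c s ω P (Set.Icc (-t) t) u → u 0 = u₀ →
      (∀ τ ∈ Set.Icc (-t) t, IsRealSeq (u τ)) → (∀ τ ∈ Set.Icc (-t) t, normW f c s (u τ) ≤ b) →
      ∀ τ ∈ Set.Icc (-t) t, normW f c s (u τ) < b) :
    ∃ u : ℝ → Index n → ℂ, IsSolutionOn f c s ω P (Set.Icc (-T) T) u ∧ u 0 = u₀ ∧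
      (∀ t ∈ Set.Icc (-T) T, normW f c s (u t) < b) ∧
      ∀ T' : ℝ, 0 < T' → T' ≤ T → ∀ v : ℝ → Index n → ℂ,
        IsSolutionOn f c s ω P (Set.Icc (-T') T') v → v 0 = u₀ →
          ∀ t ∈ Set.Icc (-T') T', v t = u t := by
  have hρ0' : (0 : ℝ) < ρ := hρ0
  obtain ⟨g, L, hgL, hgb, hg⟩ := exists_field hgw hP hb hρ0 hρ
  obtain ⟨z, hz0, hz⟩ := exists_rotField_solution (ω := ω) hgL hgb hT (toSeq f c s u₀)
  have hzc : ContinuousOn (fun t => ‖z t‖) (Set.Icc (-T) T) := fun t ht =>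
    (hz t ht).continuousWithinAt.norm
  have hu0 : ofSeq f c s (rot ω 0 (z 0)) = u₀ := by
    rw [rot_zero_time, hz0, ofSeq_toSeq (memW_iff.1 hu₀)]
  have hsol : ∀ t, t ≤ T → (∀ τ ∈ Set.Icc (-t) t, ‖z τ‖ ≤ ρ) →
      IsSolutionOn f c s ω P (Set.Icc (-t) t) fun t => ofSeq f c s (rot ω t (z t)) :=
    fun t htT h => isSolutionOn_of_rotField hgw hP hb hρ hg (fun τ hτ =>
      (hz τ ⟨by linarith [hτ.1], by linarith [hτ.2]⟩).mono
        (Set.Icc_subset_Icc (by linarith) htT)) h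
  have hnorm : ∀ t, normW f c s (ofSeq f c s (rot ω t (z t))) = ‖z t‖ := fun t => by
    rw [normW_ofSeq, norm_rot]
  have hlt : ∀ t ∈ Set.Icc (-T) T, ‖z t‖ < b := by
    refine forall_lt_of_forall_le hzc ?_ fun t ht0 htT hle => ?_
    · rwa [hz0, norm_toSeq hu₀]
    · have hle' : ∀ τ ∈ Set.Icc (-t) t, ‖z τ‖ ≤ ρ := fun τ hτ => (hle τ hτ).trans (by linarith)
      have h1 := hsol t htT hle'
      have h2 := hap t _ ht0 htT h1 hu0 (fun τ hτ => h1.isRealSeq hP hgL hg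
        (fun σ hσ => (hnorm σ).trans_le (hle' σ hσ)) (by rw [hu0]; exact hreal) τ hτ)
        fun τ hτ => (hnorm τ).trans_le (hle τ hτ)
      exact fun τ hτ => (hnorm τ).symm.trans_lt (h2 τ hτ)
  have hsolT := hsol T le_rfl fun τ hτ => (hlt τ hτ).le.trans (by linarith)
  refine ⟨_, hsolT, hu0, fun t ht => (hnorm t).trans_lt (hlt t ht), fun T' _ hT' v hv hv0 t ht => ?_⟩
  have hsub : Set.Icc (-T') T' ⊆ Set.Icc (-T) T := Set.Icc_subset_Icc (by linarith) hT'
  exact (hsolT.mono hsub).unique hρ0 hgL hg hv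
    (fun τ hτ => (hnorm τ).trans_le ((hlt τ (hsub hτ)).le.trans hbρ)) (hv0.trans hu0.symm) t ht

/-- Each of the three contributions is at most b² / 4. The first equals it, by the choice b = 2 M e,
and the missing quarter makes the inequality strict. -/
theorem energy_lt {M K α A R B b e γ T δ : ℝ≥0} {r : ℕ} (hK : 1 ≤ K) (hα : 1 ≤ α)
    (hb : b = 2 * M * e) (hb0 : 0 < b) (hR : R ≤ B)
    (hx : 13 * (M ^ 2 * K * α) * (300 * K ^ 2 * α * B * b) ≤ 1)
    (hδ : 24 * A * R ^ 2 * K * α * δ ≤ b * γ)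
    (hT : T * (28000 * M ^ 2 * K ^ 3 * α ^ 3 * (2 + 24 * A * R ^ 2 * K * α)) *
      (γ + (300 * K ^ 2 * α * B * b) ^ (r + 1)) ≤ 1) :
    M * (M * e ^ 2 + 312 * M * K ^ 2 * α ^ 2 * b ^ 2 * (3 * K * B * b) +
      T * (7000 * M * K ^ 3 * α ^ 3 * (γ * b ^ 2 + b ^ 2 * (300 * K ^ 2 * α * B * b) ^ (r + 1) +
        b * (24 * A * R ^ 2 * K * α * δ + 4 * A * R * α * (6 * K * R * b) ^ (r + 2))))) < b ^ 2 := by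
  set x := 300 * K ^ 2 * α * B * b with hxdef
  have hKα : 1 ≤ K * α := one_le_mul hK hα
  have hy : 6 * K * R * b ≤ x := by
    calc 6 * K * R * b = 6 * K * 1 * R * b := by ring
      _ ≤ 300 * K * (K * α) * B * b := by gcongr; norm_num
      _ = x := by rw [hxdef]; ring
  have h1 : M * (M * e ^ 2) ≤ b ^ 2 / 4 := by
    rw [hb]
    refine le_of_eq ?_
    rw [eq_div_iff (by norm_num)]
    ring
  have h2 : M * (312 * M * K ^ 2 * α ^ 2 * b ^ 2 * (3 * K * B * b)) ≤ b ^ 2 / 4 := by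
    rw [le_div_iff₀ (by norm_num)]
    calc M * (312 * M * K ^ 2 * α ^ 2 * b ^ 2 * (3 * K * B * b)) * 4
        = 3744 * (M ^ 2 * K ^ 3 * α ^ 2 * B * b) * b ^ 2 := by ring
      -- 3900 = 13 · 300 matches the form of `hx`.
      _ ≤ 3900 * (M ^ 2 * K ^ 3 * α ^ 2 * B * b) * b ^ 2 := by gcongr; norm_num
      _ = 13 * (M ^ 2 * K * α) * x * b ^ 2 := by rw [hxdef]; ring
      _ ≤ 1 * b ^ 2 := by gcongr
      _ = b ^ 2 := one_mul _
  have h3 : M * (T * (7000 * M * K ^ 3 * α ^ 3 * (γ * b ^ 2 + b ^ 2 * x ^ (r + 1) +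
      b * (24 * A * R ^ 2 * K * α * δ + 4 * A * R * α * (6 * K * R * b) ^ (r + 2))))) ≤
      b ^ 2 / 4 := by
    have h4 : γ * b ^ 2 + b ^ 2 * x ^ (r + 1) +
        b * (24 * A * R ^ 2 * K * α * δ + 4 * A * R * α * (6 * K * R * b) ^ (r + 2)) ≤
        b ^ 2 * ((2 + 24 * A * R ^ 2 * K * α) * (γ + x ^ (r + 1))) := by
      calc _ ≤ γ * b ^ 2 + b ^ 2 * x ^ (r + 1) +
            b * (b * γ + 4 * A * R * α * ((6 * K * R * b) * x ^ (r + 1))) := by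
            rw [pow_succ' _ (r + 1)]
            gcongr
        _ = b ^ 2 * (2 * γ + (1 + 24 * A * R ^ 2 * K * α) * x ^ (r + 1)) := by ring
        _ ≤ b ^ 2 * (2 * γ + (1 + 24 * A * R ^ 2 * K * α) * x ^ (r + 1) +
            (24 * A * R ^ 2 * K * α * γ + x ^ (r + 1))) := by
            exact mul_le_mul_right le_self_add _
        _ = _ := by ring
    rw [le_div_iff₀ (by norm_num)]
    calc _ ≤ M * (T * (7000 * M * K ^ 3 * α ^ 3 *
          (b ^ 2 * ((2 + 24 * A * R ^ 2 * K * α) * (γ + x ^ (r + 1)))))) * 4 := by gcongr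
      _ = T * (28000 * M ^ 2 * K ^ 3 * α ^ 3 * (2 + 24 * A * R ^ 2 * K * α)) *
          (γ + x ^ (r + 1)) * b ^ 2 := by ring
      _ ≤ 1 * b ^ 2 := by gcongr
      _ = b ^ 2 := one_mul _
  rw [mul_add, mul_add]
  refine (add_le_add (add_le_add h1 h2) h3).trans_lt ?_
  have hb2 : 0 < (b : ℝ) ^ 2 := by positivity
  rw [← NNReal.coe_lt_coe]
  push_cast
  linarith

end Apriori

/-! ### The choice of the parameters -/

/-- The hypothesis gives d N ≤ 1, so the logarithm is nonpositive and the balance condition trivial.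
This shows that the cut-off tends to infinity as ε tends to zero. -/
theorem le_cutoff {f : ℝ → ℝ} {c p ε N : ℝ} (hf : WeightA0 f c) (hp : 0 < p) (hε : 0 < ε)
    (hε' : ε < 1) (hN : c ≤ N) (h : 2 * f N * N ≤ |Real.log ε|) : N ≤ cutoff f c p ε := by
  have hL : 0 < |Real.log ε| := abs_pos.2 (Real.log_neg hε hε').ne
  have hN0 : 0 < N := hf.c_pos.trans_le hN
  refine le_csSup ?_ ⟨hN, ?_⟩
  -- The set is bounded above: once d ≥ 1 the condition implies ln N ≤ |ln ε| / 2.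
  · obtain ⟨X, hX⟩ := eventually_atTop.1 (hf.tendsto.eventually_ge_atTop (|Real.log ε| / 2))
    refine ⟨max X (Real.exp (|Real.log ε| / 2)), fun x hx => ?_⟩
    by_contra hcon
    obtain ⟨h1, h2⟩ := max_lt_iff.1 (not_le.1 hcon)
    have hx0 : 0 < x := (Real.exp_pos _).trans h2
    have h3 : 1 ≤ balanceDegree f ε x := by
      rw [balanceDegree, one_le_div hL]
      linarith [hX x h1.le]
    have h4 : |Real.log ε| / 2 < Real.log x := (Real.lt_log_iff_exp_lt hx0).2 h2
    have h5 : Real.log x ≤ Real.log (balanceDegree f ε x * x) :=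
      Real.log_le_log hx0 (le_mul_of_one_le_left hx0.le h3)
    have h6 : 1 ≤ balanceDegree f ε x ^ p := Real.one_le_rpow h3 hp.le
    have h7 : Real.log (balanceDegree f ε x * x) ≤
        balanceDegree f ε x ^ p * Real.log (balanceDegree f ε x * x) :=
      le_mul_of_one_le_left (by linarith) h6
    linarith [hx.2]
  · have h1 : 0 < balanceDegree f ε N := div_pos (mul_pos two_pos (hf.pos N hN)) hL
    have h2 : balanceDegree f ε N * N ≤ 1 := by
      rw [balanceDegree, div_mul_eq_mul_div, div_le_one hL]
      exact h
    have h3 : Real.log (balanceDegree f ε N * N) ≤ 0 :=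
      Real.log_nonpos (mul_pos h1 hN0).le h2
    have h4 := mul_nonpos_of_nonneg_of_nonpos (Real.rpow_nonneg h1.le p) h3
    linarith

/-- The supremum in the definition of the cut-off is almost attained. -/
theorem exists_near_cutoff {f : ℝ → ℝ} {c p : ℝ} (hf : WeightA0 f c) (hp : 0 < p)
    (hadd : ∀ x, c ≤ x → f (x + x) ≤ f x + f x) (F : ℝ) : ∃ L₀, ∀ ε, 0 < ε → ε < 1 →
      L₀ ≤ |Real.log ε| → ∃ N, c ≤ N ∧ F ≤ N ∧ F ≤ f N ∧ f (cutoff f c p ε) ≤ 2 * f N ∧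
        balanceDegree f ε N ^ p * Real.log (balanceDegree f ε N * N) ≤ |Real.log ε| / 2 := by
  obtain ⟨X, hX⟩ := eventually_atTop.1 (hf.tendsto.eventually_ge_atTop F)
  set N₀ : ℝ := 2 * max X (max c F) with hN₀
  have hc := hf.c_pos
  have h1 : c ≤ N₀ / 2 := by
    rw [hN₀, mul_div_cancel_left₀ _ two_ne_zero]
    exact (le_max_left _ _).trans (le_max_right _ _)
  have h2 : F ≤ N₀ / 2 := by
    rw [hN₀, mul_div_cancel_left₀ _ two_ne_zero]
    exact (le_max_right _ _).trans (le_max_right _ _)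
  have h3 : X ≤ N₀ / 2 := by
    rw [hN₀, mul_div_cancel_left₀ _ two_ne_zero]
    exact le_max_left _ _
  refine ⟨2 * f N₀ * N₀, fun ε hε hε' hL => ?_⟩
  have h4 : N₀ ≤ cutoff f c p ε := le_cutoff hf hp hε hε' (by linarith) hL
  have hne : {N : ℝ | c ≤ N ∧ balanceDegree f ε N ^ p *
      Real.log (balanceDegree f ε N * N) ≤ |Real.log ε| / 2}.Nonempty := by
    by_contra hcon
    -- The supremum of the empty set is 0 by convention, which contradicts the positive lower bound.
    rw [Set.not_nonempty_iff_eq_empty] at hcon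
    rw [cutoff, hcon, Real.sSup_empty] at h4
    linarith
  -- An element beyond half of the supremum is enough, since doubling the argument at most doubles
  -- f.
  obtain ⟨N, ⟨hcN, hN⟩, hlt⟩ := exists_lt_of_lt_csSup hne
    (show cutoff f c p ε / 2 < cutoff f c p ε by linarith)
  refine ⟨N, hcN, by linarith, hX N (by linarith), ?_, hN⟩
  have h5 : f (cutoff f c p ε) ≤ f (N + N) :=
    hf.mono (show c ≤ cutoff f c p ε by linarith) (show c ≤ N + N by linarith) (by linarith)
  linarith [hadd N hcN]

/-- If r + 2 ≤ η d with τ η^p ≤ 1 / 4, the balance condition bounds the exponent of the divisors by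
L / 8. The polynomial factor (r + 2)⁴ takes another e^{L/8}, and e^{L/4} is left for the constants.
Otherwise r = 0, and there is nothing to eliminate. -/
theorem exists_degree {p γ τ A : ℝ} (hp : 0 < p) (hγ : 0 < γ) (hγ1 : γ ≤ 1) (hτ : 0 ≤ τ)
    (hA : 1 ≤ A) : ∃ θ, 0 < θ ∧ ∀ a, 0 < a → ∃ L₀, ∀ L N d, L₀ ≤ L → A ≤ N → 0 < d →
      d ^ p * Real.log (d * N) ≤ L / 2 → ∃ (r : ℕ) (D : ℝ), 1 ≤ D ∧
        (r = 0 ∨ 1 ≤ D * (γ * Real.exp (-(τ * (r + 2) ^ p * Real.log ((r + 2) * (N + A)))))) ∧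
        a * D * (r + 2) ^ 4 ≤ Real.exp (L / 2) ∧ θ * d ≤ r + 1 := by
  set η : ℝ := min (1 / 2) ((1 / (4 * (τ + 1))) ^ (1 / p)) with hη
  have hτ1 : 0 < 1 / (4 * (τ + 1)) := by positivity
  have hη0 : 0 < η := lt_min (by norm_num) (Real.rpow_pos_of_pos hτ1 _)
  have hη2 : η ≤ 1 / 2 := min_le_left _ _
  have hηp : τ * η ^ p ≤ 1 / 4 := by
    have h1 : η ^ p ≤ 1 / (4 * (τ + 1)) := by
      refine (Real.rpow_le_rpow hη0.le (min_le_right _ _) hp.le).trans (le_of_eq ?_)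
      rw [← Real.rpow_mul hτ1.le, one_div_mul_cancel hp.ne', Real.rpow_one]
    refine (mul_le_mul_of_nonneg_left h1 hτ).trans ?_
    rw [mul_one_div, div_le_div_iff₀ (by positivity) (by norm_num)]
    linarith
  -- The division by 3 gives r + 2 ≤ 3 r ≤ η d for r ≥ 1.
  refine ⟨η / 3, by positivity, fun a ha => ?_⟩
  have hlim : Tendsto (fun L : ℝ => Real.exp (L / 4)) atTop atTop :=
    Real.tendsto_exp_atTop.comp (tendsto_id.atTop_div_const (by norm_num))
  have hlim2 := tendsto_exp_div_rpow_atTop (4 / p)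
  have hlim3 : ∀ᶠ L : ℝ in atTop, L ^ (4 / p) ≤ Real.exp (L / 8) := by
    have h1 : Tendsto (fun L : ℝ => Real.exp (L / 8) / (L / 8) ^ (4 / p)) atTop atTop :=
      hlim2.comp (tendsto_id.atTop_div_const (by norm_num))
    filter_upwards [h1.eventually_ge_atTop (8 ^ (4 / p)), eventually_gt_atTop 0] with L h2 h3
    rw [le_div_iff₀ (by positivity), ← Real.mul_rpow (by norm_num) (by positivity),
      mul_div_cancel₀ _ (by norm_num : (8 : ℝ) ≠ 0)] at h2
    exact h2
  obtain ⟨L₀, hL₀⟩ := eventually_atTop.1 ((hlim3.and (hlim.eventually_ge_atTop (a * 16 / γ))).and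
    (eventually_ge_atTop 0))
  refine ⟨L₀, fun L N d hL hN hd hbal => ?_⟩
  obtain ⟨⟨hL1, hL2⟩, hL3⟩ := hL₀ L hL
  have hN1 : 1 ≤ N := hA.trans hN
  have hexp : Real.exp (L / 2) = Real.exp (L / 4) * (Real.exp (L / 8) * Real.exp (L / 8)) := by
    rw [← Real.exp_add, ← Real.exp_add]
    congr 1
    ring
  have hone : 1 ≤ Real.exp (L / 8) := Real.one_le_exp (by positivity)
  have haγ : a * 16 ≤ Real.exp (L / 4) * γ := (div_le_iff₀ hγ).1 hL2
  have haL : a * 16 ≤ Real.exp (L / 4) :=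
    haγ.trans (mul_le_of_le_one_right (Real.exp_pos _).le hγ1)
  rcases Nat.eq_zero_or_pos ⌊η / 3 * d⌋₊ with h0 | hpos
  · refine ⟨0, 1, le_rfl, Or.inl rfl, ?_, ?_⟩
    · rw [hexp]
      have := one_le_mul_of_one_le_of_one_le hone hone
      have h2 := mul_le_mul haL this (by norm_num) (Real.exp_pos _).le
      norm_num
      linarith
    · have := Nat.lt_floor_add_one (η / 3 * d)
      rw [h0] at this
      exact_mod_cast this.le
  · set r := ⌊η / 3 * d⌋₊ with hr
    have hr1 : (1 : ℝ) ≤ r := by exact_mod_cast hpos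
    have hrd : (r : ℝ) ≤ η / 3 * d := Nat.floor_le (by positivity)
    have hr2 : (r : ℝ) + 2 ≤ η * d := by linarith
    have hd6 : 6 ≤ d := by
      have : η * d ≤ 1 / 2 * d := mul_le_mul_of_nonneg_right hη2 hd.le
      linarith
    have hdN : 6 ≤ d * N := by
      have : d * 1 ≤ d * N := mul_le_mul_of_nonneg_left hN1 hd.le
      linarith
    have hlog1 : 1 ≤ Real.log (d * N) := by
      rw [Real.le_log_iff_exp_le (by linarith)]
      linarith [Real.exp_one_lt_d9]
    have hdp : d ^ p ≤ L := by
      have h1 : d ^ p ≤ d ^ p * Real.log (d * N) :=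
        le_mul_of_one_le_right (Real.rpow_nonneg hd.le _) hlog1
      linarith
    have hrp : ((r : ℝ) + 2) ^ p ≤ η ^ p * d ^ p := by
      rw [← Real.mul_rpow hη0.le hd.le]
      exact Real.rpow_le_rpow (by positivity) hr2 hp.le
    -- The factor 1 / 2 in η compensates for N + A ≤ 2 N.
    have hlog : Real.log (((r : ℝ) + 2) * (N + A)) ≤ Real.log (d * N) := by
      refine Real.log_le_log (by positivity) ?_
      calc ((r : ℝ) + 2) * (N + A) ≤ (1 / 2 * d) * (N + N) := by
            refine mul_le_mul (hr2.trans (mul_le_mul_of_nonneg_right hη2 hd.le)) (by linarith)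
              (by linarith) (by positivity)
        _ = d * N := by ring
    have hlog0 : 0 ≤ Real.log (((r : ℝ) + 2) * (N + A)) := by
      refine Real.log_nonneg ?_
      nlinarith
    have hE : τ * (r + 2) ^ p * Real.log ((r + 2) * (N + A)) ≤ L / 8 := by
      calc τ * ((r : ℝ) + 2) ^ p * Real.log ((r + 2) * (N + A))
          ≤ τ * (η ^ p * d ^ p) * Real.log (d * N) := by
            refine mul_le_mul (mul_le_mul_of_nonneg_left hrp hτ) hlog hlog0 ?_
            have := Real.rpow_nonneg hη0.le p
            have := Real.rpow_nonneg hd.le p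
            positivity
        _ = τ * η ^ p * (d ^ p * Real.log (d * N)) := by ring
        _ ≤ 1 / 4 * (L / 2) := mul_le_mul hηp hbal
            (mul_nonneg (Real.rpow_nonneg hd.le _) (by linarith)) (by norm_num)
        _ = L / 8 := by ring
    have hrL : ((r : ℝ) + 2) ^ 4 ≤ Real.exp (L / 8) := by
      have h1 : (r : ℝ) + 2 ≤ d := by nlinarith
      have h2 : d ≤ L ^ (1 / p) := by
        have := Real.rpow_le_rpow (Real.rpow_nonneg hd.le p) hdp (one_div_nonneg.2 hp.le)
        rwa [← Real.rpow_mul hd.le, mul_one_div_cancel hp.ne', Real.rpow_one] at this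
      calc ((r : ℝ) + 2) ^ 4 ≤ (L ^ (1 / p)) ^ 4 := pow_le_pow_left₀ (by positivity) (h1.trans h2) 4
        _ = L ^ (4 / p) := by
            rw [← Real.rpow_natCast, ← Real.rpow_mul hL3]
            congr 1
            push_cast
            ring
        _ ≤ _ := hL1
    refine ⟨r, Real.exp (L / 8) / γ, ?_, Or.inr ?_, ?_, ?_⟩
    · rw [one_le_div hγ]
      linarith
    · rw [div_mul_eq_mul_div, mul_left_comm, mul_div_cancel_left₀ _ hγ.ne', ← Real.exp_add]
      exact Real.one_le_exp (by linarith)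
    · rw [hexp, mul_div_assoc', div_mul_eq_mul_div, div_le_iff₀ hγ]
      have h1 : a ≤ Real.exp (L / 4) * γ := by linarith
      calc a * Real.exp (L / 8) * ((r : ℝ) + 2) ^ 4
          ≤ (Real.exp (L / 4) * γ) * Real.exp (L / 8) * Real.exp (L / 8) := by
            refine mul_le_mul (mul_le_mul_of_nonneg_right h1 (Real.exp_pos _).le) hrL
              (by positivity) (by positivity)
        _ = _ := by ring
    · exact (Nat.lt_floor_add_one _).le

/-! ### The main theorem -/

section Main

variable {n : ℕ} {f : ℝ → ℝ} {c s κ : ℝ} {K A R : ℝ≥0} {P : FormalSeries n}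
  {ω : (Fin n → ℤ) → ℝ} {rep : (Fin n → ℤ) → Fin n → ℤ} {C C₂ δ₀ : ℝ}

/-- Lengths of an index and its representative differ by at most C, and subadditivity turns this
into a bounded additive change of f. -/
theorem Blocks.f_bracket_rep_le (hbl : Blocks ω rep C C₂ δ₀) (hgw : GoodWeight n f c s κ K)
    (j : Fin n → ℤ) : f (bracket c (rep j)) ≤ f (bracket c j) + f (max C c) := by
  refine le_trans (hgw.mono (le_bracket _) ?_ ?_)
    (hgw.add_le (le_bracket (c := c) j) (le_max_right C c))
  · exact (le_bracket (c := c) j).trans (le_add_of_nonneg_right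
      (hgw.c_pos.le.trans (le_max_right _ _)))
  · refine max_le ((hbl.len_rep_le j).trans (add_le_add (le_max_left _ _) (le_max_left _ _))) ?_
    exact (le_bracket (c := c) j).trans (le_add_of_nonneg_right
      (hgw.c_pos.le.trans (le_max_right _ _)))

theorem Blocks.f_bracket_le (hbl : Blocks ω rep C C₂ δ₀) (hgw : GoodWeight n f c s κ K)
    (j : Fin n → ℤ) : f (bracket c j) ≤ f (bracket c (rep j)) + f (max C c) := by
  refine le_trans (hgw.mono (le_bracket _) ?_ ?_)
    (hgw.add_le (le_bracket (c := c) (rep j)) (le_max_right C c))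
  · exact (le_bracket (c := c) (rep j)).trans (le_add_of_nonneg_right
      (hgw.c_pos.le.trans (le_max_right _ _)))
  · refine max_le ((hbl.len_le j).trans (add_le_add (le_max_left _ _) (le_max_left _ _))) ?_
    exact (le_bracket (c := c) (rep j)).trans (le_add_of_nonneg_right
      (hgw.c_pos.le.trans (le_max_right _ _)))

theorem Blocks.le_f_bracket (hbl : Blocks ω rep C C₂ δ₀) (hgw : GoodWeight n f c s κ K) {N : ℝ}
    (hN : c ≤ N) (j : Fin n → ℤ) (hj : N < len (rep j)) :
    f N - f (max C c) ≤ f (bracket c j) := by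
  rw [sub_le_iff_le_add]
  have h1 : N ≤ bracket c j + max C c :=
    hj.le.trans ((hbl.len_rep_le j).trans (add_le_add (le_max_left _ _) (le_max_left _ _)))
  exact (hgw.mono hN (hN.trans h1) h1).trans (hgw.add_le (le_bracket (c := c) j) (le_max_right C c))

/-- The constant that compares the weights within the blocks. -/
noncomputable def blockConst (f : ℝ → ℝ) (c s C : ℝ) : ℝ≥0 :=
  (Real.exp (2 * s * f (max C c))).toNNReal

theorem wt_sq (j : Fin n → ℤ) :
    wt f c s j ^ 2 = ENNReal.ofReal (Real.exp (2 * s * f (bracket c j))) := by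
  rw [wt, ← ENNReal.ofReal_pow (Real.exp_pos _).le, ← Real.exp_nat_mul]
  congr 2
  push_cast
  ring

theorem ofReal_exp_le {x y z : ℝ} (h : x ≤ y + z) : ENNReal.ofReal (Real.exp x) ≤
    ((Real.exp z).toNNReal : ℝ≥0∞) * ENNReal.ofReal (Real.exp y) := by
  change _ ≤ ENNReal.ofReal (Real.exp z) * _
  rw [← ENNReal.ofReal_mul (Real.exp_pos _).le, ← Real.exp_add, add_comm z]
  exact ENNReal.ofReal_le_ofReal (Real.exp_le_exp.2 h)

theorem Blocks.exp_rep_le (hbl : Blocks ω rep C C₂ δ₀) (hgw : GoodWeight n f c s κ K)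
    (j : Fin n → ℤ) : ENNReal.ofReal (Real.exp (2 * s * f (bracket c (rep j)))) ≤
      blockConst f c s C * wt f c s j ^ 2 := by
  rw [wt_sq]
  refine ofReal_exp_le ?_
  rw [← mul_add]
  exact mul_le_mul_of_nonneg_left (hbl.f_bracket_rep_le hgw j) (by linarith [hgw.s_pos])

theorem Blocks.wt_sq_le (hbl : Blocks ω rep C C₂ δ₀) (hgw : GoodWeight n f c s κ K)
    (j : Fin n → ℤ) : wt f c s j ^ 2 ≤
      blockConst f c s C * ENNReal.ofReal (Real.exp (2 * s * f (bracket c (rep j)))) := by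
  rw [wt_sq]
  refine ofReal_exp_le ?_
  rw [← mul_add]
  exact mul_le_mul_of_nonneg_left (hbl.f_bracket_le hgw j) (by linarith [hgw.s_pos])

/-- The bootstrap step: as long as the norm is at most b, the energy estimate together with
`energy_lt` makes it strictly smaller than b. -/
theorem IsSolutionOn.normW_lt (hgw : GoodWeight n f c s κ K) (hP : MemP3 P)
    (hb : ∀ d 𝒥, ‖P d 𝒥‖₊ ≤ A * R ^ d) (hbl : Blocks ω rep C C₂ δ₀) {N : ℝ} (hN : c ≤ N)
    {r : ℕ} {B M α b e γ T : ℝ≥0} (hM : M = blockConst f c s C)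
    (hα : (α : ℝ≥0∞) = wt f c s (0 : Fin n → ℤ))
    (hnf : ∀ k, ∃ χ Z, NormalForm (modePhase n k) (modeHigh rep N k) r B
      (modeWeight f c s rep k) (modeHam ω P k) χ Z)
    (hγ : γ = (Real.exp (-(s * (1 - κ) / 2) * (f N - f (max C c)))).toNNReal)
    (hbe : b = 2 * M * e) (hb0 : 0 < b) (hR : R ≤ B) (hρ : 48 * K * R * b ≤ 1)
    (hM1 : 1 ≤ M) (hα1 : 1 ≤ α) (hx : 13 * (M ^ 2 * K * α) * (300 * K ^ 2 * α * B * b) ≤ 1)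
    (hT : T * (28000 * M ^ 2 * K ^ 3 * α ^ 3 * (2 + 24 * A * R ^ 2 * K * α)) *
      (γ + (300 * K ^ 2 * α * B * b) ^ (r + 1)) ≤ 1)
    {t : ℝ} (ht : t ≤ T) {u : ℝ → Index n → ℂ}
    (hu : IsSolutionOn f c s ω P (Set.Icc (-t) t) u) (hu0 : normW f c s (u 0) = e)
    (hreal : ∀ τ ∈ Set.Icc (-t) t, IsRealSeq (u τ))
    (hub : ∀ τ ∈ Set.Icc (-t) t, normW f c s (u τ) ≤ b) (τ : ℝ) (hτ : τ ∈ Set.Icc (-t) t) :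
    normW f c s (u τ) < b := by
  have ht0 : 0 ≤ t := by have := hτ.1; have := hτ.2; linarith
  have hγ0 : 0 < γ := by
    rw [hγ]
    exact Real.toNNReal_pos.2 (Real.exp_pos _)
  -- The error of the box is made as small as the gain γ; the 1 in the denominator covers the case A
  -- = 0.
  set δ : ℝ≥0 := b * γ / (24 * A * R ^ 2 * K * α + 1) with hδ
  have hδ0 : 0 < δ := by positivity
  have hδ1 : 24 * A * R ^ 2 * K * α * δ ≤ b * γ := by
    rw [hδ, mul_div_assoc', div_le_iff₀ (by positivity), mul_comm (b * γ)]
    exact mul_le_mul_left le_self_add _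
  have hw0 : wenorm f c s (u 0) = e := by
    rw [← ofReal_normW (hu.mem 0 ⟨by linarith, ht0⟩), hu0, ENNReal.ofReal_coe_nnreal]
  have hwb : ∀ σ ∈ Set.Icc (-t) t, wenorm f c s (u σ) ≤ b := fun σ hσ => by
    rw [← ofReal_normW (hu.mem σ hσ), ← ENNReal.ofReal_coe_nnreal]
    exact ENNReal.ofReal_le_ofReal (hub σ hσ)
  have hhalf : ∀ y : ℝ≥0, 2 * y ≤ 1 → (y : ℝ≥0∞) ≤ 1 / 2 := fun y hy => by
    rw [ENNReal.le_div_iff_mul_le (by simp) (by simp), mul_comm]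
    exact_mod_cast hy
  have hρ' : 24 * K * R * (b : ℝ≥0∞) ≤ 1 / 2 := by
    have := hhalf (24 * K * R * b) (le_trans (le_of_eq (by ring)) hρ)
    exact_mod_cast this
  have hx' : 300 * K ^ 2 * wt f c s (0 : Fin n → ℤ) * B * (b : ℝ≥0∞) ≤ 1 / 2 := by
    rw [← hα]
    have h2 : 2 ≤ 13 * (M ^ 2 * K * α) := by
      have : 1 ≤ M ^ 2 * K * α := one_le_mul (one_le_mul (one_le_pow₀ hM1) hgw.one_le) hα1
      calc (2 : ℝ≥0) ≤ 13 * 1 := by norm_num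
        _ ≤ _ := by gcongr
    have := hhalf (300 * K ^ 2 * α * B * b) ((mul_le_mul_left h2 _).trans hx)
    exact_mod_cast this
  have htT : t.toNNReal ≤ T := Real.toNNReal_le_iff_le_coe.2 ht
  have h1 := hu.wenorm_sq_le hgw hP hb (M := M) (by rw [hM]; exact hbl.exp_rep_le hgw)
    (by rw [hM]; exact hbl.wt_sq_le hgw) hnf (hbl.le_f_bracket hgw hN) hreal hwb hρ' hx' hτ hδ0
  have h2 := energy_lt (r := r) (T := t.toNNReal) hgw.one_le hα1 hbe hb0 hR hx hδ1
    (le_trans (by gcongr) hT)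
  rw [hw0, ← hα] at h1
  change _ ≤ (M : ℝ≥0∞) * (_ + (t.toNNReal : ℝ≥0∞) * (_ * (((Real.exp _).toNNReal : ℝ≥0∞) * _ + _ + _)))
    at h1
  rw [← hγ] at h1
  have h3 : wenorm f c s (u τ) ^ 2 < (b : ℝ≥0∞) ^ 2 := by
    refine h1.trans_lt ?_
    exact_mod_cast h2
  have h4 : wenorm f c s (u τ) < b := lt_of_pow_lt_pow_left' 2 h3
  rw [← ofReal_normW (hu.mem τ hτ), ← ENNReal.ofReal_coe_nnreal,
    ENNReal.ofReal_lt_ofReal_iff (by exact_mod_cast hb0)] at h4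
  exact h4

theorem exists_coeff_bound (hP : MemP3 P) : ∃ A R : ℝ≥0, 1 ≤ R ∧ ∀ d 𝒥, ‖P d 𝒥‖₊ ≤ A * R ^ d := by
  obtain ⟨C, R, h⟩ := hP.bounded
  refine ⟨‖C‖₊, max 1 ‖R‖₊, le_max_left _ _, fun d 𝒥 => ?_⟩
  have h1 : ‖P d 𝒥‖ ≤ ‖C‖ * ‖R‖ ^ d := by
    rw [← norm_pow, ← norm_mul]
    exact (h d 𝒥).trans (Real.le_norm_self _)
  have h2 : ‖P d 𝒥‖₊ ≤ ‖C‖₊ * ‖R‖₊ ^ d := by exact_mod_cast h1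
  refine h2.trans ?_
  gcongr
  exact le_max_right _ _

/-- For m ≥ 1 the prefactor, the shift m + 2 ≤ 3 m and the half required by the normal form are
absorbed into the geometric rate. -/
theorem coeff_bound_le {A R : ℝ≥0} (hR : 1 ≤ R) (m : ℕ) (hm : 1 ≤ m) :
    A * R ^ (m + 2) ≤ (2 * (1 + A) * R ^ 3) ^ m / 2 := by
  rw [le_div_iff₀ (by norm_num)]
  calc A * R ^ (m + 2) * 2 ≤ (1 + A) * R ^ (3 * m) * 2 := by
        gcongr
        · exact le_add_self
        · omega
    _ = 2 * (1 + A) * (R ^ 3) ^ m := by rw [pow_mul]; ring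
    _ ≤ (2 * (1 + A)) ^ m * (R ^ 3) ^ m := by
        gcongr
        refine le_self_pow₀ (one_le_mul (by norm_num) le_self_add) (by omega)
    _ = _ := (mul_pow _ _ _).symm

/-- The estimate of the life span. -/
theorem life_span_le {m a θ E F C₀ g γ X T : ℝ} (hm : 0 < m) (hma : m ≤ a) (hmθ : m ≤ θ)
    (hF : 0 ≤ F) (hC₀ : 0 < C₀) (hT : T = Real.exp E) (hE : E ≤ m / 2 * F)
    (hγ : γ = Real.exp (-a * (F - g))) (hX0 : 0 ≤ X)
    (hX : X ≤ Real.exp (-(θ * F)))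
    (hF' : 2 / m * Real.log (C₀ * (Real.exp (a * g) + 1)) ≤ F) :
    T * C₀ * (γ + X) ≤ 1 := by
  have h1 : γ ≤ Real.exp (a * g) * Real.exp (-(m * F)) := by
    rw [hγ, ← Real.exp_add]
    refine Real.exp_le_exp.2 ?_
    have := mul_le_mul_of_nonneg_right hma hF
    linarith
  have h2 : X ≤ Real.exp (-(m * F)) := by
    refine hX.trans (Real.exp_le_exp.2 ?_)
    have := mul_le_mul_of_nonneg_right hmθ hF
    linarith
  have hC1 : 0 < C₀ * (Real.exp (a * g) + 1) := mul_pos hC₀ (by positivity)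
  have h3 : C₀ * (Real.exp (a * g) + 1) ≤ Real.exp (m / 2 * F) := by
    rw [← Real.log_le_iff_le_exp hC1]
    have h4 := mul_le_mul_of_nonneg_left hF' (half_pos hm).le
    refine le_trans (le_of_eq ?_) h4
    field_simp
  calc T * C₀ * (γ + X) ≤ Real.exp (m / 2 * F) * C₀ *
        (Real.exp (a * g) * Real.exp (-(m * F)) + Real.exp (-(m * F))) := by
        rw [hT]
        refine mul_le_mul (mul_le_mul_of_nonneg_right (Real.exp_le_exp.2 hE) hC₀.le)
          (add_le_add h1 h2) ?_ (by positivity)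
        rw [hγ]
        positivity
    _ = (C₀ * (Real.exp (a * g) + 1)) * (Real.exp (m / 2 * F) * Real.exp (-(m * F))) := by ring
    _ ≤ Real.exp (m / 2 * F) * (Real.exp (m / 2 * F) * Real.exp (-(m * F))) :=
        mul_le_mul_of_nonneg_right h3 (by positivity)
    _ = 1 := by
        rw [← Real.exp_add, ← Real.exp_add, ← Real.exp_zero]
        congr 1
        ring

-- With L = |ln ε|, the small parameter x is at most e^{-L/2}, and r + 1 is at least θ · 2 f(N) / L,
-- so x^{r+1} ≤ e^{-θ f(N)}. The gain γ is of order e^{-s (1 - κ) f(N) / 2}. Hence both remainders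
-- are O(e^{-m f(N)}) with m the smaller of the two rates.
set_option maxHeartbeats 1000000 in
theorem exists_thresholds {p γ₀ τ A₀ : ℝ} (hf : WeightA0 f c) (hp : 0 < p)
    (hgw : GoodWeight n f c s κ K) (hP : MemP3 P) (hbl : Blocks ω rep C C₂ δ₀) (hγ₀ : 0 < γ₀)
    (hγ₁ : γ₀ ≤ 1) (hτ : 0 ≤ τ) (hA₀ : 1 ≤ A₀)
    (hdiv : ∀ (N : ℝ) (r d : ℕ) (𝒥 : Fin d → Index n) (W : (Fin n → ℤ) → ℝ), 0 ≤ N → 1 ≤ d →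
      d ≤ r + 2 → momentum 𝒥 = 0 → ∑ l, sgn (𝒥 l).2 * W (rep (𝒥 l).1) ≠ restSum rep N W 𝒥 →
        γ₀ * Real.exp (-(τ * (r + 2) ^ p * Real.log ((r + 2) * (N + A₀)))) ≤ |divisor ω 𝒥|) :
    ∃ ε₀ Csta Cfin : ℝ, 0 < ε₀ ∧ 0 < Csta ∧ 0 < Cfin ∧
      ∀ u₀ : Index n → ℂ, MemW f c s u₀ → IsRealSeq u₀ →
        ∀ ε : ℝ, ε = normW f c s u₀ → 0 < ε → ε < ε₀ →
          ∃ T : ℝ, Real.exp (Cfin * s * f (cutoff f c p ε)) / Csta < T ∧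
            ∃ u : ℝ → Index n → ℂ,
              IsSolutionOn f c s ω P (Set.Icc (-T) T) u ∧ u 0 = u₀ ∧
              (∀ t ∈ Set.Icc (-T) T, normW f c s (u t) < Csta * ε) ∧
              (∀ T' : ℝ, 0 < T' → T' ≤ T → ∀ v : ℝ → Index n → ℂ,
                IsSolutionOn f c s ω P (Set.Icc (-T') T') v → v 0 = u₀ →
                  ∀ t ∈ Set.Icc (-T') T', v t = u t) := by
  obtain ⟨A, R, hR, hb⟩ := exists_coeff_bound hP
  have hs := hgw.s_pos
  have hK : 1 ≤ K := hgw.one_le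
  have hfC : 0 < f (max C c) := hgw.pos _ (le_max_right _ _)
  set M : ℝ≥0 := blockConst f c s C with hM
  have hM1 : 1 ≤ M := by
    rw [hM, blockConst, ← Real.toNNReal_one]
    exact Real.toNNReal_mono (Real.one_le_exp (by positivity))
  set α : ℝ≥0 := (Real.exp (s * f c)).toNNReal with hα
  have hαw : (α : ℝ≥0∞) = wt f c s (0 : Fin n → ℤ) := (wt_zero hgw.c_pos).symm
  have hα1 : 1 ≤ α := by
    rw [hα, ← Real.toNNReal_one]
    exact Real.toNNReal_mono (Real.one_le_exp (mul_pos hs (hgw.pos c le_rfl)).le)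
  set R' : ℝ≥0 := 2 * (1 + A) * R ^ 3 with hR'
  have hRR' : R ≤ R' := by
    calc R = 1 * 1 * R ^ 1 := by ring
      _ ≤ 2 * (1 + A) * R ^ 3 := by
        gcongr
        · norm_num
        · exact le_self_add
        · norm_num
  have hR'0 : 0 < R' := lt_of_lt_of_le (zero_lt_one.trans_le hR) hRR'
  obtain ⟨θ, hθ, hdeg⟩ := exists_degree hp hγ₀ hγ₁ hτ hA₀
  have hκ : 0 < s * (1 - κ) / 2 := by
    have := hgw.κ_lt
    have : 0 < 1 - κ := by linarith
    positivity
  set m : ℝ := min (s * (1 - κ) / 2) θ with hm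
  have hm0 : 0 < m := lt_min hκ hθ
  set C₀ : ℝ≥0 := 28000 * M ^ 2 * K ^ 3 * α ^ 3 * (2 + 24 * A * R ^ 2 * K * α) with hC₀
  have hC₀0 : 0 < C₀ := by positivity
  -- Chosen so that x = ε a D (r + 2)⁴.
  set a : ℝ≥0 := 300 * K ^ 2 * α * R' * 8 * (2 * M) with ha
  have ha0 : 0 < a := by positivity
  obtain ⟨L₁, hL₁⟩ := hdeg a ha0
  obtain ⟨L₂, hL₂⟩ := exists_near_cutoff hf hp (fun x hx => hgw.add_le hx hx)
    (max A₀ (2 / m * Real.log (C₀ * (Real.exp (s * (1 - κ) / 2 * f (max C c)) + 1))))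
  set L₃ : ℝ := 2 * Real.log (13 * (M ^ 2 * K * α)) with hL₃
  set ρ₀ : ℝ≥0 := 1 / (48 * K * R) with hρ₀
  have hρ₀0 : 0 < ρ₀ := by positivity
  have hρ₀' : 24 * K * R * (ρ₀ : ℝ≥0∞) ≤ 1 / 2 := by
    rw [ENNReal.le_div_iff_mul_le (by simp) (by simp)]
    have : 24 * K * R * ρ₀ * 2 ≤ 1 := by
      rw [hρ₀]
      refine le_of_eq ?_
      field_simp
      norm_num
    exact_mod_cast this
  -- The bound ρ₀ / (4 M) keeps b = 2 M ε below ρ₀ / 2. The exponent m / (4 s) gives T = e^{(m/4)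
  -- f(N(ε))}.
  refine ⟨min (Real.exp (-max 1 (max L₁ (max L₂ L₃)))) (ρ₀ / (4 * M)), 2 * M, m / (4 * s),
    lt_min (Real.exp_pos _) (by positivity), by positivity, by positivity,
    fun u₀ hu₀ hreal ε hε hε0 hεlt => ?_⟩
  obtain ⟨hε1, hε2⟩ := lt_min_iff.1 hεlt
  have hlogε : Real.log ε < -max 1 (max L₁ (max L₂ L₃)) := (Real.log_lt_iff_lt_exp hε0).2 hε1
  obtain ⟨L, hL⟩ : ∃ L, L = |Real.log ε| := ⟨_, rfl⟩
  have hlog1 : (1 : ℝ) ≤ max 1 (max L₁ (max L₂ L₃)) := le_max_left _ _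
  have hLlog : L = -Real.log ε := by rw [hL, abs_of_neg (by linarith)]
  have hLmax : max 1 (max L₁ (max L₂ L₃)) ≤ L := by linarith
  simp only [max_le_iff] at hLmax
  obtain ⟨hLa, hLb, hLc, hLd⟩ := hLmax
  have hεL : ε = Real.exp (-L) := by rw [hLlog, neg_neg, Real.exp_log hε0]
  have hεone : ε < 1 := by
    rw [hεL]
    exact Real.exp_zero ▸ Real.exp_lt_exp.2 (by linarith)
  obtain ⟨N, hcN, hFN, hFfN, hcut, hbal⟩ := hL₂ ε hε0 hεone (by rw [← hL]; exact hLc)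
  have hfN : 0 < f N := hgw.pos N hcN
  have hN0 : 0 < N := hgw.c_pos.trans_le hcN
  have hd : balanceDegree f ε N = 2 * f N / L := by rw [balanceDegree, ← hL]
  rw [hd, ← hL] at hbal
  have hd0 : 0 < 2 * f N / L := by positivity
  obtain ⟨r, D, hD1, hrD, hDL, hrd⟩ := hL₁ L N (2 * f N / L) hLb ((le_max_left _ _).trans hFN) hd0 hbal
  obtain ⟨D, rfl⟩ : ∃ D' : ℝ≥0, D = D' := ⟨D.toNNReal, (Real.coe_toNNReal D (by linarith)).symm⟩
  have hD1' : 1 ≤ D := by exact_mod_cast hD1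
  obtain ⟨e, rfl⟩ : ∃ e : ℝ≥0, ε = e := ⟨ε.toNNReal, (Real.coe_toNNReal ε hε0.le).symm⟩
  have he0 : 0 < e := by exact_mod_cast hε0
  set B : ℝ≥0 := R' * (D * (8 * (r + 2) ^ 4)) with hB
  have hRB : R ≤ B := by
    refine hRR'.trans (le_mul_of_one_le_right' (one_le_mul hD1' ?_))
    calc (1 : ℝ≥0) ≤ 8 * (0 + 2) ^ 4 := by norm_num
      _ ≤ 8 * (r + 2) ^ 4 := by gcongr; exact zero_le
  set b : ℝ≥0 := 2 * M * e with hbdef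
  have hb0 : 0 < b := by positivity
  have hnf : ∀ k, ∃ χ Z, NormalForm (modePhase n k) (modeHigh rep N k) r B
      (modeWeight f c s rep k) (modeHam ω P k) χ Z := by
    refine exists_normalForm hP hb (coeff_bound_le hR) hD1' f c s fun d 𝒥 hd3 hdr hmom hne => ?_
    rcases hrD with h0 | h0
    · omega
    · refine h0.trans (mul_le_mul_of_nonneg_left ?_ D.2)
      exact hdiv N r d 𝒥 (fun j => Real.exp (2 * s * f (bracket c j))) hN0.le (by omega) hdr hmom hne
  set x : ℝ≥0 := 300 * K ^ 2 * α * B * b with hx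
  -- The normal form may consume e^{L/2} of the smallness ε = e^{-L}; the other half is kept.
  have hxe : (x : ℝ) ≤ Real.exp (-L / 2) := by
    have e1 : (x : ℝ) = Real.exp (-L) * (a * D * (r + 2) ^ 4) := by
      rw [← hεL, hx, hB, hbdef, ha]
      push_cast
      ring
    rw [e1]
    refine (mul_le_mul_of_nonneg_left hDL (Real.exp_pos _).le).trans (le_of_eq ?_)
    rw [← Real.exp_add]
    congr 1
    ring
  have hx1 : 13 * (M ^ 2 * K * α) * x ≤ 1 := by
    have h1 : ((13 * (M ^ 2 * K * α) : ℝ≥0) : ℝ) ≤ Real.exp (L / 2) := by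
      rw [← Real.log_le_iff_le_exp (by positivity)]
      push_cast
      linarith
    have h2 := mul_le_mul h1 hxe x.2 (Real.exp_pos _).le
    rw [← Real.exp_add, show L / 2 + -L / 2 = 0 by ring, Real.exp_zero] at h2
    exact_mod_cast h2
  have hxr : (x : ℝ) ^ (r + 1) ≤ Real.exp (-(θ * f N)) := by
    refine (pow_le_pow_left₀ x.2 hxe _).trans ?_
    rw [← Real.exp_nat_mul, Real.exp_le_exp]
    have h1 := mul_le_mul_of_nonneg_right hrd (show (0 : ℝ) ≤ L / 2 by linarith)
    have h2 : θ * (2 * f N / L) * (L / 2) = θ * f N := by field_simp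
    push_cast
    linarith
  set γ : ℝ≥0 := (Real.exp (-(s * (1 - κ) / 2) * (f N - f (max C c)))).toNNReal with hγ
  set T : ℝ≥0 := (Real.exp (m / (4 * s) * s * f (cutoff f c p e))).toNNReal with hT
  have hTe : (T : ℝ) = Real.exp (m / (4 * s) * s * f (cutoff f c p e)) :=
    Real.coe_toNNReal _ (Real.exp_pos _).le
  -- Since f(N(ε)) ≤ 2 f(N), the exponent of T is at most (m / 2) f(N), half of the decay rate; the
  -- other half absorbs the constants.
  have hspan : T * C₀ * (γ + x ^ (r + 1)) ≤ 1 := by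
    have := life_span_le (F := f N) hm0 (min_le_left _ _) (min_le_right _ _) hfN.le
      (C₀ := C₀) hC₀0 hTe (by
        have h1 : m / (4 * s) * s = m / 4 := by field_simp
        rw [h1]
        have := mul_le_mul_of_nonneg_left hcut (show 0 ≤ m / 4 by positivity)
        linarith) (g := f (max C c)) (γ := γ) (Real.coe_toNNReal _ (Real.exp_pos _).le)
      (pow_nonneg x.2 _) hxr
      ((le_max_right _ _).trans hFfN)
    exact_mod_cast this
  clear_value T γ
  have hbρ : (b : ℝ) ≤ ρ₀ / 2 := by
    have h1 : (e : ℝ) * (4 * M) ≤ ρ₀ := ((lt_div_iff₀ (by positivity)).1 hε2).le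
    rw [hbdef]
    push_cast
    linarith
  have h48 : 48 * K * R * b ≤ 1 := by
    have h1 : b ≤ ρ₀ := by
      rw [← NNReal.coe_le_coe]
      linarith [ρ₀.2]
    refine (mul_le_mul_right h1 _).trans (le_of_eq ?_)
    rw [hρ₀, mul_one_div_cancel]
    positivity
  have heb : (e : ℝ) < b := by
    rw [hbdef]
    push_cast
    have h1 : (1 : ℝ) ≤ M := by exact_mod_cast hM1
    have h2 := le_mul_of_one_le_left hε0.le h1
    linarith
  have hbC : (b : ℝ) = 2 * M * e := by
    rw [hbdef]
    push_cast
    rfl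
  clear_value b B x C₀ M α ρ₀
  subst hx hC₀
  refine ⟨T, ?_, ?_⟩
  · rw [← hTe]
    have : (1 : ℝ) ≤ M := by exact_mod_cast hM1
    refine div_lt_self ?_ (by linarith)
    rw [hTe]
    exact Real.exp_pos _
  · rw [← hbC]
    refine exists_solution_of_apriori hgw hP hb hρ₀0 hρ₀' T.2 hbρ hu₀ hreal (by rw [← hε]; exact heb)
      fun t u _ htT hu hu0 hureal hub => ?_
    exact hu.normW_lt hgw hP hb hbl hcN hM hαw hnf hγ hbdef hb0 hRB h48 hM1 hα1 hx1 hspan htT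
      (by rw [hu0, ← hε]) hureal hub

end Main

end UltraDiff

open UltraDiff in
theorem mainTheorem1 (n : ℕ) (hn : 1 ≤ n) (f : ℝ → ℝ) (c : ℝ) (hf : WeightA0 f c)
    (hs₀ : ∃ s₀ : ℝ, Summable (fun J : Index n => Real.exp (-s₀ * f (bracket c J.1))))
    (ω : (Fin n → ℤ) → ℝ) (β p : ℝ) (hβ : 1 < β) (hp : 0 < p)
    (hA1 : FreqA1 ω β) (hA2 : FreqA2 ω p) (hA3 : FreqA3 ω)
    (P : FormalSeries n) (hP : MemP3 P) :
    ∃ S : ℝ, ∀ s : ℝ, S < s →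
      ∃ ε₀ Csta Cfin : ℝ, 0 < ε₀ ∧ 0 < Csta ∧ 0 < Cfin ∧
        ∀ u₀ : Index n → ℂ, MemW f c s u₀ → IsRealSeq u₀ →
          ∀ ε : ℝ, ε = normW f c s u₀ → 0 < ε → ε < ε₀ →
            ∃ T : ℝ, Real.exp (Cfin * s * f (cutoff f c p ε)) / Csta < T ∧
              ∃ u : ℝ → Index n → ℂ,
                IsSolutionOn f c s ω P (Set.Icc (-T) T) u ∧ u 0 = u₀ ∧
                (∀ t ∈ Set.Icc (-T) T, normW f c s (u t) < Csta * ε) ∧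
                (∀ T' : ℝ, 0 < T' → T' ≤ T → ∀ v : ℝ → Index n → ℂ,
                  IsSolutionOn f c s ω P (Set.Icc (-T') T') v → v 0 = u₀ →
                    ∀ t ∈ Set.Icc (-T') T', v t = u t) := by
  obtain ⟨S, κ, hS⟩ := hf.exists_goodWeight hs₀
  obtain ⟨rep, C, C₂, δ, hbl⟩ := hA3.exists_blocks
  obtain ⟨γ, τ, A, hγ, hγ₁, hτ, hA, hdiv⟩ :=
    hbl.exists_divisor_bound (zero_lt_one.trans hβ) hp hA1 hA2
  refine ⟨S, fun s hs => ?_⟩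
  obtain ⟨K, hgw⟩ := hS s hs
  exact exists_thresholds hf hp hgw hP hbl hγ hγ₁ hτ hA hdiv
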